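/- **Theorem (Existence of the kinetic function).** Let $f:\mathbb{R}\to\mathbb{R}$ be a concave-convex flux, that is, $f$ is of class $C^3$, $u\,f''(u)>0$ for all $u\neq 0$, $f'''(0)\neq 0$, and $f'(u)\to+\infty$ as $u\to\pm\infty$. For $u_-\neq u_+$ write $\bar a(u_-,u_+)=\frac{f(u_-)-f(u_+)}{u_--u_+}$. *Notation.* The tangent function $\varphi^\natural:\mathbb{R}\to\mathbb{R}$ is defined by $\varphi^\natural(0)=0$ and, for $u\ne0$, $\varphi^\natural(u)\neq u$ and $f'(\varphi^\natural(u))=\bar a(u,\varphi^\natural(u))$. The zero entropy dissipation function $\varphi^\flat_0:\mathbb{R}\to\mathbb{R}$ is defined by $\varphi^\flat_0(0)=0$ and, for $u\neq0$, $\varphi^\flat_0(u)\ne u$ and $E(u,\varphi^\flat_0(u))=0$, where $$E(u_-,u_+)=-\bar a(u_-,u_+)\,\frac{u_+^2-u_-^2}{2}+\int_{u_-}^{u_+}f'(v)\,v\,dv$$ is the entropy dissipation for the entropy $U(u)=u^2/2$. For $\alpha>0$ and $p\ge0$, consider the model $$u_t+f(u)_x=\alpha\,(|u_x|^p u_x)_x+u_{xxx}.$$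 A traveling wave connecting $u_-$ to $u_+$ is a $C^2$ function $w:\mathbb{R}\to\mathbb{R}$ which, for some $\lambda$ with $-\lambda(u_+-u_-)+f(u_+)-f(u_-)=0$, satisfies on $\mathbb{R}$ $$-\lambda(w-u_-)+f(w)-f(u_-)=\alpha|w'|^pw'+w'',\qquad \lim_{y\to\pm\infty}w(y)=u_\pm .$$ Let $S_{\alpha,p}(u_-)$ be the set of all $u_+\in\mathbb{R}$ for which there is a traveling wave connecting $u_-$ to $u_+$. A shock $(u_-,u_+)$ is one with $u_+\neq u_-$ and $u_+\in S_{\alpha,p}(u_-)$. For $u_->0$ it is called classical if $\varphi^\natural(u_-)\le u_+<u_-$ and nonclassical if $\varphi^\flat_0(u_-)\le u_+<\varphi^\natural(u_-)$; for $u_-<0$ the inequalities are reversed. *Claim.* The functions $\varphi^\natural$ and $\varphi^\flat_0$ exist, and for all $\alpha>0$, $p\geq0$ there are functions $\varphi^\flat_{\alpha,p},\varphi^\sharp_{\alpha,p}:\mathbb{R}\to\mathbb{R}$ such that the following holds. 1. The kinetic function $\varphi^\flat_{\alpha,p}$ is locally Lipschitz continuous and strictly decreasing. It satisfies $\varphi^\flat_0(u)<\varphi^\flat_{\alpha,p}(u)\le\varphi^\natural(u)$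 for $u>0$ and $\varphi^\natural(u)\le\varphi^\flat_{\alpha,p}(u)<\varphi^\flat_0(u)$ for $u<0$. 2. The function $\varphi^\sharp_{\alpha,p}$ is the companion of $\varphi^\flat_{\alpha,p}$: $\varphi^\sharp_{\alpha,p}(0)=0$ and, for $u\ne0$, $\varphi^\sharp_{\alpha,p}(u)\neq u$ and the solutions $v\neq u$ of $\bar a(u,v)=\bar a(u,\varphi^\flat_{\alpha,p}(u))$ are exactly $\varphi^\flat_{\alpha,p}(u)$ and $\varphi^\sharp_{\alpha,p}(u)$ (which may coincide). Moreover $$S_{\alpha,p}(u)=\{\varphi^\flat_{\alpha,p}(u)\}\cup(\varphi^\sharp_{\alpha,p}(u),u]\quad(u>0),\qquad S_{\alpha,p}(u)=\{\varphi^\flat_{\alpha,p}(u)\}\cup[u,\varphi^\sharp_{\alpha,p}(u))\quad(u<0).$$ 3. If $0\le p\le1/3$, there is a threshold function $A^\natural_p:\mathbb{R}\to[0,\infty)$, independent of $\alpha$, with $A^\natural_p(0)=0$, which is continuous on $\mathbb{R}$ and locally Lipschitz continuous on $\mathbb{R}\setminus\{0\}$ (on all of $\mathbb{R}$ if $p=0$),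 such that for all $\alpha>0$ and $u\in\mathbb{R}$ $$\varphi^\flat_{\alpha,p}(u)=\varphi^\natural(u)\quad\text{if and only if}\quad\alpha\ge A^\natural_p(u).$$ In particular all shocks of sufficiently small strength are classical: for every $\alpha>0$ there is $\delta>0$ such that every shock with $|u_+-u_-|<\delta$ is classical. 4. If $p>1/3$, then for every $\alpha>0$ one has $\varphi^\flat_{\alpha,p}(u)\ne\varphi^\natural(u)$ for all $u\neq0$. In particular there are nonclassical shocks of arbitrarily small strength $|u_+-u_-|$. -/

import Mathlib

open Filter Topology

noncomputable section

namespace KineticRelation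

/-- A concave-convex flux: `f` is `C³`, `u f''(u) > 0` for `u ≠ 0`, `f'''(0) ≠ 0`, and
`f'(u) → +∞` as `u → ±∞`. -/
structure IsConcaveConvexFlux (f : ℝ → ℝ) : Prop where
  contDiff : ContDiff ℝ 3 f
  concave_convex : ∀ u : ℝ, u ≠ 0 → 0 < u * iteratedDeriv 2 f u
  third_ne_zero : iteratedDeriv 3 f 0 ≠ 0
  tendsto_atTop : Tendsto (deriv f) atTop atTop
  tendsto_atBot : Tendsto (deriv f) atBot atTop

/-- The slope of the chord of `f` between two states, i.e. the speed of the shock between them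
(only used for `a ≠ b`). -/
def chordSpeed (f : ℝ → ℝ) (a b : ℝ) : ℝ := (f a - f b) / (a - b)

/-- The Rankine-Hugoniot relation for the shock `(um, up)` with speed `lam`. -/
def RankineHugoniot (f : ℝ → ℝ) (um up lam : ℝ) : Prop :=
  -lam * (up - um) + f up - f um = 0

/-- `w` is the profile of a traveling wave with speed `lam` of
`u_t + f(u)_x = α (|u_x|^p u_x)_x + u_xxx` connecting `um` (at `-∞`) to `up` (at `+∞`): a `C²`
solution of `-lam (w - um) + f(w) - f(um) = α |w'|^p w' + w''` on the whole line, with these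
limits. -/
structure IsTravelingWave (f : ℝ → ℝ) (α p um up lam : ℝ) (w : ℝ → ℝ) : Prop where
  contDiff : ContDiff ℝ 2 w
  ode : ∀ y : ℝ, -lam * (w y - um) + f (w y) - f um
    = α * (|deriv w y| ^ p * deriv w y) + iteratedDeriv 2 w y
  tendsto_atBot : Tendsto w atBot (𝓝 um)
  tendsto_atTop : Tendsto w atTop (𝓝 up)

/-- The set `S(um)` of the right states that a traveling wave connects to the left state `um`. -/
def admissibleStates (f : ℝ → ℝ) (α p um : ℝ) : Set ℝ :=
  {up | ∃ lam : ℝ, RankineHugoniot f um up lam ∧ ∃ w : ℝ → ℝ, IsTravelingWave f α p um up lam w}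

/-- The tangent function `φ♮`: for `u ≠ 0`, the line through `(u, f u)` and `(φ♮ u, f (φ♮ u))`,
`φ♮ u ≠ u`, is tangent to the graph of `f` at `φ♮ u`; and `φ♮ 0 = 0`. For a concave-convex flux
these conditions have exactly one solution. -/
def IsTangentFunction (f phiNat : ℝ → ℝ) : Prop :=
  phiNat 0 = 0 ∧
    ∀ u : ℝ, u ≠ 0 → phiNat u ≠ u ∧ deriv f (phiNat u) = chordSpeed f u (phiNat u)

/-- The entropy dissipation `E(um, up) = -λ (U(up) - U(um)) + F(up) - F(um)`, with `λ` the chord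
speed, for the entropy pair `U(v) = v² / 2`, `F'(v) = f'(v) U'(v) = f'(v) v` of the model. -/
def entropyDissipation (f : ℝ → ℝ) (um up : ℝ) : ℝ :=
  -chordSpeed f um up * (up ^ 2 / 2 - um ^ 2 / 2) + ∫ v in um..up, deriv f v * v

/-- The zero entropy dissipation function `φ♭₀`: for `u ≠ 0`, `φ♭₀ u ≠ u` and `E(u, φ♭₀ u) = 0`;
and `φ♭₀ 0 = 0`. For a concave-convex flux these conditions have exactly one solution. -/
def IsZeroDissipationFunction (f phiZero : ℝ → ℝ) : Prop :=
  phiZero 0 = 0 ∧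
    ∀ u : ℝ, u ≠ 0 → phiZero u ≠ u ∧ entropyDissipation f u (phiZero u) = 0

/-- `φ♯` is the companion function of `φ♭`: for `u ≠ 0`, the line through `(u, f u)` and
`(φ♭ u, f (φ♭ u))` meets the graph of `f` again at the abscissa `φ♯ u`. The points of the graph
on this line are exactly those with abscissae `u`, `φ♭ u`, `φ♯ u`, so that `φ♯ u` is the third one
if there are three, and `φ♯ u = φ♭ u` if the line is tangent to the graph at `φ♭ u`. -/
def IsCompanionFunction (f phiFlat phiSharp : ℝ → ℝ) : Prop :=
  phiSharp 0 = 0 ∧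
    ∀ u : ℝ, u ≠ 0 → phiSharp u ≠ u ∧
      ∀ v : ℝ, v ≠ u →
        (chordSpeed f u v = chordSpeed f u (phiFlat u) ↔ v = phiFlat u ∨ v = phiSharp u)

/-- `φ♭₀(u) < φ♭(u) ≤ φ♮(u)` for `u > 0`, and the mirror image for `u < 0`. -/
def IsBetween (phiZero phiNat phiFlat : ℝ → ℝ) : Prop :=
  (∀ u : ℝ, 0 < u → phiZero u < phiFlat u ∧ phiFlat u ≤ phiNat u) ∧
    (∀ u : ℝ, u < 0 → phiNat u ≤ phiFlat u ∧ phiFlat u < phiZero u)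

/-- The shock `(um, up)` is classical (compressive): `φ♮(um) ≤ up < um` if `um > 0`, and the
mirror image if `um < 0`. -/
def IsClassicalShock (phiNat : ℝ → ℝ) (um up : ℝ) : Prop :=
  (0 < um ∧ phiNat um ≤ up ∧ up < um) ∨ (um < 0 ∧ um < up ∧ up ≤ phiNat um)

/-- The shock `(um, up)` is nonclassical (undercompressive, and not classical):
`φ♭₀(um) ≤ up < φ♮(um)` if `um > 0`, and the mirror image if `um < 0`. -/
def IsNonclassicalShock (phiZero phiNat : ℝ → ℝ) (um up : ℝ) : Prop :=
  (0 < um ∧ phiZero um ≤ up ∧ up < phiNat um) ∨ (um < 0 ∧ phiNat um < up ∧ up ≤ phiZero um)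

end KineticRelation

end

open Filter Topology Set MeasureTheory

/-! It suffices to treat left states `u > 0`: the reflection `f ↦ -f(-·)` exchanges the two signs.
With speed `lam`, a profile solves `w'' = -e(w) - α |w'|^p w'`, where `e(w) = lam (w - u) + f u - f
w` is the `excess`: a particle in a potential, with friction. While `w` decreases, the kinetic
energy `y = w'^2 / 2`, as a function of `s = u - w`, solves the scalar equation `y' = e(u - s) - α
(2y)^q`, `y(0) = 0`, with `q = (p + 1) / 2`. The friction term need not be Lipschitz at `y = 0`, but
it is monotone, so sub- and supersolutions are ordered (`le_of_deriv_le_of_lt`). Most of the proof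
consists of such comparisons.

Kinetic state. Let `A(v)` be the energy on arrival at `v` when `lam` is the chord speed of `(u, v)`
(`arrivalEnergy`). At the tangent state `A ≥ 0`, because the excess is nonnegative on the way. At
the zero dissipation state `A < 0`, because without friction the arrival energy would be the chord
area, which vanishes there. Once `A ≤ 0` at a state left of the tangent state, `A < 0` further left.
Hence `A` has exactly one zero in between, the kinetic state, and it is the tangent state iff `A ≤
0` there.

Regularity. For a larger `u` the chord to the same `v` is higher, so more energy arrives and the
kinetic state moves left; equality is excluded by comparing two orbits that enter the same saddle
(`kineticState_strictAnti`). Conversely, moving `u` right by `ε` and `v` left by `K ε` creates no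
arrival energy if `K` is large (`arrivalEnergy_move_nonpos`), which gives the Lipschitz bound. Both
arguments use `q ≥ 1/2`, that is, `p ≥ 0`.

Threshold. Friction lowers `A` at the tangent state, so the admissible `α` form a half-line. There
the excess vanishes to second order in the distance `τ`. A barrier `u τ^3` is dissipated at a rate
of order `τ^(3q)`, which can balance `τ^2` iff `3q ≤ 2`, that is, `p ≤ 1/3`; this yields a threshold
of size at most `u^(3 - 4q)` (`exists_arrivalEnergy_nonpos`). For `q > 2/3` an orbit reaching the
tangent state with zero energy would be so flat that the excess beats the friction, a contradiction
(`arrivalEnergy_tangentState_pos`).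

Waves. A wave to a lower state must leave `u` on the energy profile and follow it until it stops
(`profile_alternative`). The signs of `A`, and the decrease of kinetic plus potential energy, leave
only the kinetic state and the states above its companion (`eq_or_lt_of_wave`). Conversely, the
orbit on the profile reaches the kinetic state exactly; for a faster admissible speed it either
descends to the right state or stops inside a potential well and settles at its only rest point
(`exists_wave_kineticState`, `exists_wave_of_companion_lt`). -/

namespace KineticRelation

/-! ### Comparison and monotonicity from derivative bounds. -/

/-- Comparison principle: `f ≤ g` persists if `f' ≤ g'` wherever `g < f`. -/
theorem le_of_deriv_le_of_lt {f g f' g' : ℝ → ℝ} {a b : ℝ}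
    (hf : ∀ x ∈ Icc a b, HasDerivAt f (f' x) x) (hg : ∀ x ∈ Icc a b, HasDerivAt g (g' x) x)
    (ha : f a ≤ g a) (h : ∀ x ∈ Icc a b, g x < f x → f' x ≤ g' x) :
    ∀ x ∈ Icc a b, f x ≤ g x := by
  intro x hx
  by_contra! hlt
  have hfc : ContinuousOn f (Icc a x) := fun y hy =>
    (hf y ⟨hy.1, hy.2.trans hx.2⟩).continuousAt.continuousWithinAt
  have hgc : ContinuousOn g (Icc a x) := fun y hy =>
    (hg y ⟨hy.1, hy.2.trans hx.2⟩).continuousAt.continuousWithinAt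
  -- After the last point of `S` one has `g < f`, so the hypothesis on the derivatives makes `f - g`
  -- nonincreasing from a point where it is at most zero.
  set S := {y ∈ Icc a x | f y ≤ g y} with hS
  have hScl : IsClosed S := isClosed_Icc.isClosed_le hfc hgc
  have hSne : S.Nonempty := ⟨a, ⟨le_rfl, hx.1⟩, ha⟩
  have hSb : BddAbove S := ⟨x, fun y hy => hy.1.2⟩
  have hz : sSup S ∈ S := hScl.csSup_mem hSne hSb
  set z := sSup S
  have hzx : z ≤ x := hz.1.2
  have hlt' : ∀ y ∈ Ioc z x, g y < f y := by
    intro y hy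
    by_contra! hc
    exact absurd (le_csSup hSb (show y ∈ S from ⟨⟨hz.1.1.trans hy.1.le, hy.2⟩, hc⟩))
      (not_le.mpr hy.1)
  have hd : ∀ y ∈ Icc z x, HasDerivAt (fun y => f y - g y) (f' y - g' y) y := fun y hy =>
    (hf y ⟨hz.1.1.trans hy.1, hy.2.trans hx.2⟩).sub (hg y ⟨hz.1.1.trans hy.1, hy.2.trans hx.2⟩)
  have hanti : AntitoneOn (fun y => f y - g y) (Icc z x) := by
    apply antitoneOn_of_deriv_nonpos (convex_Icc z x)
    · exact fun y hy => (hd y hy).continuousAt.continuousWithinAt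
    · intro y hy
      rw [interior_Icc] at hy
      exact (hd y (Ioo_subset_Icc_self hy)).differentiableAt.differentiableWithinAt
    · intro y hy
      rw [interior_Icc] at hy
      rw [(hd y (Ioo_subset_Icc_self hy)).deriv]
      have := h y ⟨hz.1.1.trans hy.1.le, hy.2.le.trans hx.2⟩ (hlt' y ⟨hy.1, hy.2.le⟩)
      linarith
  have := hanti ⟨le_rfl, hzx⟩ ⟨hzx, le_rfl⟩ hzx
  have h2 := hz.2
  simp only at this
  linarith

theorem antitoneOn_of_hasDerivAt_nonpos {f f' : ℝ → ℝ} {D : Set ℝ} (hD : Convex ℝ D)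
    (hf : ∀ x ∈ D, HasDerivAt f (f' x) x) (h : ∀ x ∈ D, f' x ≤ 0) : AntitoneOn f D := by
  apply antitoneOn_of_deriv_nonpos hD
  · exact fun y hy => (hf y hy).continuousAt.continuousWithinAt
  · exact fun y hy => (hf y (interior_subset hy)).differentiableAt.differentiableWithinAt
  · intro y hy
    rw [(hf y (interior_subset hy)).deriv]
    exact h y (interior_subset hy)

theorem monotoneOn_of_hasDerivAt_nonneg {f f' : ℝ → ℝ} {D : Set ℝ} (hD : Convex ℝ D)
    (hf : ∀ x ∈ D, HasDerivAt f (f' x) x) (h : ∀ x ∈ D, 0 ≤ f' x) : MonotoneOn f D := by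
  apply monotoneOn_of_deriv_nonneg hD
  · exact fun y hy => (hf y hy).continuousAt.continuousWithinAt
  · exact fun y hy => (hf y (interior_subset hy)).differentiableAt.differentiableWithinAt
  · intro y hy
    rw [(hf y (interior_subset hy)).deriv]
    exact h y (interior_subset hy)

theorem strictMonoOn_of_hasDerivAt_pos {f f' : ℝ → ℝ} {D : Set ℝ} (hD : Convex ℝ D)
    (hf : ∀ x ∈ D, HasDerivAt f (f' x) x) (h : ∀ x ∈ interior D, 0 < f' x) : StrictMonoOn f D := by
  apply strictMonoOn_of_deriv_pos hD
  · exact fun y hy => (hf y hy).continuousAt.continuousWithinAt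
  · intro y hy
    rw [(hf y (interior_subset hy)).deriv]
    exact h y hy

theorem strictAntiOn_of_hasDerivAt_neg {f f' : ℝ → ℝ} {D : Set ℝ} (hD : Convex ℝ D)
    (hf : ∀ x ∈ D, HasDerivAt f (f' x) x) (h : ∀ x ∈ interior D, f' x < 0) : StrictAntiOn f D := by
  apply strictAntiOn_of_deriv_neg hD
  · exact fun y hy => (hf y hy).continuousAt.continuousWithinAt
  · intro y hy
    rw [(hf y (interior_subset hy)).deriv]
    exact h y hy

/-! ### Global integral curves. -/

/-- Global existence for vector fields that are, locally in time, bounded and Lipschitz. -/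
theorem exists_global_integralCurve {E : Type*} [NormedAddCommGroup E] [NormedSpace ℝ E]
    [CompleteSpace E] (F : ℝ → E → E) (hc : ∀ x, Continuous fun t => F t x)
    (hF : ∀ N : ℝ, ∃ K C : NNReal, ∀ t ∈ Icc (-N) N, LipschitzWith K (F t) ∧ ∀ x, ‖F t x‖ ≤ C)
    (x₀ : E) : ∃ γ : ℝ → E, γ 0 = x₀ ∧ ∀ t, HasDerivAt γ (F t (γ t)) t := by
  have key : ∀ n : ℕ, ∃ γ : ℝ → E, γ 0 = x₀ ∧
      ∀ t ∈ Ioo (-(n + 1 : ℝ)) (n + 1), HasDerivAt γ (F t (γ t)) t := by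
    intro n
    obtain ⟨K, C, h⟩ := hF (n + 1)
    have hn : (0 : ℝ) < n + 1 := by positivity
    have hpl : IsPicardLindelof F (⟨0, by constructor <;> linarith⟩ : Icc (-(n + 1 : ℝ)) (n + 1)) x₀
        (C * (n + 1)) 0 C K :=
      { lipschitzOnWith := fun t ht => (h t ht).1.lipschitzOnWith
        continuousOn := fun x _ => (hc x).continuousOn
        norm_le := fun t ht x _ => (h t ht).2 x
        mul_max_le := by simp }
    obtain ⟨γ, h0, hγ⟩ := hpl.exists_eq_forall_mem_Icc_hasDerivWithinAt₀
    exact ⟨γ, h0, fun t ht => (hγ t (Ioo_subset_Icc_self ht)).hasDerivAt (Icc_mem_nhds ht.1 ht.2)⟩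
  choose γ h0 hγ using key
  have huniq : ∀ m n : ℕ, m ≤ n → EqOn (γ m) (γ n) (Ioo (-(m + 1 : ℝ)) (m + 1)) := by
    intro m n hmn
    obtain ⟨K, C, h⟩ := hF (m + 1)
    have hm : (0 : ℝ) < m + 1 := by positivity
    have hmn' : (m : ℝ) ≤ n := by exact_mod_cast hmn
    refine ODE_solution_unique_of_mem_Ioo (K := K) (v := F) (s := fun _ => univ) (t₀ := 0)
      (fun t ht => (h t (Ioo_subset_Icc_self ht)).1.lipschitzOnWith) ⟨by linarith, hm⟩
      (fun t ht => ⟨hγ m t ht, trivial⟩) (fun t ht => ⟨hγ n t ⟨?_, ?_⟩, trivial⟩)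
      ((h0 m).trans (h0 n).symm)
    · linarith [ht.1]
    · linarith [ht.2]
  -- The index `⌈|t|⌉₊` puts `t` inside the open interval on which that local solution lives, and
  -- uniqueness makes the choice of index irrelevant nearby.
  refine ⟨fun t => γ ⌈|t|⌉₊ t, by simp [h0], fun t => ?_⟩
  have hmem : ∀ t : ℝ, t ∈ Ioo (-((⌈|t|⌉₊ : ℝ) + 1)) (⌈|t|⌉₊ + 1) := by
    intro t
    have h1 := Nat.le_ceil |t|
    have h2 := abs_le.mp h1
    constructor <;> linarith [h2.1, h2.2]
  have hev : (fun t => γ ⌈|t|⌉₊ t) =ᶠ[𝓝 t] γ ⌈|t|⌉₊ := by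
    filter_upwards [Ioo_mem_nhds (hmem t).1 (hmem t).2] with s hs
    rcases le_total ⌈|s|⌉₊ ⌈|t|⌉₊ with hle | hle
    · exact huniq _ _ hle (hmem s)
    · exact (huniq _ _ hle hs).symm
  exact (hγ _ t (hmem t)).congr_of_eventuallyEq hev

/-! ### The energy equation and the existence of its solutions. -/

/-- The dissipation rate as a function of the kinetic energy. -/
noncomputable def damp (q y : ℝ) : ℝ := (2 * max y 0) ^ q

theorem damp_nonneg (q y : ℝ) : 0 ≤ damp q y := by unfold damp; positivity

theorem damp_mono {q : ℝ} (hq : 0 ≤ q) {x y : ℝ} (h : x ≤ y) : damp q x ≤ damp q y := by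
  unfold damp
  have := max_le_max_right 0 h
  gcongr

theorem damp_of_nonpos {q : ℝ} (hq : 0 < q) {y : ℝ} (hy : y ≤ 0) : damp q y = 0 := by
  simp [damp, max_eq_right hy, Real.zero_rpow hq.ne']

theorem damp_of_nonneg {q y : ℝ} (hy : 0 ≤ y) : damp q y = (2 * y) ^ q := by
  simp [damp, max_eq_left hy]

theorem damp_pos {q y : ℝ} (hy : 0 < y) : 0 < damp q y := by
  rw [damp_of_nonneg hy.le]; positivity

theorem continuous_damp {q : ℝ} (hq : 0 < q) : Continuous (damp q) := by
  unfold damp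
  exact Continuous.rpow_const (by fun_prop) (fun _ => Or.inr hq.le)

theorem damp_mul {q m y : ℝ} (hm : 0 ≤ m) : damp q (m * y) = m ^ q * damp q y := by
  unfold damp
  rw [← Real.mul_rpow hm (by positivity)]
  congr 1
  rcases le_total 0 y with h | h
  · rw [max_eq_left h, max_eq_left (mul_nonneg hm h)]; ring
  · rw [max_eq_right h, max_eq_right (mul_nonpos_of_nonneg_of_nonpos hm h)]; ring

/-- `y` is the kinetic energy along the profile leaving the rest state: `y(0) = 0` and
`y' = H - α (2 y⁺)^q`. -/
def IsEnergyProfile (α q : ℝ) (H y : ℝ → ℝ) : Prop :=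
  y 0 = 0 ∧ ∀ s, 0 ≤ s → HasDerivAt y (H s - α * damp q (y s)) s

theorem exists_lipschitzOnWith_rpow {q δ M : ℝ} (hδ : 0 < δ) :
    ∃ K : NNReal, LipschitzOnWith K (fun x : ℝ => (2 * x) ^ q) (Icc δ M) := by
  have h : ContDiffOn ℝ 1 (fun x : ℝ => (2 * x) ^ q) (Icc δ M) := by
    apply ContDiffOn.rpow_const_of_ne (by fun_prop)
    intro x hx
    have : 0 < x := hδ.trans_le hx.1
    positivity
  exact (h.locallyLipschitzOn (convex_Icc _ _)).exists_lipschitzOnWith_of_compact isCompact_Icc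

/-- A bounded Lipschitz regularization of `damp`. -/
noncomputable def regDamp (q δ M y : ℝ) : ℝ := (2 * max δ (min y M)) ^ q

theorem regDamp_nonneg {q δ M y : ℝ} (hδ : 0 < δ) : 0 ≤ regDamp q δ M y := by
  unfold regDamp
  have := le_max_left δ (min y M)
  have : 0 ≤ max δ (min y M) := hδ.le.trans this
  positivity

theorem regDamp_mono {q δ δ' M M' y y' : ℝ} (hq : 0 ≤ q) (hδ : 0 < δ) (h : δ ≤ δ') (hM : M ≤ M')
    (hy : y ≤ y') : regDamp q δ M y ≤ regDamp q δ' M' y' := by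
  unfold regDamp
  have h1 : 0 ≤ max δ (min y M) := hδ.le.trans (le_max_left _ _)
  have h2 : max δ (min y M) ≤ max δ' (min y' M') := max_le_max h (min_le_min hy hM)
  gcongr

/-- Raising the floor changes the value only where the clamped energy is below the higher floor, and
there the value is `(2 * δ) ^ q`. -/
theorem regDamp_le {q δ δ' M y : ℝ} (hδ' : 0 < δ') (h : δ' ≤ δ) :
    regDamp q δ M y ≤ regDamp q δ' M y + (2 * δ) ^ q := by
  have hδ := hδ'.trans_le h
  rcases le_total (min y M) δ with h1 | h1
  · have : regDamp q δ M y = (2 * δ) ^ q := by rw [regDamp, max_eq_left h1]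
    linarith [regDamp_nonneg (q := q) (M := M) (y := y) hδ']
  · have : regDamp q δ M y = regDamp q δ' M y := by
      rw [regDamp, regDamp, max_eq_right h1, max_eq_right (h.trans h1)]
    have h3 : 0 ≤ (2 * δ) ^ q := by positivity
    linarith

theorem continuous_regDamp {q δ : ℝ} (hδ : 0 < δ) :
    Continuous fun z : ℝ × ℝ => regDamp q δ z.1 z.2 := by
  unfold regDamp
  refine Continuous.rpow_const (by fun_prop) (fun z => Or.inl ?_)
  have : 0 < max δ (min z.2 z.1) := hδ.trans_le (le_max_left _ _)
  positivity

theorem exists_regularized_profile {α q : ℝ} (hq : 0 < q) {H M : ℝ → ℝ}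
    (hH : Continuous H) (hM : Continuous M) {δ : ℝ} (hδ : 0 < δ) :
    ∃ y : ℝ → ℝ, y 0 = 0 ∧ ∀ s, HasDerivAt y (H s - α * regDamp q δ (M s) (y s)) s := by
  apply exists_global_integralCurve (fun s y => H s - α * regDamp q δ (M s) y)
  · intro x
    have := (continuous_regDamp (q := q) hδ).comp (hM.prodMk (continuous_const (y := x)))
    exact hH.sub (continuous_const.mul this)
  · intro N
    obtain ⟨B, hB⟩ := (isCompact_Icc (a := -N) (b := N)).exists_bound_of_continuousOn hH.continuousOn
    obtain ⟨B', hB'⟩ := (isCompact_Icc (a := -N) (b := N)).exists_bound_of_continuousOn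
      hM.continuousOn
    obtain ⟨K, hK⟩ := exists_lipschitzOnWith_rpow (q := q) (M := max δ B') hδ
    have hmem : ∀ t ∈ Icc (-N) N, ∀ x, max δ (min x (M t)) ∈ Icc δ (max δ B') := by
      intro t ht x
      refine ⟨le_max_left _ _, max_le_max le_rfl ?_⟩
      exact (min_le_right _ _).trans ((le_abs_self _).trans (hB' t ht))
    refine ⟨‖α‖₊ * K, (|B| + |α| * (2 * max δ B') ^ q).toNNReal, fun t ht => ⟨?_, fun x => ?_⟩⟩
    · apply LipschitzWith.of_dist_le_mul
      intro x y
      have h1 := hK.dist_le_mul _ (hmem t ht x) _ (hmem t ht y)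
      have h2 : dist (max δ (min x (M t))) (max δ (min y (M t))) ≤ dist x y := by
        have := ((LipschitzWith.id.min_const (M t)).const_max δ).dist_le_mul x y
        simpa using this
      have h3 : dist (regDamp q δ (M t) x) (regDamp q δ (M t) y) ≤ K * dist x y :=
        h1.trans (by gcongr)
      rw [Real.dist_eq] at h3 ⊢
      rw [show H t - α * regDamp q δ (M t) x - (H t - α * regDamp q δ (M t) y)
        = -(α * (regDamp q δ (M t) x - regDamp q δ (M t) y)) by ring, abs_neg, abs_mul]
      push_cast
      rw [mul_assoc]
      simp only [Real.norm_eq_abs]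
      gcongr
    · have h1 : 0 ≤ (2 * max δ B') ^ q := by
        have : 0 < max δ B' := hδ.trans_le (le_max_left _ _)
        positivity
      rw [Real.coe_toNNReal _ (by positivity)]
      have h2 : |regDamp q δ (M t) x| ≤ (2 * max δ B') ^ q := by
        rw [abs_of_nonneg (regDamp_nonneg hδ), regDamp]
        have h3 := hmem t ht x
        have h4 : 0 ≤ max δ (min x (M t)) := hδ.le.trans h3.1
        have h5 := h3.2
        gcongr
      have h3 : |H t| ≤ |B| := (hB t ht).trans (le_abs_self _)
      calc ‖H t - α * regDamp q δ (M t) x‖ ≤ |H t| + |α * regDamp q δ (M t) x| := abs_sub _ _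
        _ ≤ _ := by rw [abs_mul]; gcongr

/-- Picard-Lindelöf does not apply because `damp` may fail to be Lipschitz at zero. Lowering the
floor of the regularized damping increases the solutions by a controlled amount, so they converge
locally uniformly and the integral equation passes to the limit. -/
theorem exists_isEnergyProfile {α q : ℝ} (hα : 0 ≤ α) (hq : 0 < q) {H : ℝ → ℝ}
    (hH : Continuous H) : ∃ y, IsEnergyProfile α q H y := by
  -- An a priori bound for every solution, since the damping only lowers it; the cap at `M` is
  -- therefore inactive.
  set M : ℝ → ℝ := fun s => ∫ t in (0 : ℝ)..s, |H t| with hMdef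
  have hMd : ∀ s, HasDerivAt M |H s| s := fun s =>
    intervalIntegral.integral_hasDerivAt_right (hH.abs.intervalIntegrable _ _)
      (hH.abs.stronglyMeasurableAtFilter _ _) hH.abs.continuousAt
  have hMc : Continuous M := continuous_iff_continuousAt.mpr fun s => (hMd s).continuousAt
  set δ : ℕ → ℝ := fun n => 1 / ((n : ℝ) + 1) with hδdef
  have hδ : ∀ n, 0 < δ n := fun n => by positivity
  have hδanti : ∀ m n, m ≤ n → δ n ≤ δ m := fun m n h => by
    have : (m : ℝ) ≤ n := by exact_mod_cast h
    simp only [hδdef]; gcongr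
  choose y hy0 hyd using fun n => exists_regularized_profile (α := α) hq hH hMc (hδ n)
  have hyc : ∀ n, Continuous (y n) := fun n =>
    continuous_iff_continuousAt.mpr fun s => (hyd n s).continuousAt
  have hmono : ∀ m n, m ≤ n → ∀ s, 0 ≤ s → y m s ≤ y n s := by
    intro m n hmn s hs
    refine le_of_deriv_le_of_lt (fun x _ => hyd m x) (fun x _ => hyd n x)
      (by rw [hy0, hy0]) (fun x hx hlt => ?_) s ⟨hs, le_rfl⟩
    have := regDamp_mono hq.le (hδ n) (hδanti m n hmn) (le_refl (M x)) hlt.le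
    gcongr
  -- The error term tends to zero uniformly for bounded `s`, which makes the limit continuous.
  have hclose : ∀ m n, m ≤ n → ∀ s, 0 ≤ s → y n s ≤ y m s + α * (2 * δ m) ^ q * s := by
    intro m n hmn s hs
    refine le_of_deriv_le_of_lt (fun x _ => hyd n x)
      (fun x _ => (hyd m x).add ((hasDerivAt_id x).const_mul (α * (2 * δ m) ^ q)))
      (by simp [hy0]) (fun x hx hlt => ?_) s ⟨hs, le_rfl⟩
    simp only [id_eq] at hlt
    have hx0 := hx.1
    have hδm := hδ m
    have h0 : 0 ≤ α * (2 * δ m) ^ q * x := by positivity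
    have h1 : y m x ≤ y n x := by simp only [Pi.add_apply] at hlt; linarith
    have h2 := regDamp_mono hq.le (hδ n) le_rfl (le_refl (M x)) h1
    have h3 := regDamp_le (q := q) (M := M x) (y := y m x) (hδ n) (hδanti m n hmn)
    have h4 : α * regDamp q (δ m) (M x) (y m x) ≤
      α * (regDamp q (δ n) (M x) (y n x) + (2 * δ m) ^ q) := by gcongr; linarith
    linarith
  have hle : ∀ n s, 0 ≤ s → y n s ≤ M s := by
    intro n s hs
    refine le_of_deriv_le_of_lt (fun x _ => hyd n x) (fun x _ => hMd x)
      (by simp [hy0, hMdef]) (fun x hx hlt => ?_) s ⟨hs, le_rfl⟩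
    have := mul_nonneg hα (regDamp_nonneg (q := q) (M := M x) (y := y n x) (hδ n))
    linarith [le_abs_self (H x)]
  have hlim : ∀ s, ∃ l, 0 ≤ s → Tendsto (fun n => y n s) atTop (𝓝 l) := by
    intro s
    rcases lt_or_ge s 0 with hs | hs
    · exact ⟨0, fun h => absurd h (not_le.mpr hs)⟩
    · exact ⟨_, fun _ => tendsto_atTop_ciSup (fun m n hmn => hmono m n hmn s hs)
        ⟨M s, by rintro _ ⟨n, rfl⟩; exact hle n s hs⟩⟩
  choose z hz using hlim
  have hδlim : Tendsto (fun n => (2 * δ n) ^ q) atTop (𝓝 0) := by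
    have h1 : Tendsto (fun n => 2 * δ n) atTop (𝓝 (2 * 0)) :=
      (tendsto_one_div_add_atTop_nhds_zero_nat (𝕜 := ℝ)).const_mul 2
    have h2 := h1.rpow_const (p := q) (Or.inr hq.le)
    simpa [Real.zero_rpow hq.ne'] using h2
  have hzy : ∀ n s, 0 ≤ s → y n s ≤ z s ∧ z s ≤ y n s + α * (2 * δ n) ^ q * s := by
    intro n s hs
    constructor
    · exact ge_of_tendsto (hz s hs) (eventually_atTop.mpr ⟨n, fun m hm => hmono n m hm s hs⟩)
    · exact le_of_tendsto (hz s hs) (eventually_atTop.mpr ⟨n, fun m hm => hclose n m hm s hs⟩)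
  have hzc : ContinuousOn z (Ici 0) := by
    have : ∀ S, ContinuousOn z (Icc 0 S) := by
      intro S
      refine TendstoUniformlyOn.continuousOn (F := y) (p := atTop) ?_
        (Eventually.of_forall fun n => (hyc n).continuousOn).frequently
      rw [Metric.tendstoUniformlyOn_iff]
      intro ε hε
      have h1 : Tendsto (fun n => α * (2 * δ n) ^ q * S) atTop (𝓝 (α * 0 * S)) :=
        (hδlim.const_mul α).mul_const S
      rw [mul_zero, zero_mul] at h1
      filter_upwards [h1.eventually (gt_mem_nhds hε)] with n hn s hs
      obtain ⟨ha, hb⟩ := hzy n s hs.1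
      rw [Real.dist_eq, abs_of_nonneg (by linarith)]
      have : α * (2 * δ n) ^ q * s ≤ α * (2 * δ n) ^ q * S := by
        have := hδ n
        have := hs.2
        gcongr
      linarith
    intro s hs
    have h1 : Icc (0 : ℝ) (s + 1) ∈ 𝓝[Ici 0] s := by
      rw [← Ici_inter_Iic]
      exact inter_mem_nhdsWithin _ (Iic_mem_nhds (by linarith))
    exact ((this (s + 1)) s ⟨hs, by linarith⟩).mono_of_mem_nhdsWithin h1
  have hzc' : Continuous fun s => z (max s 0) :=
    hzc.comp_continuous (by fun_prop) (fun s => mem_Ici.mpr (le_max_right _ _))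
  have hzM : ∀ s, 0 ≤ s → z s ≤ M s := fun s hs =>
    le_of_tendsto (hz s hs) (Eventually.of_forall fun n => hle n s hs)
  have hR : Continuous fun s => H s - α * damp q (z (max s 0)) :=
    hH.sub (continuous_const.mul ((continuous_damp hq).comp hzc'))
  have hpt : ∀ s, 0 ≤ s → Tendsto (fun n => regDamp q (δ n) (M s) (y n s)) atTop
      (𝓝 (damp q (z s))) := by
    intro s hs
    have h1 : Tendsto (fun n => 2 * max (δ n) (min (y n s) (M s))) atTop
        (𝓝 (2 * max 0 (min (z s) (M s)))) :=
      ((tendsto_one_div_add_atTop_nhds_zero_nat (𝕜 := ℝ)).max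
        ((hz s hs).min tendsto_const_nhds)).const_mul 2
    have h2 := h1.rpow_const (p := q) (Or.inr hq.le)
    rw [min_eq_left (hzM s hs), max_comm] at h2
    exact h2
  have hint : ∀ s, 0 ≤ s → z s = ∫ t in (0 : ℝ)..s, (H t - α * damp q (z (max t 0))) := by
    intro s hs
    refine tendsto_nhds_unique (hz s hs) ?_
    have h1 : ∀ n, Continuous fun t => H t - α * regDamp q (δ n) (M t) (y n t) := fun n =>
      hH.sub (continuous_const.mul ((continuous_regDamp (hδ n)).comp (hMc.prodMk (hyc n))))
    have h2 : ∀ n, y n s = ∫ t in (0 : ℝ)..s, (H t - α * regDamp q (δ n) (M t) (y n t)) := by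
      intro n
      rw [intervalIntegral.integral_eq_sub_of_hasDerivAt (fun t _ => hyd n t)
        ((h1 n).intervalIntegrable _ _), hy0, sub_zero]
    simp_rw [h2]
    -- The dominating function uses the highest floor `δ 0` and the bound `M` in place of the
    -- solution.
    refine intervalIntegral.tendsto_integral_filter_of_dominated_convergence
      (fun t => |H t| + α * regDamp q (δ 0) (M t) (M t))
      (Eventually.of_forall fun n => (h1 n).aestronglyMeasurable) ?_ ?_ ?_
    · refine Eventually.of_forall fun n => Eventually.of_forall fun t ht => ?_
      rw [uIoc_of_le hs] at ht
      have h3 := regDamp_mono hq.le (hδ n) (hδanti 0 n (Nat.zero_le n)) (le_refl (M t))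
        (hle n t ht.1.le)
      have h4 := regDamp_nonneg (q := q) (M := M t) (y := y n t) (hδ n)
      refine (abs_sub _ _).trans ?_
      rw [abs_mul, abs_of_nonneg hα, abs_of_nonneg h4]
      gcongr
    · exact (hH.abs.add (continuous_const.mul
        ((continuous_regDamp (hδ 0)).comp (hMc.prodMk hMc)))).intervalIntegrable _ _
    · refine Eventually.of_forall fun t ht => ?_
      rw [uIoc_of_le hs] at ht
      have := hpt t ht.1.le
      rw [← max_eq_left ht.1.le] at this
      rw [max_eq_left ht.1.le] at this ⊢
      exact tendsto_const_nhds.sub (this.const_mul α)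
  refine ⟨fun s => ∫ t in (0 : ℝ)..s, (H t - α * damp q (z (max t 0))), by simp, fun s hs => ?_⟩
  have h1 := intervalIntegral.integral_hasDerivAt_right (hR.intervalIntegrable 0 s)
    (hR.stronglyMeasurableAtFilter _ _) hR.continuousAt
  rw [max_eq_left hs] at h1
  beta_reduce
  rw [← hint s hs]
  exact h1

end KineticRelation

/-! ### Comparison and positivity for energy profiles. -/

namespace KineticRelation

namespace IsEnergyProfile

variable {α β q S : ℝ} {H K y z : ℝ → ℝ}

theorem continuousOn (h : IsEnergyProfile α q H y) : ContinuousOn y (Ici 0) := fun s hs =>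
  (h.2 s hs).continuousAt.continuousWithinAt

/-- Where the claimed order fails, the larger energy is damped at least as much, by monotonicity of
`damp`; no Lipschitz condition is needed. Equal data give uniqueness. -/
theorem mono (hβ : 0 ≤ β) (hβα : β ≤ α) (hq : 0 ≤ q) (hy : IsEnergyProfile α q H y)
    (hz : IsEnergyProfile β q K z) (hHK : ∀ s ∈ Icc 0 S, H s ≤ K s) :
    ∀ s ∈ Icc 0 S, y s ≤ z s := by
  refine le_of_deriv_le_of_lt (fun x hx => hy.2 x hx.1) (fun x hx => hz.2 x hx.1)
    (by rw [hy.1, hz.1]) (fun x hx hlt => ?_)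
  have h1 := damp_mono hq hlt.le
  have h2 := damp_nonneg q (z x)
  have h3 := hHK x hx
  have hα := hβ.trans hβα
  have : β * damp q (z x) ≤ α * damp q (y x) := by gcongr
  linarith

theorem nonneg (hq : 0 < q) (hy : IsEnergyProfile α q H y)
    (hH : ∀ s ∈ Icc 0 S, 0 ≤ H s) : ∀ s ∈ Icc 0 S, 0 ≤ y s := by
  refine le_of_deriv_le_of_lt (f := fun _ => 0) (f' := fun _ => 0) (fun x hx => hasDerivAt_const _ _)
    (fun x hx => hy.2 x hx.1) (by rw [hy.1]) (fun x hx hlt => ?_)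
  rw [damp_of_nonpos hq hlt.le, mul_zero, sub_zero]
  exact hH x hx

/-- The profile is nonnegative, so an interior zero would be a minimum; but without energy there is
no damping and the derivative is `H > 0`. -/
theorem pos (hq : 0 < q) (hy : IsEnergyProfile α q H y) (hHc : Continuous H)
    (hH : ∀ s ∈ Ioo 0 S, 0 < H s) : ∀ s ∈ Ioo 0 S, 0 < y s := by
  intro s hs
  have hS : (0 : ℝ) < S := hs.1.trans hs.2
  have hH' : ∀ s ∈ Icc 0 S, 0 ≤ H s := by
    have h1 : closure (Ioo 0 S) ⊆ {s | 0 ≤ H s} :=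
      closure_minimal (fun s hs => (hH s hs).le) (isClosed_le continuous_const hHc)
    rwa [closure_Ioo hS.ne] at h1
  have hnn := nonneg hq hy hH'
  refine lt_of_le_of_ne (hnn s ⟨hs.1.le, hs.2.le⟩) (fun h0 => ?_)
  have hmin : IsLocalMin y s := by
    filter_upwards [Ioo_mem_nhds hs.1 hs.2] with t ht
    rw [← h0]
    exact hnn t ⟨ht.1.le, ht.2.le⟩
  have := hmin.hasDerivAt_eq_zero (hy.2 s hs.1.le)
  rw [← h0, damp_of_nonpos hq le_rfl, mul_zero, sub_zero] at this
  exact (hH s hs).ne' this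

/-- Without damping the energy would be the primitive of `H`. The inequality is strict because the
energy is positive, and hence damped, on `(0, c)`. -/
theorem lt_primitive (hα : 0 < α) (hq : 0 < q) (hy : IsEnergyProfile α q H y) (hHc : Continuous H)
    {G : ℝ → ℝ} (hG : ∀ s, 0 ≤ s → HasDerivAt G (H s) s) {c : ℝ}
    (hH : ∀ s ∈ Ioo 0 c, 0 < H s) (hc : 0 < c) {s : ℝ} (hs : c ≤ s) : y s < G s - G 0 := by
  have hpos := pos hq hy hHc hH
  have h1 := strictAntiOn_of_hasDerivAt_neg (convex_Icc (0 : ℝ) c)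
    (fun x hx => (hy.2 x hx.1).sub (hG x hx.1))
    (fun x hx => by
      rw [interior_Icc] at hx
      have := mul_pos hα (damp_pos (q := q) (hpos x hx)); linarith)
    ⟨le_rfl, hc.le⟩ ⟨hc.le, le_rfl⟩ hc
  have h := antitoneOn_of_hasDerivAt_nonpos (convex_Ici (0 : ℝ))
    (fun x hx => (hy.2 x hx).sub (hG x hx))
    (fun x hx => by have := mul_nonneg hα.le (damp_nonneg q (y x)); linarith)
    (mem_Ici.mpr hc.le) (mem_Ici.mpr (hc.le.trans hs)) hs
  simp only [Pi.sub_apply, hy.1] at h h1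
  linarith

/-- A time shift of the profile solves the equation with a larger force and a nonnegative start, so
it dominates the profile. Thus the profile is nondecreasing and its derivative `H - α * damp` is
nonnegative. -/
theorem damp_le_of_monotoneOn (hα : 0 ≤ α) (hq : 0 < q) (hy : IsEnergyProfile α q H y)
    (hHc : Continuous H) (hH0 : 0 ≤ H 0) (hH : MonotoneOn H (Icc 0 S)) :
    ∀ s ∈ Icc 0 S, α * damp q (y s) ≤ H s := by
  have hHnn : ∀ s ∈ Icc 0 S, 0 ≤ H s := fun s hs =>
    hH0.trans (hH ⟨le_rfl, hs.1.trans hs.2⟩ hs hs.1)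
  have hshift : ∀ a b, 0 ≤ a → a ≤ b → b ≤ S → y a ≤ y b := by
    intro a b ha hab hb
    have hy' : ∀ x ∈ Icc 0 a, HasDerivAt (fun t => y (t + (b - a)))
        (H (x + (b - a)) - α * damp q (y (x + (b - a)))) x := fun x hx =>
      (hy.2 (x + (b - a)) (by linarith [hx.1])).comp_add_const _ _
    have := le_of_deriv_le_of_lt (fun x hx => hy.2 x hx.1) hy' (by
      rw [hy.1]; exact nonneg hq hy hHnn _ ⟨by linarith, by linarith⟩) (fun x hx hlt => by
      have h1 := hH ⟨hx.1, by linarith [hx.2]⟩ ⟨by linarith [hx.1], by linarith [hx.2]⟩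
        (show x ≤ x + (b - a) by linarith)
      have h2 := mul_le_mul_of_nonneg_left (damp_mono hq.le hlt.le) hα
      linarith) a ⟨ha, le_rfl⟩
    simpa using this
  have hint : ∀ s ∈ Ioo 0 S, α * damp q (y s) ≤ H s := by
    intro s hs
    have hd := hy.2 s hs.1.le
    have hm : MonotoneOn y (Ioo 0 S) := fun a ha b hb hab => hshift a b ha.1.le hab hb.2.le
    have : 0 ≤ derivWithin y (Ioo 0 S) s := hm.derivWithin_nonneg
    rw [hd.hasDerivWithinAt.derivWithin (isOpen_Ioo.uniqueDiffWithinAt hs)] at this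
    linarith
  intro s hs
  rcases eq_or_lt_of_le (hs.1.trans hs.2) with hS | hS
  · have : s = 0 := le_antisymm (hS ▸ hs.2) hs.1
    subst this
    rw [hy.1, damp_of_nonpos hq le_rfl, mul_zero]
    exact hH0
  have hcl : s ∈ closure (Ioo 0 S) := by rw [closure_Ioo hS.ne]; exact hs
  have hsub : ContinuousOn (fun s => H s - α * damp q (y s)) (Icc 0 S) :=
    hHc.continuousOn.sub (continuousOn_const.mul ((continuous_damp hq).comp_continuousOn
      (hy.continuousOn.mono fun x hx => mem_Ici.mpr hx.1)))
  have hmem : (fun s => H s - α * damp q (y s)) s ∈ closure (Ici (0 : ℝ)) := by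
    refine (hsub s hs).mono Ioo_subset_Icc_self |>.mem_closure hcl ?_
    intro t ht
    exact sub_nonneg.mpr (hint t ht)
  rw [closure_Ici] at hmem
  exact sub_nonneg.mp hmem

theorem le_quadratic (hα : 0 ≤ α) (hy : IsEnergyProfile α q H y) {C : ℝ}
    (hH : ∀ s ∈ Icc 0 S, H s ≤ C * s) : ∀ s ∈ Icc 0 S, y s ≤ C * s ^ 2 / 2 := by
  refine le_of_deriv_le_of_lt (g := fun s => C * s ^ 2 / 2) (g' := fun s => C * s) (fun x hx => hy.2 x hx.1)
    (fun x hx => ?_) (by simp [hy.1]) (fun x hx hlt => ?_)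
  · have := ((hasDerivAt_pow 2 x).const_mul C).div_const 2
    refine this.congr_deriv ?_
    norm_num
    ring
  · have := mul_nonneg hα (damp_nonneg q (y x))
    linarith [hH x hx]

end IsEnergyProfile

end KineticRelation

/-! ### Geometry of a concave-convex graph: tangents, chords and chord areas. -/

namespace KineticRelation

/-- A flux `f` with derivatives `f1 = f'`, `f2 = f''`, such that `f''(x) / x` is locally bounded
above and below by positive constants. -/
structure Flux (f f1 f2 : ℝ → ℝ) : Prop where
  hasDerivAt : ∀ x, HasDerivAt f (f1 x) x
  hasDerivAt1 : ∀ x, HasDerivAt f1 (f2 x) x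
  lipschitz : ∀ R, ∃ K, 0 ≤ K ∧
    ∀ x ∈ Icc (-R) R, ∀ y ∈ Icc (-R) R, |f2 x - f2 y| ≤ K * |x - y|
  bounds : ∀ R, ∃ c C, 0 < c ∧ c ≤ C ∧
    ∀ x ∈ Icc (-R) R, c * x ^ 2 ≤ x * f2 x ∧ x * f2 x ≤ C * x ^ 2
  tendsto_atTop : Tendsto f1 atTop atTop
  tendsto_atBot : Tendsto f1 atBot atTop

/-- The tangent to the graph at `v`, minus `f`, at `w`. -/
def tangentGap (f f1 : ℝ → ℝ) (v w : ℝ) : ℝ := f v + f1 v * (w - v) - f w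

/-- The line of slope `lam` through `(u, f u)`, minus `f`, at `w`. -/
def excess (f : ℝ → ℝ) (u lam w : ℝ) : ℝ := lam * (w - u) + f u - f w

/-- The integral from `v` to `u` of the chord between `v` and `u`, minus `f`. -/
noncomputable def chordArea (f : ℝ → ℝ) (u v : ℝ) : ℝ :=
  (u - v) * (f u + f v) / 2 - ∫ x in v..u, f x

theorem excess_eq_mul {f : ℝ → ℝ} {u lam w : ℝ} (h : u ≠ w) :
    excess f u lam w = (u - w) * (chordSpeed f u w - lam) := by
  have : u - w ≠ 0 := sub_ne_zero.mpr h
  unfold excess chordSpeed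
  field_simp
  ring

theorem excess_self (f : ℝ → ℝ) (u lam : ℝ) : excess f u lam u = 0 := by simp [excess]

theorem excess_chordSpeed {f : ℝ → ℝ} {u w : ℝ} (h : u ≠ w) :
    excess f u (chordSpeed f u w) w = 0 := by rw [excess_eq_mul h, sub_self, mul_zero]

theorem chordSpeed_mul {f : ℝ → ℝ} {u w : ℝ} (h : u ≠ w) :
    chordSpeed f u w * (u - w) = f u - f w :=
  div_mul_cancel₀ _ (sub_ne_zero.mpr h)

namespace Flux

variable {f f1 f2 : ℝ → ℝ}

/-- The symmetry `u ↦ -u`, which transfers every result for positive left states to negative ones.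
-/
theorem reflect (F : Flux f f1 f2) :
    Flux (fun x => -f (-x)) (fun x => f1 (-x)) (fun x => -f2 (-x)) where
  hasDerivAt x := by
    have := ((F.hasDerivAt (-x)).comp x (hasDerivAt_neg x)).neg
    refine this.congr_deriv ?_
    ring
  hasDerivAt1 x := by
    refine ((F.hasDerivAt1 (-x)).comp x (hasDerivAt_neg x)).congr_deriv ?_
    ring
  lipschitz R := by
    obtain ⟨K, hK, h⟩ := F.lipschitz R
    refine ⟨K, hK, fun x hx y hy => ?_⟩
    have h1 := h (-x) ⟨by linarith [hx.2], by linarith [hx.1]⟩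
      (-y) ⟨by linarith [hy.2], by linarith [hy.1]⟩
    rw [show -f2 (-x) - -f2 (-y) = -(f2 (-x) - f2 (-y)) by ring, abs_neg]
    rwa [show -x - -y = -(x - y) by ring, abs_neg] at h1
  bounds R := by
    obtain ⟨c, C, hc, hcC, h⟩ := F.bounds R
    refine ⟨c, C, hc, hcC, fun x hx => ?_⟩
    have h1 := h (-x) ⟨by linarith [hx.2], by linarith [hx.1]⟩
    constructor <;> nlinarith [h1.1, h1.2]
  tendsto_atTop := F.tendsto_atBot.comp tendsto_neg_atTop_atBot
  tendsto_atBot := F.tendsto_atTop.comp tendsto_neg_atBot_atTop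

section basic
variable (F : Flux f f1 f2)
include F

theorem continuous : Continuous f :=
  continuous_iff_continuousAt.mpr fun x => (F.hasDerivAt x).continuousAt

theorem continuous1 : Continuous f1 :=
  continuous_iff_continuousAt.mpr fun x => (F.hasDerivAt1 x).continuousAt

theorem f2_pos {x : ℝ} (hx : 0 < x) : 0 < f2 x := by
  obtain ⟨c, C, hc, -, h⟩ := F.bounds x
  have h1 := (h x ⟨by linarith, le_rfl⟩).1
  have : 0 < x * f2 x := lt_of_lt_of_le (by positivity) h1
  exact (mul_pos_iff_of_pos_left hx).mp this

theorem f2_neg {x : ℝ} (hx : x < 0) : f2 x < 0 := by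
  have := F.reflect.f2_pos (neg_pos.mpr hx)
  simpa using this

theorem strictMonoOn1 : StrictMonoOn f1 (Ici 0) :=
  strictMonoOn_of_hasDerivAt_pos (convex_Ici 0) (fun x _ => F.hasDerivAt1 x)
    (fun x hx => F.f2_pos (by simpa using hx))

theorem strictAntiOn1 : StrictAntiOn f1 (Iic 0) :=
  strictAntiOn_of_hasDerivAt_neg (convex_Iic 0) (fun x _ => F.hasDerivAt1 x)
    (fun x hx => F.f2_neg (by simpa using hx))

theorem f1_zero_lt {x : ℝ} (hx : x ≠ 0) : f1 0 < f1 x := by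
  rcases lt_or_gt_of_ne hx with h | h
  · exact F.strictAntiOn1 (mem_Iic.mpr h.le) (mem_Iic.mpr le_rfl) h
  · exact F.strictMonoOn1 (mem_Ici.mpr le_rfl) (mem_Ici.mpr h.le) h

theorem hasDerivAt_tangentGap_left (v w : ℝ) :
    HasDerivAt (fun v => tangentGap f f1 v w) (f2 v * (w - v)) v := by
  have h := ((F.hasDerivAt v).add ((F.hasDerivAt1 v).mul
    ((hasDerivAt_const v w).sub (hasDerivAt_id v)))).sub_const (f w)
  refine h.congr_deriv ?_
  simp

theorem hasDerivAt_tangentGap_right (v w : ℝ) :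
    HasDerivAt (fun w => tangentGap f f1 v w) (f1 v - f1 w) w := by
  have h := ((((hasDerivAt_id w).sub_const v).const_mul (f1 v)).const_add (f v)).sub (F.hasDerivAt w)
  refine h.congr_deriv ?_
  simp

theorem hasDerivAt_excess (u lam w : ℝ) :
    HasDerivAt (fun w => excess f u lam w) (lam - f1 w) w := by
  have h := ((((hasDerivAt_id w).sub_const u).const_mul lam).add_const (f u)).sub (F.hasDerivAt w)
  refine h.congr_deriv ?_
  simp

theorem continuous_excess (u lam : ℝ) : Continuous (excess f u lam) :=
  continuous_iff_continuousAt.mpr fun w => (F.hasDerivAt_excess u lam w).continuousAt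

/-- The sign of the tangent gap thus decides where the chord speed from `u` increases and where it
decreases. -/
theorem hasDerivAt_chordSpeed {u w : ℝ} (h : w ≠ u) :
    HasDerivAt (fun w => chordSpeed f u w) (-tangentGap f f1 w u / (u - w) ^ 2) w := by
  have h0 : u - w ≠ 0 := sub_ne_zero.mpr h.symm
  have h := ((F.hasDerivAt w).const_sub (f u)).div ((hasDerivAt_id w).const_sub u) h0
  refine h.congr_deriv ?_
  simp only [id_eq, tangentGap]
  congr 1
  ring

/-- `f` is strictly convex on the positive half-line. -/
theorem tangentGap_neg {v w : ℝ} (hv : 0 ≤ v) (hw : 0 ≤ w) (h : v ≠ w) :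
    tangentGap f f1 v w < 0 := by
  have h0 : tangentGap f f1 w w = 0 := by simp [tangentGap]
  rcases lt_or_gt_of_ne h with h | h
  · have := strictMonoOn_of_hasDerivAt_pos (convex_Icc v w)
      (fun x _ => F.hasDerivAt_tangentGap_left x w) (fun x hx => by
        rw [interior_Icc] at hx
        exact mul_pos (F.f2_pos (hv.trans_lt hx.1)) (by linarith [hx.2]))
      ⟨le_rfl, h.le⟩ ⟨h.le, le_rfl⟩ h
    linarith
  · have := strictAntiOn_of_hasDerivAt_neg (convex_Icc w v)
      (fun x _ => F.hasDerivAt_tangentGap_left x w) (fun x hx => by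
        rw [interior_Icc] at hx
        exact mul_neg_of_pos_of_neg (F.f2_pos (hw.trans_lt hx.1)) (by linarith [hx.1]))
      ⟨le_rfl, h.le⟩ ⟨h.le, le_rfl⟩ h
    linarith

/-- The derivative in `v` is `f2 v * (u - v)`, negative on the concave side; the tangent state is
therefore unique on that side. -/
theorem strictAntiOn_tangentGap {u : ℝ} (hu : 0 ≤ u) :
    StrictAntiOn (fun v => tangentGap f f1 v u) (Iic 0) :=
  strictAntiOn_of_hasDerivAt_neg (convex_Iic 0) (fun x _ => F.hasDerivAt_tangentGap_left x u)
    (fun x hx => by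
      rw [interior_Iic] at hx
      have : x < 0 := hx
      exact mul_neg_of_neg_of_pos (F.f2_neg hx) (by linarith))

theorem exists_tangent {u : ℝ} (hu : 0 < u) : ∃ v, v < 0 ∧ tangentGap f f1 v u = 0 := by
  -- A tangent steeper than `f1 u` stays above the graph up to `u`, while the tangent at the
  -- inflection point passes below `(u, f u)`.
  obtain ⟨v, hv0, hv⟩ : ∃ v, v < 0 ∧ f1 u < f1 v :=
    ((eventually_lt_atBot (0 : ℝ)).and (F.tendsto_atBot.eventually_gt_atTop (f1 u))).exists
  have hpos : 0 < tangentGap f f1 v u := by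
    have h1 : StrictMonoOn (fun w => tangentGap f f1 v w) (Icc v u) := by
      refine strictMonoOn_of_hasDerivAt_pos (convex_Icc v u)
        (fun x _ => F.hasDerivAt_tangentGap_right v x) (fun x hx => ?_)
      rw [interior_Icc] at hx
      rcases le_total x 0 with h | h
      · linarith [F.strictAntiOn1 (mem_Iic.mpr hv0.le) (mem_Iic.mpr h) hx.1]
      · linarith [F.strictMonoOn1 (mem_Ici.mpr h) (mem_Ici.mpr hu.le) hx.2]
    have := h1 ⟨le_rfl, by linarith⟩ ⟨by linarith, le_rfl⟩ (hv0.trans hu)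
    simpa [tangentGap] using this
  have hneg := F.tangentGap_neg le_rfl hu.le hu.ne
  have hcont : ContinuousOn (fun v => tangentGap f f1 v u) (Icc v 0) := fun x _ =>
    (F.hasDerivAt_tangentGap_left x u).continuousAt.continuousWithinAt
  obtain ⟨z, hz, hz0⟩ := intermediate_value_Icc' hv0.le hcont ⟨hneg.le, hpos.le⟩
  refine ⟨z, lt_of_le_of_ne hz.2 ?_, hz0⟩
  rintro rfl
  exact hneg.ne hz0

end basic

end Flux

open Classical in
/-- The abscissa of the point where a line through `(u, f u)`, `u > 0`, is tangent to the
graph. -/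
noncomputable def tangentState (f f1 : ℝ → ℝ) (u : ℝ) : ℝ :=
  if h : ∃ v, v < 0 ∧ tangentGap f f1 v u = 0 then h.choose else 0

namespace Flux

variable {f f1 f2 : ℝ → ℝ} (F : Flux f f1 f2)
include F

theorem tangentState_neg {u : ℝ} (hu : 0 < u) : tangentState f f1 u < 0 := by
  rw [tangentState, dif_pos (F.exists_tangent hu)]
  exact (F.exists_tangent hu).choose_spec.1

theorem tangentGap_tangentState {u : ℝ} (hu : 0 < u) :
    tangentGap f f1 (tangentState f f1 u) u = 0 := by
  rw [tangentState, dif_pos (F.exists_tangent hu)]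
  exact (F.exists_tangent hu).choose_spec.2

theorem tangentState_lt {u : ℝ} (hu : 0 < u) : tangentState f f1 u < u :=
  (F.tangentState_neg hu).trans hu

theorem tangentGap_pos_of_lt {u v : ℝ} (hu : 0 < u) (hv : v < tangentState f f1 u) :
    0 < tangentGap f f1 v u := by
  have h := F.tangentState_neg hu
  have := F.strictAntiOn_tangentGap hu.le (mem_Iic.mpr (hv.trans h).le) (mem_Iic.mpr h.le) hv
  simp only [F.tangentGap_tangentState hu] at this
  exact this

theorem tangentGap_neg_of_lt {u v : ℝ} (hu : 0 < u) (hv : tangentState f f1 u < v) (hvu : v ≠ u) :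
    tangentGap f f1 v u < 0 := by
  rcases le_or_gt v 0 with h0 | h0
  · have h := F.tangentState_neg hu
    have := F.strictAntiOn_tangentGap hu.le (mem_Iic.mpr h.le) (mem_Iic.mpr h0) hv
    simp only [F.tangentGap_tangentState hu] at this
    exact this
  · exact F.tangentGap_neg h0.le hu.le hvu

theorem le_tangentState_of_tangentGap_nonneg {u v : ℝ} (hu : 0 < u) (hvu : v ≠ u)
    (h : 0 ≤ tangentGap f f1 v u) : v ≤ tangentState f f1 u := by
  by_contra! hc
  exact absurd h (not_le.mpr (F.tangentGap_neg_of_lt hu hc hvu))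

/-- The tangent at the tangent state `v` of `u` crosses the graph at `u` with `f1 v < f1 u`, so it
is strictly below the graph at any larger `u'`. A negative gap at `u'` places `v` to the right of
the tangent state of `u'`. -/
theorem tangentState_strictAnti {u u' : ℝ} (hu : 0 < u) (h : u < u') :
    tangentState f f1 u' < tangentState f f1 u := by
  by_contra! hc
  have hu' := hu.trans h
  set v := tangentState f f1 u with hv
  have hv0 : v < 0 := F.tangentState_neg hu
  have h1 : 0 ≤ tangentGap f f1 v u' := by
    rcases eq_or_lt_of_le hc with he | he
    · rw [he, F.tangentGap_tangentState hu']
    · exact (F.tangentGap_pos_of_lt hu' he).le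
  have h2 : tangentGap f f1 v u = 0 := F.tangentGap_tangentState hu
  -- on `[u, ∞)` the gap is strictly decreasing, since `f1 v < f1 u`
  have h3 : f1 v < f1 u := by
    by_contra! h3
    have h4 : StrictMonoOn (fun w => tangentGap f f1 v w) (Icc v u) := by
      refine strictMonoOn_of_hasDerivAt_pos (convex_Icc v u)
        (fun x _ => F.hasDerivAt_tangentGap_right v x) (fun x hx => ?_)
      rw [interior_Icc] at hx
      rcases le_total x 0 with h | h
      · linarith [F.strictAntiOn1 (mem_Iic.mpr hv0.le) (mem_Iic.mpr h) hx.1]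
      · linarith [F.strictMonoOn1 (mem_Ici.mpr h) (mem_Ici.mpr hu.le) hx.2]
    have := h4 ⟨le_rfl, by linarith⟩ ⟨by linarith, le_rfl⟩ (hv0.trans hu)
    have h5 : tangentGap f f1 v v = 0 := by simp [tangentGap]
    simp only [h2, h5] at this
    exact lt_irrefl _ this
  have h4 : StrictAntiOn (fun w => tangentGap f f1 v w) (Icc u u') := by
    refine strictAntiOn_of_hasDerivAt_neg (convex_Icc u u')
      (fun x _ => F.hasDerivAt_tangentGap_right v x) (fun x hx => ?_)
    rw [interior_Icc] at hx
    linarith [F.strictMonoOn1 (mem_Ici.mpr hu.le) (mem_Ici.mpr (hu.trans hx.1).le) hx.1]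
  have := h4 ⟨le_rfl, h.le⟩ ⟨h.le, le_rfl⟩ h
  simp only [h2] at this
  linarith

theorem deriv_tangentState_eq {u : ℝ} (hu : 0 < u) :
    f1 (tangentState f f1 u) = chordSpeed f u (tangentState f f1 u) := by
  have h := F.tangentGap_tangentState hu
  have h1 : u - tangentState f f1 u ≠ 0 := by linarith [F.tangentState_lt hu]
  rw [chordSpeed, eq_div_iff h1]
  unfold tangentGap at h
  linarith

theorem strictAntiOn_chordSpeed {u : ℝ} (hu : 0 < u) :
    StrictAntiOn (chordSpeed f u) (Iic (tangentState f f1 u)) := by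
  have hlt := F.tangentState_lt hu
  refine strictAntiOn_of_hasDerivAt_neg (convex_Iic _)
    (fun x hx => F.hasDerivAt_chordSpeed ?_) (fun x hx => ?_)
  · have : x ≤ tangentState f f1 u := hx
    linarith
  · rw [interior_Iic] at hx
    have hx' : x < tangentState f f1 u := hx
    have h1 := F.tangentGap_pos_of_lt hu hx
    have h2 : 0 < (u - x) ^ 2 := by have : 0 < u - x := by linarith
                                    positivity
    exact div_neg_of_neg_of_pos (by linarith) h2

theorem strictMonoOn_chordSpeed {u : ℝ} (hu : 0 < u) :
    StrictMonoOn (chordSpeed f u) (Ico (tangentState f f1 u) u) := by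
  refine strictMonoOn_of_hasDerivAt_pos (convex_Ico _ _)
    (fun x hx => F.hasDerivAt_chordSpeed hx.2.ne) (fun x hx => ?_)
  rw [interior_Ico] at hx
  have h1 := F.tangentGap_neg_of_lt hu hx.1 hx.2.ne
  have h2 : 0 < (u - x) ^ 2 := by have : 0 < u - x := by linarith [hx.2]
                                  positivity
  exact div_pos (by linarith) h2

theorem chordSpeed_tangentState_le {u w : ℝ} (hu : 0 < u) (hw : w < u) :
    chordSpeed f u (tangentState f f1 u) ≤ chordSpeed f u w := by
  rcases le_total w (tangentState f f1 u) with h | h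
  · exact (F.strictAntiOn_chordSpeed hu).antitoneOn h (mem_Iic.mpr le_rfl) h
  · exact (F.strictMonoOn_chordSpeed hu).monotoneOn ⟨le_rfl, F.tangentState_lt hu⟩ ⟨h, hw⟩ h

/-- On the positive side, chord speeds lie between the characteristic speeds. -/
theorem lt_chordSpeed_lt {u w : ℝ} (hw : 0 ≤ w) (hwu : w < u) :
    f1 w < chordSpeed f u w ∧ chordSpeed f u w < f1 u := by
  have h : 0 < u - w := by linarith
  have h1 := F.tangentGap_neg hw (hw.trans hwu.le) hwu.ne
  have h2 := F.tangentGap_neg (hw.trans hwu.le) hw hwu.ne'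
  unfold tangentGap at h1 h2
  rw [chordSpeed, lt_div_iff₀ h, div_lt_iff₀ h]
  constructor <;> linarith

theorem chordSpeed_lt {u w : ℝ} (hu : 0 < u) (hw : tangentState f f1 u ≤ w) (hwu : w < u) :
    chordSpeed f u w < f1 u := by
  rcases le_or_gt 0 w with h | h
  · exact (F.lt_chordSpeed_lt h hwu).2
  · exact ((F.strictMonoOn_chordSpeed hu).monotoneOn ⟨hw, hwu⟩
      ⟨hw.trans h.le, hu⟩ h.le).trans_lt (F.lt_chordSpeed_lt le_rfl hu).2

theorem lt_chordSpeed_of_gt {u w : ℝ} (hu : 0 ≤ u) (hw : u < w) : f1 u < chordSpeed f u w := by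
  have := (F.lt_chordSpeed_lt hu hw).1
  rwa [chordSpeed, ← neg_sub (f u), ← neg_sub u, neg_div_neg_eq] at this

/-- Intermediate values on the branch where the chord speed increases from the tangent speed; near
`u` it exceeds any speed below `f1 u`, being larger than `f1` at the right state. -/
theorem exists_companion {u lam : ℝ} (hu : 0 < u)
    (h1 : chordSpeed f u (tangentState f f1 u) ≤ lam) (h2 : lam < f1 u) :
    ∃ c ∈ Ico (tangentState f f1 u) u, chordSpeed f u c = lam := by
  have hev : ∀ᶠ w in 𝓝[<] u, lam < f1 w :=
    (F.continuous1.continuousAt.eventually (lt_mem_nhds h2)).filter_mono nhdsWithin_le_nhds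
  obtain ⟨w, hw, hw0⟩ := (hev.and (Ioo_mem_nhdsLT hu)).exists
  have h3 := (F.lt_chordSpeed_lt hw0.1.le hw0.2).1
  have hcont : ContinuousOn (chordSpeed f u) (Icc (tangentState f f1 u) w) := fun x hx =>
    (F.hasDerivAt_chordSpeed (hx.2.trans_lt hw0.2).ne).continuousAt.continuousWithinAt
  obtain ⟨c, hc, hc'⟩ := intermediate_value_Icc ((F.tangentState_neg hu).le.trans hw0.1.le) hcont
    ⟨h1, (hw.trans h3).le⟩
  exact ⟨c, ⟨hc.1, hc.2.trans_lt hw0.2⟩, hc'⟩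

theorem hasDerivAt_primitive (x : ℝ) : HasDerivAt (fun x => ∫ t in (0 : ℝ)..x, f t) (f x) x :=
  intervalIntegral.integral_hasDerivAt_right (F.continuous.intervalIntegrable _ _)
    (F.continuous.stronglyMeasurableAtFilter _ _) F.continuous.continuousAt

theorem chordArea_eq (u v : ℝ) : chordArea f u v = (u - v) * (f u + f v) / 2 -
    ((∫ x in (0 : ℝ)..u, f x) - ∫ x in (0 : ℝ)..v, f x) := by
  rw [chordArea, intervalIntegral.integral_interval_sub_left
    (F.continuous.intervalIntegrable _ _) (F.continuous.intervalIntegrable _ _)]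

/-- Integration by parts: `x f(x) - ∫ f` is a primitive of `f'(x) x`, and the chord relation
eliminates the speed. -/
theorem entropyDissipation_eq {u v : ℝ} (h : u ≠ v) :
    entropyDissipation f u v = -chordArea f u v := by
  have hd : ∀ x, HasDerivAt (fun x => x * f x - ∫ t in (0 : ℝ)..x, f t) (f1 x * x) x := by
    intro x
    refine (((hasDerivAt_id x).mul (F.hasDerivAt x)).sub (F.hasDerivAt_primitive x)).congr_deriv ?_
    simp; ring
  have hderiv : deriv f = f1 := funext fun x => (F.hasDerivAt x).deriv
  have hint := intervalIntegral.integral_eq_sub_of_hasDerivAt (a := u) (b := v) (fun x _ => hd x)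
    ((F.continuous1.mul continuous_id).intervalIntegrable _ _)
  rw [entropyDissipation, hderiv, hint, F.chordArea_eq]
  have h1 := chordSpeed_mul (f := f) h
  linear_combination ((u + v) / 2) * h1

/-- The same tangent gap drives the chord area, which therefore increases in `v` up to the tangent
state and decreases from there to `u`. -/
theorem hasDerivAt_chordArea_right (u v : ℝ) :
    HasDerivAt (fun v => chordArea f u v) (tangentGap f f1 v u / 2) v := by
  simp_rw [F.chordArea_eq]
  have h := ((((hasDerivAt_id v).const_sub u).mul ((F.hasDerivAt v).const_add (f u))).div_const 2).sub
    ((F.hasDerivAt_primitive v).const_sub (∫ x in (0 : ℝ)..u, f x))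
  refine h.congr_deriv ?_
  simp [tangentGap]; ring

theorem hasDerivAt_chordArea_left (u v : ℝ) :
    HasDerivAt (fun u => chordArea f u v) (((u - v) * f1 u - (f u - f v)) / 2) u := by
  simp_rw [F.chordArea_eq]
  have h := ((((hasDerivAt_id u).sub_const v).mul ((F.hasDerivAt u).add_const (f v))).div_const 2).sub
    ((F.hasDerivAt_primitive u).sub_const (∫ x in (0 : ℝ)..v, f x))
  refine h.congr_deriv ?_
  simp; ring

theorem chordArea_pos {u v : ℝ} (hu : 0 < u) (hv : tangentState f f1 u ≤ v) (hvu : v < u) :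
    0 < chordArea f u v := by
  have h := strictAntiOn_of_hasDerivAt_neg (convex_Icc v u)
    (fun x _ => F.hasDerivAt_chordArea_right u x) (fun x hx => by
      rw [interior_Icc] at hx
      linarith [F.tangentGap_neg_of_lt hu (hv.trans_lt hx.1) hx.2.ne])
    ⟨le_rfl, hvu.le⟩ ⟨hvu.le, le_rfl⟩ hvu
  simpa [chordArea] using h

theorem strictMonoOn_chordArea {u : ℝ} (hu : 0 < u) :
    StrictMonoOn (chordArea f u) (Iic (tangentState f f1 u)) :=
  strictMonoOn_of_hasDerivAt_pos (convex_Iic _) (fun x _ => F.hasDerivAt_chordArea_right u x)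
    (fun x hx => by
      rw [interior_Iic] at hx
      linarith [F.tangentGap_pos_of_lt hu hx])

theorem exists_chordArea_eq_zero {u : ℝ} (hu : 0 < u) :
    ∃ v, v < tangentState f f1 u ∧ chordArea f u v = 0 := by
  set t := tangentState f f1 u
  have ht0 : t < 0 := F.tangentState_neg hu
  have hpos : 0 < chordArea f u t := F.chordArea_pos hu le_rfl (F.tangentState_lt hu)
  -- Left of `t - 1` the gap is at least `T`, so the area has slope at least `T / 2` there and
  -- becomes negative far enough to the left.
  set T := tangentGap f f1 (t - 1) u
  have hT : 0 < T := F.tangentGap_pos_of_lt hu (by linarith : t - 1 < t)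
  have hlin : MonotoneOn (fun v => chordArea f u v - T / 2 * v) (Iic (t - 1)) := by
    refine monotoneOn_of_hasDerivAt_nonneg (convex_Iic _)
      (fun x _ => (F.hasDerivAt_chordArea_right u x).sub ((hasDerivAt_id x).const_mul (T / 2)))
      (fun x hx => ?_)
    have := (F.strictAntiOn_tangentGap hu.le).antitoneOn
      (mem_Iic.mpr ((mem_Iic.mp hx).trans (by linarith))) (mem_Iic.mpr (by linarith : t - 1 ≤ 0)) hx
    linarith
  set v := min (t - 1) (t - 1 - 2 * |chordArea f u (t - 1)| / T)
  have hv1 : v ≤ t - 1 := min_le_left _ _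
  have hneg : chordArea f u v ≤ 0 := by
    have h1 := hlin (mem_Iic.mpr hv1) (mem_Iic.mpr le_rfl) hv1
    simp only at h1
    have h2 : v ≤ t - 1 - 2 * |chordArea f u (t - 1)| / T := min_le_right _ _
    have h3 : T / 2 * v ≤ T / 2 * (t - 1 - 2 * |chordArea f u (t - 1)| / T) := by gcongr
    have h4 : T / 2 * (t - 1 - 2 * |chordArea f u (t - 1)| / T)
      = T / 2 * (t - 1) - |chordArea f u (t - 1)| := by field_simp
    linarith [le_abs_self (chordArea f u (t - 1))]
  have hcont : ContinuousOn (chordArea f u) (Icc v t) := fun x _ =>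
    (F.hasDerivAt_chordArea_right u x).continuousAt.continuousWithinAt
  obtain ⟨z, hz, hz0⟩ := intermediate_value_Icc (by linarith : v ≤ t) hcont ⟨hneg, hpos.le⟩
  refine ⟨z, lt_of_le_of_ne hz.2 ?_, hz0⟩
  rintro rfl
  exact hpos.ne' hz0

end Flux

open Classical in
/-- The state with zero entropy dissipation for the left state `u > 0`. -/
noncomputable def zeroState (f f1 : ℝ → ℝ) (u : ℝ) : ℝ :=
  if h : ∃ v, v < tangentState f f1 u ∧ chordArea f u v = 0 then h.choose else 0

namespace Flux

variable {f f1 f2 : ℝ → ℝ} (F : Flux f f1 f2)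
include F

theorem zeroState_lt {u : ℝ} (hu : 0 < u) : zeroState f f1 u < tangentState f f1 u := by
  rw [zeroState, dif_pos (F.exists_chordArea_eq_zero hu)]
  exact (F.exists_chordArea_eq_zero hu).choose_spec.1

theorem chordArea_zeroState {u : ℝ} (hu : 0 < u) : chordArea f u (zeroState f f1 u) = 0 := by
  rw [zeroState, dif_pos (F.exists_chordArea_eq_zero hu)]
  exact (F.exists_chordArea_eq_zero hu).choose_spec.2

theorem chordArea_neg_of_lt {u v : ℝ} (hu : 0 < u) (hv : v < zeroState f f1 u) :
    chordArea f u v < 0 := by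
  have h := F.zeroState_lt hu
  have := F.strictMonoOn_chordArea hu (mem_Iic.mpr (hv.trans h).le) (mem_Iic.mpr h.le) hv
  rwa [F.chordArea_zeroState hu] at this

theorem chordArea_nonneg {u v : ℝ} (hu : 0 < u) (hv : zeroState f f1 u ≤ v) (hvu : v < u) :
    0 ≤ chordArea f u v := by
  rcases le_total v (tangentState f f1 u) with h | h
  · have := (F.strictMonoOn_chordArea hu).monotoneOn (mem_Iic.mpr (F.zeroState_lt hu).le)
      (mem_Iic.mpr h) hv
    rwa [F.chordArea_zeroState hu] at this
  · exact (F.chordArea_pos hu h hvu).le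

/-- A lower bound for the compressivity of the shock at its left state. -/
theorem le_mul_sub_chordSpeed {u v c R : ℝ} (hu : 0 < u) (huR : u ≤ R) (hv : v ≤ 0) (hvR : -R ≤ v)
    (hA : 0 ≤ chordArea f u v) (hc : 0 ≤ c)
    (hb : ∀ x ∈ Icc (-R) R, c * x ^ 2 ≤ x * f2 x) :
    c * (-v) * u ^ 3 / 3 ≤ u * (u - v) * (f1 u - chordSpeed f u v) := by
  -- `P` is built so that `P' = (x - v) x f''(x)` is nonnegative on `[v, u]`, while `P u - P v` is
  -- the compressivity term minus twice the chord area.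
  set P : ℝ → ℝ := fun x => (x - v) * x * f1 x - (2 * x - v) * f x + 2 * ∫ t in (0 : ℝ)..x, f t
    with hP
  have hPd : ∀ x, HasDerivAt P ((x - v) * (x * f2 x)) x := by
    intro x
    have h := ((((hasDerivAt_id x).sub_const v).mul (hasDerivAt_id x)).mul (F.hasDerivAt1 x)).sub
      ((((hasDerivAt_id x).const_mul 2).sub_const v).mul (F.hasDerivAt x)) |>.add
      ((F.hasDerivAt_primitive x).const_mul 2)
    refine h.congr_deriv ?_
    simp; ring
  have h1 : P v ≤ P 0 := by
    refine monotoneOn_of_hasDerivAt_nonneg (convex_Icc v 0) (fun x _ => hPd x) (fun x hx => ?_)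
      ⟨le_rfl, hv⟩ ⟨hv, le_rfl⟩ hv
    have := (hb x ⟨hvR.trans hx.1, by linarith [hx.2]⟩)
    have h2 : 0 ≤ c * x ^ 2 := by positivity
    exact mul_nonneg (by linarith [hx.1]) (h2.trans this)
  have h2 : P 0 - c * (-v) * 0 ^ 3 / 3 ≤ P u - c * (-v) * u ^ 3 / 3 := by
    refine monotoneOn_of_hasDerivAt_nonneg (f := fun x => P x - c * (-v) * x ^ 3 / 3)
      (f' := fun x => (x - v) * (x * f2 x) - c * (-v) * x ^ 2) (convex_Icc 0 u)
      (fun x _ => (hPd x).sub ?_) (fun x hx => ?_)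
      ⟨le_rfl, hu.le⟩ ⟨hu.le, le_rfl⟩ hu.le
    · refine (((hasDerivAt_pow 3 x).const_mul (c * (-v))).div_const 3).congr_deriv ?_
      norm_num; ring
    · have h3 := (hb x ⟨by linarith [hx.1], hx.2.trans huR⟩)
      have h4 : (-v) * (c * x ^ 2) ≤ (x - v) * (x * f2 x) :=
        mul_le_mul (by linarith [hx.1]) h3 (by positivity) (by linarith [hx.1])
      linarith
  have h3 : P u - P v = u * (u - v) * (f1 u - chordSpeed f u v) - 2 * chordArea f u v := by
    have := chordSpeed_mul (f := f) (show u ≠ v by linarith)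
    rw [F.chordArea_eq]
    simp only [hP]
    linear_combination u * this
  linarith

theorem chordSpeed_lt_of_zeroState_le {u v : ℝ} (hu : 0 < u) (hv : zeroState f f1 u ≤ v)
    (hvu : v < u) : chordSpeed f u v < f1 u := by
  rcases le_total (tangentState f f1 u) v with h | h
  · exact F.chordSpeed_lt hu h hvu
  have hv0 : v < 0 := h.trans_lt (F.tangentState_neg hu)
  obtain ⟨c, C, hc, -, hb⟩ := F.bounds (max u (-v))
  have := F.le_mul_sub_chordSpeed hu (le_max_left _ _) hv0.le (neg_le.mp (le_max_right _ _))
    (F.chordArea_nonneg hu hv hvu) hc.le (fun x hx => (hb x hx).1)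
  have h1 : 0 < c * (-v) * u ^ 3 / 3 := by
    have : 0 < -v := by linarith
    positivity
  have h2 : 0 < u * (u - v) := mul_pos hu (by linarith)
  have h3 := (mul_pos_iff_of_pos_left h2).mp (h1.trans_le this)
  linarith

/-- A larger left state gives the chord to the same `v` a positive area, because the chord is slower
than `f1 u`; the zero of the area must then lie further left. -/
theorem zeroState_anti {u u' : ℝ} (hu : 0 < u) (h : u < u') :
    zeroState f f1 u' < zeroState f f1 u := by
  set v := zeroState f f1 u
  have hv := F.zeroState_lt hu
  have hv0 := hv.trans (F.tangentState_neg hu)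
  have hA := F.chordArea_zeroState hu
  have h0 : f u - f v < (u - v) * f1 u := by
    have h1 := F.chordSpeed_lt_of_zeroState_le hu le_rfl (hv.trans (F.tangentState_lt hu))
    have h2 : 0 < u - v := by linarith
    rw [chordSpeed, div_lt_iff₀ h2] at h1
    linarith
  have hpos : 0 < chordArea f u' v := by
    have h3 := strictMonoOn_of_hasDerivAt_pos (convex_Icc u u')
      (fun x _ => F.hasDerivAt_chordArea_left x v) (fun x hx => by
        rw [interior_Icc] at hx
        have h4 := F.tangentGap_neg (hu.trans hx.1).le hu.le hx.1.ne'
        have h5 : f1 u ≤ f1 x := (F.strictMonoOn1 (mem_Ici.mpr hu.le)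
          (mem_Ici.mpr (hu.trans hx.1).le) hx.1).le
        unfold tangentGap at h4
        have h6 : (u - v) * f1 u ≤ (u - v) * f1 x := by
          have : 0 ≤ u - v := by linarith
          gcongr
        linarith) ⟨le_rfl, h.le⟩ ⟨h.le, le_rfl⟩ h
    simp only at h3
    linarith
  by_contra! hc
  rcases eq_or_lt_of_le hc with he | he
  · rw [he, F.chordArea_zeroState (hu.trans h)] at hpos
    exact lt_irrefl _ hpos
  · exact absurd hpos (not_lt.mpr (F.chordArea_neg_of_lt (hu.trans h) he).le)

end Flux

end KineticRelation

/-! ### Profiles, arrival energy and the kinetic state. -/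

namespace KineticRelation

/-- The nonnegative term `D` absorbs the surplus of the force, and the extra energy is only damped
more. This gives continuous dependence on the force. -/
theorem IsEnergyProfile.le_add {α q S : ℝ} {H K y z D D' : ℝ → ℝ} (hα : 0 ≤ α) (hq : 0 ≤ q)
    (hy : IsEnergyProfile α q H y) (hz : IsEnergyProfile α q K z)
    (hD : ∀ s ∈ Icc 0 S, HasDerivAt D (D' s) s) (hD0 : ∀ s ∈ Icc 0 S, 0 ≤ D s)
    (h : ∀ s ∈ Icc 0 S, H s ≤ K s + D' s) : ∀ s ∈ Icc 0 S, y s ≤ z s + D s := by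
  intro s hs
  refine le_of_deriv_le_of_lt (fun x hx => hy.2 x hx.1)
    (fun x hx => (hz.2 x hx.1).add (hD x hx)) ?_ (fun x hx hlt => ?_) s hs
  · simpa [hy.1, hz.1] using hD0 0 ⟨le_rfl, hs.1.trans hs.2⟩
  · simp only [Pi.add_apply] at hlt
    have h1 := mul_le_mul_of_nonneg_left
      (damp_mono hq (show z x ≤ y x by linarith [hD0 x hx])) hα
    linarith [h x hx]

open Classical in
/-- The kinetic energy `w'² / 2`, as a function of `s = u - w`, of the profile with speed `lam`
leaving the left state `u`. -/
noncomputable def profile (α q : ℝ) (f : ℝ → ℝ) (u lam : ℝ) : ℝ → ℝ :=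
  if h : ∃ y, IsEnergyProfile α q (fun s => excess f u lam (u - s)) y then h.choose else 0

/-- The kinetic energy at `v` of the profile leaving `u` with the speed of the shock `(u, v)`. -/
noncomputable def arrivalEnergy (α q : ℝ) (f : ℝ → ℝ) (u v : ℝ) : ℝ :=
  profile α q f u (chordSpeed f u v) (u - v)

theorem excess_pos {f : ℝ → ℝ} {u lam w : ℝ} (hw : w < u) (h : lam < chordSpeed f u w) :
    0 < excess f u lam w := by
  rw [excess_eq_mul hw.ne']
  exact mul_pos (by linarith) (by linarith)

theorem excess_nonneg {f : ℝ → ℝ} {u lam w : ℝ} (hw : w < u) (h : lam ≤ chordSpeed f u w) :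
    0 ≤ excess f u lam w := by
  rw [excess_eq_mul hw.ne']
  exact mul_nonneg (by linarith) (by linarith)

theorem excess_neg {f : ℝ → ℝ} {u lam w : ℝ} (hw : w < u) (h : chordSpeed f u w < lam) :
    excess f u lam w < 0 := by
  rw [excess_eq_mul hw.ne']
  exact mul_neg_of_pos_of_neg (by linarith) (by linarith)

namespace Flux

variable {f f1 f2 : ℝ → ℝ} {α q : ℝ} (F : Flux f f1 f2)
include F

theorem isEnergyProfile (hα : 0 ≤ α) (hq : 0 < q) (u lam : ℝ) :
    IsEnergyProfile α q (fun s => excess f u lam (u - s)) (profile α q f u lam) := by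
  have h : ∃ y, IsEnergyProfile α q (fun s => excess f u lam (u - s)) y :=
    exists_isEnergyProfile hα hq
      ((F.continuous_excess u lam).comp (continuous_const.sub continuous_id))
  rw [profile, dif_pos h]
  exact h.choose_spec

theorem continuous_excess_sub (u lam : ℝ) : Continuous fun s => excess f u lam (u - s) :=
  (F.continuous_excess u lam).comp (continuous_const.sub continuous_id)

theorem hasDerivAt_primitive_excess (u lam s : ℝ) :
    HasDerivAt (fun s => (∫ t in (0 : ℝ)..(u - s), f t) - lam * s ^ 2 / 2 + f u * s)
      (excess f u lam (u - s)) s := by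
  have h := (((F.hasDerivAt_primitive (u - s)).comp s ((hasDerivAt_id s).const_sub u)).sub
    (((hasDerivAt_pow 2 s).const_mul lam).div_const 2)).add ((hasDerivAt_id s).const_mul (f u))
  refine h.congr_deriv ?_
  simp [excess]; ring

theorem profile_pos (hα : 0 ≤ α) (hq : 0 < q) {u lam w₁ w : ℝ}
    (h : ∀ w ∈ Ioo w₁ u, lam < chordSpeed f u w) (hw : w ∈ Ioo w₁ u) :
    0 < profile α q f u lam (u - w) := by
  refine (F.isEnergyProfile hα hq u lam).pos hq (F.continuous_excess_sub u lam) (S := u - w₁)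
    (fun s hs => ?_) _ ⟨by linarith [hw.2], by linarith [hw.1]⟩
  exact excess_pos (by linarith [hs.1]) (h _ ⟨by linarith [hs.2], by linarith [hs.1]⟩)

theorem profile_nonneg (hα : 0 ≤ α) (hq : 0 < q) {u lam w₁ w : ℝ}
    (h : ∀ w ∈ Ico w₁ u, lam ≤ chordSpeed f u w) (hw : w ∈ Icc w₁ u) :
    0 ≤ profile α q f u lam (u - w) := by
  refine (F.isEnergyProfile hα hq u lam).nonneg hq (S := u - w₁)
    (fun s hs => ?_) _ ⟨by linarith [hw.2], by linarith [hw.1]⟩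
  rcases eq_or_lt_of_le hs.1 with h0 | h0
  · simp [← h0, excess_self]
  · exact excess_nonneg (by linarith) (h _ ⟨by linarith [hs.2], by linarith⟩)

theorem profile_le_of_le (hα : 0 ≤ α) (hq : 0 < q) {u lam lam' s : ℝ} (h : lam ≤ lam')
    (hs : 0 ≤ s) : profile α q f u lam' s ≤ profile α q f u lam s := by
  refine (F.isEnergyProfile hα hq u lam').mono hα le_rfl hq.le (F.isEnergyProfile hα hq u lam)
    (S := s) (fun x hx => ?_) s ⟨hs, le_rfl⟩
  have : lam * x ≤ lam' * x := mul_le_mul_of_nonneg_right h hx.1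
  simp only [excess]
  linarith

theorem profile_le_add (hα : 0 ≤ α) (hq : 0 < q) {u lam lam' s : ℝ} (hs : 0 ≤ s) :
    profile α q f u lam' s ≤ profile α q f u lam s + |lam - lam'| * s ^ 2 / 2 := by
  refine (F.isEnergyProfile hα hq u lam').le_add hα hq.le (F.isEnergyProfile hα hq u lam)
    (S := s) (D := fun x => |lam - lam'| * x ^ 2 / 2) (D' := fun x => |lam - lam'| * x)
    (fun x hx => ?_) (fun x hx => by positivity) (fun x hx => ?_) s ⟨hs, le_rfl⟩
  · refine (((hasDerivAt_pow 2 x).const_mul |lam - lam'|).div_const 2).congr_deriv ?_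
    norm_num; ring
  · have := mul_le_mul_of_nonneg_right (le_abs_self (lam - lam')) hx.1
    simp only [excess]
    linarith

theorem profile_anti {β : ℝ} (hβ : 0 ≤ β) (hβα : β ≤ α) (hq : 0 < q) {u lam s : ℝ} (hs : 0 ≤ s) :
    profile α q f u lam s ≤ profile β q f u lam s :=
  (F.isEnergyProfile (hβ.trans hβα) hq u lam).mono hβ hβα hq.le (F.isEnergyProfile hβ hq u lam)
    (fun _ _ => le_rfl) s ⟨hs, le_rfl⟩

/-- Once the profile energy vanishes where the chord lies below the graph, it becomes negative. -/
theorem profile_neg_of_nonpos (hα : 0 ≤ α) (hq : 0 < q) {u lam v w : ℝ} (hvw : v < w) (hwu : w ≤ u)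
    (h : ∀ x ∈ Ioo v w, chordSpeed f u x < lam) (hw : profile α q f u lam (u - w) ≤ 0) :
    profile α q f u lam (u - v) < 0 := by
  have hy := F.isEnergyProfile hα hq u lam
  have := strictAntiOn_of_hasDerivAt_neg (convex_Icc (u - w) (u - v))
    (fun x hx => hy.2 x (by linarith [hx.1])) (fun x hx => by
      rw [interior_Icc] at hx
      have h1 := excess_neg (f := f) (u := u) (lam := lam) (w := u - x) (by linarith [hx.1])
        (h _ ⟨by linarith [hx.2], by linarith [hx.1]⟩)
      have := mul_nonneg hα (damp_nonneg q (profile α q f u lam x))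
      linarith) ⟨le_rfl, by linarith⟩ ⟨by linarith, le_rfl⟩ (by linarith : u - w < u - v)
  exact this.trans_le hw

theorem arrivalEnergy_nonneg (hα : 0 ≤ α) (hq : 0 < q) {u v : ℝ} (hu : 0 < u)
    (hv : tangentState f f1 u ≤ v) (hvu : v < u) : 0 ≤ arrivalEnergy α q f u v :=
  F.profile_nonneg hα hq (w₁ := v) (fun _ hw => (F.strictMonoOn_chordSpeed hu).monotoneOn
    ⟨hv, hvu⟩ ⟨hv.trans hw.1, hw.2⟩ hw.1) ⟨le_rfl, hvu.le⟩

/-- The integral of the excess from `v` to `u` is the chord area; between the companion and `u` the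
excess is positive, so friction really consumes energy. -/
theorem profile_sub_le_chordArea (hα : 0 < α) (hq : 0 < q) {u v : ℝ} (hu : 0 < u)
    (hv : zeroState f f1 u ≤ v) (hvt : v ≤ tangentState f f1 u) :
    arrivalEnergy α q f u v < chordArea f u v := by
  have hvu : v < u := hvt.trans_lt (F.tangentState_lt hu)
  obtain ⟨c, hc, hc'⟩ := F.exists_companion hu (F.chordSpeed_tangentState_le hu hvu)
    (F.chordSpeed_lt_of_zeroState_le hu hv hvu)
  have h := (F.isEnergyProfile hα.le hq u (chordSpeed f u v)).lt_primitive hα hq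
    (F.continuous_excess_sub u _) (fun s _ => F.hasDerivAt_primitive_excess u _ s) (c := u - c)
    (fun s hs => excess_pos (by linarith [hs.1]) (by
      rw [← hc']
      exact F.strictMonoOn_chordSpeed hu hc ⟨by linarith [hs.2, hc.1], by linarith [hs.1]⟩
        (by linarith [hs.2])))
    (by linarith [hc.2]) (s := u - v) (by linarith [hc.1])
  rw [arrivalEnergy, F.chordArea_eq]
  have h1 := chordSpeed_mul (f := f) hvu.ne'
  simp only [sub_sub_cancel, sub_zero] at h
  refine h.trans_eq ?_
  linear_combination (-(u - v) / 2) * h1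

/-- Moving further left raises the speed, which lowers the excess everywhere, and the remaining way
to `v'` lies where the chord is below the graph. This one-way sign change makes the zero of the
arrival energy unique. -/
theorem arrivalEnergy_neg_of_lt (hα : 0 ≤ α) (hq : 0 < q) {u v v' : ℝ} (hu : 0 < u) (h : v' < v)
    (hv : v ≤ tangentState f f1 u) (h0 : arrivalEnergy α q f u v ≤ 0) :
    arrivalEnergy α q f u v' < 0 := by
  have hvu : v < u := hv.trans_lt (F.tangentState_lt hu)
  have hlam := F.strictAntiOn_chordSpeed hu (mem_Iic.mpr (h.le.trans hv)) (mem_Iic.mpr hv) h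
  refine F.profile_neg_of_nonpos hα hq h hvu.le (fun x hx => ?_)
    ((F.profile_le_of_le hα hq hlam.le (by linarith)).trans h0)
  exact F.strictAntiOn_chordSpeed hu (mem_Iic.mpr (h.le.trans hv)) (mem_Iic.mpr (hx.2.le.trans hv))
    hx.1

/-- Changing the speed changes the energy by at most a quadratic in the distance times the speed
difference, in both directions; this squeezes the arrival energy around the fixed-speed profile. -/
theorem continuousAt_arrivalEnergy (hα : 0 ≤ α) (hq : 0 < q) {u v : ℝ} (hvu : v < u) :
    ContinuousAt (arrivalEnergy α q f u) v := by
  have hy := F.isEnergyProfile hα hq u (chordSpeed f u v)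
  have h1 : ContinuousAt (chordSpeed f u) v := (F.hasDerivAt_chordSpeed hvu.ne).continuousAt
  have h2 : ContinuousAt (fun x => profile α q f u (chordSpeed f u v) (u - x)) v :=
    ContinuousAt.comp (f := fun x => u - x) (hy.2 (u - v) (by linarith)).continuousAt (by fun_prop)
  have h3 : ContinuousAt (fun x => |chordSpeed f u v - chordSpeed f u x| * (u - x) ^ 2 / 2) v := by
    fun_prop
  have h4 : Tendsto (fun x => profile α q f u (chordSpeed f u v) (u - x) +
      |chordSpeed f u v - chordSpeed f u x| * (u - x) ^ 2 / 2) (𝓝 v)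
      (𝓝 (arrivalEnergy α q f u v)) := by
    have := h2.add h3
    simpa [ContinuousAt, arrivalEnergy, Pi.add_def, Pi.sub_def] using this
  have h5 : Tendsto (fun x => profile α q f u (chordSpeed f u v) (u - x) -
      |chordSpeed f u v - chordSpeed f u x| * (u - x) ^ 2 / 2) (𝓝 v)
      (𝓝 (arrivalEnergy α q f u v)) := by
    have := h2.sub h3
    simpa [ContinuousAt, arrivalEnergy, Pi.add_def, Pi.sub_def] using this
  refine tendsto_of_tendsto_of_tendsto_of_le_of_le' h5 h4 ?_ ?_
  · filter_upwards [Iio_mem_nhds hvu] with x hx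
    have := F.profile_le_add hα hq (u := u) (lam := chordSpeed f u x) (lam' := chordSpeed f u v)
      (s := u - x) (by linarith [mem_Iio.mp hx])
    rw [abs_sub_comm] at this
    unfold arrivalEnergy
    linarith
  · filter_upwards [Iio_mem_nhds hvu] with x hx
    exact F.profile_le_add hα hq (by linarith [mem_Iio.mp hx])

/-- The arrival energy is negative at the zero dissipation state by friction and nonnegative at the
tangent state. -/
theorem exists_kineticState (hα : 0 < α) (hq : 0 < q) {u : ℝ} (hu : 0 < u) :
    ∃ v, zeroState f f1 u < v ∧ v ≤ tangentState f f1 u ∧ arrivalEnergy α q f u v = 0 := by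
  have hz := F.zeroState_lt hu
  have h1 := F.profile_sub_le_chordArea hα hq hu le_rfl hz.le
  rw [F.chordArea_zeroState hu] at h1
  have h2 := F.arrivalEnergy_nonneg hα.le hq hu le_rfl (F.tangentState_lt hu)
  have hcont : ContinuousOn (arrivalEnergy α q f u) (Icc (zeroState f f1 u) (tangentState f f1 u)) :=
    fun x hx => (F.continuousAt_arrivalEnergy hα.le hq
      (hx.2.trans_lt (F.tangentState_lt hu))).continuousWithinAt
  obtain ⟨v, hv, hv0⟩ := intermediate_value_Icc hz.le hcont ⟨h1.le, h2⟩
  refine ⟨v, lt_of_le_of_ne hv.1 ?_, hv.2, hv0⟩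
  rintro rfl
  exact h1.ne hv0

end Flux

open Classical in
/-- The right state of the undercompressive shock with left state `u > 0`. -/
noncomputable def kineticState (α q : ℝ) (f f1 : ℝ → ℝ) (u : ℝ) : ℝ :=
  if h : ∃ v, zeroState f f1 u < v ∧ v ≤ tangentState f f1 u ∧ arrivalEnergy α q f u v = 0
  then h.choose else 0

namespace Flux

variable {f f1 f2 : ℝ → ℝ} {α q : ℝ} (F : Flux f f1 f2)
include F

theorem kineticState_spec (hα : 0 < α) (hq : 0 < q) {u : ℝ} (hu : 0 < u) :
    zeroState f f1 u < kineticState α q f f1 u ∧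
      kineticState α q f f1 u ≤ tangentState f f1 u ∧
      arrivalEnergy α q f u (kineticState α q f f1 u) = 0 := by
  rw [kineticState, dif_pos (F.exists_kineticState hα hq hu)]
  exact (F.exists_kineticState hα hq hu).choose_spec

theorem kineticState_lt (hα : 0 < α) (hq : 0 < q) {u : ℝ} (hu : 0 < u) :
    kineticState α q f f1 u < u :=
  (F.kineticState_spec hα hq hu).2.1.trans_lt (F.tangentState_lt hu)

theorem kineticState_neg (hα : 0 < α) (hq : 0 < q) {u : ℝ} (hu : 0 < u) :
    kineticState α q f f1 u < 0 :=
  (F.kineticState_spec hα hq hu).2.1.trans_lt (F.tangentState_neg hu)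

theorem arrivalEnergy_neg_of_lt_kineticState (hα : 0 < α) (hq : 0 < q) {u v : ℝ} (hu : 0 < u)
    (h : v < kineticState α q f f1 u) : arrivalEnergy α q f u v < 0 :=
  have hs := F.kineticState_spec hα hq hu
  F.arrivalEnergy_neg_of_lt hα.le hq hu h hs.2.1 hs.2.2.le

theorem arrivalEnergy_pos_of_gt_kineticState (hα : 0 < α) (hq : 0 < q) {u v : ℝ} (hu : 0 < u)
    (h : kineticState α q f f1 u < v) (hv : v ≤ tangentState f f1 u) :
    0 < arrivalEnergy α q f u v := by
  by_contra! hc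
  exact (F.arrivalEnergy_neg_of_lt hα.le hq hu h hv hc).ne (F.kineticState_spec hα hq hu).2.2

theorem le_kineticState (hα : 0 < α) (hq : 0 < q) {u v : ℝ} (hu : 0 < u)
    (hv : v ≤ tangentState f f1 u) (h : arrivalEnergy α q f u v ≤ 0) :
    v ≤ kineticState α q f f1 u := by
  by_contra! hc
  exact absurd h (not_le.mpr (F.arrivalEnergy_pos_of_gt_kineticState hα hq hu hc hv))

theorem kineticState_le (hα : 0 < α) (hq : 0 < q) {u v : ℝ} (hu : 0 < u)
    (h : 0 ≤ arrivalEnergy α q f u v) : kineticState α q f f1 u ≤ v := by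
  by_contra! hc
  exact absurd h (not_le.mpr (F.arrivalEnergy_neg_of_lt_kineticState hα hq hu hc))

theorem kineticState_eq_tangentState_iff (hα : 0 < α) (hq : 0 < q) {u : ℝ} (hu : 0 < u) :
    kineticState α q f f1 u = tangentState f f1 u ↔
      arrivalEnergy α q f u (tangentState f f1 u) ≤ 0 := by
  constructor
  · intro h
    rw [← h, (F.kineticState_spec hα hq hu).2.2]
  · intro h
    exact le_antisymm (F.kineticState_spec hα hq hu).2.1 (F.le_kineticState hα hq hu le_rfl h)

end Flux

end KineticRelation

/-! ### Strict monotonicity of the kinetic state. -/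

namespace KineticRelation

/-- A nonnegative solution of `y' ≤ C t + B √y` starting from zero grows at most quadratically. -/
theorem exists_quadratic_bound {y y' : ℝ → ℝ} {T B C : ℝ} (hB : 0 ≤ B) (hC : 0 ≤ C)
    (hd : ∀ t ∈ Icc 0 T, HasDerivAt y (y' t) t) (h0 : y 0 = 0)
    (h : ∀ t ∈ Icc 0 T, y' t ≤ C * t + B * √(y t)) :
    ∃ k, 0 < k ∧ ∀ t ∈ Icc 0 T, y t ≤ k * t ^ 2 := by
  -- With this `k` one has `C + B * k < 2 * k ^ 2`, so `k ^ 2 * (t + η) ^ 2` is a strict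
  -- supersolution. The shift `η > 0` keeps it positive at `t = 0` and is removed in the limit.
  set k := B + C + 1
  have hk : 0 < k := by positivity
  refine ⟨k ^ 2, by positivity, fun t ht => ?_⟩
  have key : ∀ η > 0, y t ≤ k ^ 2 * (t + η) ^ 2 := by
    intro η hη
    refine image_le_of_deriv_right_lt_deriv_boundary (a := 0) (b := T)
      (B := fun x => k ^ 2 * (x + η) ^ 2) (B' := fun x => k ^ 2 * (2 * (x + η)))
      (fun x hx => (hd x hx).continuousAt.continuousWithinAt)
      (fun x hx => (hd x ⟨hx.1, hx.2.le⟩).hasDerivWithinAt) ?_ (fun x => ?_) ?_ ht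
    · simp only [h0]; positivity
    · refine (((hasDerivAt_id x).add_const η).pow 2 |>.const_mul (k ^ 2)).congr_deriv ?_
      simp
    · intro x hx heq
      have hxη : 0 < x + η := by linarith [hx.1]
      have h1 := h x ⟨hx.1, hx.2.le⟩
      rw [heq, ← mul_pow, Real.sqrt_sq (by positivity)] at h1
      have h2 : C * x ≤ C * (x + η) := by gcongr; linarith
      have h3 : C + B * k < k ^ 2 * 2 := by nlinarith [hk, mul_nonneg hB hC, sq_nonneg B]
      nlinarith
  have hlim : Tendsto (fun η => k ^ 2 * (t + η) ^ 2) (𝓝[>] 0) (𝓝 (k ^ 2 * (t + 0) ^ 2)) :=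
    ((by fun_prop : Continuous fun η => k ^ 2 * (t + η) ^ 2).tendsto 0).mono_left
      nhdsWithin_le_nhds
  rw [add_zero] at hlim
  exact ge_of_tendsto hlim (eventually_mem_nhdsWithin.mono fun η hη => key η hη)

theorem exists_damp_le_sqrt {q : ℝ} (hq : 1 / 2 ≤ q) (M : ℝ) :
    ∃ B, 0 ≤ B ∧ ∀ y, 0 ≤ y → y ≤ M → damp q y ≤ B * √y := by
  refine ⟨(2 * max M 0) ^ (q - 1 / 2) * √2, by positivity, fun y hy hyM => ?_⟩
  rcases eq_or_lt_of_le hy with h0 | h0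
  · rw [← h0, damp_of_nonpos (by linarith) le_rfl]; simp
  rw [damp_of_nonneg hy, show q = (q - 1 / 2) + 1 / 2 by ring, Real.rpow_add (by positivity),
    ← Real.sqrt_eq_rpow, Real.sqrt_mul (by norm_num), ← mul_assoc]
  have h1 : y ≤ max M 0 := hyM.trans (le_max_left _ _)
  have h2 : 0 ≤ q - 1 / 2 := by linarith
  simp only [add_sub_cancel_right]
  gcongr

/-- The quotient is a multiple of `y ^ (q - 1)`: nonincreasing for `q ≤ 1`, and bounded on bounded
sets for `q ≥ 1`. -/
theorem exists_damp_div_le {q : ℝ} (M : ℝ) :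
    ∃ E, 0 ≤ E ∧ ∀ x y, 0 < x → x ≤ y → y ≤ M → damp q y / y ≤ damp q x / x + E := by
  have hdiv : ∀ x : ℝ, 0 < x → damp q x / x = 2 ^ q * x ^ (q - 1) := by
    intro x hx
    rw [damp_of_nonneg hx.le, Real.mul_rpow (by norm_num) hx.le, Real.rpow_sub_one hx.ne']
    ring
  rcases le_total q 1 with hq | hq
  · refine ⟨0, le_rfl, fun x y hx hxy _ => ?_⟩
    rw [hdiv x hx, hdiv y (hx.trans_le hxy), add_zero]
    have := Real.rpow_le_rpow_of_nonpos hx hxy (by linarith : q - 1 ≤ 0)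
    gcongr
  · refine ⟨2 ^ q * (max M 0) ^ (q - 1), by positivity, fun x y hx hxy hyM => ?_⟩
    have hy := hx.trans_le hxy
    rw [hdiv y hy]
    have h1 : y ^ (q - 1) ≤ (max M 0) ^ (q - 1) :=
      Real.rpow_le_rpow hy.le (hyM.trans (le_max_left _ _)) (by linarith)
    have h2 : 0 ≤ damp q x / x := div_nonneg (damp_nonneg _ _) hx.le
    have h3 : (2 : ℝ) ^ q * y ^ (q - 1) ≤ 2 ^ q * (max M 0) ^ (q - 1) := by gcongr
    linarith

/-- Two ordered solutions of `y' = g + α damp y` that leave zero quadratically cannot have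
linearly separated right-hand sides in the wrong order. -/
theorem false_of_ordered_solutions {α q T a c k M : ℝ} {y z g g' : ℝ → ℝ} (hα : 0 ≤ α)
    (hT : 0 < T) (ha : 0 < a) (hc : 0 < c) (hk : 0 < k)
    (hy : ∀ t ∈ Ioc 0 T, HasDerivAt y (g t + α * damp q (y t)) t)
    (hz : ∀ t ∈ Ioc 0 T, HasDerivAt z (g' t + α * damp q (z t)) t)
    (hg : ∀ t ∈ Ioc 0 T, 0 ≤ g t) (hgg : ∀ t ∈ Ioc 0 T, g' t = g t - a * t)
    (hyc : ∀ t ∈ Ioc 0 T, c * t ^ 2 ≤ y t) (hzk : ∀ t ∈ Ioc 0 T, z t ≤ k * t ^ 2)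
    (hzM : ∀ t ∈ Ioc 0 T, z t ≤ M) (hyz : ∀ t ∈ Ioc 0 T, y t ≤ z t) : False := by
  obtain ⟨E, hE, hdamp⟩ := exists_damp_div_le (q := q) M
  have hypos : ∀ t ∈ Ioc 0 T, 0 < y t := fun t ht => by
    have := ht.1
    exact lt_of_lt_of_le (by positivity) (hyc t ht)
  have hzpos : ∀ t ∈ Ioc 0 T, 0 < z t := fun t ht => (hypos t ht).trans_le (hyz t ht)
  -- The separation `a * t` makes `log (z / y)` decrease at least like `a / k * log t` grows, up to
  -- `α * E`. Near zero the quadratic bounds keep `log (z / y)` below `log (k / c)`, so `P` would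
  -- tend to `-∞` there although it is nonincreasing.
  set P : ℝ → ℝ := fun t => Real.log (z t) - Real.log (y t) + a / k * Real.log t - α * E * t
  have hP : AntitoneOn P (Ioc 0 T) := by
    refine antitoneOn_of_hasDerivAt_nonpos (convex_Ioc 0 T)
      (f' := fun t => (g' t + α * damp q (z t)) / z t - (g t + α * damp q (y t)) / y t
        + a / k * t⁻¹ - α * E) (fun t ht => ?_) (fun t ht => ?_)
    · have h := ((((hz t ht).log (hzpos t ht).ne').sub ((hy t ht).log (hypos t ht).ne')).add
        ((Real.hasDerivAt_log ht.1.ne').const_mul (a / k))).sub ((hasDerivAt_id t).const_mul (α * E))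
      refine h.congr_deriv ?_
      simp
    · have h1 := hypos t ht
      have h2 := hzpos t ht
      have ht0 := ht.1
      have h3 := mul_le_mul_of_nonneg_left (hdamp (y t) (z t) h1 (hyz t ht) (hzM t ht)) hα
      have h4 : g t / z t ≤ g t / y t := div_le_div_of_nonneg_left (hg t ht) h1 (hyz t ht)
      have h5 : a / k * t⁻¹ ≤ a * t / z t := by
        rw [le_div_iff₀ h2]
        calc a / k * t⁻¹ * z t ≤ a / k * t⁻¹ * (k * t ^ 2) := by
              have := hzk t ht
              gcongr
          _ = a * t := by field_simp
      have h6 : (g' t + α * damp q (z t)) / z t - (g t + α * damp q (y t)) / y t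
        + a / k * t⁻¹ - α * E = (g t / z t - g t / y t) + (a / k * t⁻¹ - a * t / z t) +
          (α * (damp q (z t) / z t) - α * (damp q (y t) / y t + E)) := by
        rw [hgg t ht]; ring
      rw [h6]
      linarith
  have hlim : Tendsto (fun t => Real.log (k / c) + a / k * Real.log t) (𝓝[>] 0) atBot :=
    tendsto_atBot_add_const_left _ _ (Real.tendsto_log_nhdsGT_zero.const_mul_atBot (by positivity))
  obtain ⟨t, ht, ht'⟩ := ((hlim.eventually_lt_atBot (P T)).and (Ioo_mem_nhdsGT hT)).exists
  have htm : t ∈ Ioc 0 T := ⟨ht'.1, ht'.2.le⟩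
  have h1 := hP htm ⟨hT, le_rfl⟩ htm.2
  have ht0 := htm.1
  have h2 : Real.log (z t) - Real.log (y t) ≤ Real.log (k / c) := by
    rw [← Real.log_div (hzpos t htm).ne' (hypos t htm).ne']
    refine Real.log_le_log (div_pos (hzpos t htm) (hypos t htm)) ?_
    rw [div_le_div_iff₀ (hypos t htm) hc]
    calc z t * c ≤ k * t ^ 2 * c := by gcongr; exact hzk t htm
      _ = k * (c * t ^ 2) := by ring
      _ ≤ k * y t := by gcongr; exact hyc t htm
  have h3 : 0 ≤ α * E * t := by positivity
  simp only [P] at h1 ht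
  linarith

theorem excess_chordSpeed_eq {f : ℝ → ℝ} {u v w : ℝ} (h : u ≠ v) :
    excess f u (chordSpeed f u v) w = chordSpeed f u v * (w - v) + f v - f w := by
  have := chordSpeed_mul (f := f) h
  unfold excess
  linear_combination -this

namespace Flux

variable {f f1 f2 : ℝ → ℝ} {α q : ℝ} (F : Flux f f1 f2)
include F

/-- On `[u, u']` convexity keeps the graph above its tangent at `u`, which is steeper than the chord
from `v`. -/
theorem chordSpeed_lt_chordSpeed {u u' v : ℝ} (hu : 0 < u) (hu' : u < u') (hvu : v < u)
    (h : chordSpeed f u v < f1 u) : chordSpeed f u v < chordSpeed f u' v := by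
  have h1 := F.tangentGap_neg hu.le (hu.trans hu').le hu'.ne
  have h2 := chordSpeed_mul (f := f) hvu.ne'
  unfold tangentGap at h1
  rw [chordSpeed, chordSpeed, lt_div_iff₀ (by linarith), ← chordSpeed]
  have h3 : chordSpeed f u v * (u' - u) < f1 u * (u' - u) := by
    have : 0 < u' - u := by linarith
    gcongr
  linarith

theorem kineticState_strictAnti (hα : 0 < α) (hq : 1 / 2 ≤ q) {u u' : ℝ} (hu : 0 < u)
    (huu : u < u') : kineticState α q f f1 u' < kineticState α q f f1 u := by
  have hq0 : 0 < q := by linarith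
  have hu' := hu.trans huu
  set v := kineticState α q f f1 u with hv
  obtain ⟨hv1, hv2, hv3⟩ := F.kineticState_spec hα hq0 hu
  rw [← hv] at hv1 hv2 hv3
  -- In the remaining case `v` is strictly left of the tangent state of `u`, hence a genuine saddle
  -- for the speed `lam`.
  rcases lt_or_ge (tangentState f f1 u') v with hc | hc
  · exact (F.kineticState_spec hα hq0 hu').2.1.trans_lt hc
  have hvt : v < tangentState f f1 u := hc.trans_lt (F.tangentState_strictAnti hu huu)
  have hv0 : v < 0 := hvt.trans (F.tangentState_neg hu)
  have hvu : v < u := hv0.trans hu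
  set lam := chordSpeed f u v with hlam
  set lam' := chordSpeed f u' v with hlam'
  have hll : lam < lam' := F.chordSpeed_lt_chordSpeed hu huu hvu
    (F.chordSpeed_lt_of_zeroState_le hu hv1.le hvu)
  -- Both chords pass through `(v, f v)`, so the excesses differ by a term that is nonnegative to
  -- the right of `v`.
  have hex : ∀ w, excess f u' lam' w = excess f u lam w + (lam' - lam) * (w - v) := by
    intro w
    rw [hlam', excess_chordSpeed_eq (by linarith), hlam, excess_chordSpeed_eq (by linarith)]
    ring
  have hy := F.isEnergyProfile hα.le hq0 u lam
  have hz := F.isEnergyProfile hα.le hq0 u' lam'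
  have hinit : 0 ≤ profile α q f u' lam' (u' - u) := by
    refine F.profile_nonneg hα.le hq0 (w₁ := u) (fun w hw => ?_) ⟨le_rfl, huu.le⟩
    have h1 : lam' ≤ chordSpeed f u' u := by
      by_contra! h2
      have h3 := excess_neg huu h2
      rw [hex, excess_self, zero_add] at h3
      have : 0 < (lam' - lam) * (u - v) := mul_pos (by linarith) (by linarith)
      linarith
    exact h1.trans ((F.strictMonoOn_chordSpeed hu').monotoneOn
      ⟨((F.tangentState_neg hu').trans hu).le, huu⟩
      ⟨((F.tangentState_neg hu').trans (hu.trans_le hw.1)).le, hw.2⟩ hw.1)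
  -- The two energies are compared at the same position `w`, which for `u'` is reached at distance
  -- `s + (u' - u)`.
  have hle : ∀ s ∈ Icc 0 (u - v), profile α q f u lam s ≤ profile α q f u' lam' (s + (u' - u)) := by
    refine le_of_deriv_le_of_lt (fun x hx => hy.2 x hx.1)
      (fun x hx => (hz.2 (x + (u' - u)) (by linarith [hx.1])).comp_add_const x (u' - u))
      (by rw [hy.1]; simpa using hinit) (fun x hx hlt => ?_)
    have h1 := mul_le_mul_of_nonneg_left (damp_mono hq0.le hlt.le) hα.le
    have h2 : 0 ≤ (lam' - lam) * (u - x - v) := mul_nonneg (by linarith) (by linarith [hx.2])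
    beta_reduce
    rw [show u' - (x + (u' - u)) = u - x by ring, hex]
    linarith
  have hend := hle (u - v) ⟨by linarith, le_rfl⟩
  rw [show u - v + (u' - u) = u' - v by ring] at hend
  have hA : 0 ≤ arrivalEnergy α q f u' v := by
    have : arrivalEnergy α q f u v = profile α q f u lam (u - v) := rfl
    rw [← this, hv3] at hend
    exact hend
  refine lt_of_le_of_ne (F.kineticState_le hα hq0 hu' hA) (fun heq => ?_)
  have hA' : profile α q f u' lam' (u' - v) = 0 := by
    have := (F.kineticState_spec hα hq0 hu').2.2
    rwa [heq] at this
  -- Both profiles enter the saddle point `v`.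
  set d := f1 v - lam with hd
  have hdpos : 0 < d := by
    have h1 := F.tangentGap_pos_of_lt hu hvt
    have h2 := chordSpeed_mul (f := f) hvu.ne'
    unfold tangentGap at h1
    by_contra! h3
    have : d * (u - v) ≤ 0 := mul_nonpos_of_nonpos_of_nonneg h3 (by linarith)
    rw [hd, hlam] at this
    linarith
  obtain ⟨T, hT0, hT⟩ : ∃ T, 0 < T ∧ ∀ t ∈ Icc 0 T, v + t ≤ 0 ∧ f1 v - d / 2 ≤ f1 (v + t) := by
    have h1 : ∀ᶠ t in 𝓝 (0 : ℝ), v + t < 0 ∧ f1 v - d / 2 < f1 (v + t) := by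
      refine Filter.Eventually.and ?_ ?_
      · exact (by fun_prop : ContinuousAt (fun t => v + t) 0).eventually
          (gt_mem_nhds (by simpa using hv0))
      · exact (F.continuous1.comp (continuous_const.add continuous_id)).continuousAt.eventually
          (lt_mem_nhds (by simp; linarith))
    obtain ⟨ε, hε, h2⟩ := Metric.eventually_nhds_iff.mp h1
    refine ⟨ε / 2, by positivity, fun t ht => ?_⟩
    have := h2 (y := t) (by rw [Real.dist_eq, sub_zero, abs_of_nonneg ht.1]; linarith [ht.2])
    exact ⟨this.1.le, this.2.le⟩
  have hTv : T ≤ -v := by linarith [(hT T ⟨hT0.le, le_rfl⟩).1]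
  set g : ℝ → ℝ := fun t => -excess f u lam (v + t) with hg
  have hgd : ∀ t, HasDerivAt g (f1 (v + t) - lam) t := fun t => by
    refine (((F.hasDerivAt_excess u lam (v + t)).comp_const_add v t).neg).congr_deriv (by ring)
  have hg0 : g 0 = 0 := by simp [hg, hlam, excess_chordSpeed (show u ≠ v by linarith)]
  have hglow : ∀ t ∈ Icc 0 T, d / 2 * t ≤ g t := by
    intro t ht
    have := monotoneOn_of_hasDerivAt_nonneg (convex_Icc 0 T)
      (fun x _ => (hgd x).sub ((hasDerivAt_id x).const_mul (d / 2)))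
      (fun x hx => by linarith [(hT x hx).2]) ⟨le_rfl, hT0.le⟩ ht ht.1
    simp [hg0] at this
    linarith
  have hgup : ∀ t ∈ Icc 0 T, g t ≤ d * t := by
    intro t ht
    have := antitoneOn_of_hasDerivAt_nonpos (convex_Icc 0 T)
      (fun x _ => (hgd x).sub ((hasDerivAt_id x).const_mul d))
      (fun x hx => by
        have := F.strictAntiOn1.antitoneOn (mem_Iic.mpr hv0.le) (mem_Iic.mpr (hT x hx).1)
          (by linarith [hx.1])
        linarith) ⟨le_rfl, hT0.le⟩ ht ht.1
    simp [hg0] at this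
    linarith
  -- Energies as functions of the distance `t` from the saddle. In this direction the damping term
  -- changes sign and the comparison principle no longer applies, hence the logarithmic argument.
  set Y : ℝ → ℝ := fun t => profile α q f u lam (u - v - t) with hY
  set Z : ℝ → ℝ := fun t => profile α q f u' lam' (u' - v - t) with hZ
  have hYd : ∀ t ∈ Icc 0 T, HasDerivAt Y (g t + α * damp q (Y t)) t := by
    intro t ht
    have h1 := (hy.2 (u - v - t) (by linarith [ht.2])).comp_const_sub (u - v) t
    refine h1.congr_deriv ?_
    simp only [hg, hY]
    rw [show u - (u - v - t) = v + t by ring]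
    ring
  have hZd : ∀ t ∈ Icc 0 T, HasDerivAt Z ((g t - (lam' - lam) * t) + α * damp q (Z t)) t := by
    intro t ht
    have h1 := (hz.2 (u' - v - t) (by linarith [ht.2])).comp_const_sub (u' - v) t
    refine h1.congr_deriv ?_
    simp only [hg, hZ]
    rw [show u' - (u' - v - t) = v + t by ring, hex]
    ring
  have hYlow : ∀ t ∈ Icc 0 T, d / 4 * t ^ 2 ≤ Y t := by
    intro t ht
    have := monotoneOn_of_hasDerivAt_nonneg (convex_Icc 0 T)
      (fun x hx => (hYd x hx).sub ((hasDerivAt_pow 2 x).const_mul (d / 4)))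
      (fun x hx => by
        have h1 := hglow x hx
        have h2 := mul_nonneg hα.le (damp_nonneg q (Y x))
        norm_num
        linarith) ⟨le_rfl, hT0.le⟩ ht ht.1
    have hY0 : Y 0 = 0 := by
      have : arrivalEnergy α q f u v = Y 0 := by simp [hY, arrivalEnergy, hlam]
      rw [← this, hv3]
    simp [hY0] at this
    linarith
  have hYZ : ∀ t ∈ Icc 0 T, Y t ≤ Z t := by
    intro t ht
    have := hle (u - v - t) ⟨by linarith [ht.2], by linarith [ht.1]⟩
    rwa [show u - v - t + (u' - u) = u' - v - t by ring] at this
  obtain ⟨M, hM⟩ := (isCompact_Icc (a := (0 : ℝ)) (b := T)).exists_bound_of_continuousOn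
    (f := Z) (fun t ht => (hZd t ht).continuousAt.continuousWithinAt)
  have hZM : ∀ t ∈ Icc 0 T, Z t ≤ M := fun t ht => (le_abs_self _).trans (hM t ht)
  obtain ⟨B, hB, hBs⟩ := exists_damp_le_sqrt hq M
  have hY0 : ∀ t ∈ Icc 0 T, 0 ≤ Y t := fun t ht => le_trans (by positivity) (hYlow t ht)
  obtain ⟨k, hk, hZk⟩ := exists_quadratic_bound (T := T) (B := α * B) (C := d) (by positivity)
    hdpos.le hZd (by simpa [hZ] using hA') (fun t ht => by
      have h1 := hBs (Z t) ((hY0 t ht).trans (hYZ t ht)) (hZM t ht)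
      have h2 := mul_le_mul_of_nonneg_left h1 hα.le
      have h3 : 0 ≤ (lam' - lam) * t := mul_nonneg (by linarith) ht.1
      linarith [hgup t ht])
  have hsub : ∀ t ∈ Ioc 0 T, t ∈ Icc 0 T := fun t ht => ⟨ht.1.le, ht.2⟩
  exact false_of_ordered_solutions (a := lam' - lam) (c := d / 4) hα.le hT0 (by linarith)
    (by positivity) hk
    (fun t ht => hYd t (hsub t ht)) (fun t ht => hZd t (hsub t ht))
    (fun t ht => le_trans (by have := ht.1; positivity) (hglow t (hsub t ht))) (fun t _ => rfl)
    (fun t ht => hYlow t (hsub t ht)) (fun t ht => hZk t (hsub t ht))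
    (fun t ht => hZM t (hsub t ht)) (fun t ht => hYZ t (hsub t ht))

end Flux

end KineticRelation

/-! ### Scaling comparisons and Lipschitz bounds from short steps. -/

namespace KineticRelation

theorem IsEnergyProfile.le_sq_mul {α q S ρ : ℝ} {H K y z : ℝ → ℝ} (hα : 0 ≤ α) (hq : 1 / 2 ≤ q)
    (hρ : 1 ≤ ρ) (hy : IsEnergyProfile α q H y) (hz : IsEnergyProfile α q K z) (hHc : Continuous H)
    (hH0 : 0 ≤ H 0) (hH : MonotoneOn H (Icc 0 S)) (hK : ∀ s ∈ Icc 0 S, K s ≤ ρ * H s) :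
    ∀ s ∈ Icc 0 S, z s ≤ ρ ^ 2 * y s := by
  have hq0 : 0 < q := by linarith
  have hd := hy.damp_le_of_monotoneOn hα hq0 hHc hH0 hH
  refine le_of_deriv_le_of_lt (fun x hx => hz.2 x hx.1)
    (fun x hx => (hy.2 x hx.1).const_mul (ρ ^ 2)) (by rw [hy.1, hz.1, mul_zero])
    (fun x hx hlt => ?_)
  have h1 := mul_le_mul_of_nonneg_left (damp_mono hq0.le hlt.le) hα
  rw [damp_mul (by positivity)] at h1
  -- The exponent `2 * q` is at least one. The force grows by `ρ` only, while the energy is allowed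
  -- to grow by `ρ ^ 2`; the difference is paid by `α * damp ≤ H`, valid since `H` is nondecreasing.
  have h2 : ρ ≤ (ρ ^ 2) ^ q := by
    rw [← Real.rpow_natCast_mul (by positivity)]
    exact Real.self_le_rpow_of_one_le hρ (by push_cast; linarith)
  have h3 := hd x hx
  have h4 := hK x hx
  have h5 : ρ * (α * damp q (y x)) ≤ (ρ ^ 2) ^ q * (α * damp q (y x)) :=
    mul_le_mul_of_nonneg_right h2 (mul_nonneg hα (damp_nonneg _ _))
  have h6 : (ρ ^ 2 - ρ) * (α * damp q (y x)) ≤ (ρ ^ 2 - ρ) * H x :=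
    mul_le_mul_of_nonneg_left h3 (by nlinarith)
  linarith

/-- Stretching distance by `r` and energy by `m` turns the damping into a multiple with factor `m ^
q`, by homogeneity. The condition `hmr` says that the stretched friction is at least as strong as
required of a comparison function. -/
theorem IsEnergyProfile.le_mul_rescale {α β q S S' r m l : ℝ} {H K y z : ℝ → ℝ} (hβ : 0 ≤ β)
    (hq : 0 ≤ q) (hr : 0 < r) (hm : 0 ≤ m) (hS : 0 ≤ S) (hS' : 0 ≤ S')
    (hy : IsEnergyProfile α q H y) (hz : IsEnergyProfile β q K z)
    (hmr : α * m ≤ β * (r * m ^ q)) (h0 : z S' ≤ m * y S)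
    (hHK : ∀ t ∈ Icc 0 l, r * K (S' + r * t) ≤ m * H (S + t)) :
    ∀ t ∈ Icc 0 l, z (S' + r * t) ≤ m * y (S + t) := by
  refine le_of_deriv_le_of_lt
    (f' := fun t => (K (S' + r * t) - β * damp q (z (S' + r * t))) * r)
    (g' := fun t => m * (H (S + t) - α * damp q (y (S + t))))
    (fun x hx => ?_) (fun x hx => ?_) (by simpa using h0) (fun x hx hlt => ?_)
  · have h1 : HasDerivAt (fun t => S' + r * t) r x := by
      simpa using ((hasDerivAt_id x).const_mul r).const_add S'
    exact (hz.2 (S' + r * x) (by have := hx.1; positivity)).comp x h1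
  · exact ((hy.2 (S + x) (by linarith [hx.1])).comp_const_add S x).const_mul m
  · have h1 := mul_le_mul_of_nonneg_left (damp_mono hq hlt.le) (mul_nonneg hβ hr.le)
    rw [damp_mul hm] at h1
    have h2 := hHK x hx
    have h3 := mul_le_mul_of_nonneg_right hmr (damp_nonneg q (y (S + x)))
    linarith

/-- A function whose increments over relatively short steps are bounded by `K` times the step is
Lipschitz. -/
theorem abs_sub_le_of_short_steps {g : ℝ → ℝ} {R K c u u' : ℝ} (hc : 0 < c)
    (h : ∀ w, u ≤ w → ∀ e, 0 < e → e ≤ c * w → w + e ≤ R → |g (w + e) - g w| ≤ K * e)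
    (hu : 0 < u) (huu : u ≤ u') (hR : u' ≤ R) : |g u' - g u| ≤ K * (u' - u) := by
  have key : ∀ n : ℕ, ∀ u', u ≤ u' → u' ≤ R → u' - u ≤ n * (c * u) →
      |g u' - g u| ≤ K * (u' - u) := by
    intro n
    induction n with
    | zero =>
      intro u' h1 _ h3
      have : u' = u := by simp at h3; linarith
      simp [this]
    | succ n ih =>
      intro u' h1 h2 h3
      rcases eq_or_lt_of_le h1 with h4 | h4
      · simp [h4]
      have hn : (0 : ℝ) < n + 1 := by positivity
      -- Induction on the number of equal steps; the allowed step length, relative to the current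
      -- point, only grows to the right of `u`.
      set e := (u' - u) / (n + 1) with he
      have he0 : 0 < e := div_pos (by linarith) hn
      have hec : e ≤ c * u := by
        rw [he, div_le_iff₀ hn]; push_cast at h3; linarith
      have heq : u' - u = (n + 1) * e := by rw [he]; field_simp
      have hne : 0 ≤ n * e := by positivity
      have h5 := ih (u' - e) (by linarith) (by linarith) (by
        have : n * e ≤ n * (c * u) := by gcongr
        linarith)
      have h6 := h (u' - e) (by linarith) e he0 (hec.trans (by gcongr; linarith)) (by linarith)
      rw [sub_add_cancel] at h6
      calc |g u' - g u| = |(g u' - g (u' - e)) + (g (u' - e) - g u)| := by ring_nf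
        _ ≤ K * e + K * (u' - e - u) := (abs_add_le _ _).trans (add_le_add h6 h5)
        _ = K * (u' - u) := by ring
  obtain ⟨n, hn⟩ := exists_nat_ge ((u' - u) / (c * u))
  exact key n u' huu hR (by rwa [div_le_iff₀ (by positivity)] at hn)

/-! ### Quantitative size estimates on bounded intervals. -/

/-- Cubic bounds for the flux on a bounded interval. -/
structure CubicBounds (f2 : ℝ → ℝ) (R c C : ℝ) : Prop where
  pos : 0 < c
  le : c ≤ C
  bound : ∀ x ∈ Icc (-R) R, c * x ^ 2 ≤ x * f2 x ∧ x * f2 x ≤ C * x ^ 2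

namespace CubicBounds

variable {f f1 f2 : ℝ → ℝ} {R c C : ℝ} (F : Flux f f1 f2) (B : CubicBounds f2 R c C)
include B

theorem pos' : 0 < C := B.pos.trans_le B.le

theorem le_f2 {x : ℝ} (hx : 0 < x) (hxR : x ≤ R) : c * x ≤ f2 x := by
  have := (B.bound x ⟨by linarith, hxR⟩).1
  nlinarith

theorem f2_le {x : ℝ} (hx : 0 < x) (hxR : x ≤ R) : f2 x ≤ C * x := by
  have := (B.bound x ⟨by linarith, hxR⟩).2
  nlinarith

theorem f2_le_of_neg {x : ℝ} (hx : x < 0) (hxR : -R ≤ x) : f2 x ≤ c * x := by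
  have := (B.bound x ⟨hxR, by linarith⟩).1
  nlinarith

theorem le_f2_of_neg {x : ℝ} (hx : x < 0) (hxR : -R ≤ x) : C * x ≤ f2 x := by
  have := (B.bound x ⟨hxR, by linarith⟩).2
  nlinarith

include F

theorem f1_sub_le {x y : ℝ} (hx : 0 ≤ x) (hxy : x ≤ y) (hy : y ≤ R) :
    f1 y - f1 x ≤ C * (y ^ 2 - x ^ 2) / 2 := by
  have := B.pos'
  have h : AntitoneOn (fun x => f1 x - C / 2 * x ^ 2) (Icc 0 R) := by
    apply antitoneOn_of_deriv_nonpos (convex_Icc 0 R)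
    · exact (F.continuous1.sub (by fun_prop)).continuousOn
    · exact fun z _ => ((F.hasDerivAt1 z).sub
        ((hasDerivAt_pow 2 z).const_mul (C / 2))).differentiableAt.differentiableWithinAt
    · intro z hz
      rw [interior_Icc] at hz
      have hd : HasDerivAt (fun x => f1 x - C / 2 * x ^ 2) _ z :=
        (F.hasDerivAt1 z).sub ((hasDerivAt_pow 2 z).const_mul (C / 2))
      rw [hd.deriv]
      have := B.f2_le hz.1 hz.2.le
      norm_num; linarith
  have := h ⟨hx, hxy.trans hy⟩ ⟨hx.trans hxy, hy⟩ hxy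
  simp only at this
  linarith

theorem le_f1_sub {x y : ℝ} (hx : 0 ≤ x) (hxy : x ≤ y) (hy : y ≤ R) :
    c * (y ^ 2 - x ^ 2) / 2 ≤ f1 y - f1 x := by
  have h : MonotoneOn (fun x => f1 x - c / 2 * x ^ 2) (Icc 0 R) := by
    apply monotoneOn_of_deriv_nonneg (convex_Icc 0 R)
    · exact (F.continuous1.sub (by fun_prop)).continuousOn
    · exact fun z _ => ((F.hasDerivAt1 z).sub
        ((hasDerivAt_pow 2 z).const_mul (c / 2))).differentiableAt.differentiableWithinAt
    · intro z hz
      rw [interior_Icc] at hz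
      have hd : HasDerivAt (fun x => f1 x - c / 2 * x ^ 2) _ z :=
        (F.hasDerivAt1 z).sub ((hasDerivAt_pow 2 z).const_mul (c / 2))
      rw [hd.deriv]
      have := B.le_f2 hz.1 hz.2.le
      norm_num; linarith
  have := h ⟨hx, hxy.trans hy⟩ ⟨hx.trans hxy, hy⟩ hxy
  simp only at this
  linarith

end CubicBounds

theorem CubicBounds.reflect {f2 : ℝ → ℝ} {R c C : ℝ} (B : CubicBounds f2 R c C) :
    CubicBounds (fun x => -f2 (-x)) R c C where
  pos := B.pos
  le := B.le
  bound x hx := by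
    have h1 := B.bound (-x) ⟨by linarith [hx.2], by linarith [hx.1]⟩
    constructor <;> nlinarith [h1.1, h1.2]

theorem Flux.exists_cubicBounds {f f1 f2 : ℝ → ℝ} (F : Flux f f1 f2) (R : ℝ) :
    ∃ c C, CubicBounds f2 R c C := by
  obtain ⟨c, C, h1, h2, h3⟩ := F.bounds R
  exact ⟨c, C, h1, h2, h3⟩

namespace CubicBounds

variable {f f1 f2 : ℝ → ℝ} {R c C : ℝ} (F : Flux f f1 f2) (B : CubicBounds f2 R c C)
include F B

theorem f1_sub_le_of_neg {x y : ℝ} (hx : -R ≤ x) (hxy : x ≤ y) (hy : y ≤ 0) :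
    f1 x - f1 y ≤ C * (x ^ 2 - y ^ 2) / 2 := by
  have := B.reflect.f1_sub_le F.reflect (x := -y) (y := -x) (by linarith) (by linarith)
    (by linarith)
  simpa using this

theorem le_f1_sub_of_neg {x y : ℝ} (hx : -R ≤ x) (hxy : x ≤ y) (hy : y ≤ 0) :
    c * (x ^ 2 - y ^ 2) / 2 ≤ f1 x - f1 y := by
  have := B.reflect.le_f1_sub F.reflect (x := -y) (y := -x) (by linarith) (by linarith)
    (by linarith)
  simpa using this

theorem f1_le (x : ℝ) (hx : x ∈ Icc (-R) R) : f1 x - f1 0 ≤ C * x ^ 2 / 2 := by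
  rcases le_total 0 x with h | h
  · simpa using B.f1_sub_le F le_rfl h hx.2
  · simpa using B.f1_sub_le_of_neg F hx.1 h le_rfl

theorem le_f1 (x : ℝ) (hx : x ∈ Icc (-R) R) : c * x ^ 2 / 2 ≤ f1 x - f1 0 := by
  rcases le_total 0 x with h | h
  · simpa using B.le_f1_sub F le_rfl h hx.2
  · simpa using B.le_f1_sub_of_neg F hx.1 h le_rfl

theorem le_f_sub {x : ℝ} (hx : 0 ≤ x) (hxR : x ≤ R) : c * x ^ 3 / 6 ≤ f x - f 0 - f1 0 * x := by
  have h := monotoneOn_of_hasDerivAt_nonneg (convex_Icc 0 x)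
    (fun z _ => ((F.hasDerivAt z).sub ((hasDerivAt_id z).const_mul (f1 0))).sub
      ((hasDerivAt_pow 3 z).const_mul (c / 6))) (fun z hz => by
      have := B.le_f1 F z ⟨by linarith [hz.1], hz.2.trans hxR⟩
      norm_num; linarith) ⟨le_rfl, hx⟩ ⟨hx, le_rfl⟩ hx
  simp at h
  linarith

theorem le_f_sub_of_neg {x : ℝ} (hx : x ≤ 0) (hxR : -R ≤ x) :
    f x - f 0 - f1 0 * x ≤ c * x ^ 3 / 6 := by
  have := B.reflect.le_f_sub F.reflect (x := -x) (by linarith) (by linarith)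
  simp at this
  nlinarith

/-- States to the left of the tangent state are comparable with `u` from below. -/
theorem mul_le_neg {u v : ℝ} (hu : 0 < u) (huR : u ≤ R) (hvR : -R ≤ v)
    (hv : v ≤ tangentState f f1 u) : c / (6 * C) * u ≤ -v := by
  have hC := B.pos'
  have hc := B.pos
  have hv0 : v < 0 := hv.trans_lt (F.tangentState_neg hu)
  have hT : 0 ≤ tangentGap f f1 v u := by
    rcases eq_or_lt_of_le hv with h | h
    · rw [h, F.tangentGap_tangentState hu]
    · exact (F.tangentGap_pos_of_lt hu h).le
  have h1 := B.f1_le F v ⟨hvR, by linarith⟩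
  have h2 := B.le_f_sub F hu.le huR
  have h3 := B.le_f_sub_of_neg F hv0.le hvR
  have h4 : c * v ^ 3 / 6 ≤ 0 := by
    have : v ^ 3 ≤ 0 := by nlinarith [sq_nonneg v]
    nlinarith
  -- A tangent at `v` that passes above `(u, f u)` has to outgrow the cubic lower bound for `f` at
  -- `u`, which forces `-v` to be a fixed fraction of `u`.
  have h5 : c * u ^ 3 / 6 ≤ C * v ^ 2 / 2 * (u - v) := by
    have h6 : (f1 v - f1 0) * (u - v) ≤ C * v ^ 2 / 2 * (u - v) :=
      mul_le_mul_of_nonneg_right h1 (by linarith)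
    unfold tangentGap at hT
    linarith
  by_contra! hlt
  have hη : c / (6 * C) ≤ 1 / 6 := by
    rw [div_le_div_iff₀ (by positivity) (by norm_num)]; linarith [B.le]
  have hb : -v < u / 6 := hlt.trans_le (by nlinarith)
  have h7 : C * (-v) ≤ c / 6 * u := by
    have : C * (-v) ≤ C * (c / (6 * C) * u) := by gcongr
    rwa [show C * (c / (6 * C) * u) = c / 6 * u by field_simp] at this
  have h8 : C * v ^ 2 ≤ c / 36 * u ^ 2 := by
    calc C * v ^ 2 = C * (-v) * (-v) := by ring
      _ ≤ c / 6 * u * (u / 6) := by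
        have : 0 ≤ -v := by linarith
        gcongr
      _ = c / 36 * u ^ 2 := by ring
  have h9 : C * v ^ 2 / 2 * (u - v) ≤ c / 72 * u ^ 2 * (7 / 6 * u) := by
    have h10 : C * v ^ 2 / 2 ≤ c / 72 * u ^ 2 := by linarith
    have h11 : u - v ≤ 7 / 6 * u := by linarith
    have : 0 ≤ u - v := by linarith
    gcongr
  have : 0 < c * u ^ 3 := by positivity
  nlinarith

/-- Right states of compressive chords are comparable with `u` from above. -/
theorem neg_le_mul {u v : ℝ} (hu : 0 < u) (huR : u ≤ R) (hvR : -R ≤ v) (hv : v ≤ 0)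
    (h : chordSpeed f u v < f1 u) : -v ≤ 6 * C / c * u := by
  have hC := B.pos'
  have hc := B.pos
  have h1 := B.f1_le F u ⟨by linarith, huR⟩
  have h2 := B.le_f_sub F hu.le huR
  have h3 := B.le_f_sub_of_neg F hv hvR
  rw [chordSpeed, div_lt_iff₀ (by linarith)] at h
  -- A chord slower than `f1 u` rises by at most order `u ^ 2 * (u - v)`, whereas the graph drops by
  -- order `(-v) ^ 3`.
  have h4 : c * u ^ 3 / 6 - c * v ^ 3 / 6 ≤ C * u ^ 2 / 2 * (u - v) := by
    have : (f1 u - f1 0) * (u - v) ≤ C * u ^ 2 / 2 * (u - v) :=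
      mul_le_mul_of_nonneg_right h1 (by linarith)
    linarith
  by_contra! hlt
  have hκ : 6 ≤ 6 * C / c := by rw [le_div_iff₀ hc]; linarith [B.le]
  have hub : u < -v := by nlinarith
  have h5 : c * (-v) ^ 3 / 6 < C * u ^ 2 * (-v) := by
    have h6 : C * u ^ 2 / 2 * (u - v) ≤ C * u ^ 2 / 2 * (2 * (-v)) := by gcongr; linarith
    have h7 : 0 < c * u ^ 3 := by positivity
    nlinarith
  have h8 : c * (-v) ^ 2 < 6 * C * u ^ 2 := by nlinarith
  have h9 : 6 * C * u < c * (-v) := by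
    rw [div_mul_eq_mul_div, div_lt_iff₀ hc] at hlt; linarith
  have h10 : 6 * C * u * u < c * (-v) * (-v) := by
    have : 6 * C * u * u < c * (-v) * u := mul_lt_mul_of_pos_right h9 hu
    have : c * (-v) * u < c * (-v) * (-v) :=
      mul_lt_mul_of_pos_left hub (mul_pos hc (by linarith))
    linarith
  linarith

end CubicBounds

end KineticRelation

/-! ### The stretching inequality for moved end states. -/

namespace KineticRelation

/-- The states `v < 0 < x < u` have comparable sizes and separations, and `f1 x ≤ f1 v`. -/
structure Comparable (f1 : ℝ → ℝ) (R θ u v x : ℝ) : Prop where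
  pos : 0 < u
  le : u ≤ R
  ge : -R ≤ v
  le_neg : θ * u ≤ -v
  neg_le : θ * -v ≤ u
  le_mid : θ * u ≤ x
  mid_le : x + θ * u ≤ u
  f1_le : f1 x ≤ f1 v

namespace CubicBounds

variable {f f1 f2 : ℝ → ℝ} {R c C : ℝ} (F : Flux f f1 f2) (B : CubicBounds f2 R c C)
include F B

/-- The infinitesimal form of the stretching inequality. The left side is the loss from moving `u`
and `x` to the right with speed one, the right side the gain from moving `v` to the left with speed
`K`. -/
theorem stretch_aux {θ K u v x w : ℝ} (hθ : 0 < θ) (hθ1 : θ ≤ 1) (hK : 12 * C ≤ K * (c * θ ^ 8))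
    (h : Comparable f1 R θ u v x) (hw : w ∈ Icc v x) :
    (w - v) * (x - v) * (f1 u - f1 w) + (u - x) * (f w - f v - (w - v) * f1 w) ≤
      K * ((u - v) * (x - w) * (f1 v - f1 w) + (u - x) * tangentGap f f1 v w) := by
  obtain ⟨hu, huR, hvR, hv1, hv2, hx1, hx2, hfx⟩ := h
  have hC := B.pos'
  have hc := B.pos
  have hθu : 0 < θ * u := mul_pos hθ hu
  have hK0 : 0 < K := pos_of_mul_pos_left (by linarith : 0 < K * (c * θ ^ 8)) (by positivity)
  have hv0 : v < 0 := by linarith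
  have hx0 : 0 < x := by linarith
  have hzero : ∀ y, f1 0 ≤ f1 y := fun y => by
    rcases eq_or_ne y 0 with rfl | hy
    · exact le_rfl
    · exact (F.f1_zero_lt hy).le
  have hA : ∀ y ∈ Icc v x, f1 y ≤ f1 v := fun y hy => by
    rcases le_total y 0 with h0 | h0
    · exact F.strictAntiOn1.antitoneOn (mem_Iic.mpr hv0.le) (mem_Iic.mpr h0) hy.1
    · exact (F.strictMonoOn1.monotoneOn (mem_Ici.mpr h0)
        (mem_Ici.mpr (h0.trans hy.2)) hy.2).trans hfx
  have hTm : MonotoneOn (fun w => tangentGap f f1 v w) (Icc v x) :=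
    monotoneOn_of_hasDerivAt_nonneg (convex_Icc v x)
      (fun y _ => F.hasDerivAt_tangentGap_right v y) (fun y hy => by linarith [hA y hy])
  have hT0 : 0 ≤ tangentGap f f1 v w := by
    have := hTm ⟨le_rfl, by linarith⟩ hw hw.1
    simpa [tangentGap] using this
  have hAw := hA w hw
  have hD : f w - f v - (w - v) * f1 w ≤ (w - v) * (f1 v - f1 w) := by
    unfold tangentGap at hT0
    linarith
  have hwv : 0 ≤ w - v := by linarith [hw.1]
  have hfu : f1 u - f1 w ≤ C * u ^ 2 / 2 := by
    have := B.f1_le F u ⟨by linarith, huR⟩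
    linarith [hzero w]
  have hfv : f1 v - f1 w ≤ C * v ^ 2 / 2 := by
    have := B.f1_le F v ⟨hvR, by linarith⟩
    linarith [hzero w]
  have hv2' : θ ^ 2 * v ^ 2 ≤ u ^ 2 := by
    have : (θ * -v) ^ 2 ≤ u ^ 2 := pow_le_pow_left₀ (mul_nonneg hθ.le (by linarith)) hv2 2
    linarith
  have hL : 0 ≤ u - v := by linarith
  have hL2 : θ * (u - v) ≤ 2 * u := by nlinarith
  have hlhs : θ ^ 2 * ((w - v) * (x - v) * (f1 u - f1 w) +
      (u - x) * (f w - f v - (w - v) * f1 w)) ≤ (w - v) * ((u - v) * (C * u ^ 2)) := by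
    have h1 : (w - v) * (x - v) * (f1 u - f1 w) ≤ (w - v) * (u - v) * (C * u ^ 2 / 2) := by
      have h2 : (w - v) * (x - v) * (f1 u - f1 w) ≤ (w - v) * (x - v) * (C * u ^ 2 / 2) :=
        mul_le_mul_of_nonneg_left hfu (mul_nonneg hwv (by linarith))
      refine h2.trans ?_
      gcongr
      linarith
    have h3 : (u - x) * (f w - f v - (w - v) * f1 w) ≤ (u - v) * ((w - v) * (C * v ^ 2 / 2)) := by
      have h4 : (u - x) * (f w - f v - (w - v) * f1 w) ≤ (u - x) * ((w - v) * (C * v ^ 2 / 2)) :=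
        mul_le_mul_of_nonneg_left (hD.trans (mul_le_mul_of_nonneg_left hfv hwv)) (by linarith)
      refine h4.trans ?_
      gcongr
      linarith
    have h5 : θ ^ 2 * ((u - v) * ((w - v) * (C * v ^ 2 / 2))) ≤
        (u - v) * ((w - v) * (C * u ^ 2 / 2)) := by
      calc _ = (u - v) * ((w - v) * (C * (θ ^ 2 * v ^ 2) / 2)) := by ring
        _ ≤ _ := by gcongr
    have h6 : θ ^ 2 * ((w - v) * (u - v) * (C * u ^ 2 / 2)) ≤
        (w - v) * (u - v) * (C * u ^ 2 / 2) :=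
      mul_le_of_le_one_left (mul_nonneg (mul_nonneg hwv hL) (by positivity))
        (pow_le_one₀ hθ.le hθ1)
    have h7 := mul_le_mul_of_nonneg_left (add_le_add h1 h3) (sq_nonneg θ)
    linarith
  have hθ2 : 0 < θ ^ 2 := by positivity
  refine le_of_mul_le_mul_left (hlhs.trans ?_) hθ2
  -- For `w ≤ 0` the gain comes from `f1 v - f1 w`, at least of order `u * (w - v)`; for `w ≥ 0` it
  -- comes from the tangent gap, at least of order `u ^ 3`. The losses have matching orders.
  rcases le_total w 0 with h0 | h0
  · have h1 : c * (w - v) * (θ * u) / 2 ≤ f1 v - f1 w := by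
      refine le_trans ?_ (B.le_f1_sub_of_neg F hvR hw.1 h0)
      have : (w - v) * (θ * u) ≤ (w - v) * (-v - w) := by gcongr; linarith
      have := mul_le_mul_of_nonneg_left this hc.le
      linarith
    have h2 : (u - v) * (θ * u) * (c * (w - v) * (θ * u) / 2) ≤
        (u - v) * (x - w) * (f1 v - f1 w) := by
      have h3 : θ * u ≤ x - w := by linarith
      have h4 : 0 ≤ x - w := by linarith
      gcongr
    have h5 : 0 ≤ (u - x) * tangentGap f f1 v w := mul_nonneg (by linarith) hT0
    calc (w - v) * ((u - v) * (C * u ^ 2)) = C * ((w - v) * (u - v) * u ^ 2) := by ring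
      _ ≤ (K * (c * θ ^ 4) / 2) * ((w - v) * (u - v) * u ^ 2) := by
        gcongr
        have h6 : K * (c * θ ^ 8) ≤ K * (c * θ ^ 4) := by
          gcongr _ * (_ * ?_)
          exact pow_le_pow_of_le_one hθ.le hθ1 (by norm_num)
        linarith
      _ = θ ^ 2 * (K * ((u - v) * (θ * u) * (c * (w - v) * (θ * u) / 2))) := by ring
      _ ≤ _ := by gcongr; linarith
  · have hT : c * (θ * u) ^ 3 / 3 ≤ tangentGap f f1 v w := by
      refine le_trans ?_ (hTm ⟨hv0.le, hx0.le⟩ hw h0)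
      have h1 := monotoneOn_of_hasDerivAt_nonneg (convex_Icc v 0)
        (fun y _ => (F.hasDerivAt_tangentGap_right v y).sub
          (((hasDerivAt_id y).const_mul (c / 2 * v ^ 2)).sub
            ((hasDerivAt_pow 3 y).const_mul (c / 6))))
        (fun y hy => by
          have := B.le_f1_sub_of_neg F hvR hy.1 hy.2
          norm_num
          linarith) ⟨le_rfl, hv0.le⟩ ⟨hv0.le, le_rfl⟩ hv0.le
      have h2 : tangentGap f f1 v v = 0 := by simp [tangentGap]
      have h3 : c * (θ * u) ^ 3 ≤ c * (-v) ^ 3 := by gcongr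
      simp [h2] at h1
      linarith
    have h2 : (θ * u) * (c * (θ * u) ^ 3 / 3) ≤ (u - x) * tangentGap f f1 v w := by
      have : θ * u ≤ u - x := by linarith
      have : 0 ≤ u - x := by linarith
      gcongr
    have h3 : 0 ≤ (u - v) * (x - w) * (f1 v - f1 w) :=
      mul_nonneg (mul_nonneg hL (by linarith [hw.2])) (by linarith)
    have h4 : θ ^ 2 * ((w - v) * ((u - v) * (C * u ^ 2))) ≤ 4 * C * u ^ 4 := by
      have h5 : w - v ≤ u - v := by linarith [hw.2]
      calc θ ^ 2 * ((w - v) * ((u - v) * (C * u ^ 2)))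
          ≤ θ ^ 2 * ((u - v) * ((u - v) * (C * u ^ 2))) := by gcongr
        _ = (θ * (u - v)) ^ 2 * (C * u ^ 2) := by ring
        _ ≤ (2 * u) ^ 2 * (C * u ^ 2) := by gcongr
        _ = _ := by ring
    refine le_of_mul_le_mul_left (h4.trans ?_) hθ2
    calc 4 * C * u ^ 4 = 12 * C / 3 * u ^ 4 := by ring
      _ ≤ K * (c * θ ^ 8) / 3 * u ^ 4 := by gcongr
      _ = θ ^ 2 * (θ ^ 2 * (K * ((θ * u) * (c * (θ * u) ^ 3 / 3)))) := by ring
      _ ≤ _ := by gcongr; linarith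

/-- Along the motion `u + e`, `v - K e`, the chord minus the graph, seen in a frame attached to
`v` and stretched with the motion, decreases. -/
theorem stretch_le {θ K ε u v x t : ℝ} (hθ : 0 < θ) (hθ1 : θ ≤ 1)
    (hK : 12 * C ≤ K * (c * θ ^ 8)) (hε : 0 ≤ ε)
    (h : ∀ e ∈ Icc 0 ε, Comparable f1 R θ (u + e) (v - K * e) (x + e)) (ht : t ∈ Icc 0 (x - v)) :
    t * (f (u + ε) - f (v - K * ε)) - (u - v + (K + 1) * ε) / (x - v + (K + 1) * ε) * (x - v) *
        (f (v - K * ε + (x - v + (K + 1) * ε) / (x - v) * t) - f (v - K * ε)) ≤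
      t * (f u - f v) - (u - v) * (f (v + t) - f v) := by
  have hl : 0 < x - v := by
    obtain ⟨hu, huR, hvR, hv1, hv2, hx1, hx2, hfx⟩ := h 0 ⟨le_rfl, hε⟩
    have : 0 < θ * (u + 0) := mul_pos hθ hu
    linarith
  have hle : ∀ e ∈ Icc 0 ε, 0 < x - v + (K + 1) * e := by
    intro e he
    obtain ⟨hu, huR, hvR, hv1, hv2, hx1, hx2, hfx⟩ := h e he
    have : 0 < θ * (u + e) := mul_pos hθ hu
    linarith
  have hd1 : ∀ e, HasDerivAt (fun e => f (u + e)) (f1 (u + e)) e := fun e =>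
    (F.hasDerivAt (u + e)).comp_const_add u e
  have hvd : ∀ e, HasDerivAt (fun e => v - K * e) (-K) e := fun e => by
    simpa using ((hasDerivAt_id e).const_mul K).const_sub v
  have hd2 : ∀ e, HasDerivAt (fun e => f (v - K * e)) (f1 (v - K * e) * -K) e := fun e =>
    (F.hasDerivAt (v - K * e)).comp e (hvd e)
  have hlin : ∀ a e, HasDerivAt (fun e => a + (K + 1) * e) (K + 1) e := fun a e => by
    simpa using ((hasDerivAt_id e).const_mul (K + 1)).const_add a
  have hd3 : ∀ e, HasDerivAt (fun e => f (v - K * e + (x - v + (K + 1) * e) / (x - v) * t))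
      (f1 (v - K * e + (x - v + (K + 1) * e) / (x - v) * t) * (-K + (K + 1) / (x - v) * t)) e :=
    fun e => (F.hasDerivAt _).comp e
      ((hvd e).add (((hlin (x - v) e).div_const (x - v)).mul_const t))
  have hmono := antitoneOn_of_hasDerivAt_nonpos (convex_Icc 0 ε)
    (fun e he => (((hd1 e).sub (hd2 e)).const_mul t).sub
      ((((hlin (u - v) e).div (hlin (x - v) e) (hle e he).ne').mul_const (x - v)).mul
        ((hd3 e).sub (hd2 e)))) (fun e he => ?_) ⟨le_rfl, hε⟩ ⟨hε, le_rfl⟩ hε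
  · simpa [hl.ne'] using hmono
  · have hcomp := h e he
    have hle' := hle e he
    set ue := u + e with hue
    set ve := v - K * e with hve
    set l := x - v with hl_def
    set le := x - v + (K + 1) * e with hle_def
    set we := ve + le / l * t with hwe
    have hτ : le / l * t = we - ve := by rw [hwe]; ring
    have hτl : le / l * t ≤ le := by
      rw [div_mul_eq_mul_div, div_le_iff₀ hl]
      exact mul_le_mul_of_nonneg_left ht.2 hle'.le
    have hτ0 : 0 ≤ le / l * t := mul_nonneg (div_nonneg hle'.le hl.le) ht.1
    have hlee : x + e - ve = le := by rw [hve, hle_def]; ring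
    have key := B.stretch_aux F hθ hθ1 hK hcomp (w := we) ⟨by linarith, by linarith⟩
    have hxe : x + e = ve + le := by linarith
    have huv : u - v + (K + 1) * e = ue - ve := by rw [hue, hve]; ring
    have hdef : we = ve + le / l * t := hwe
    change t * (f1 ue - f1 ve * -K) - (((K + 1) * le - (u - v + (K + 1) * e) * (K + 1)) / le ^ 2 * l *
      (f we - f ve) + (u - v + (K + 1) * e) / le * l * (f1 we * (-K + (K + 1) / l * t) -
      f1 ve * -K)) ≤ 0
    rw [huv]
    rw [hxe] at key
    unfold tangentGap at key
    generalize f we = a1 at *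
    generalize f ve = a2 at *
    generalize f1 we = a3 at *
    generalize f1 ve = a4 at *
    generalize f1 ue = a5 at *
    clear_value we ve ue le l
    subst hdef
    -- The derivative along the motion is the positive factor `l / le ^ 2` times the difference of
    -- the two sides of `stretch_aux`.
    refine le_of_eq_of_le (b := l / le ^ 2 * (((ve + le / l * t - ve) * (ve + le - ve) * (a5 - a3) +
      (ue - (ve + le)) * (a1 - a2 - (ve + le / l * t - ve) * a3)) -
      K * ((ue - ve) * (ve + le - (ve + le / l * t)) * (a4 - a3) +
        (ue - (ve + le)) * (a2 + a4 * (ve + le / l * t - ve) - a1)))) ?_ ?_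
    · have := hl.ne'
      have := hle'.ne'
      field_simp
      ring
    · exact mul_nonpos_of_nonneg_of_nonpos (by positivity) (by linarith)

end CubicBounds

end KineticRelation

/-! ### Moving the end states creates no arrival energy. -/

namespace KineticRelation

namespace CubicBounds

variable {f f1 f2 : ℝ → ℝ} {R c C : ℝ} (F : Flux f f1 f2) (B : CubicBounds f2 R c C)

include B in
-- Since `12 * 2 ^ 8 = 3072`, undoing the halving of `θ` leaves a factor 3000 of slack, enough for
-- all later uses of a large `K`.
theorem mul_theta_le {θ K : ℝ} (hθ : 0 < θ) (hθ1 : θ ≤ 1) (hK : 12 * C ≤ K * (c * (θ / 2) ^ 8))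
    (n : ℕ) (hn : n ≤ 8) : 3000 * C ≤ K * (c * θ ^ n) := by
  have hC := B.pos'
  have hc := B.pos
  have hK0 : 0 < K := pos_of_mul_pos_left (by linarith : 0 < K * (c * (θ / 2) ^ 8)) (by positivity)
  have h1 : θ ^ 8 ≤ θ ^ n := pow_le_pow_of_le_one hθ.le hθ1 hn
  have h2 : K * (c * θ ^ 8) ≤ K * (c * θ ^ n) := by gcongr
  have h3 : K * (c * (θ / 2) ^ 8) = K * (c * θ ^ 8) / 256 := by ring
  linarith

include F B in
-- As `v` moves left, `f1 v` gains order `K * e * u`, more than the order `e * u` that `f1 x` gains;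
-- sizes change by at most a factor two as long as `e` and `K * e` are at most `u`.
theorem comparable_move {θ K e u v x : ℝ} (hθ : 0 < θ) (hθ1 : θ ≤ 1)
    (hK : 12 * C ≤ K * (c * (θ / 2) ^ 8)) (h : Comparable f1 R θ u v x) (he : 0 ≤ e)
    (heu : e ≤ u) (hKe : K * e ≤ u) (huR : u + e ≤ R) (hvR : -R ≤ v - K * e) :
    Comparable f1 R (θ / 2) (u + e) (v - K * e) (x + e) := by
  obtain ⟨hu, huR', hvR', hv1, hv2, hx1, hx2, hfx⟩ := h
  have hC := B.pos'
  have hc := B.pos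
  have hθu : 0 < θ * u := mul_pos hθ hu
  have hK0 : 0 < K := pos_of_mul_pos_left (by linarith : 0 < K * (c * (θ / 2) ^ 8)) (by positivity)
  have hKe0 : 0 ≤ K * e := by positivity
  have hθe : θ * e ≤ θ * u := by gcongr
  have hx0 : 0 < x := by linarith
  refine ⟨by linarith, huR, hvR, by linarith, ?_, by linarith, by linarith, ?_⟩
  · have : θ * (K * e) ≤ u := (mul_le_of_le_one_left hKe0 hθ1).trans hKe
    linarith
  · have h1 := B.f1_sub_le F hx0.le (by linarith : x ≤ x + e) (by linarith)
    have h2 := B.le_f1_sub_of_neg F hvR (by linarith : v - K * e ≤ v) (by linarith)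
    have h3 : C * ((x + e) ^ 2 - x ^ 2) / 2 ≤ C * e * (3 * u) / 2 := by
      have : C * e * (2 * x + e) ≤ C * e * (3 * u) := by gcongr; linarith
      linarith
    have h4 : c * (K * e) * (θ * u) ≤ c * ((v - K * e) ^ 2 - v ^ 2) / 2 := by
      have : c * (K * e) * (2 * (θ * u)) ≤ c * (K * e) * (2 * -v + K * e) := by
        gcongr; linarith
      linarith
    have h5 : 3000 * C * (e * u) ≤ K * (c * θ ^ 1) * (e * u) :=
      mul_le_mul_of_nonneg_right (B.mul_theta_le hθ hθ1 hK 1 (by norm_num)) (by positivity)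
    have h6 : 0 ≤ C * (e * u) := by positivity
    linarith

include F B in
-- The gap gains from `f2 v < 0`, multiplied by `K`, more than it loses from the motion of `u`. It
-- keeps the moved `v` to the left of the moved tangent state.
theorem tangentGap_move_nonneg {θ K ε u v x : ℝ} (hθ : 0 < θ) (hθ1 : θ ≤ 1)
    (hK : 12 * C ≤ K * (c * (θ / 2) ^ 8)) (hε : 0 ≤ ε)
    (h : ∀ e ∈ Icc 0 ε, Comparable f1 R (θ / 2) (u + e) (v - K * e) (x + e))
    (h0 : 0 ≤ tangentGap f f1 v u) : 0 ≤ tangentGap f f1 (v - K * ε) (u + ε) := by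
  have hC := B.pos'
  have hc := B.pos
  have hK0 : 0 < K := pos_of_mul_pos_left (by linarith : 0 < K * (c * (θ / 2) ^ 8)) (by positivity)
  have hvd : ∀ e, HasDerivAt (fun e => v - K * e) (-K) e := fun e => by
    simpa using ((hasDerivAt_id e).const_mul K).const_sub v
  have hud : ∀ e, HasDerivAt (fun e => u + e) 1 e := fun e => (hasDerivAt_id e).const_add u
  have hm := monotoneOn_of_hasDerivAt_nonneg (convex_Icc 0 ε)
    (fun e _ => (((F.hasDerivAt (v - K * e)).comp e (hvd e)).add
      (((F.hasDerivAt1 (v - K * e)).comp e (hvd e)).mul ((hud e).sub (hvd e)))).sub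
      ((F.hasDerivAt (u + e)).comp e (hud e))) (fun e he => ?_) ⟨le_rfl, hε⟩ ⟨hε, le_rfl⟩ hε
  · refine h0.trans ?_
    simp [tangentGap] at hm ⊢
    linarith
  · obtain ⟨hu, huR, hvR, hv1, hv2, hx1, hx2, hfx⟩ := h e he
    change 0 ≤ f1 (v - K * e) * -K + (f2 (v - K * e) * -K * (u + e - (v - K * e)) +
      f1 (v - K * e) * (1 - -K)) - f1 (u + e) * 1
    set ue := u + e
    set ve := v - K * e
    have hθu : 0 < θ / 2 * ue := by positivity
    have h1 := B.f2_le_of_neg (x := ve) (by linarith) hvR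
    have h2 := B.f1_le F ue ⟨by linarith, huR⟩
    have h3 := B.le_f1 F ve ⟨hvR, by linarith⟩
    have h4 : 0 ≤ c * ve ^ 2 / 2 := by positivity
    have h5 : K * (c * (θ / 2 * ue)) * ue ≤ K * -f2 ve * (ue - ve) := by
      have : 0 ≤ ue - ve := by linarith
      have h6 : c * (θ / 2 * ue) ≤ -f2 ve := by
        have : c * (θ / 2 * ue) ≤ c * -ve := by gcongr
        linarith
      have h10 : 0 ≤ K * -f2 ve := mul_nonneg hK0.le (le_trans (by positivity) h6)
      gcongr
      linarith
    have h7 := B.mul_theta_le hθ hθ1 hK 1 (by norm_num)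
    have h8 : 3000 * C * ue ^ 2 ≤ K * (c * θ ^ 1) * ue ^ 2 :=
      mul_le_mul_of_nonneg_right h7 (by positivity)
    have h9 : 0 ≤ C * ue ^ 2 := by positivity
    linarith

include F in
-- Along the motion both end slopes `f1 (u + e)` and `f1 (v - K e)` are at least `f1 x`, which is
-- the original chord speed.
theorem chordSpeed_le_move {θ K ε u v x : ℝ} (hθ : 0 < θ) (hK0 : 0 ≤ K) (hε : 0 ≤ ε)
    (h : ∀ e ∈ Icc 0 ε, Comparable f1 R θ (u + e) (v - K * e) (x + e))
    (h0 : f1 x = chordSpeed f u v) : chordSpeed f u v ≤ chordSpeed f (u + ε) (v - K * ε) := by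
  have hvd : ∀ e, HasDerivAt (fun e => v - K * e) (-K) e := fun e => by
    simpa using ((hasDerivAt_id e).const_mul K).const_sub v
  have hud : ∀ e, HasDerivAt (fun e => u + e) 1 e := fun e => (hasDerivAt_id e).const_add u
  have hm := monotoneOn_of_hasDerivAt_nonneg (convex_Icc 0 ε)
    (fun e _ => (((F.hasDerivAt (u + e)).comp e (hud e)).sub
      ((F.hasDerivAt (v - K * e)).comp e (hvd e))).sub
      (((hud e).sub (hvd e)).const_mul (chordSpeed f u v)))
    (fun e he => ?_) ⟨le_rfl, hε⟩ ⟨hε, le_rfl⟩ hε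
  · obtain ⟨hu, huR, hvR, hv1, hv2, hx1, hx2, hfx⟩ := h ε ⟨hε, le_rfl⟩
    obtain ⟨hu', -, -, hv1', -, -, -, -⟩ := h 0 ⟨le_rfl, hε⟩
    have hθu := mul_pos hθ hu
    have hθu' := mul_pos hθ hu'
    have h1 := chordSpeed_mul (f := f) (u := u) (w := v) (by linarith)
    rw [chordSpeed.eq_1 f (u + ε), le_div_iff₀ (by linarith)]
    simp at hm
    linarith
  · obtain ⟨hu, huR, hvR, hv1, hv2, hx1, hx2, hfx⟩ := h e he
    have hθu := mul_pos hθ hu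
    obtain ⟨hu', -, -, hv1', -, hx1', hx2', hfx'⟩ := h 0 ⟨le_rfl, hε.trans' le_rfl⟩
    have hθu' := mul_pos hθ hu'
    rw [add_zero] at hx1' hu' hθu' hx2' hfx'
    simp only [mul_zero, sub_zero, add_zero] at hfx' hv1'
    have h1 : f1 x ≤ f1 (u + e) := F.strictMonoOn1.monotoneOn (mem_Ici.mpr (by linarith))
      (mem_Ici.mpr hu.le) (by linarith [he.1])
    have h2 : f1 v ≤ f1 (v - K * e) := F.strictAntiOn1.antitoneOn (mem_Iic.mpr (by linarith))
      (mem_Iic.mpr (by linarith)) (by linarith [mul_nonneg hK0 he.1])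
    have h3 : f1 x * K ≤ f1 (v - K * e) * K := by gcongr; linarith
    rw [← h0]
    linarith

include F B in
theorem le_excess {u x s lam : ℝ} (hx : 0 < x) (huR : u ≤ R) (hlam : f1 x = lam)
    (hs : s ∈ Icc 0 (u - x)) : c * x * (u - x) / 2 * s ≤ excess f u lam (u - s) := by
  have hc := B.pos
  have hm := monotoneOn_of_hasDerivAt_nonneg (convex_Icc x u)
    (fun y _ => ((F.hasDerivAt y).sub ((hasDerivAt_id y).const_mul lam)).sub
      ((((hasDerivAt_id y).sub_const x).pow 2).const_mul (c * x / 2)))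
    (fun y hy => by
      have := B.le_f1_sub F hx.le hy.1 (hy.2.trans huR)
      have h1 : c * (2 * x * (y - x)) ≤ c * (y ^ 2 - x ^ 2) := by
        gcongr; linarith [sq_nonneg (y - x)]
      norm_num
      linarith)
    (a := u - s) (b := u) ⟨by linarith [hs.2], by linarith [hs.1]⟩
    ⟨by linarith [hs.1, hs.2], le_rfl⟩ (by linarith [hs.1])
  simp at hm
  have h2 : 0 ≤ c * x / 2 * (s * (u - x - s)) :=
    mul_nonneg (by positivity) (mul_nonneg hs.1 (by linarith [hs.2]))
  unfold excess
  linarith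

include F B in
theorem excess_shift_le {u s ε lam lam' : ℝ} (hε : 0 ≤ ε) (huR : u + ε ≤ R) (hs : 0 ≤ s)
    (hsu : s ≤ u) (hlam : lam ≤ lam') :
    excess f (u + ε) lam' (u + ε - s) ≤ excess f u lam (u - s) + 2 * C * u * ε * s + C * ε ^ 2 * s := by
  have hC := B.pos'
  have hm := antitoneOn_of_hasDerivAt_nonpos (convex_Icc 0 ε)
    (fun e _ => (((F.hasDerivAt (u + e)).comp_const_add u e).sub
      (((F.hasDerivAt (u - s + e)).comp_const_add (u - s) e))).sub
      ((((hasDerivAt_id e).const_mul (2 * C * u * s)).add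
        ((hasDerivAt_pow 2 e).const_mul (C * s)))))
    (fun e he => by
      have h1 := B.f1_sub_le F (x := u - s + e) (y := u + e) (by linarith [he.1]) (by linarith)
        (by linarith [he.2])
      have h2 : 0 ≤ C * s ^ 2 := by positivity
      have h3 : 0 ≤ C * s * u := mul_nonneg (by positivity) (by linarith)
      have h4 : 0 ≤ C * s * e := mul_nonneg (by positivity) he.1
      norm_num
      linarith) ⟨le_rfl, hε⟩ ⟨hε, le_rfl⟩ hε
  have h2 : lam * s ≤ lam' * s := by gcongr
  simp at hm
  unfold excess
  rw [show u + ε - s = u - s + ε by ring]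
  linarith

/-- The friction condition of `le_mul_rescale`. It amounts to `m ^ (1 - q) ≤ r`, which for `q ≤ 1`
follows from `m ≤ r ^ 2` and `2 * (1 - q) ≤ 1`; this is where `q ≥ 1/2` enters. -/
theorem le_mul_rpow_self {r m q : ℝ} (hq : 1 / 2 ≤ q) (hr1 : 1 ≤ r) (hrm : r ≤ m)
    (hm1 : m ≤ r ^ 2) : m ≤ r * m ^ q := by
  have hr0 : 0 < r := by linarith
  have hm0 : 0 < m := by linarith
  have h1 : m ^ (1 - q) ≤ r := by
    rcases le_total q 1 with h | h
    · calc m ^ (1 - q) ≤ (r ^ 2) ^ (1 - q) := Real.rpow_le_rpow hm0.le hm1 (by linarith)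
        _ = r ^ (2 * (1 - q)) := by
          rw [← Real.rpow_natCast_mul hr0.le]
          norm_num
        _ ≤ r ^ (1 : ℝ) := Real.rpow_le_rpow_of_exponent_le hr1 (by linarith)
        _ = r := Real.rpow_one r
    · exact (Real.rpow_le_one_of_one_le_of_nonpos (hr1.trans hrm) (by linarith)).trans hr1
  calc m = m ^ (1 - q) * m ^ q := by
        rw [← Real.rpow_add hm0]
        simp
    _ ≤ r * m ^ q := by gcongr

theorem excess_mul_sub {u v w : ℝ} (h : v < u) :
    excess f u (chordSpeed f u v) w * (u - v) =
      (w - v) * (f u - f v) - (u - v) * (f w - f v) := by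
  have e := chordSpeed_mul (f := f) (u := u) (w := v) h.ne'
  unfold excess
  linear_combination (w - u) * e

include F B in
theorem excess_stretch_le {θ K ε u v x t : ℝ} (hθ : 0 < θ) (hθ1 : θ ≤ 1)
    (hK : 12 * C ≤ K * (c * θ ^ 8)) (hε : 0 ≤ ε)
    (h : ∀ e ∈ Icc 0 ε, Comparable f1 R θ (u + e) (v - K * e) (x + e)) (ht : t ∈ Icc 0 (x - v))
    {r m : ℝ} (hr : r = (x - v + (K + 1) * ε) / (x - v)) (hr0 : 0 < r)
    (hl : 0 < x - v) (hvu : v < u) (hvu' : 0 < u - v + (K + 1) * ε)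
    (hm : m = r * (r * (u - v) / (u - v + (K + 1) * ε))) :
    r * excess f (u + ε) (chordSpeed f (u + ε) (v - K * ε)) (u + ε - (u - x + r * t)) ≤
      m * excess f u (chordSpeed f u v) (u - (u - x + t)) := by
  have hs := B.stretch_le F hθ hθ1 hK hε h (t := x - v - t)
    ⟨by linarith [ht.2], by linarith [ht.1]⟩
  have hrl : r * (x - v) = x - v + (K + 1) * ε := by rw [hr]; field_simp
  rw [← hr, show v - K * ε + r * (x - v - t) = u + ε - (u - x + r * t) by linear_combination hrl,
    show v + (x - v - t) = u - (u - x + t) by ring, ← hrl] at hs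
  have e1 := excess_mul_sub (f := f) (w := u - (u - x + t)) hvu
  have e2 := excess_mul_sub (f := f) (u := u + ε) (v := v - K * ε) (w := u + ε - (u - x + r * t))
    (by linarith)
  rw [show u - (u - x + t) - v = x - v - t by ring] at e1
  rw [show u + ε - (u - x + r * t) - (v - K * ε) = r * (x - v - t) by linear_combination -hrl] at e2
  rw [← e1] at hs
  set E' := excess f (u + ε) (chordSpeed f (u + ε) (v - K * ε)) (u + ε - (u - x + r * t))
  set E := excess f u (chordSpeed f u v) (u - (u - x + t))
  set D := f (u + ε - (u - x + r * t)) - f (v - K * ε)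
  set L' := u - v + (K + 1) * ε
  rw [show u + ε - (v - K * ε) = L' by ring] at e2
  have e3 : L' / (r * (x - v)) * (x - v) * D = L' * D / r := by field_simp
  rw [e3] at hs
  have h1 : E' * L' ≤ r * (E * (u - v)) := by
    rw [e2]
    have := mul_le_mul_of_nonneg_left hs hr0.le
    refine le_trans (le_of_eq ?_) this
    field_simp
  have h2 : m * E = r * (r * (E * (u - v)) / L') := by rw [hm]; ring
  rw [h2]
  gcongr
  rwa [le_div_iff₀ hvu']

include F B in
-- Between `x` and `u` the excess is nondecreasing in the distance from `u` and at least linear with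
-- slope of order `u ^ 2`. A shift by `ε` therefore changes it by a relative amount `ρ - 1` of order
-- `ε / u`.
theorem profile_move_le {α q θ K ε u v x ρ : ℝ} (hα : 0 < α) (hq : 1 / 2 ≤ q) (hθ : 0 < θ)
    (hε : 0 ≤ ε) (huR' : u + ε ≤ R) (hεu : ε ≤ u) (hlamle : chordSpeed f u v ≤
      chordSpeed f (u + ε) (v - K * ε)) (h' : Comparable f1 R θ u v x)
    (hx : f1 x = chordSpeed f u v) (hρ : ρ = 1 + 6 * C * ε / (c * θ ^ 2 * u)) :
    profile α q f (u + ε) (chordSpeed f (u + ε) (v - K * ε)) (u - x) ≤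
      ρ ^ 2 * profile α q f u (chordSpeed f u v) (u - x) := by
  have hC := B.pos'
  have hc := B.pos
  have hq0 : 0 < q := by linarith
  obtain ⟨hu, huR, hvR, hv1, hv2, hx1, hx2, hfx⟩ := h'
  have hθu : 0 < θ * u := mul_pos hθ hu
  have hx0 : 0 < x := by linarith
  set lam := chordSpeed f u v with hlam
  set lam' := chordSpeed f (u + ε) (v - K * ε) with hlam'
  have hy := F.isEnergyProfile hα.le hq0 u lam
  have hz := F.isEnergyProfile hα.le hq0 (u + ε) lam'
  have hρ0 : 0 ≤ 6 * C * ε / (c * θ ^ 2 * u) := by positivity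
  refine hy.le_sq_mul (S := u - x) hα.le hq (by linarith : 1 ≤ ρ) hz
    (F.continuous_excess_sub u lam) (by simp [excess_self])
    (monotoneOn_of_hasDerivAt_nonneg (convex_Icc _ _)
      (fun s _ => (F.hasDerivAt_excess u lam (u - s)).comp_const_sub u s) (fun s hs => ?_))
    (fun s hs => ?_) _ ⟨by linarith, le_rfl⟩
  · have := F.strictMonoOn1.monotoneOn (mem_Ici.mpr hx0.le)
      (mem_Ici.mpr (by linarith [hs.2] : 0 ≤ u - s)) (by linarith [hs.2])
    linarith
  · have h1 := B.le_excess F hx0 huR hx hs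
    have h2 := B.excess_shift_le F (s := s) hε huR' hs.1 (by linarith [hs.2]) hlamle
    have h3 : 3 * C * u * ε * s ≤ 6 * C * ε / (c * θ ^ 2 * u) * (c * x * (u - x) / 2 * s) := by
      have h4 : 6 * C * ε / (c * θ ^ 2 * u) * (c * (θ * u) * (θ * u) / 2 * s) =
          3 * C * u * ε * s := by field_simp; ring
      rw [← h4]
      have := hs.1
      have : θ * u ≤ u - x := by linarith
      gcongr
    have h5 : C * ε ^ 2 * s ≤ C * u * ε * s := by
      have : C * ε * s * ε ≤ C * ε * s * u :=
        mul_le_mul_of_nonneg_left hεu (mul_nonneg (by positivity) hs.1)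
      linarith
    have h6 := mul_le_mul_of_nonneg_left h1 hρ0
    rw [hρ]
    linarith

include B in
-- The stretch `r - 1 = (K + 1) * ε / l` dominates the relative error of order `ε / u` because `l`
-- is at most of order `u` and `K` is large.
theorem sq_le_stretch {θ K ε u l r : ℝ} (hθ : 0 < θ) (hθ1 : θ ≤ 1)
    (hK : 12 * C ≤ K * (c * (θ / 2) ^ 8)) (hε : 0 ≤ ε) (hKε : K * ε ≤ u) (hu : 0 < u)
    (hl0 : 0 < l) (h3 : θ * l ≤ 2 * u) (hr : r = (l + (K + 1) * ε) / l) :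
    (1 + 6 * C * ε / (c * θ ^ 2 * u)) ^ 2 ≤ r := by
  have hC := B.pos'
  have hc := B.pos
  have hKb := B.mul_theta_le hθ hθ1 hK
  have hρ0 : 0 ≤ 6 * C * ε / (c * θ ^ 2 * u) := by positivity
  have hρ1 : 6 * C * ε / (c * θ ^ 2 * u) ≤ 1 := by
    rw [div_le_one (by positivity)]
    have h1 := hKb 2 (by norm_num)
    have h2 : 3000 * C * ε ≤ K * (c * θ ^ 2) * ε := mul_le_mul_of_nonneg_right h1 hε
    have h3 : (c * θ ^ 2) * (K * ε) ≤ (c * θ ^ 2) * u := by gcongr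
    have h4 : 0 ≤ C * ε := by positivity
    linarith
  have h1 : (1 + 6 * C * ε / (c * θ ^ 2 * u)) ^ 2 ≤ 1 + 3 * (6 * C * ε / (c * θ ^ 2 * u)) := by
    nlinarith
  refine h1.trans ?_
  have h2 : r = 1 + (K + 1) * ε / l := by rw [hr]; field_simp
  rw [h2]
  gcongr
  rw [← mul_div_assoc, div_le_div_iff₀ (by positivity) hl0]
  have h4 := mul_le_mul_of_nonneg_right (hKb 3 (by norm_num)) (mul_nonneg hε hu.le)
  have h5 : θ * (18 * C * ε * l) ≤ θ * (K * ε * (c * θ ^ 2 * u)) := by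
    have h6 : 18 * C * ε * (θ * l) ≤ 18 * C * ε * (2 * u) := by gcongr
    have h7 : 0 ≤ C * ε * u := by positivity
    linarith
  have h8 := le_of_mul_le_mul_left h5 hθ
  have h9 : 0 ≤ ε * (c * θ ^ 2 * u) := by positivity
  linarith

include B in
theorem le_stretch_constant {θ K : ℝ} (hθ : 0 < θ) (hθ1 : θ ≤ 1)
    (hK : 12 * C ≤ K * (c * (θ / 2) ^ 8)) : 3000 ≤ K := by
  have hC := B.pos'
  have hc := B.pos
  have hKC : 3000 * C ≤ K * c := by simpa using B.mul_theta_le hθ hθ1 hK 0 (by norm_num)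
  by_contra! hlt
  have : K * c < 3000 * c := by gcongr
  linarith [B.le]

include F B in
/-- Moving `u` to the right by `ε` and `v` to the left by `K ε` does not create arrival energy. -/
theorem arrivalEnergy_move_nonpos {α q θ K ε u v x : ℝ} (hα : 0 < α) (hq : 1 / 2 ≤ q) (hθ : 0 < θ)
    (hθ1 : θ ≤ 1) (hK : 12 * C ≤ K * (c * (θ / 2) ^ 8)) (hε : 0 ≤ ε) (hKε : K * ε ≤ u)
    (h : ∀ e ∈ Icc 0 ε, Comparable f1 R (θ / 2) (u + e) (v - K * e) (x + e))
    (h' : Comparable f1 R θ u v x)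
    (hx : f1 x = chordSpeed f u v) (hv : 0 ≤ profile α q f u (chordSpeed f u v) (u - x))
    (h0 : arrivalEnergy α q f u v = 0) : arrivalEnergy α q f (u + ε) (v - K * ε) ≤ 0 := by
  have hq0 : 0 < q := by linarith
  have hK3 := B.le_stretch_constant hθ hθ1 hK
  have hK0 : 0 < K := by linarith
  have hlamle := chordSpeed_le_move F (by positivity) hK0.le hε h hx
  have huR' : u + ε ≤ R := (h ε ⟨hε, le_rfl⟩).le
  have hu := h'.pos
  have hθu : 0 < θ * u := mul_pos hθ hu
  have hx0 : 0 < x := by linarith [h'.le_mid]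
  have hv0 : v < 0 := by linarith [h'.le_neg]
  have hxu := h'.mid_le
  have hεu : ε ≤ u := by nlinarith
  have hright := B.profile_move_le F hα hq hθ hε huR' hεu hlamle h' hx rfl
  have hl0 : 0 < x - v := by linarith
  have hKε0 : 0 ≤ (K + 1) * ε := by positivity
  have hrρ := B.sq_le_stretch (l := x - v) hθ hθ1 hK hε hKε hu hl0
    (by nlinarith [h'.neg_le]) rfl
  obtain ⟨r, hr⟩ : ∃ r, r = (x - v + (K + 1) * ε) / (x - v) := ⟨_, rfl⟩
  rw [← hr] at hrρ
  have hrl : r * (x - v) = x - v + (K + 1) * ε := by rw [hr]; field_simp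
  have hL'0 : 0 < u - v + (K + 1) * ε := by linarith
  have hr1 : 1 ≤ r := by rw [hr, le_div_iff₀ hl0]; linarith
  have hr0 : 0 < r := by linarith
  have hrL : 1 ≤ r * (u - v) / (u - v + (K + 1) * ε) := by
    rw [le_div_iff₀ hL'0, hr, div_mul_eq_mul_div, le_div_iff₀ hl0]
    have : (K + 1) * ε * (x - v) ≤ (K + 1) * ε * (u - v) := by gcongr; linarith
    linarith
  have hm1 : r * (r * (u - v) / (u - v + (K + 1) * ε)) ≤ r ^ 2 := by
    have h1 : (u - v) / (u - v + (K + 1) * ε) ≤ 1 := by rw [div_le_one hL'0]; linarith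
    calc r * (r * (u - v) / (u - v + (K + 1) * ε)) =
        r ^ 2 * ((u - v) / (u - v + (K + 1) * ε)) := by ring
      _ ≤ r ^ 2 * 1 := by gcongr
      _ = _ := mul_one _
  -- This energy factor combines the stretch of distance with the change of chord length in the
  -- stretching inequality; it lies between `r` and `r ^ 2`.
  obtain ⟨m, hm⟩ : ∃ m, m = r * (r * (u - v) / (u - v + (K + 1) * ε)) := ⟨_, rfl⟩
  rw [← hm] at hm1
  have hrm : r ≤ m := hm ▸ le_mul_of_one_le_right hr0.le hrL
  have hm0 : 0 < m := by linarith
  have hmr := le_mul_rpow_self hq hr1 hrm hm1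
  -- The estimate from `u` to `x` supplies the initial ordering, and the stretched comparison
  -- carries it from `x` to `v`.
  have hleft := (F.isEnergyProfile hα.le hq0 u (chordSpeed f u v)).le_mul_rescale
    (S := u - x) (S' := u - x) (r := r) (m := m) (l := x - v) hα.le hq0.le
    hr0 hm0.le (by linarith) (by linarith)
    (F.isEnergyProfile hα.le hq0 (u + ε) (chordSpeed f (u + ε) (v - K * ε)))
    (mul_le_mul_of_nonneg_left hmr hα.le)
    (hright.trans (mul_le_mul_of_nonneg_right (hrρ.trans hrm) hv))
    (fun t ht => B.excess_stretch_le F (half_pos hθ) (by linarith) hK hε h ht hr hr0 hl0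
      (by linarith) hL'0 hm)
  have hend := hleft (x - v) ⟨hl0.le, le_rfl⟩
  rw [hrl, show u - x + (x - v) = u - v by ring,
    show u - x + (x - v + (K + 1) * ε) = u + ε - (v - K * ε) by ring] at hend
  refine hend.trans_eq ?_
  have : profile α q f u (chordSpeed f u v) (u - v) = arrivalEnergy α q f u v := rfl
  rw [this, h0, mul_zero]

end CubicBounds

end KineticRelation

/-! ### Lipschitz continuity of the kinetic state. -/

namespace KineticRelation

variable {f f1 f2 : ℝ → ℝ} {R c C : ℝ}

/-- The state `x` is where the excess is maximal. It is kept away from zero because the chord speed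
is at least the slope at the tangent state, and away from `u` by the quantitative compressivity in
`le_mul_sub_chordSpeed`. -/
theorem CubicBounds.exists_comparable (F : Flux f f1 f2) (B : CubicBounds f2 R c C) {u v : ℝ}
    (hu : 0 < u) (huR : u ≤ R) (hvR : -R ≤ v) (hv : zeroState f f1 u ≤ v)
    (hvt : v ≤ tangentState f f1 u) :
    ∃ x, f1 x = chordSpeed f u v ∧ Comparable f1 R ((c / (6 * C)) ^ 2) u v x := by
  have hC := B.pos'
  have hc := B.pos
  have hv0 : v < 0 := hvt.trans_lt (F.tangentState_neg hu)
  have hvu : v < u := hv0.trans hu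
  have ht0 := F.tangentState_neg hu
  obtain ⟨η, hη⟩ : ∃ η, η = c / (6 * C) := ⟨_, rfl⟩
  rw [← hη]
  have hη0 : 0 < η := by rw [hη]; positivity
  have hη1 : η ≤ 1 / 6 := by
    rw [hη, div_le_div_iff₀ (by positivity) (by norm_num)]; linarith [B.le]
  have hηC : 6 * C * η = c := by rw [hη]; field_simp
  have hη2 : η ^ 2 ≤ η := by nlinarith
  have h1 : η * u ≤ -v := hη ▸ B.mul_le_neg F hu huR hvR hvt
  have h1t : η * u ≤ -tangentState f f1 u :=
    hη ▸ B.mul_le_neg F hu huR (hvR.trans hvt) le_rfl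
  have hlt := F.chordSpeed_lt_of_zeroState_le hu hv hvu
  have h2 : η * -v ≤ u := by
    have h3 := B.neg_le_mul F hu huR hvR hv0.le hlt
    rw [div_mul_eq_mul_div, le_div_iff₀ hc, ← hηC] at h3
    have h4 : (6 * C) * (η * -v) ≤ (6 * C) * u := by linarith
    exact le_of_mul_le_mul_left h4 (by positivity)
  have hge := F.chordSpeed_tangentState_le hu hvu
  rw [← F.deriv_tangentState_eq hu] at hge
  have h5 : f1 0 < f1 (tangentState f f1 u) := F.f1_zero_lt ht0.ne
  obtain ⟨x, hx, hfx⟩ := intermediate_value_Icc hu.le F.continuous1.continuousOn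
    (show chordSpeed f u v ∈ Icc (f1 0) (f1 u) from ⟨by linarith, hlt.le⟩)
  have h6 := B.f1_le F x ⟨by linarith [hx.1], hx.2.trans huR⟩
  have h7 := B.le_f1 F (tangentState f f1 u) ⟨hvR.trans hvt, by linarith⟩
  have hmid : η ^ 2 * u ≤ x := by
    by_contra! hlt
    have h8 : x ^ 2 < (η ^ 2 * u) ^ 2 := pow_lt_pow_left₀ hlt hx.1 (by norm_num)
    have h9 : (η * u) ^ 2 ≤ (tangentState f f1 u) ^ 2 := by
      rw [← neg_sq (tangentState f f1 u)]
      exact pow_le_pow_left₀ (by positivity) h1t 2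
    have h10 : c * (η * u) ^ 2 ≤ c * (tangentState f f1 u) ^ 2 := by gcongr
    have h11 : C * x ^ 2 < C * (η ^ 2 * u) ^ 2 := by gcongr
    have h12 : C * (η ^ 2 * u) ^ 2 ≤ 6 * C * η * (η * u) ^ 2 := by
      have : (C * η * (η * u) ^ 2) * η ≤ (C * η * (η * u) ^ 2) * 6 := by gcongr; linarith
      linarith
    rw [hηC] at h12
    linarith
  have hmid2 : x + η ^ 2 * u ≤ u := by
    have h8 := F.le_mul_sub_chordSpeed hu huR hv0.le hvR (F.chordArea_nonneg hu hv hvu) hc.le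
      (fun y hy => (B.bound y hy).1)
    rw [← hfx] at h8
    have h9 := B.f1_sub_le F hx.1 hx.2 huR
    have h10 : C * (u ^ 2 - x ^ 2) / 2 ≤ C * (u * (u - x)) := by
      have : C * (u ^ 2 - x ^ 2) ≤ C * (2 * (u * (u - x))) := by
        gcongr; linarith [sq_nonneg (u - x)]
      linarith
    have h11 : u * (u - v) * (f1 u - f1 x) ≤ u * (u - v) * (C * (u * (u - x))) := by
      have : 0 ≤ u - v := by linarith
      gcongr
      linarith
    have h12 : η * (u - v) ≤ 2 * -v := by nlinarith
    by_contra! hlt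
    have h13 : u * (u - v) * (C * (u * (u - x))) < u * (u - v) * (C * (u * (η ^ 2 * u))) := by
      have : 0 < u - v := by linarith
      gcongr
      linarith
    have h14 : u * (u - v) * (C * (u * (η ^ 2 * u))) ≤ c * (-v) * u ^ 3 / 3 := by
      calc u * (u - v) * (C * (u * (η ^ 2 * u))) = C * u ^ 3 * η * (η * (u - v)) := by ring
        _ ≤ C * u ^ 3 * η * (2 * -v) := by gcongr
        _ = _ := by rw [← hηC]; ring
    linarith
  exact ⟨x, hfx, hu, huR, hvR, by nlinarith, by nlinarith, hmid, hmid2, by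
    have := F.tangentGap_tangentState hu
    rw [hfx]
    have h := chordSpeed_mul (f := f) hvu.ne'
    have hT : 0 ≤ tangentGap f f1 v u := by
      rcases eq_or_lt_of_le hvt with h | h
      · rw [h, F.tangentGap_tangentState hu]
      · exact (F.tangentGap_pos_of_lt hu h).le
    unfold tangentGap at hT
    refine le_of_mul_le_mul_right ?_ (by linarith : 0 < u - v)
    linarith⟩

namespace Flux

variable (F : Flux f f1 f2) {α q : ℝ}
include F

/-- The zero dissipation state is monotone, so its value at `R` bounds all others; the margin `R`
leaves room for moving the right state. -/
theorem exists_zeroState_bound {R : ℝ} (hR : 0 < R) :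
    ∃ R', R ≤ R' ∧ ∀ u, 0 < u → u ≤ R → -R' + R ≤ zeroState f f1 u := by
  refine ⟨R - zeroState f f1 R, ?_, fun u hu huR => ?_⟩
  · linarith [F.zeroState_lt hR, F.tangentState_neg hR]
  · rcases eq_or_lt_of_le huR with h | h
    · rw [h]; linarith
    · linarith [F.zeroState_anti hu h]

theorem exists_kineticState_lipschitz (hα : 0 < α) (hq : 1 / 2 ≤ q) {R : ℝ} (hR : 0 < R) :
    ∃ K, 0 ≤ K ∧ ∀ u u', 0 < u → u ≤ u' → u' ≤ R →
      |kineticState α q f f1 u' - kineticState α q f f1 u| ≤ K * (u' - u) := by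
  obtain ⟨R', hR', hz⟩ := F.exists_zeroState_bound hR
  obtain ⟨c, C, B⟩ := F.exists_cubicBounds R'
  have hC := B.pos'
  have hc := B.pos
  have hq0 : 0 < q := by linarith
  set θ := (c / (6 * C)) ^ 2 with hθ
  have hθ0 : 0 < θ := by positivity
  have hθ1 : θ ≤ 1 := pow_le_one₀ (by positivity) (by
    rw [div_le_one (by positivity)]; linarith [B.le])
  -- The constant of the stretching inequality for `θ / 2`, as comparability may lose a factor two
  -- along the move.
  set K := 12 * C / (c * (θ / 2) ^ 8) with hKdef
  have hK : 12 * C ≤ K * (c * (θ / 2) ^ 8) := by rw [hKdef]; field_simp; exact le_rfl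
  have hK3 := B.le_stretch_constant hθ0 hθ1 hK
  refine ⟨K, by positivity, fun u u' hu huu hu'R => ?_⟩
  -- Relative steps `1 / K` guarantee `K * ε ≤ u`.
  refine abs_sub_le_of_short_steps (c := 1 / K) (by positivity) (fun w hw ε hε hεu huR => ?_)
    hu huu hu'R
  replace hu := hu.trans_le hw
  clear hw huu
  generalize w = u at *
  have hKε : K * ε ≤ u := by
    rw [div_mul_eq_mul_div, one_mul, le_div_iff₀ (by linarith)] at hεu
    linarith
  have hεu' : ε ≤ u := by nlinarith
  obtain ⟨h1, h2, h3⟩ := F.kineticState_spec hα hq0 hu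
  have hz' := hz u hu (by linarith)
  set v := kineticState α q f f1 u with hv
  obtain ⟨x, hx, hcomp⟩ := B.exists_comparable F hu (by linarith) (by linarith) h1.le h2
  have hmove : ∀ e ∈ Icc 0 ε, Comparable f1 R' (θ / 2) (u + e) (v - K * e) (x + e) := by
    intro e he
    have : K * e ≤ K * ε := by gcongr; exact he.2
    exact B.comparable_move F hθ0 hθ1 hK hcomp he.1 (by linarith [he.2]) (by linarith)
      (by linarith [he.2]) (by linarith)
  have hT : 0 ≤ tangentGap f f1 v u := by
    rcases eq_or_lt_of_le h2 with h | h
    · rw [h, F.tangentGap_tangentState hu]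
    · exact (F.tangentGap_pos_of_lt hu h).le
  have h4 := F.le_tangentState_of_tangentGap_nonneg (by linarith : 0 < u + ε)
    (by
      have := mul_nonneg (by linarith : 0 ≤ K) hε.le
      exact (by linarith [F.kineticState_neg hα hq0 hu] : v - K * ε < u + ε).ne)
    (B.tangentGap_move_nonneg F hθ0 hθ1 hK hε.le hmove hT)
  have hx0 : 0 < x := lt_of_lt_of_le (mul_pos hθ0 hu) hcomp.le_mid
  have hxu : x < u := by linarith [hcomp.mid_le, mul_pos hθ0 hu]
  have h5 := B.arrivalEnergy_move_nonpos F hα hq hθ0 hθ1 hK hε.le hKε hmove hcomp hx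
    (F.profile_nonneg hα.le hq0 (w₁ := x) (fun w hw => by
      rw [← hx]
      exact (F.strictMonoOn1.monotoneOn (mem_Ici.mpr hx0.le) (mem_Ici.mpr (hx0.le.trans hw.1))
        hw.1).trans (F.lt_chordSpeed_lt (hx0.le.trans hw.1) hw.2).1.le) ⟨le_rfl, hxu.le⟩) h3
  have h6 := F.le_kineticState hα hq0 (by linarith : 0 < u + ε) h4 h5
  -- Strict monotonicity gives the other side of the bound.
  have h7 := F.kineticState_strictAnti hα hq hu (by linarith : u < u + ε)
  rw [abs_of_neg (by linarith)]
  linarith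

/-- The kinetic state is at most comparable with `u`. -/
theorem exists_neg_kineticState_le (hα : 0 < α) (hq : 1 / 2 ≤ q) {R : ℝ} (hR : 0 < R) :
    ∃ K, 0 ≤ K ∧ ∀ u, 0 < u → u ≤ R → -kineticState α q f f1 u ≤ K * u := by
  obtain ⟨R', hR', hz⟩ := F.exists_zeroState_bound hR
  obtain ⟨c, C, B⟩ := F.exists_cubicBounds R'
  have hC := B.pos'
  have hc := B.pos
  have hq0 : 0 < q := by linarith
  refine ⟨6 * C / c, by positivity, fun u hu huR => ?_⟩
  have h1 := F.kineticState_spec hα hq0 hu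
  exact B.neg_le_mul F hu (by linarith) (by linarith [hz u hu huR])
    (F.kineticState_neg hα hq0 hu).le
    (F.chordSpeed_lt_of_zeroState_le hu h1.1.le (F.kineticState_lt hα hq0 hu))

end Flux

end KineticRelation

/-! ### The diffusion threshold and its size. -/

namespace KineticRelation

/-- A function with bounded second derivative that vanishes to second order at `0`, and at `1`. -/
theorem le_of_second_deriv_le {D D1 D2 : ℝ → ℝ} {M : ℝ}
    (h1 : ∀ x ∈ Icc (0 : ℝ) 1, HasDerivAt D (D1 x) x)
    (h2 : ∀ x ∈ Icc (0 : ℝ) 1, HasDerivAt D1 (D2 x) x) (hM : ∀ x ∈ Icc (0 : ℝ) 1, |D2 x| ≤ M)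
    (hD0 : D 0 = 0) (hD1 : D 1 = 0) (hD10 : D1 0 = 0) {x : ℝ} (hx : x ∈ Icc (0 : ℝ) 1) :
    D x ≤ 4 * M * x ^ 2 * (1 - x) := by
  have hM0 : 0 ≤ M := (abs_nonneg _).trans (hM 0 ⟨le_rfl, zero_le_one⟩)
  have hup : ∀ y ∈ Icc (0 : ℝ) 1, D1 y ≤ M * y := by
    intro y hy
    have := antitoneOn_of_hasDerivAt_nonpos (convex_Icc (0 : ℝ) 1)
      (fun z hz => (h2 z hz).sub ((hasDerivAt_id z).const_mul M))
      (fun z hz => by linarith [(abs_le.mp (hM z hz)).2]) ⟨le_rfl, zero_le_one⟩ hy hy.1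
    simp [hD10] at this
    linarith
  have hlow : ∀ y ∈ Icc (0 : ℝ) 1, -(M * y) ≤ D1 y := by
    intro y hy
    have := monotoneOn_of_hasDerivAt_nonneg (convex_Icc (0 : ℝ) 1)
      (fun z hz => (h2 z hz).add ((hasDerivAt_id z).const_mul M))
      (fun z hz => by linarith [(abs_le.mp (hM z hz)).1]) ⟨le_rfl, zero_le_one⟩ hy hy.1
    simp [hD10] at this
    linarith
  have hD : D x ≤ M * x ^ 2 / 2 := by
    have := antitoneOn_of_hasDerivAt_nonpos (convex_Icc (0 : ℝ) 1)
      (fun z hz => (h1 z hz).sub ((hasDerivAt_pow 2 z).const_mul (M / 2)))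
      (fun z hz => by norm_num; linarith [hup z hz]) ⟨le_rfl, zero_le_one⟩ hx hx.1
    simp [hD0] at this
    linarith
  have hD' : D x ≤ M * (1 - x) := by
    have := monotoneOn_of_hasDerivAt_nonneg (convex_Icc (0 : ℝ) 1)
      (fun z hz => (h1 z hz).add ((hasDerivAt_id z).const_mul M))
      (fun z hz => by
        have : M * z ≤ M * 1 := mul_le_mul_of_nonneg_left hz.2 hM0
        linarith [hlow z hz]) hx ⟨zero_le_one, le_rfl⟩ hx.2
    simp [hD1] at this
    linarith
  have h0 := hx.1
  have h3 : 0 ≤ 1 - x := by linarith [hx.2]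
  -- The quadratic bound from the left end is used near `0`, the linear bound from the right end
  -- near `1`.
  rcases le_total x (1 / 2) with h | h
  · refine hD.trans ?_
    have : M * x ^ 2 * (1 / 8) ≤ M * x ^ 2 * (1 - x) := by gcongr; linarith
    linarith
  · refine hD'.trans ?_
    have : M * (1 - x) * (1 / 4) ≤ M * (1 - x) * x ^ 2 := by gcongr; nlinarith
    linarith

open Classical in
/-- The diffusion threshold above which the shock to the tangent state has a profile. -/
noncomputable def threshold (q : ℝ) (f f1 : ℝ → ℝ) (u : ℝ) : ℝ :=
  sInf {α | 0 < α ∧ arrivalEnergy α q f u (tangentState f f1 u) ≤ 0}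

theorem threshold_nonneg (q : ℝ) (f f1 : ℝ → ℝ) (u : ℝ) : 0 ≤ threshold q f f1 u :=
  Real.sInf_nonneg fun _ h => h.1.le

theorem threshold_le {q u α : ℝ} {f f1 : ℝ → ℝ} (hα : 0 < α)
    (h : arrivalEnergy α q f u (tangentState f f1 u) ≤ 0) : threshold q f f1 u ≤ α :=
  csInf_le ⟨0, fun _ h => h.1.le⟩ ⟨hα, h⟩

theorem CubicBounds.abs_f2_le {f2 : ℝ → ℝ} {R c C : ℝ} (B : CubicBounds f2 R c C) (h0 : f2 0 = 0)
    {x M : ℝ} (hx : x ∈ Icc (-R) R) (hM : |x| ≤ M) : |f2 x| ≤ C * M := by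
  have hC := B.pos'
  have hc := B.pos
  refine le_trans ?_ (mul_le_mul_of_nonneg_left hM hC.le)
  rcases lt_trichotomy x 0 with h | rfl | h
  · rw [abs_of_neg h, abs_of_neg ((B.f2_le_of_neg h hx.1).trans_lt (mul_neg_of_pos_of_neg hc h))]
    linarith [B.le_f2_of_neg h hx.1]
  · simp [h0]
  · rw [abs_of_pos h, abs_of_pos (lt_of_lt_of_le (mul_pos hc h) (B.le_f2 h hx.2))]
    exact B.f2_le h hx.2

theorem Flux.f2_zero {f f1 f2 : ℝ → ℝ} (F : Flux f f1 f2) : f2 0 = 0 := by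
  obtain ⟨K, hK, h⟩ := F.lipschitz 1
  have hle : f2 0 ≤ 0 := by
    by_contra! hlt
    set e := min 1 (f2 0 / (K + 1)) with he
    have he0 : 0 < e := lt_min one_pos (by positivity)
    have h1 := (abs_le.mp (h 0 ⟨by norm_num, by norm_num⟩ (-e) ⟨by linarith [min_le_left 1 (f2 0 / (K + 1))], by linarith⟩)).2
    have h2 := F.f2_neg (x := -e) (by linarith)
    rw [sub_neg_eq_add, zero_add, abs_of_pos he0] at h1
    have h3 : (K + 1) * e ≤ f2 0 := by
      have := min_le_right 1 (f2 0 / (K + 1))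
      rw [← he, le_div_iff₀ (by linarith)] at this
      linarith
    linarith
  have hge : 0 ≤ f2 0 := by
    by_contra! hlt
    set e := min 1 (-f2 0 / (K + 1)) with he
    have he0 : 0 < e := lt_min one_pos (div_pos (by linarith) (by linarith))
    have h1 := (abs_le.mp (h 0 ⟨by norm_num, by norm_num⟩ e ⟨by linarith, by linarith [min_le_left 1 (-f2 0 / (K + 1))]⟩)).1
    have h2 := F.f2_pos (x := e) he0
    rw [zero_sub, abs_neg, abs_of_pos he0] at h1
    have h3 : (K + 1) * e ≤ -f2 0 := by
      have := min_le_right 1 (-f2 0 / (K + 1))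
      rw [← he, le_div_iff₀ (by linarith)] at this
      linarith
    linarith
  exact le_antisymm hle hge

namespace Flux

variable {f f1 f2 : ℝ → ℝ} (F : Flux f f1 f2) {α q : ℝ}
include F

/-- The same moving argument as for the kinetic state, but only the tangent gap has to be followed.
-/
theorem exists_tangentState_lipschitz {R : ℝ} (hR : 0 < R) :
    ∃ K, 0 ≤ K ∧ ∀ u u', 0 < u → u ≤ u' → u' ≤ R →
      |tangentState f f1 u' - tangentState f f1 u| ≤ K * (u' - u) := by
  obtain ⟨R', hR', hz⟩ := F.exists_zeroState_bound hR
  obtain ⟨c, C, B⟩ := F.exists_cubicBounds R'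
  have hC := B.pos'
  have hc := B.pos
  set θ := (c / (6 * C)) ^ 2 with hθ
  have hθ0 : 0 < θ := by positivity
  have hθ1 : θ ≤ 1 := pow_le_one₀ (by positivity) (by
    rw [div_le_one (by positivity)]; linarith [B.le])
  set K := 12 * C / (c * (θ / 2) ^ 8) with hKdef
  have hK : 12 * C ≤ K * (c * (θ / 2) ^ 8) := by rw [hKdef]; field_simp; exact le_rfl
  have hK3 := B.le_stretch_constant hθ0 hθ1 hK
  refine ⟨K, by positivity, fun u u' hu huu hu'R => ?_⟩
  refine abs_sub_le_of_short_steps (c := 1 / K) (by positivity) (fun w hw ε hε hεu huR => ?_)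
    hu huu hu'R
  replace hu := hu.trans_le hw
  clear hw huu
  generalize w = u at *
  have hKε : K * ε ≤ u := by
    rw [div_mul_eq_mul_div, one_mul, le_div_iff₀ (by linarith)] at hεu
    linarith
  have hεu' : ε ≤ u := by nlinarith
  have hz' := hz u hu (by linarith)
  have hzt := F.zeroState_lt hu
  set v := tangentState f f1 u with hv
  obtain ⟨x, hx, hcomp⟩ := B.exists_comparable F hu (by linarith) (by linarith) hzt.le le_rfl
  have hmove : ∀ e ∈ Icc 0 ε, Comparable f1 R' (θ / 2) (u + e) (v - K * e) (x + e) := by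
    intro e he
    have : K * e ≤ K * ε := by gcongr; exact he.2
    exact B.comparable_move F hθ0 hθ1 hK hcomp he.1 (by linarith [he.2]) (by linarith)
      (by linarith [he.2]) (by linarith)
  have h4 := F.le_tangentState_of_tangentGap_nonneg (by linarith : 0 < u + ε)
    (by
      have := mul_nonneg (by linarith : 0 ≤ K) hε.le
      exact (by linarith [F.tangentState_neg hu] : v - K * ε < u + ε).ne)
    (B.tangentGap_move_nonneg F hθ0 hθ1 hK hε.le hmove (F.tangentGap_tangentState hu).ge)
  have h7 := F.tangentState_strictAnti hu (by linarith : u < u + ε)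
  rw [abs_of_neg (by linarith)]
  linarith

/-- Sizes of the tangent states on a bounded interval. -/
theorem exists_tangentState_bounds {R : ℝ} (hR : 0 < R) :
    ∃ R' c C η κ, R ≤ R' ∧ CubicBounds f2 R' c C ∧ 0 < η ∧ η ≤ 1 ∧ 1 ≤ κ ∧ ∀ u, 0 < u → u ≤ R →
      -R' ≤ tangentState f f1 u ∧ η * u ≤ -tangentState f f1 u ∧
      -tangentState f f1 u ≤ κ * u := by
  obtain ⟨R', hR', hz⟩ := F.exists_zeroState_bound hR
  obtain ⟨c, C, B⟩ := F.exists_cubicBounds R'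
  have hC := B.pos'
  have hc := B.pos
  refine ⟨R', c, C, c / (6 * C), 6 * C / c, hR', B, by positivity, ?_, ?_, fun u hu huR => ?_⟩
  · rw [div_le_one (by positivity)]; linarith [B.le]
  · rw [le_div_iff₀ hc]; linarith [B.le]
  · have h1 := hz u hu huR
    have h2 := F.zeroState_lt hu
    exact ⟨by linarith, B.mul_le_neg F hu (by linarith) (by linarith) le_rfl,
      B.neg_le_mul F hu (by linarith) (by linarith) (F.tangentState_neg hu).le
        (F.chordSpeed_lt hu le_rfl (F.tangentState_lt hu))⟩

/-- The excess over the tangent chord vanishes to second order at the tangent state. -/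
theorem le_tangent_excess {R c C η u σ : ℝ} (B : CubicBounds f2 R c C) (hη : 0 < η) (hu : 0 < u)
    (ht : -R ≤ tangentState f f1 u) (hηt : η * u ≤ -tangentState f f1 u)
    (hσ : σ ∈ Icc (0 : ℝ) 1) :
    c * (η * u) ^ 3 / 4 * (σ ^ 2 * (1 - σ)) ≤
      excess f u (chordSpeed f u (tangentState f f1 u))
        (tangentState f f1 u + σ * (u - tangentState f f1 u)) := by
  have hc := B.pos
  rw [← F.deriv_tangentState_eq hu]
  have ht0 := F.tangentState_neg hu
  have hgap := F.tangentGap_tangentState hu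
  set t := tangentState f f1 u
  have hex0 : excess f u (f1 t) t = 0 := by unfold excess; unfold tangentGap at hgap; linarith
  have hηu : 0 < η * u := mul_pos hη hu
  have hconvex : ∀ w ∈ Icc t 0, c * (-t) * (w - t) ^ 2 / 4 ≤ excess f u (f1 t) w := by
    intro w hw
    have := monotoneOn_of_hasDerivAt_nonneg (convex_Icc t 0)
      (fun y _ => (F.hasDerivAt_excess u (f1 t) y).sub
        ((((hasDerivAt_id y).sub_const t).pow 2).const_mul (c * (-t) / 4)))
      (fun y hy => by
        have h1 := B.le_f1_sub_of_neg F ht hy.1 hy.2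
        have h2 : c * ((-t) * (y - t)) ≤ c * (t ^ 2 - y ^ 2) := by
          gcongr; nlinarith [hy.1, hy.2]
        norm_num
        linarith) ⟨le_rfl, ht0.le⟩ hw hw.1
    simp [hex0] at this
    linarith
  set w := t + σ * (u - t) with hw
  have hwt : t ≤ w := by rw [hw]; linarith [mul_nonneg hσ.1 (by linarith : 0 ≤ u - t)]
  rcases le_total w 0 with h0 | h0
  · refine le_trans ?_ (hconvex w ⟨hwt, h0⟩)
    have h1 : w - t = σ * (u - t) := by rw [hw]; ring
    rw [h1]
    have h2 : η * u ≤ u - t := by linarith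
    have h3 : 1 - σ ≤ 1 := by linarith [hσ.1]
    have h5 : (η * u) ^ 3 ≤ (-t) * (u - t) ^ 2 := by
      calc (η * u) ^ 3 = (η * u) * (η * u) ^ 2 := by ring
        _ ≤ _ := by gcongr; linarith
    have h4 : 0 ≤ 1 - σ := by linarith [hσ.2]
    calc c * (η * u) ^ 3 / 4 * (σ ^ 2 * (1 - σ)) ≤ c * ((-t) * (u - t) ^ 2) / 4 * (σ ^ 2 * 1) := by
          have : 0 ≤ (-t) * (u - t) ^ 2 := mul_nonneg (by linarith) (sq_nonneg _)
          gcongr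
      _ = _ := by ring
  · have h1 := hconvex 0 ⟨ht0.le, le_rfl⟩
    -- On the convex side of the graph the excess is concave, hence above the segment from its value
    -- at `0` to its zero at `u`.
    have hconc : ConcaveOn ℝ (Icc 0 u) (excess f u (f1 t)) := by
      refine AntitoneOn.concaveOn_of_deriv (convex_Icc 0 u)
        (F.continuous_excess u (f1 t)).continuousOn
        (fun y _ => (F.hasDerivAt_excess u (f1 t) y).differentiableAt.differentiableWithinAt) ?_
      rw [interior_Icc]
      intro a ha b hb hab
      rw [(F.hasDerivAt_excess u (f1 t) a).deriv, (F.hasDerivAt_excess u (f1 t) b).deriv]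
      have := F.strictMonoOn1.monotoneOn (mem_Ici.mpr ha.1.le) (mem_Ici.mpr hb.1.le) hab
      linarith
    have hwu : w ≤ u := by
      rw [hw]
      have := mul_le_mul_of_nonneg_right hσ.2 (by linarith : 0 ≤ u - t)
      linarith
    have h2 := hconc.2 (⟨le_rfl, hu.le⟩ : (0 : ℝ) ∈ Icc 0 u) (⟨hu.le, le_rfl⟩ : u ∈ Icc 0 u)
      (div_nonneg (by linarith) hu.le : 0 ≤ (u - w) / u) (div_nonneg h0 hu.le : 0 ≤ w / u)
      (by field_simp; ring)
    simp only [smul_eq_mul, mul_zero, zero_add, excess_self, add_zero] at h2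
    rw [div_mul_cancel₀ w hu.ne'] at h2
    refine le_trans ?_ h2
    have h3 : 1 - σ ≤ (u - w) / u := by
      rw [le_div_iff₀ hu, hw]
      have : 0 ≤ (1 - σ) * -t := mul_nonneg (by linarith [hσ.2]) (by linarith)
      linarith
    have h5 : c * (η * u) ^ 3 / 4 ≤ excess f u (f1 t) 0 := by
      refine le_trans ?_ h1
      have : (η * u) ^ 3 ≤ (-t) ^ 3 := by gcongr
      have := mul_le_mul_of_nonneg_left this hc.le
      linarith
    have h6 : σ ^ 2 ≤ 1 := pow_le_one₀ hσ.1 hσ.2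
    have h7 : 0 ≤ 1 - σ := by linarith [hσ.2]
    calc c * (η * u) ^ 3 / 4 * (σ ^ 2 * (1 - σ)) ≤ c * (η * u) ^ 3 / 4 * (1 * (1 - σ)) := by gcongr
      _ = (1 - σ) * (c * (η * u) ^ 3 / 4) := by ring
      _ ≤ _ := by gcongr

end Flux

end KineticRelation

namespace KineticRelation

namespace Flux

variable {f f1 f2 : ℝ → ℝ} (F : Flux f f1 f2) {α q : ℝ}
include F

/-- With `[tangentState, u]` scaled to `[0, 1]`, the difference of two excesses is at most of order
`u ^ 2 * |u' - u| * σ ^ 2 * (1 - σ)`, while each excess is at least of order `u ^ 3 * σ ^ 2 * (1 -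
σ)`. Their relative difference is thus of order `|u' - u| / u`. -/
theorem exists_tangent_excess_le {R : ℝ} (hR : 0 < R) :
    ∃ C₀, 2 ≤ C₀ ∧ ∀ u u' x, 0 < u → u ≤ R → 0 < u' → u' ≤ R → x * u = C₀ * |u' - u| → x ≤ 1 →
      u' - tangentState f f1 u' ≤ (1 + x) * (u - tangentState f f1 u) ∧
      u - tangentState f f1 u ≤ (1 + x) * (u' - tangentState f f1 u') ∧
      ∀ σ ∈ Icc (0 : ℝ) 1, excess f u' (chordSpeed f u' (tangentState f f1 u'))
        (tangentState f f1 u' + σ * (u' - tangentState f f1 u')) ≤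
        (1 + x) * excess f u (chordSpeed f u (tangentState f f1 u))
          (tangentState f f1 u + σ * (u - tangentState f f1 u)) := by
  obtain ⟨R', c, C, η, κ, hRR, B, hη, hη1, hκ, hb⟩ := F.exists_tangentState_bounds hR
  obtain ⟨K, hK, hKlip⟩ := F.exists_tangentState_lipschitz hR
  obtain ⟨K2, hK2, hlip2⟩ := F.lipschitz R'
  have hC := B.pos'
  have hc := B.pos
  set M₀ := 4 * κ ^ 2 * (K2 * (K + 1)) + 12 * κ ^ 2 * (C * (K + 1)) with hM₀
  have hM₀0 : 0 ≤ M₀ := by positivity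
  set c₁ := c * η ^ 3 / 4 with hc₁
  have hc₁0 : 0 < c₁ := by positivity
  refine ⟨4 * M₀ / c₁ + 2 * (K + 1), by have : 0 ≤ 4 * M₀ / c₁ := by positivity
                                        linarith, ?_⟩
  intro u u' x hu huR hu' hu'R hx hx1
  obtain ⟨d, hd⟩ : ∃ d, d = |u' - u| := ⟨_, rfl⟩
  have hd0 : 0 ≤ d := hd ▸ abs_nonneg _
  rw [← hd] at hx
  have hdiv : 0 ≤ 4 * M₀ / c₁ * d := by positivity
  have hx0 : 0 ≤ x := by
    refine nonneg_of_mul_nonneg_left ?_ hu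
    rw [hx]; positivity
  have hxu : x * u ≤ u := mul_le_of_le_one_left hu.le hx1
  have hKd : 2 * ((K + 1) * d) ≤ x * u := by rw [hx]; linarith
  have hKd0 : 0 ≤ K * d := by positivity
  have hdu : d ≤ u / 2 := by linarith
  have huu := abs_le.mp (hd ▸ le_rfl : |u' - u| ≤ d)
  obtain ⟨ht1, ht2, ht3⟩ := hb u hu huR
  obtain ⟨ht1', ht2', ht3'⟩ := hb u' hu' hu'R
  have hlam := F.deriv_tangentState_eq hu
  have hlam' := F.deriv_tangentState_eq hu'
  have hlow := fun σ hσ => F.le_tangent_excess (σ := σ) B hη hu ht1 ht2 hσ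
  have hex0 := excess_chordSpeed (f := f) (F.tangentState_lt hu).ne'
  have hex0' := excess_chordSpeed (f := f) (F.tangentState_lt hu').ne'
  have htt : |tangentState f f1 u' - tangentState f f1 u| ≤ K * d := by
    rw [hd]
    rcases le_total u u' with h | h
    · rw [abs_of_nonneg (by linarith : 0 ≤ u' - u)]
      exact hKlip u u' hu h hu'R
    · rw [abs_sub_comm, abs_of_nonpos (by linarith : u' - u ≤ 0), neg_sub]
      exact hKlip u' u hu' h huR
  rw [← hlam] at hlow hex0 ⊢
  rw [← hlam'] at hex0' ⊢
  have htneg := F.tangentState_neg hu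
  have htneg' := F.tangentState_neg hu'
  set t := tangentState f f1 u
  set t' := tangentState f f1 u'
  have htt' := abs_le.mp htt
  have hκu : 0 < κ * u := by positivity
  have hκu' : u ≤ κ * u := le_mul_of_one_le_left hu.le hκ
  have hκuu : κ * u' ≤ 2 * (κ * u) := by nlinarith
  have hLd : |(u - t) - (u' - t')| ≤ (K + 1) * d := abs_le.mpr ⟨by linarith, by linarith⟩
  refine ⟨?_, ?_, fun σ hσ => ?_⟩
  · have : x * u ≤ x * (u - t) := by gcongr; linarith
    linarith
  · have : x * u ≤ x * (2 * (u' - t')) := by gcongr; linarith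
    linarith
  have hw : ∀ σ ∈ Icc (0 : ℝ) 1, ∀ a b : ℝ, a ≤ b → a ≤ a + σ * (b - a) ∧ a + σ * (b - a) ≤ b := by
    intro σ hσ a b hab
    have h1 := mul_nonneg hσ.1 (by linarith : 0 ≤ b - a)
    have h2 := mul_le_mul_of_nonneg_right hσ.2 (by linarith : 0 ≤ b - a)
    exact ⟨by linarith, by linarith⟩
  have hwd : ∀ a L σ : ℝ, HasDerivAt (fun σ => a + σ * L) L σ := fun a L σ => by
    simpa using ((hasDerivAt_id σ).mul_const L).const_add a
  -- The difference vanishes to second order at `σ = 0` because both chords are tangent there, and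
  -- it vanishes at `σ = 1`.
  have hD := le_of_second_deriv_le (M := M₀ * u ^ 2 * d)
    (D := fun σ => excess f u' (f1 t') (t' + σ * (u' - t')) - excess f u (f1 t) (t + σ * (u - t)))
    (D1 := fun σ => (f1 t' - f1 (t' + σ * (u' - t'))) * (u' - t') -
      (f1 t - f1 (t + σ * (u - t))) * (u - t))
    (D2 := fun σ => -(f2 (t' + σ * (u' - t')) * (u' - t')) * (u' - t') -
      -(f2 (t + σ * (u - t)) * (u - t)) * (u - t))
    (fun σ _ => ((F.hasDerivAt_excess _ _ _).comp σ (hwd t' (u' - t') σ)).sub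
      ((F.hasDerivAt_excess _ _ _).comp σ (hwd t (u - t) σ)))
    (fun σ _ => ((((F.hasDerivAt1 _).comp σ (hwd t' (u' - t') σ)).const_sub _).mul_const _).sub
      ((((F.hasDerivAt1 _).comp σ (hwd t (u - t) σ)).const_sub _).mul_const _))
    (fun σ hσ => ?_) (by simp [hex0, hex0']) (by simp [excess_self]) (by simp) hσ
  · have h1 := hlow σ hσ
    have h2 : 4 * (M₀ * u ^ 2 * d) * σ ^ 2 * (1 - σ) ≤
        x * (c * (η * u) ^ 3 / 4 * (σ ^ 2 * (1 - σ))) := by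
      have h3 : 4 * (M₀ * u ^ 2 * d) = (4 * M₀ / c₁ * d) * (c₁ * u ^ 2) := by field_simp
      have h4 : (4 * M₀ / c₁ * d) * (c₁ * u ^ 2) ≤ x * u * (c₁ * u ^ 2) := by
        have : 0 ≤ (K + 1) * d := by linarith
        exact mul_le_mul_of_nonneg_right (by linarith) (by positivity)
      have h5 : 0 ≤ σ ^ 2 * (1 - σ) := mul_nonneg (sq_nonneg σ) (by linarith [hσ.2])
      have h6 := mul_le_mul_of_nonneg_right (h3.trans_le h4) h5
      rw [hc₁] at h6
      linarith
    have h3 := mul_le_mul_of_nonneg_left h1 hx0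
    linarith
  · obtain ⟨hw1, hw2⟩ := hw σ hσ t u (by linarith)
    obtain ⟨hw1', hw2'⟩ := hw σ hσ t' u' (by linarith)
    have hww : |(t + σ * (u - t)) - (t' + σ * (u' - t'))| ≤ (K + 1) * d := by
      have h1 : (t + σ * (u - t)) - (t' + σ * (u' - t')) = (1 - σ) * (t - t') + σ * (u - u') := by
        ring
      have h2 : (1 - σ) * |t - t'| ≤ 1 * (K * d) := by
        have : |t - t'| ≤ K * d := by rwa [abs_sub_comm]
        have := hσ.1
        gcongr
        linarith
      have h3 : σ * |u - u'| ≤ 1 * d := by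
        have : |u - u'| ≤ d := by rw [abs_sub_comm, hd]
        have := hσ.2
        gcongr
      rw [h1]
      refine (abs_add_le _ _).trans ?_
      rw [abs_mul, abs_mul, abs_of_nonneg hσ.1, abs_of_nonneg (by linarith [hσ.2] : 0 ≤ 1 - σ)]
      linarith
    set w := t + σ * (u - t)
    set w' := t' + σ * (u' - t')
    have hwR : w ∈ Icc (-R') R' := ⟨by linarith, by linarith⟩
    have hwR' : w' ∈ Icc (-R') R' := ⟨by linarith, by linarith⟩
    have h1 := hlip2 w hwR w' hwR'
    have h2 := B.abs_f2_le F.f2_zero hwR' (M := 2 * (κ * u)) (abs_le.mpr ⟨by linarith, by linarith⟩)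
    have e : -(f2 w' * (u' - t')) * (u' - t') - -(f2 w * (u - t)) * (u - t) =
        (u - t) ^ 2 * (f2 w - f2 w') +
          ((u - t) - (u' - t')) * ((u - t) + (u' - t')) * f2 w' := by ring
    rw [e]
    refine (abs_add_le _ _).trans ?_
    rw [abs_mul, abs_mul, abs_mul, abs_of_nonneg (sq_nonneg _),
      abs_of_pos (by linarith : 0 < u - t + (u' - t'))]
    have h3 : (u - t) ^ 2 * |f2 w - f2 w'| ≤ (2 * (κ * u)) ^ 2 * (K2 * ((K + 1) * d)) := by
      have h4 : 0 ≤ u - t := by linarith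
      have h5 : u - t ≤ 2 * (κ * u) := by linarith
      gcongr
      exact h1.trans (by gcongr)
    have h6 : |u - t - (u' - t')| * (u - t + (u' - t')) * |f2 w'| ≤
        (K + 1) * d * (6 * (κ * u)) * (C * (2 * (κ * u))) := by
      have h7 : u - t + (u' - t') ≤ 6 * (κ * u) := by linarith
      have h8 : 0 ≤ u - t + (u' - t') := by linarith
      gcongr
    rw [hM₀]
    linarith

/-- Distance is stretched by the ratio `r` of the interval lengths, energy by `m = r * (1 + x)` and
diffusion by `1 + x`. The friction condition reduces to `m ^ q ≥ 1`, which holds as `m ≥ 1`. -/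
theorem exists_threshold_step (hq : 0 < q) {R : ℝ} (hR : 0 < R) :
    ∃ C₀, 2 ≤ C₀ ∧ ∀ u u' x, 0 < u → u ≤ R → 0 < u' → u' ≤ R → x * u = C₀ * |u' - u| → x ≤ 1 →
      ∀ α, 0 < α → arrivalEnergy α q f u (tangentState f f1 u) ≤ 0 →
        arrivalEnergy (α * (1 + x)) q f u' (tangentState f f1 u') ≤ 0 := by
  obtain ⟨C₀, hC₀, h⟩ := F.exists_tangent_excess_le hR
  refine ⟨C₀, hC₀, fun u u' x hu huR hu' hu'R hx hx1 α hα hA => ?_⟩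
  obtain ⟨h1, h2, h3⟩ := h u u' x hu huR hu' hu'R hx hx1
  have hx0 : 0 ≤ x := by
    refine nonneg_of_mul_nonneg_left ?_ hu
    rw [hx]; positivity
  have hL := F.tangentState_lt hu
  have hL' := F.tangentState_lt hu'
  have ht := hL
  set t := tangentState f f1 u with htdef
  set t' := tangentState f f1 u' with htdef'
  have hL0 : 0 < u - t := by linarith
  obtain ⟨r, hr⟩ : ∃ r, r = (u' - t') / (u - t) := ⟨_, rfl⟩
  have hr0 : 0 < r := hr ▸ div_pos (by linarith) hL0
  have hrL : r * (u - t) = u' - t' := by rw [hr]; field_simp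
  have hm1 : 1 ≤ r * (1 + x) := by
    rw [hr, div_mul_eq_mul_div, le_div_iff₀ hL0]
    linarith
  have hβ : 0 < α * (1 + x) := by positivity
  have hleft := (F.isEnergyProfile hα.le hq u (chordSpeed f u t)).le_mul_rescale
    (S := 0) (S' := 0) (r := r) (m := r * (1 + x)) (l := u - t) hβ.le hq.le hr0 (by positivity)
    le_rfl le_rfl (F.isEnergyProfile hβ.le hq u' (chordSpeed f u' t'))
    (by
      have : 1 ≤ (r * (1 + x)) ^ q := Real.one_le_rpow hm1 hq.le
      have := mul_le_mul_of_nonneg_left this (by positivity : 0 ≤ α * (1 + x) * r)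
      linarith)
    (by rw [(F.isEnergyProfile hα.le hq u _).1, (F.isEnergyProfile hβ.le hq u' _).1, mul_zero])
    (fun s hs => by
      have h4 := h3 ((u - t - s) / (u - t)) ⟨div_nonneg (by linarith [hs.2]) hL0.le, by
        rw [div_le_one hL0]; linarith [hs.1]⟩
      have e1 : t + (u - t - s) / (u - t) * (u - t) = u - (0 + s) := by
        rw [div_mul_cancel₀ _ hL0.ne']; ring
      have e2 : t' + (u - t - s) / (u - t) * (u' - t') = u' - (0 + r * s) := by
        rw [hr]; field_simp; ring
      rw [e1, e2] at h4
      rw [mul_assoc]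
      exact mul_le_mul_of_nonneg_left h4 hr0.le)
    (u - t) ⟨hL0.le, le_rfl⟩
  rw [zero_add, zero_add, hrL] at hleft
  exact hleft.trans (mul_nonpos_of_nonneg_of_nonpos (by positivity) hA)

/-- With strong enough diffusion, the shock to the tangent state has a profile. -/
theorem exists_arrivalEnergy_nonpos (hq : 1 / 2 ≤ q) (hq2 : q ≤ 2 / 3) {R : ℝ} (hR : 0 < R) :
    ∃ C₀, 0 < C₀ ∧ ∀ u, 0 < u → u ≤ R →
      arrivalEnergy (C₀ * u ^ (3 - 4 * q)) q f u (tangentState f f1 u) ≤ 0 := by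
  obtain ⟨R', c, C, η, κ, hRR, B, hη, hη1, hκ, hb⟩ := F.exists_tangentState_bounds hR
  have hC := B.pos'
  have hc := B.pos
  have hq0 : 0 < q := by linarith
  set P := (2 * (2 * κ) ^ 3) ^ q with hP
  have hP0 : 0 < P := by positivity
  refine ⟨(2 * κ) ^ 2 * (3 + C * κ) / P, by positivity, fun u hu huR => ?_⟩
  obtain ⟨ht1, ht2, ht3⟩ := hb u hu huR
  set α := (2 * κ) ^ 2 * (3 + C * κ) / P * u ^ (3 - 4 * q) with hαdef
  have hα : 0 < α := by positivity
  have hlam := F.deriv_tangentState_eq hu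
  have hex0 := excess_chordSpeed (f := f) (F.tangentState_lt hu).ne'
  have htneg := F.tangentState_neg hu
  unfold arrivalEnergy
  rw [← hlam] at hex0 ⊢
  set t := tangentState f f1 u
  have hκu : u ≤ κ * u := le_mul_of_one_le_left hu.le hκ
  have hκ0 : 0 < κ := by linarith
  have hf1 : ∀ w ∈ Icc t u, f1 t - f1 w ≤ C * κ * u * (w - t) := by
    intro w hw
    have h1 := antitoneOn_of_hasDerivAt_nonpos (convex_Icc t u)
      (fun y _ => ((F.hasDerivAt1 y).const_sub (f1 t)).sub
        (((hasDerivAt_id y).sub_const t).const_mul (C * κ * u)))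
      (fun y hy => by
        have := B.abs_f2_le F.f2_zero (x := y) (M := κ * u) ⟨by linarith [hy.1], by linarith [hy.2]⟩
          (abs_le.mpr ⟨by linarith [hy.1], by linarith [hy.2]⟩)
        have := (abs_le.mp this).1
        linarith) ⟨le_rfl, by linarith⟩ hw hw.1
    simp at h1
    linarith
  have hex : ∀ w ∈ Icc t u, excess f u (f1 t) w ≤ C * κ * u * (w - t) ^ 2 := by
    intro w hw
    have h1 := antitoneOn_of_hasDerivAt_nonpos (convex_Icc t u)
      (fun y _ => (F.hasDerivAt_excess u (f1 t) y).sub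
        ((((hasDerivAt_id y).sub_const t).pow 2).const_mul (C * κ * u)))
      (fun y hy => by
        have h2 := hf1 y hy
        have h3 : 0 ≤ C * κ * u * (y - t) := mul_nonneg (by positivity) (by linarith [hy.1])
        norm_num
        linarith) ⟨le_rfl, by linarith⟩ hw hw.1
    simp [hex0] at h1
    linarith
  have hy := F.isEnergyProfile hα.le hq0 u (f1 t)
  -- The barrier is `u * τ ^ 3`, with `τ` the distance to the tangent state; it vanishes on arrival.
  have key := le_of_deriv_le_of_lt (a := 0) (b := u - t) (fun x hx => hy.2 x hx.1)
    (fun x _ => (((hasDerivAt_id x).const_sub (u - t)).pow 3).const_mul u)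
    (by
      rw [hy.1]
      have : 0 ≤ u - t := by linarith
      simp only [id_eq, sub_zero, Pi.pow_apply]
      positivity) (fun x hx hlt => ?_) (u - t) ⟨by linarith, le_rfl⟩
  · simpa using key
  · simp only [id_eq, Pi.pow_apply] at hlt
    have h1 := hex (u - x) ⟨by linarith [hx.2], by linarith [hx.1]⟩
    rw [show u - x - t = u - t - x by ring] at h1
    have hτ0 : 0 ≤ u - t - x := by linarith [hx.2]
    have hτ1 : u - t - x ≤ 2 * κ * u := by linarith [hx.1]
    set τ := u - t - x
    have h2 : α * damp q (u * τ ^ 3) ≤ α * damp q (profile α q f u (f1 t) x) :=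
      mul_le_mul_of_nonneg_left (damp_mono hq0.le hlt.le) hα.le
    set M := 2 * κ * u with hM
    have hM0 : 0 < M := by positivity
    -- The base is at most one and `3 * q ≤ 2`, so `(τ / M) ^ (3 * q) ≥ (τ / M) ^ 2`. This is the
    -- only place where `q ≤ 2/3` matters for the barrier.
    have h3 : (τ / M) ^ 2 * (2 * (u * M ^ 3)) ^ q ≤ damp q (u * τ ^ 3) := by
      rw [damp_of_nonneg (by positivity), show 2 * (u * τ ^ 3) = (τ / M) ^ 3 * (2 * (u * M ^ 3)) by
        field_simp, Real.mul_rpow (x := (τ / M) ^ 3) (by positivity) (by positivity)]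
      gcongr
      have h4 : τ / M ≤ 1 := by rwa [div_le_one hM0]
      rcases eq_or_lt_of_le (div_nonneg hτ0 hM0.le) with h5 | h5
      · rw [← h5]; simp; exact Real.rpow_nonneg le_rfl _
      · rw [← Real.rpow_natCast_mul h5.le, ← Real.rpow_natCast]
        exact Real.rpow_le_rpow_of_exponent_ge h5 h4 (by push_cast; linarith)
    have h5 : (2 * (u * M ^ 3)) ^ q = P * u ^ (4 * q) := by
      rw [hP, hM, show 2 * (u * (2 * κ * u) ^ 3) = (2 * (2 * κ) ^ 3) * u ^ 4 by ring,
        Real.mul_rpow (by positivity) (by positivity), ← Real.rpow_natCast_mul hu.le]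
      norm_num
    -- The exponent `3 - 4 * q` in the diffusion makes both sides of order `u ^ 3`.
    have h6 : α * (P * u ^ (4 * q)) = M ^ 2 * ((3 + C * κ) * u) := by
      have h7 : u ^ (3 - 4 * q) * u ^ (4 * q) = u ^ 3 := by
        rw [← Real.rpow_add hu, sub_add_cancel]
        norm_cast
      calc α * (P * u ^ (4 * q)) =
          (2 * κ) ^ 2 * (3 + C * κ) * (u ^ (3 - 4 * q) * u ^ (4 * q)) := by
            rw [hαdef]; field_simp
        _ = _ := by rw [h7, hM]; ring
    have h8 : τ ^ 2 * ((3 + C * κ) * u) ≤ α * damp q (u * τ ^ 3) := by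
      calc τ ^ 2 * ((3 + C * κ) * u) = (τ / M) ^ 2 * (M ^ 2 * ((3 + C * κ) * u)) := by field_simp
        _ = α * ((τ / M) ^ 2 * (2 * (u * M ^ 3)) ^ q) := by rw [← h6, h5]; ring
        _ ≤ _ := by gcongr
    norm_num
    linarith

end Flux

end KineticRelation

/-! ### Threshold criterion, regularity of the threshold, and the regime without threshold. -/

namespace KineticRelation

theorem exists_damp_le_rpow {q q₀ M : ℝ} (hq₀ : 0 < q₀) (h : q₀ ≤ q) (hM : 0 ≤ M) :
    ∃ B, 0 < B ∧ ∀ y, 0 ≤ y → y ≤ M → damp q y ≤ B * y ^ q₀ := by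
  refine ⟨2 ^ q * (M + 1) ^ (q - q₀), by positivity, fun y hy hyM => ?_⟩
  rcases eq_or_lt_of_le hy with rfl | hy0
  · rw [damp_of_nonpos (by linarith) le_rfl, Real.zero_rpow hq₀.ne', mul_zero]
  · rw [damp_of_nonneg hy, Real.mul_rpow (by norm_num) hy]
    have h1 : y ^ q = y ^ (q - q₀) * y ^ q₀ := by rw [← Real.rpow_add hy0, sub_add_cancel]
    have h2 : y ^ (q - q₀) ≤ (M + 1) ^ (q - q₀) :=
      Real.rpow_le_rpow hy (by linarith) (by linarith)
    rw [h1, mul_assoc]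
    gcongr

/-- A function that starts at `0` and whose growth rate is at most `B y ^ q₀`. -/
theorem le_rpow_of_deriv_le_rpow {y y' : ℝ → ℝ} {q₀ B T : ℝ} (hq₁ : q₀ < 1)
    (hy : ∀ t ∈ Icc 0 T, HasDerivAt y (y' t) t) (h0 : y 0 = 0) (hpos : ∀ t ∈ Ioc 0 T, 0 < y t)
    (hB : ∀ t ∈ Ioc 0 T, y' t ≤ B * y t ^ q₀) :
    ∀ t ∈ Icc 0 T, y t ^ (1 - q₀) ≤ (1 - q₀) * B * t := by
  intro t ht
  have he : 0 < 1 - q₀ := by linarith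
  have hT : 0 ≤ T := ht.1.trans ht.2
  have hd : ∀ s ∈ Ioo 0 T, HasDerivAt (fun s => y s ^ (1 - q₀) - (1 - q₀) * B * s)
      (y' s * (1 - q₀) * y s ^ (1 - q₀ - 1) - (1 - q₀) * B) s := fun s hs => by
    have h1 := (hy s ⟨hs.1.le, hs.2.le⟩).rpow_const (p := 1 - q₀)
      (Or.inl (hpos s ⟨hs.1, hs.2.le⟩).ne')
    exact (h1.sub ((hasDerivAt_id s).const_mul ((1 - q₀) * B))).congr_deriv (by simp)
  have hanti : AntitoneOn (fun s => y s ^ (1 - q₀) - (1 - q₀) * B * s) (Icc 0 T) := by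
    apply antitoneOn_of_deriv_nonpos (convex_Icc 0 T)
    · have hc : ContinuousOn y (Icc 0 T) := fun s hs => (hy s hs).continuousAt.continuousWithinAt
      exact (hc.rpow_const fun s _ => Or.inr he.le).sub (by fun_prop)
    · rw [interior_Icc]
      exact fun s hs => (hd s hs).differentiableAt.differentiableWithinAt
    · rw [interior_Icc]
      intro s hs
      rw [(hd s hs).deriv]
      have h1 := hpos s ⟨hs.1, hs.2.le⟩
      have h2 := mul_le_mul_of_nonneg_right (hB s ⟨hs.1, hs.2.le⟩)
        (mul_nonneg he.le (Real.rpow_nonneg h1.le (1 - q₀ - 1)))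
      have h3 : y s ^ q₀ * y s ^ (1 - q₀ - 1) = 1 := by
        rw [← Real.rpow_add h1]; simp
      have h4 : B * y s ^ q₀ * ((1 - q₀) * y s ^ (1 - q₀ - 1)) = (1 - q₀) * B := by
        linear_combination (B * (1 - q₀)) * h3
      linarith
  have := hanti ⟨le_rfl, hT⟩ ht ht.1
  simp only [h0, Real.zero_rpow he.ne', mul_zero, sub_zero] at this
  linarith

namespace Flux

variable {f f1 f2 : ℝ → ℝ} (F : Flux f f1 f2) {α q : ℝ}
include F

/-- The set of good diffusion strengths is upward closed, and it contains its infimum because a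
positive arrival energy survives a small increase of the diffusion. -/
theorem arrivalEnergy_nonpos_iff (hq : 1 / 2 ≤ q) (hq2 : q ≤ 2 / 3) (hα : 0 < α) {u : ℝ}
    (hu : 0 < u) :
    arrivalEnergy α q f u (tangentState f f1 u) ≤ 0 ↔ threshold q f f1 u ≤ α := by
  refine ⟨threshold_le hα, fun h => ?_⟩
  have hq0 : 0 < q := by linarith
  obtain ⟨C₀, hC₀, hne⟩ := F.exists_arrivalEnergy_nonpos hq hq2 hu
  have hL : 0 < u - tangentState f f1 u := by linarith [F.tangentState_lt hu]
  by_contra! hpos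
  unfold arrivalEnergy at hpos
  set lam := chordSpeed f u (tangentState f f1 u) with hlam
  set L := u - tangentState f f1 u with hLdef
  have hy := F.isEnergyProfile hα.le hq0 u lam
  have hdc : ContinuousOn (fun s => damp q (profile α q f u lam s)) (Icc 0 L) :=
    (continuous_damp hq0).comp_continuousOn
      fun s hs => (hy.2 s hs.1).continuousAt.continuousWithinAt
  obtain ⟨M, hM⟩ := isCompact_Icc.exists_bound_of_continuousOn hdc
  have hM0 : 0 ≤ M := (norm_nonneg _).trans (hM 0 ⟨le_rfl, hL.le⟩)
  -- Extra diffusion `δ` costs at most `δ * M * L`, strictly less than the energy available.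
  set δ := profile α q f u lam L / ((M + 1) * L) with hδ
  have hδ0 : 0 < δ := by positivity
  obtain ⟨a, ⟨ha0, ha⟩, haβ⟩ : ∃ a ∈ {α | 0 < α ∧ arrivalEnergy α q f u (tangentState f f1 u) ≤ 0},
      a < α + δ :=
    exists_lt_of_csInf_lt ⟨C₀ * u ^ (3 - 4 * q), by positivity, hne u hu le_rfl⟩
      (by unfold threshold at h; linarith)
  have h1 := F.profile_anti ha0.le haβ.le hq0 (u := u) (lam := lam) hL.le
  have hz := F.isEnergyProfile (by positivity : 0 ≤ α + δ) hq0 u lam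
  -- The profile for `α + δ` is read as a profile for `α` with the extra damping moved into the
  -- force.
  have hz' : IsEnergyProfile α q
      (fun s => excess f u lam (u - s) - δ * damp q (profile (α + δ) q f u lam s))
      (profile (α + δ) q f u lam) :=
    ⟨hz.1, fun s hs => (hz.2 s hs).congr_deriv (by ring)⟩
  have h2 := hy.le_add hα.le hq0.le hz' (S := L) (D := fun s => δ * M * s) (D' := fun _ => δ * M)
    (fun s _ => by simpa using (hasDerivAt_id s).const_mul (δ * M))
    (fun s hs => by have := hs.1; positivity)
    (fun s hs => by
      have h3 := F.profile_anti hα.le (by linarith : α ≤ α + δ) hq0 (u := u) (lam := lam) hs.1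
      have h4 := (damp_mono hq0.le h3).trans ((le_abs_self _).trans (hM s hs))
      have := mul_le_mul_of_nonneg_left h4 hδ0.le
      linarith) L ⟨hL.le, le_rfl⟩
  have h3 : profile a q f u lam L ≤ 0 := ha
  have h4 : δ * ((M + 1) * L) = profile α q f u lam L := by rw [hδ]; field_simp
  have h5 : 0 < δ * L := by positivity
  linarith

theorem exists_threshold_le_rpow (hq : 1 / 2 ≤ q) (hq2 : q ≤ 2 / 3) {R : ℝ} (hR : 0 < R) :
    ∃ C₀, 0 < C₀ ∧ ∀ u, 0 < u → u ≤ R → threshold q f f1 u ≤ C₀ * u ^ (3 - 4 * q) := by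
  obtain ⟨C₀, hC₀, h⟩ := F.exists_arrivalEnergy_nonpos hq hq2 hR
  exact ⟨C₀, hC₀, fun u hu huR => threshold_le (by positivity) (h u hu huR)⟩

/-- Relative changes of the threshold are at most of order `|u' - u| / u`; a linear bound `M * w` on
the threshold turns this into an absolute Lipschitz bound. -/
theorem exists_threshold_lipschitz (hq : 1 / 2 ≤ q) (hq2 : q ≤ 2 / 3) {R : ℝ} (hR : 0 < R) :
    ∃ C₀, 0 < C₀ ∧ ∀ u M, 0 < u → (∀ w ∈ Icc u R, threshold q f f1 w ≤ M * w) →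
      ∀ u', u ≤ u' → u' ≤ R →
        |threshold q f f1 u' - threshold q f f1 u| ≤ C₀ * M * (u' - u) := by
  have hq0 : 0 < q := by linarith
  obtain ⟨C₀, hC₀, h⟩ := F.exists_threshold_step hq0 hR
  obtain ⟨C₁, hC₁, hne⟩ := F.exists_arrivalEnergy_nonpos hq hq2 hR
  have step : ∀ u u' x, 0 < u → u ≤ R → 0 < u' → u' ≤ R → x * u = C₀ * |u' - u| → x ≤ 1 →
      threshold q f f1 u' ≤ (1 + x) * threshold q f f1 u := by
    intro u u' x hu huR hu' hu'R hx hx1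
    have hx0 : 0 ≤ x := by
      refine nonneg_of_mul_nonneg_left ?_ hu
      rw [hx]; positivity
    rw [mul_comm, ← div_le_iff₀ (by linarith)]
    refine le_csInf ⟨C₁ * u ^ (3 - 4 * q), by positivity, hne u hu huR⟩ fun a ha => ?_
    rw [div_le_iff₀ (by linarith)]
    exact threshold_le (mul_pos ha.1 (by linarith)) (h u u' x hu huR hu' hu'R hx hx1 a ha.1 ha.2)
  refine ⟨C₀, by linarith, fun u M hu hM u' huu hu'R => ?_⟩
  refine abs_sub_le_of_short_steps (c := 1 / C₀) (by positivity) (fun w hw e he hec hwR => ?_)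
    hu huu hu'R
  have hw0 : 0 < w := hu.trans_le hw
  have hwe : C₀ * e ≤ w := by
    rw [div_mul_eq_mul_div, one_mul, le_div_iff₀ (by linarith)] at hec
    linarith
  have h1 := step w (w + e) (C₀ * e / w) hw0 (by linarith) (by linarith) hwR
    (by rw [div_mul_cancel₀ _ hw0.ne', add_sub_cancel_left, abs_of_pos he])
    (by rwa [div_le_one hw0])
  have h2 := step (w + e) w (C₀ * e / (w + e)) (by linarith) hwR hw0 (by linarith)
    (by rw [div_mul_cancel₀ _ (by linarith), abs_sub_comm, add_sub_cancel_left, abs_of_pos he])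
    (by rw [div_le_one (by linarith)]; linarith)
  have key : ∀ v ∈ Icc u R, C₀ * e / v * threshold q f f1 v ≤ C₀ * M * e := by
    intro v hv
    have hv0 : 0 < v := hu.trans_le hv.1
    calc C₀ * e / v * threshold q f f1 v ≤ C₀ * e / v * (M * v) := by gcongr; exact hM v hv
      _ = _ := by field_simp
  have h3 := key w ⟨hw, by linarith⟩
  have h4 := key (w + e) ⟨by linarith, hwR⟩
  exact abs_le.mpr ⟨by linarith, by linarith⟩

/-- Weak nonlinear diffusion never produces a profile to the tangent state. -/
theorem arrivalEnergy_tangentState_pos (hα : 0 < α) (hq : 2 / 3 < q) {u : ℝ} (hu : 0 < u) :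
    0 < arrivalEnergy α q f u (tangentState f f1 u) := by
  have hq0 : 0 < q := by linarith
  have htu := F.tangentState_lt hu
  by_contra! hle
  have hlow : ∀ w ∈ Ioo (tangentState f f1 u) u,
      0 < profile α q f u (chordSpeed f u (tangentState f f1 u)) (u - w) := fun w hw =>
    F.profile_pos hα.le hq0 (w₁ := tangentState f f1 u) (fun w hw =>
      F.strictMonoOn_chordSpeed hu ⟨le_rfl, htu⟩ ⟨hw.1.le, hw.2⟩ hw.1) hw
  obtain ⟨R', c, C, η, κ, hRR, B, hη, hη1, hκ, hb⟩ := F.exists_tangentState_bounds hu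
  obtain ⟨ht1, ht2, -⟩ := hb u hu le_rfl
  have hc := B.pos
  have hlam := F.deriv_tangentState_eq hu
  have hex0 := excess_chordSpeed (f := f) htu.ne'
  have ht0 := F.tangentState_neg hu
  have h0 : arrivalEnergy α q f u (tangentState f f1 u) = 0 :=
    le_antisymm hle (F.arrivalEnergy_nonneg hα.le hq0 hu le_rfl htu)
  unfold arrivalEnergy at h0
  rw [← hlam] at hex0 h0 hlow
  set t := tangentState f f1 u
  have hL : 0 < u - t := by linarith
  have hy := F.isEnergyProfile hα.le hq0 u (f1 t)
  set Y : ℝ → ℝ := fun τ => profile α q f u (f1 t) (u - t - τ) with hY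
  have hYd : ∀ τ ∈ Icc 0 (-t), HasDerivAt Y (α * damp q (Y τ) - excess f u (f1 t) (t + τ)) τ := by
    intro τ hτ
    refine ((hy.2 (u - t - τ) (by linarith [hτ.2])).comp_const_sub (u - t) τ).congr_deriv ?_
    beta_reduce
    rw [show u - (u - t - τ) = t + τ by ring]
    simp only [hY]
    ring
  have hY0 : Y 0 = 0 := by simpa [hY] using h0
  have hYpos : ∀ τ ∈ Ioc 0 (-t), 0 < Y τ := fun τ hτ => by
    have := hlow (t + τ) ⟨by linarith [hτ.1], by linarith [hτ.2]⟩
    rwa [show u - (t + τ) = u - t - τ by ring] at this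
  have hexlow : ∀ τ ∈ Icc 0 (-t), c * (-t) / 4 * τ ^ 2 ≤ excess f u (f1 t) (t + τ) := by
    intro τ hτ
    have := monotoneOn_of_hasDerivAt_nonneg (convex_Icc t 0)
      (fun y _ => (F.hasDerivAt_excess u (f1 t) y).sub
        ((((hasDerivAt_id y).sub_const t).pow 2).const_mul (c * (-t) / 4)))
      (fun y hy => by
        have h1 := B.le_f1_sub_of_neg F ht1 hy.1 hy.2
        have h2 : c * ((-t) * (y - t)) ≤ c * (t ^ 2 - y ^ 2) := by
          gcongr; nlinarith [hy.1, hy.2]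
        norm_num
        linarith) ⟨le_rfl, ht0.le⟩ (⟨by linarith [hτ.1], by linarith [hτ.2]⟩ : t + τ ∈ Icc t 0)
        (by linarith [hτ.1])
    simp [hex0] at this
    linarith
  set k := c * (-t) / 4 with hk
  have hk0 : 0 < k := by have : 0 < -t := by linarith
                         positivity
  obtain ⟨M, hM⟩ := isCompact_Icc.exists_bound_of_continuousOn (s := Icc 0 (-t)) (f := Y)
    (fun τ hτ => (hYd τ hτ).continuousAt.continuousWithinAt)
  have hM0 : 0 ≤ M := (norm_nonneg _).trans (hM 0 ⟨le_rfl, by linarith⟩)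
  -- An exponent still above `2/3`, but below `1`, as needed to integrate `Y' ≤ B * Y ^ q₀`.
  set q₀ := min q (3 / 4) with hq₀
  have hq₀1 : q₀ ≤ 3 / 4 := min_le_right _ _
  have hq₀2 : 2 / 3 < q₀ := lt_min hq (by norm_num)
  obtain ⟨B', hB', hdamp⟩ := exists_damp_le_rpow (q := q) (by linarith : 0 < q₀) (min_le_left _ _) hM0
  have hdampY : ∀ τ ∈ Ioc 0 (-t), α * damp q (Y τ) ≤ α * B' * Y τ ^ q₀ := fun τ hτ => by
    have := hdamp (Y τ) (hYpos τ hτ).le ((le_abs_self _).trans (hM τ ⟨hτ.1.le, hτ.2⟩))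
    rw [mul_assoc]
    gcongr
  have hgrow := le_rpow_of_deriv_le_rpow (q₀ := q₀) (B := α * B') (by linarith) hYd hY0 hYpos
    (fun τ hτ => by
      have h1 := hexlow τ ⟨hτ.1.le, hτ.2⟩
      have h2 : 0 ≤ k * τ ^ 2 := by positivity
      linarith [hdampY τ hτ])
  set E := (1 - q₀) * (α * B') with hE
  have hE0 : 0 < E := mul_pos (by linarith) (by positivity)
  -- Integrating the growth bound gives `Y ^ q₀` of order `τ ^ e`, and `e > 2` exactly because `q₀ >
  -- 2/3`. Near the tangent state the friction is then below the excess, which is at least of order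
  -- `τ ^ 2`, so `Y` cannot grow from zero.
  set e := q₀ / (1 - q₀) with he
  have he2 : 2 < e := by rw [he, lt_div_iff₀ (by linarith)]; linarith
  have hYe : ∀ τ ∈ Ioc 0 (-t), Y τ ^ q₀ ≤ E ^ e * τ ^ e := by
    intro τ hτ
    have h1 := hgrow τ ⟨hτ.1.le, hτ.2⟩
    have h2 : Y τ ^ q₀ = (Y τ ^ (1 - q₀)) ^ e := by
      rw [← Real.rpow_mul (hYpos τ hτ).le, he, mul_div_cancel₀ _ (by linarith)]
    rw [h2, ← Real.mul_rpow hE0.le hτ.1.le]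
    exact Real.rpow_le_rpow (Real.rpow_nonneg (hYpos τ hτ).le _) h1 (by linarith)
  have hlim : Tendsto (fun τ : ℝ => α * B' * E ^ e * τ ^ (e - 2)) (𝓝 0) (𝓝 0) := by
    have h1 := (Real.continuousAt_rpow_const 0 (e - 2) (Or.inr (by linarith))).tendsto
    rw [Real.zero_rpow (by linarith)] at h1
    simpa using h1.const_mul (α * B' * E ^ e)
  obtain ⟨T, hT0, hT⟩ : ∃ T, 0 < T ∧ ∀ τ ∈ Ioc 0 T, τ ≤ -t ∧ α * B' * E ^ e * τ ^ (e - 2) ≤ k := by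
    obtain ⟨ε, hε, h2⟩ := Metric.eventually_nhds_iff.mp
      ((gt_mem_nhds (by linarith : 0 < -t)).and (hlim.eventually (gt_mem_nhds hk0)) :
        ∀ᶠ τ : ℝ in 𝓝 0, τ < -t ∧ α * B' * E ^ e * τ ^ (e - 2) < k)
    refine ⟨ε / 2, by positivity, fun τ hτ => ?_⟩
    have := h2 (y := τ) (by rw [Real.dist_eq, sub_zero, abs_of_pos hτ.1]; linarith [hτ.2])
    exact ⟨this.1.le, this.2.le⟩
  have hTt := (hT T ⟨hT0, le_rfl⟩).1
  have hanti := antitoneOn_of_hasDerivAt_nonpos (convex_Icc 0 T)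
    (fun τ hτ => hYd τ ⟨hτ.1, hτ.2.trans hTt⟩) (fun τ hτ => by
      rcases eq_or_lt_of_le hτ.1 with h | h
      · rw [← h, hY0, damp_of_nonpos hq0 le_rfl]
        simp [hex0]
      · have h1 := hdampY τ ⟨h, hτ.2.trans hTt⟩
        have h2 := hYe τ ⟨h, hτ.2.trans hTt⟩
        have h3 := hexlow τ ⟨h.le, hτ.2.trans hTt⟩
        have h4 : α * B' * (E ^ e * τ ^ e) ≤ k * τ ^ 2 := by
          have h5 : τ ^ e = τ ^ (e - 2) * τ ^ 2 := by
            rw [← Real.rpow_natCast τ 2, ← Real.rpow_add h]; norm_num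
          rw [h5]
          have := mul_le_mul_of_nonneg_right (hT τ ⟨h, hτ.2⟩).2 (sq_nonneg τ)
          linarith
        have h6 : α * B' * Y τ ^ q₀ ≤ α * B' * (E ^ e * τ ^ e) := by gcongr
        linarith) ⟨le_rfl, hT0.le⟩ ⟨hT0.le, le_rfl⟩ hT0.le
  rw [hY0] at hanti
  exact absurd hanti (not_le.mpr (hYpos T ⟨hT0, hTt⟩))

end Flux

end KineticRelation

/-! ### Motions with friction: energy, profiles, rest points. -/

namespace KineticRelation

/-- `w` solves `w'' = -e(w) - α |w'|^p w'` on `I`, with velocity `w1`. -/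
structure IsMotionOn (α p : ℝ) (e w w1 : ℝ → ℝ) (I : Set ℝ) : Prop where
  pos : ∀ t ∈ I, HasDerivAt w (w1 t) t
  vel : ∀ t ∈ I, HasDerivAt w1 (-e (w t) - α * (|w1 t| ^ p * w1 t)) t

/-- The link between the two descriptions: for kinetic energy `x ^ 2 / 2`, the exponent `(p + 1) /
2` reproduces the viscous term. -/
theorem damp_sq_half {p : ℝ} (hp : 0 ≤ p) (x : ℝ) : damp ((p + 1) / 2) (x ^ 2 / 2) = |x| ^ p * |x| := by
  rw [damp_of_nonneg (by positivity), mul_div_cancel₀ _ two_ne_zero, ← sq_abs,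
    ← Real.rpow_natCast_mul (abs_nonneg x)]
  push_cast
  rw [mul_div_cancel₀ _ two_ne_zero, Real.rpow_add_one' (abs_nonneg x) (by linarith)]

theorem IsMotionOn.mono {α p : ℝ} {e w w1 : ℝ → ℝ} {I J : Set ℝ} (h : IsMotionOn α p e w w1 I)
    (hJ : J ⊆ I) : IsMotionOn α p e w w1 J :=
  ⟨fun t ht => h.pos t (hJ ht), fun t ht => h.vel t (hJ ht)⟩

namespace IsMotionOn

variable {α p u : ℝ} {e w w1 Y G : ℝ → ℝ} {I : Set ℝ} (h : IsMotionOn α p e w w1 I)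
include h

/-- Kinetic plus potential energy is a Lyapunov function; its derivative is `-α |w'|^(p+2)`. -/
theorem antitoneOn_energy (hα : 0 ≤ α) (hI : Convex ℝ I)
    (hG : ∀ t ∈ I, HasDerivAt G (e (w t)) (w t)) :
    AntitoneOn (fun t => w1 t ^ 2 / 2 + G (w t)) I := by
  refine antitoneOn_of_hasDerivAt_nonpos hI
    (fun t ht => (((h.vel t ht).pow 2).div_const 2).add ((hG t ht).comp t (h.pos t ht)))
    (fun t ht => ?_)
  have h1 : 0 ≤ α * (|w1 t| ^ p * w1 t ^ 2) := by positivity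
  norm_num
  linarith

/-- While the velocity is nonpositive, the distance to the energy profile decreases. -/
theorem antitoneOn_sq_gap (hα : 0 ≤ α) (hp : 0 ≤ p) (hI : Convex ℝ I)
    (hY : IsEnergyProfile α ((p + 1) / 2) (fun s => e (u - s)) Y) (hw : ∀ t ∈ I, w t ≤ u)
    (hw1 : ∀ t ∈ I, w1 t ≤ 0) :
    AntitoneOn (fun t => (w1 t ^ 2 / 2 - Y (u - w t)) ^ 2) I := by
  refine antitoneOn_of_hasDerivAt_nonpos hI
    (fun t ht => ((((h.vel t ht).pow 2).div_const 2).sub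
      ((hY.2 (u - w t) (by linarith [hw t ht])).comp t ((h.pos t ht).const_sub u))).pow 2)
    (fun t ht => ?_)
  have h1 := hw1 t ht
  have h2 := damp_sq_half hp (w1 t)
  rw [abs_of_nonpos h1] at h2
  have hq : 0 ≤ (p + 1) / 2 := by positivity
  simp only [sub_sub_cancel, Pi.sub_apply, Function.comp, abs_of_nonpos h1]
  -- Monotonicity of `damp` makes the squared distance to the profile contract along a descending
  -- motion.
  have key : 0 ≤ (damp ((p + 1) / 2) (w1 t ^ 2 / 2) - damp ((p + 1) / 2) (Y (u - w t))) *
      (w1 t ^ 2 / 2 - Y (u - w t)) := by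
    rcases le_total (w1 t ^ 2 / 2) (Y (u - w t)) with h3 | h3
    · have := damp_mono hq h3
      nlinarith
    · have := damp_mono hq h3
      nlinarith
  have h4 : 0 ≤ α * -w1 t := mul_nonneg hα (by linarith)
  have h5 := mul_nonneg h4 key
  norm_num
  rw [h2] at h5
  linarith

theorem eq_profile (hα : 0 ≤ α) (hp : 0 ≤ p) (hI : Convex ℝ I)
    (hY : IsEnergyProfile α ((p + 1) / 2) (fun s => e (u - s)) Y) (hw : ∀ t ∈ I, w t ≤ u)
    (hw1 : ∀ t ∈ I, w1 t ≤ 0) {t₀ t : ℝ} (ht₀ : t₀ ∈ I) (ht : t ∈ I) (htt : t₀ ≤ t)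
    (h0 : w1 t₀ ^ 2 / 2 = Y (u - w t₀)) : w1 t ^ 2 / 2 = Y (u - w t) := by
  have := h.antitoneOn_sq_gap hα hp hI hY hw hw1 ht₀ ht htt
  simp only [h0, sub_self] at this
  have h1 := pow_eq_zero_iff (two_ne_zero) |>.mp (le_antisymm (by simpa using this) (sq_nonneg (w1 t ^ 2 / 2 - Y (u - w t))))
  linarith

end IsMotionOn

/-- A motion that starts downwards on the energy profile follows it until its velocity vanishes. -/
theorem IsMotionOn.follow_profile {α p u t₀ : ℝ} {e w w1 Y : ℝ → ℝ}
    (h : IsMotionOn α p e w w1 (Ici t₀)) (hα : 0 ≤ α) (hp : 0 ≤ p)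
    (hY : IsEnergyProfile α ((p + 1) / 2) (fun s => e (u - s)) Y) (hw : w t₀ ≤ u)
    (hw1 : w1 t₀ < 0) (h0 : w1 t₀ ^ 2 / 2 = Y (u - w t₀)) :
    (∀ t, t₀ ≤ t → w1 t < 0 ∧ w t ≤ u ∧ w1 t ^ 2 / 2 = Y (u - w t)) ∨
    ∃ T, t₀ < T ∧ w1 T = 0 ∧ e (w T) ≤ 0 ∧ AntitoneOn w (Icc t₀ T) ∧
      (∀ t ∈ Ico t₀ T, w1 t < 0) ∧ ∀ t ∈ Icc t₀ T, w1 t ≤ 0 ∧ w t ≤ u ∧ w1 t ^ 2 / 2 = Y (u - w t) := by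
  have hc : ContinuousOn w1 (Ici t₀) := fun t ht => (h.vel t ht).continuousAt.continuousWithinAt
  have hneg : ∀ T, t₀ ≤ T → (∀ t ∈ Icc t₀ T, w1 t ≤ 0) → AntitoneOn w (Icc t₀ T) ∧
      ∀ t ∈ Icc t₀ T, w t ≤ u ∧ w1 t ^ 2 / 2 = Y (u - w t) := by
    intro T hT hle
    have hm := h.mono (Icc_subset_Ici_self : Icc t₀ T ⊆ Ici t₀)
    have hanti : AntitoneOn w (Icc t₀ T) :=
      antitoneOn_of_hasDerivAt_nonpos (convex_Icc _ _) hm.pos hle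
    have hwu : ∀ t ∈ Icc t₀ T, w t ≤ u := fun t ht => (hanti ⟨le_rfl, hT⟩ ht ht.1).trans hw
    exact ⟨hanti, fun t ht => ⟨hwu t ht,
      hm.eq_profile hα hp (convex_Icc _ _) hY hwu hle ⟨le_rfl, hT⟩ ht ht.1 h0⟩⟩
  by_cases hz : ∃ t, t₀ ≤ t ∧ w1 t = 0
  · right
    set S := {t | t₀ ≤ t ∧ w1 t = 0} with hS
    have hScl : IsClosed S := by
      have : S = Ici t₀ ∩ w1 ⁻¹' {0} := by ext; simp [hS]
      rw [this]
      exact hc.preimage_isClosed_of_isClosed isClosed_Ici isClosed_singleton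
    have hSb : BddBelow S := ⟨t₀, fun t ht => ht.1⟩
    have hT : sInf S ∈ S := hScl.csInf_mem hz hSb
    set T := sInf S
    have hTt : t₀ < T := lt_of_le_of_ne hT.1 (fun heq => by rw [heq, hT.2] at hw1; exact lt_irrefl _ hw1)
    have hlt : ∀ t ∈ Ico t₀ T, w1 t < 0 := by
      intro t ht
      by_contra! hge
      obtain ⟨x, hx, hx0⟩ := intermediate_value_Icc ht.1
        (hc.mono Icc_subset_Ici_self) ⟨hw1.le, hge⟩
      exact absurd (csInf_le hSb (show x ∈ S from ⟨hx.1, hx0⟩)) (not_le.mpr (hx.2.trans_lt ht.2))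
    have hle : ∀ t ∈ Icc t₀ T, w1 t ≤ 0 := fun t ht => by
      rcases eq_or_lt_of_le ht.2 with h1 | h1
      · rw [h1, hT.2]
      · exact (hlt t ⟨ht.1, h1⟩).le
    obtain ⟨h1, h2⟩ := hneg T hT.1 hle
    refine ⟨T, hTt, hT.2, ?_, h1, hlt, fun t ht => ⟨hle t ht, h2 t ht⟩⟩
    have hd := h.vel T hT.1
    rw [hT.2, mul_zero, mul_zero, sub_zero] at hd
    by_contra! hpos
    -- The velocity is negative before `T` and zero at `T`, so the acceleration `-e (w T)` is
    -- nonnegative.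
    have h3 := hd.tendsto_slope.mono_left (nhdsWithin_mono T
      (fun x hx => (ne_of_lt hx : x ≠ T)) : 𝓝[<] T ≤ 𝓝[≠] T)
    have h4 : 0 ≤ -e (w T) := by
      refine ge_of_tendsto h3 ?_
      filter_upwards [Ioo_mem_nhdsLT hTt] with x hx
      rw [slope_def_field, hT.2]
      exact div_nonneg_of_nonpos (by linarith [hlt x ⟨hx.1.le, hx.2⟩]) (by linarith [hx.2])
    linarith
  · left
    push Not at hz
    have hlt : ∀ t, t₀ ≤ t → w1 t < 0 := by
      intro t ht
      by_contra! hge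
      obtain ⟨x, hx, hx0⟩ := intermediate_value_Icc ht (hc.mono Icc_subset_Ici_self) ⟨hw1.le, hge⟩
      exact hz x hx.1 hx0
    exact fun t ht => ⟨hlt t ht, (hneg t ht fun s hs => (hlt s hs.1).le).2 t ⟨ht, le_rfl⟩⟩

/-- The derivative of a convergent function tends to `0` along some times. -/
theorem exists_tendsto_deriv_zero {w w1 : ℝ → ℝ} {T l : ℝ} (hd : ∀ t, T ≤ t → HasDerivAt w (w1 t) t)
    (hw : Tendsto w atTop (𝓝 l)) :
    ∃ ξ : ℝ → ℝ, Tendsto ξ atTop atTop ∧ Tendsto (fun t => w1 (ξ t)) atTop (𝓝 0) := by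
  have h1 : Tendsto (fun t => w (t + 1) - w t) atTop (𝓝 0) := by
    simpa using (hw.comp (tendsto_atTop_add_const_right atTop 1 tendsto_id)).sub hw
  have h2 : ∀ t, ∃ x, t < x ∧ (T ≤ t → w1 x = w (t + 1) - w t) := by
    intro t
    by_cases ht : T ≤ t
    · obtain ⟨x, hx, hx1⟩ := exists_hasDerivAt_eq_slope w w1 (lt_add_one t)
        (fun s hs => (hd s (ht.trans hs.1)).continuousAt.continuousWithinAt)
        (fun s hs => hd s (ht.trans hs.1.le))
      exact ⟨x, hx.1, fun _ => by rw [hx1]; simp⟩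
    · exact ⟨t + 1, lt_add_one t, fun h => absurd h ht⟩
  choose ξ hξ1 hξ2 using h2
  refine ⟨ξ, tendsto_atTop_mono (fun t => (hξ1 t).le) tendsto_id, h1.congr' ?_⟩
  filter_upwards [eventually_ge_atTop T] with t ht
  exact (hξ2 t ht).symm

/-- If a function and its derivative converge at infinity, the derivative converges to `0`. -/
theorem eq_zero_of_tendsto_deriv {w w1 : ℝ → ℝ} {T l m : ℝ} (hd : ∀ t, T ≤ t → HasDerivAt w (w1 t) t)
    (hw : Tendsto w atTop (𝓝 l)) (hw1 : Tendsto w1 atTop (𝓝 m)) : m = 0 := by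
  obtain ⟨ξ, h3, h4⟩ := exists_tendsto_deriv_zero hd hw
  exact tendsto_nhds_unique (hw1.comp h3) h4

theorem exists_tendsto_deriv_zero_atBot {w w1 : ℝ → ℝ} {l : ℝ} (hd : ∀ t, HasDerivAt w (w1 t) t)
    (hw : Tendsto w atBot (𝓝 l)) :
    ∃ ξ : ℝ → ℝ, Tendsto ξ atTop atBot ∧ Tendsto (fun t => w1 (ξ t)) atTop (𝓝 0) := by
  obtain ⟨ξ, h1, h2⟩ := exists_tendsto_deriv_zero (w := fun t => w (-t)) (w1 := fun t => -w1 (-t))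
    (T := 0) (fun t _ => ((hd (-t)).comp t (hasDerivAt_neg t)).congr_deriv (by simp))
    (hw.comp tendsto_neg_atTop_atBot)
  exact ⟨fun t => -ξ t, tendsto_neg_atTop_atBot.comp h1, by simpa using h2.neg⟩

theorem exists_gt_of_second_deriv_pos {w w1 : ℝ → ℝ} {a t₀ δ : ℝ} (hd : ∀ t, HasDerivAt w (w1 t) t)
    (h : HasDerivAt w1 a t₀) (h0 : w1 t₀ = 0) (ha : 0 < a) (hδ : 0 < δ) :
    ∃ s ∈ Ioo t₀ (t₀ + δ), w t₀ < w s := by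
  have h1 : ∀ᶠ s in 𝓝[>] t₀, 0 < w1 s := by
    have h2 := (h.tendsto_slope.mono_left (nhdsWithin_mono t₀
      (fun x hx => (ne_of_gt hx : x ≠ t₀)) : 𝓝[>] t₀ ≤ 𝓝[≠] t₀)).eventually (lt_mem_nhds ha)
    filter_upwards [h2, self_mem_nhdsWithin] with s hs hst
    rw [slope_def_field, h0, sub_zero] at hs
    have : 0 < s - t₀ := sub_pos.mpr hst
    exact (div_pos_iff_of_pos_right this).mp hs
  obtain ⟨b, hb, h2⟩ := mem_nhdsGT_iff_exists_Ioo_subset.mp h1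
  set s := min ((t₀ + b) / 2) (t₀ + δ / 2) with hs
  have hb' : t₀ < b := hb
  have hs1 : t₀ < s := lt_min (by linarith) (by linarith)
  have hs2 : s ≤ (t₀ + b) / 2 := min_le_left _ _
  have hs3 : s ≤ t₀ + δ / 2 := min_le_right _ _
  refine ⟨s, ⟨hs1, by linarith⟩, ?_⟩
  exact strictMonoOn_of_hasDerivAt_pos (convex_Icc t₀ s) (fun x _ => hd x) (fun x hx => by
    rw [interior_Icc] at hx
    exact h2 ⟨hx.1, by linarith [hx.2]⟩) ⟨le_rfl, hs1.le⟩ ⟨hs1.le, le_rfl⟩ hs1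

/-- A form of Barbalat's lemma. -/
theorem eventually_le_of_deriv_le {g g' x : ℝ → ℝ} {T K l ε η : ℝ}
    (hg : ∀ t, T ≤ t → HasDerivAt g (g' t) t) (hl : Tendsto g atTop (𝓝 l)) (hK : 0 ≤ K)
    (hx : ∀ s t, T ≤ s → s ≤ t → |x s - x t| ≤ K * (t - s)) (hε : 0 < ε) (hη : 0 < η)
    (h : ∀ᶠ t in atTop, ε / 2 ≤ x t → g' t ≤ -η) : ∀ᶠ t in atTop, x t ≤ ε := by
  -- If `x t > ε`, the Lipschitz bound keeps `x ≥ ε / 2` for a time `δ`, so `g` drops by at least `η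
  -- * δ`; convergence of `g` forbids this at late times.
  set δ := ε / (2 * (K + 1)) with hδ
  have hδ0 : 0 < δ := by positivity
  have h1 : Tendsto (fun t => g (t + δ) - g t) atTop (𝓝 0) := by
    simpa using (hl.comp (tendsto_atTop_add_const_right atTop δ tendsto_id)).sub hl
  obtain ⟨T', hT'⟩ := eventually_atTop.mp h
  filter_upwards [h1.eventually (lt_mem_nhds (by nlinarith : -(η * δ) < 0)), eventually_ge_atTop T',
    eventually_ge_atTop T] with t ht htT' htT
  by_contra! hlt
  have h2 := antitoneOn_of_hasDerivAt_nonpos (convex_Icc t (t + δ))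
    (fun s hs => (hg s (htT.trans hs.1)).add ((hasDerivAt_id s).const_mul η))
    (fun s hs => by
      have h3 := (abs_le.mp (hx t s htT hs.1)).2
      have h4 : K * (s - t) ≤ ε / 2 := by
        have h5 : K * (s - t) ≤ (K + 1) * δ := by
          have := hs.1
          have := hs.2
          have : 0 ≤ s - t := by linarith
          gcongr <;> linarith
        have h6 : (K + 1) * δ = ε / 2 := by rw [hδ]; field_simp
        linarith
      have := hT' s (htT'.trans hs.1) (by linarith)
      linarith) ⟨le_rfl, by linarith⟩ ⟨by linarith, le_rfl⟩ (by linarith : t ≤ t + δ)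
  simp at h2
  linarith

/-- A motion that is at rest at an equilibrium stays there. -/
theorem IsMotionOn.eq_of_rest {α p t₀ v K M : ℝ} {e w w1 : ℝ → ℝ}
    (h : IsMotionOn α p e w w1 (Icc t₀ M)) (hα : 0 ≤ α) (hK : 0 ≤ K)
    (he : ∀ t ∈ Icc t₀ M, |e (w t)| ≤ K * |w t - v|) (hw : w t₀ = v) (hw1 : w1 t₀ = 0) :
    ∀ t ∈ Icc t₀ M, w t = v := by
  intro t ht
  have hexp : ∀ s, HasDerivAt (fun s => Real.exp (-(K + 1) * s)) (Real.exp (-(K + 1) * s) * -(K + 1)) s :=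
    fun s => by simpa using ((hasDerivAt_id s).const_mul (-(K + 1))).exp
  -- Gronwall's argument for the squared distance to the rest point in the phase plane; friction
  -- contributes with the good sign.
  have hm := antitoneOn_of_hasDerivAt_nonpos (convex_Icc t₀ M)
    (fun s hs => ((((h.pos s hs).sub_const v).pow 2).add ((h.vel s hs).pow 2)).mul (hexp s))
    (fun s hs => by
      have h1 : 0 ≤ α * (|w1 s| ^ p * w1 s ^ 2) := by positivity
      have h2 : -(e (w s) * w1 s) ≤ K * |w s - v| * |w1 s| := by
        have := neg_abs_le (e (w s) * w1 s)
        rw [abs_mul] at this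
        have := mul_le_mul_of_nonneg_right (he s hs) (abs_nonneg (w1 s))
        linarith
      have h3 : 2 * (|w s - v| * |w1 s|) ≤ (w s - v) ^ 2 + w1 s ^ 2 := by
        rw [← sq_abs (w s - v), ← sq_abs (w1 s)]
        nlinarith [sq_nonneg (|w s - v| - |w1 s|)]
      have h4 : 2 * ((w s - v) * w1 s) ≤ (w s - v) ^ 2 + w1 s ^ 2 := by
        nlinarith [sq_nonneg (w s - v - w1 s)]
      have h5 := mul_le_mul_of_nonneg_left h3 hK
      have h6 : 2 * (w s - v) * w1 s + 2 * w1 s * (-e (w s) - α * (|w1 s| ^ p * w1 s)) -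
          (K + 1) * ((w s - v) ^ 2 + w1 s ^ 2) ≤ 0 := by linarith
      have h7 := mul_nonpos_of_nonpos_of_nonneg h6 (Real.exp_pos (-(K + 1) * s)).le
      refine le_of_eq_of_le ?_ h7
      norm_num
      ring) ⟨le_rfl, ht.1.trans ht.2⟩ ht ht.1
  simp only [Pi.mul_apply, Pi.add_apply, Pi.pow_apply, hw, hw1, sub_self] at hm
  have h1 : (w t - v) ^ 2 + w1 t ^ 2 ≤ 0 := by
    refine le_of_mul_le_mul_right ?_ (Real.exp_pos (-(K + 1) * t))
    simpa using hm
  have h2 : (w t - v) ^ 2 = 0 := le_antisymm (by linarith [sq_nonneg (w1 t)]) (sq_nonneg _)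
  have := pow_eq_zero_iff (two_ne_zero) |>.mp h2
  linarith

theorem hasDerivAt_ite_le {f g : ℝ → ℝ} {a t₀ : ℝ} (hf : HasDerivAt f a t₀) (hg : HasDerivAt g a t₀)
    (h : f t₀ = g t₀) : HasDerivAt (fun t => if t ≤ t₀ then f t else g t) a t₀ := by
  have h1 : HasDerivWithinAt (fun t => if t ≤ t₀ then f t else g t) a (Iic t₀) t₀ :=
    hf.hasDerivWithinAt.congr (fun x hx => if_pos hx) (if_pos le_rfl)
  have h2 : HasDerivWithinAt (fun t => if t ≤ t₀ then f t else g t) a (Ici t₀) t₀ := by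
    refine hg.hasDerivWithinAt.congr (fun x hx => ?_) (by simp [h])
    rcases eq_or_lt_of_le (mem_Ici.mp hx) with h3 | h3
    · simp [← h3, h]
    · exact if_neg (not_le.mpr h3)
  have := h1.union h2
  rwa [Iic_union_Ici, hasDerivWithinAt_univ] at this

end KineticRelation

/-! ### What a travelling wave must do. -/

namespace KineticRelation

namespace IsMotionOn

variable {α p u up : ℝ} {e w w1 Y G : ℝ → ℝ} (h : IsMotionOn α p e w w1 univ)
include h

theorem energy_le (hα : 0 ≤ α) (hG : ∀ x, HasDerivAt G (e x) x)
    (hbot : Tendsto w atBot (𝓝 u)) (t : ℝ) : w1 t ^ 2 / 2 + G (w t) ≤ G u := by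
  have hanti := h.antitoneOn_energy hα convex_univ (fun t _ => hG (w t))
  -- The velocity is only known to vanish along some times, which suffices because the energy is
  -- monotone.
  obtain ⟨ξ, h1, h2⟩ := exists_tendsto_deriv_zero_atBot (fun t => h.pos t (mem_univ t)) hbot
  have h3 : Tendsto (fun s => w1 (ξ s) ^ 2 / 2 + G (w (ξ s))) atTop (𝓝 (0 ^ 2 / 2 + G u)) :=
    ((h2.pow 2).div_const 2).add ((hG u).continuousAt.tendsto.comp (hbot.comp h1))
  refine ge_of_tendsto (by simpa using h3) ?_
  filter_upwards [h1.eventually_le_atBot t] with s hs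
  exact hanti (mem_univ _) (mem_univ t) hs

theorem le_energy (hα : 0 ≤ α) (hG : ∀ x, HasDerivAt G (e x) x)
    (htop : Tendsto w atTop (𝓝 up)) (t : ℝ) : G up ≤ w1 t ^ 2 / 2 + G (w t) := by
  have hanti := h.antitoneOn_energy hα convex_univ (fun t _ => hG (w t))
  obtain ⟨ξ, h1, h2⟩ := exists_tendsto_deriv_zero (T := 0) (fun t _ => h.pos t (mem_univ t)) htop
  have h3 : Tendsto (fun s => w1 (ξ s) ^ 2 / 2 + G (w (ξ s))) atTop (𝓝 (0 ^ 2 / 2 + G up)) :=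
    ((h2.pow 2).div_const 2).add ((hG up).continuousAt.tendsto.comp (htop.comp h1))
  refine le_of_tendsto (by simpa using h3) ?_
  filter_upwards [h1.eventually_ge_atTop t] with s hs
  exact hanti (mem_univ t) (mem_univ _) hs

/-- A wave to a lower state stays below the left state, if the force pushes up above it. -/
theorem le_of_force_neg (hbot : Tendsto w atBot (𝓝 u)) (htop : Tendsto w atTop (𝓝 up))
    (hup : up < u) (he : ∀ x, u < x → e x < 0) (t : ℝ) : w t ≤ u := by
  have hd : ∀ t, HasDerivAt w (w1 t) t := fun t => h.pos t (mem_univ t)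
  have hc : Continuous w := continuous_iff_continuousAt.mpr fun t => (hd t).continuousAt
  by_contra! hlt
  -- At a maximum above `u` the particle would be at rest with positive acceleration.
  obtain ⟨s, hs⟩ := hc.exists_forall_ge' t (by
    rw [cocompact_eq_atBot_atTop]
    exact Filter.eventually_sup.mpr ⟨(hbot.eventually (gt_mem_nhds hlt)).mono fun _ h => h.le,
      (htop.eventually (gt_mem_nhds (hup.trans hlt))).mono fun _ h => h.le⟩)
  have hmax : IsLocalMax w s := Filter.Eventually.of_forall hs
  have h0 : w1 s = 0 := hmax.hasDerivAt_eq_zero (hd s)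
  have h1 := h.vel s (mem_univ s)
  have h2 := he (w s) (hlt.trans_le (hs t))
  rw [h0, mul_zero, mul_zero, sub_zero] at h1
  obtain ⟨x, -, hx⟩ := exists_gt_of_second_deriv_pos hd h1 h0 (by linarith) one_pos
  exact absurd (hs x) (not_le.mpr hx)

/-- A wave to a lower state departs downwards. -/
theorem velocity_nonpos {m t₀ : ℝ} (hbot : Tendsto w atBot (𝓝 u)) (hwu : ∀ t, w t ≤ u)
    (he : ∀ x ∈ Ioo m u, 0 < e x) (hm : ∀ t < t₀, m < w t) : ∀ t ≤ t₀, w1 t ≤ 0 := by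
  have hd : ∀ t, HasDerivAt w (w1 t) t := fun t => h.pos t (mem_univ t)
  have hc : Continuous w := continuous_iff_continuousAt.mpr fun t => (hd t).continuousAt
  -- If `w` were rising at `y`, it would have a minimum over all earlier times, where the force
  -- still accelerates it downwards.
  intro y hy
  by_contra! hpos
  obtain ⟨z, hzy, hz⟩ : ∃ z < y, w z < w y := by
    have h1 := ((hd y).tendsto_slope.mono_left (nhdsWithin_mono y
      (fun x hx => (ne_of_lt hx : x ≠ y)) : 𝓝[<] y ≤ 𝓝[≠] y)).eventually (lt_mem_nhds hpos)
    obtain ⟨z, hz1, hz2⟩ := (h1.and self_mem_nhdsWithin).exists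
    refine ⟨z, hz2, ?_⟩
    rw [slope_def_field] at hz1
    have : z - y < 0 := sub_neg.mpr hz2
    by_contra! hge
    exact absurd hz1 (not_lt.mpr (div_nonpos_of_nonneg_of_nonpos (by linarith) this.le))
  obtain ⟨T, hT⟩ := eventually_atBot.mp (hbot.eventually (lt_mem_nhds (hz.trans_le (hwu y))))
  obtain ⟨s, hs, hmin⟩ := isCompact_Icc.exists_isMinOn (s := Icc (min T z) y)
    ⟨z, min_le_right _ _, hzy.le⟩ hc.continuousOn
  have hsz : w s ≤ w z := hmin ⟨min_le_right _ _, hzy.le⟩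
  have hglob : ∀ x ≤ y, w s ≤ w x := fun x hx => by
    rcases le_total (min T z) x with h1 | h1
    · exact hmin ⟨h1, hx⟩
    · exact hsz.trans (hT x (h1.trans (min_le_left _ _))).le
  have hsy : s < y := lt_of_le_of_ne hs.2 (by rintro rfl; exact absurd hz (not_lt.mpr hsz))
  have h0 : w1 s = 0 := by
    refine IsLocalMin.hasDerivAt_eq_zero ?_ (hd s)
    filter_upwards [Iio_mem_nhds hsy] with x hx
    exact hglob x (le_of_lt hx)
  have h1 := h.vel s (mem_univ s)
  have h2 := he (w s) ⟨hm s (hsy.trans_le hy), (hsz.trans_lt hz).trans_le (hwu y)⟩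
  rw [h0, mul_zero, mul_zero, sub_zero] at h1
  obtain ⟨x, hx, hx'⟩ := exists_gt_of_second_deriv_pos (w := fun t => -w t) (w1 := fun t => -w1 t)
    (δ := y - s) (fun t => (hd t).neg) h1.neg (by simp [h0]) (by linarith) (by linarith)
  have := hglob x (by linarith [hx.2])
  linarith

/-- A wave to a lower state follows the energy profile until its velocity vanishes. -/
theorem profile_alternative (hα : 0 ≤ α) (hp : 0 ≤ p)
    (hbot : Tendsto w atBot (𝓝 u)) (htop : Tendsto w atTop (𝓝 up)) (hup : up < u)
    (hneg : ∀ x, u < x → e x < 0) {m₀ : ℝ} (hm₀ : m₀ < u) (hpos : ∀ x ∈ Ioo m₀ u, 0 < e x)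
    (hY : IsEnergyProfile α ((p + 1) / 2) (fun s => e (u - s)) Y)
    (hYpos : ∀ x ∈ Ioo m₀ u, 0 < Y (u - x)) :
    Y (u - up) = 0 ∨ ∃ T, w1 T = 0 ∧ e (w T) ≤ 0 ∧ w T < u ∧ Y (u - w T) = 0 ∧
      ∀ x ∈ Ico (w T) u, 0 ≤ Y (u - x) := by
  have hd : ∀ t, HasDerivAt w (w1 t) t := fun t => h.pos t (mem_univ t)
  have hc : Continuous w := continuous_iff_continuousAt.mpr fun t => (hd t).continuousAt
  have hwu := h.le_of_force_neg hbot htop hup hneg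
  obtain ⟨m, hm1, hm2⟩ := exists_between (max_lt hm₀ hup)
  have hmm₀ : m₀ < m := (le_max_left _ _).trans_lt hm1
  have hmup : up < m := (le_max_right _ _).trans_lt hm1
  set S := {t | w t ≤ m} with hS
  have hScl : IsClosed S := isClosed_le hc continuous_const
  have hSne : S.Nonempty := ((htop.eventually (gt_mem_nhds hmup)).exists).imp fun _ h => h.le
  have hSb : BddBelow S := by
    obtain ⟨T, hT⟩ := eventually_atBot.mp (hbot.eventually (lt_mem_nhds hm2))
    refine ⟨T, fun t ht => ?_⟩
    by_contra! hlt
    exact absurd ht (not_le.mpr (hT t hlt.le))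
  have hTS : sInf S ∈ S := hScl.csInf_mem hSne hSb
  set t₀ := sInf S
  have hlt : ∀ t < t₀, m < w t := fun t ht => by
    by_contra! hle
    exact absurd (csInf_le hSb (show t ∈ S from hle)) (not_le.mpr ht)
  have hwt₀ : w t₀ = m := by
    refine le_antisymm hTS (ge_of_tendsto
      (hc.continuousAt.tendsto.mono_left nhdsWithin_le_nhds : Tendsto w (𝓝[<] t₀) (𝓝 (w t₀))) ?_)
    filter_upwards [self_mem_nhdsWithin] with t ht
    exact (hlt t ht).le
  have hv := h.velocity_nonpos hbot hwu (fun x hx => hpos x ⟨hmm₀.trans hx.1, hx.2⟩) hlt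
  -- The squared distance to the profile is nonincreasing and tends to zero along times going to
  -- `-∞`, hence vanishes.
  have hgap : ∀ t ≤ t₀, w1 t ^ 2 / 2 = Y (u - w t) := by
    intro t ht
    obtain ⟨ξ, h1, h2⟩ := exists_tendsto_deriv_zero_atBot hd hbot
    have hanti := (h.mono (subset_univ (Iic t₀))).antitoneOn_sq_gap hα hp (convex_Iic t₀) hY
      (fun t _ => hwu t) hv
    have hYc : Tendsto Y (𝓝 0) (𝓝 0) := by
      have := (hY.2 0 le_rfl).continuousAt.tendsto
      rwa [hY.1] at this
    have h4 : Tendsto (fun s => u - w (ξ s)) atTop (𝓝 0) := by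
      simpa using (hbot.comp h1).const_sub u
    have h3 : Tendsto (fun s => (w1 (ξ s) ^ 2 / 2 - Y (u - w (ξ s))) ^ 2) atTop (𝓝 0) := by
      simpa using ((((h2.pow 2).div_const 2).sub (hYc.comp h4)).pow 2)
    have h5 : (w1 t ^ 2 / 2 - Y (u - w t)) ^ 2 ≤ 0 := by
      refine ge_of_tendsto h3 ?_
      filter_upwards [h1.eventually_le_atBot t] with s hs
      exact hanti (hs.trans ht) ht hs
    have h6 := pow_eq_zero_iff (two_ne_zero) |>.mp (le_antisymm h5 (sq_nonneg _))
    linarith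
  have hvt₀ : w1 t₀ < 0 := by
    refine lt_of_le_of_ne (hv t₀ le_rfl) (fun h0 => ?_)
    have h1 := hgap t₀ le_rfl
    have h2 := hYpos (w t₀) ⟨by linarith, by linarith⟩
    rw [h0] at h1
    norm_num at h1
    linarith
  rcases (h.mono (subset_univ (Ici t₀))).follow_profile hα hp hY (hwu t₀) hvt₀ (hgap t₀ le_rfl) with
    h1 | ⟨T, hT, hT1, hT2, hT3, -, hT4⟩
  · left
    have hYc : Tendsto (fun t => Y (u - w t)) atTop (𝓝 (Y (u - up))) :=
      (hY.2 (u - up) (by linarith)).continuousAt.tendsto.comp (htop.const_sub u)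
    -- The velocity is a continuous function of the position on the profile, so it converges; its
    -- limit must be zero.
    have h2 : Tendsto w1 atTop (𝓝 (-√(2 * Y (u - up)))) := by
      refine ((hYc.const_mul 2).sqrt.neg).congr' ?_
      filter_upwards [eventually_ge_atTop t₀] with t ht
      obtain ⟨h3, -, h4⟩ := h1 t ht
      rw [← h4, mul_div_cancel₀ _ two_ne_zero, Real.sqrt_sq_eq_abs, abs_of_neg h3, neg_neg]
    have h3 := eq_zero_of_tendsto_deriv (T := 0) (fun t _ => hd t) htop h2
    have h4 : Y (u - up) ≤ 0 := by
      have := Real.sqrt_eq_zero'.mp (neg_eq_zero.mp h3)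
      linarith
    have h5 : 0 ≤ Y (u - up) := by
      refine ge_of_tendsto hYc ?_
      filter_upwards [eventually_ge_atTop t₀] with t ht
      rw [← (h1 t ht).2.2]
      positivity
    exact le_antisymm h4 h5
  · right
    have hTt : T ∈ Icc t₀ T := ⟨hT.le, le_rfl⟩
    have hwT : w T < u := (hT3 ⟨le_rfl, hT.le⟩ hTt hT.le).trans_lt (by linarith)
    refine ⟨T, hT1, hT2, hwT, ?_, fun x hx => ?_⟩
    · rw [← (hT4 T hTt).2.2, hT1]; simp
    · obtain ⟨b, hb⟩ := (hbot.eventually (lt_mem_nhds hx.2)).exists_forall_of_atBot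
      obtain ⟨s, hs, hsx⟩ := intermediate_value_Icc' (min_le_right b T) hc.continuousOn
        ⟨hx.1, (hb _ (min_le_left b T)).le⟩
      rw [← hsx]
      rcases le_total s t₀ with h2 | h2
      · rw [← hgap s h2]; positivity
      · rw [← (hT4 s ⟨h2, hs.2⟩).2.2]; positivity

end IsMotionOn

end KineticRelation

/-! ### Necessary conditions on the right state. -/

namespace KineticRelation

namespace Flux

variable {f f1 f2 : ℝ → ℝ} (F : Flux f f1 f2)
include F

theorem exists_abs_excess_sub_le (u lam N : ℝ) :
    ∃ K, 0 ≤ K ∧ ∀ x ∈ Icc (-N) N, ∀ y ∈ Icc (-N) N,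
      |excess f u lam x - excess f u lam y| ≤ K * |x - y| := by
  obtain ⟨K, hK⟩ := isCompact_Icc.exists_bound_of_continuousOn (s := Icc (-N) N)
    (f := fun x => lam - f1 x) (continuous_const.sub F.continuous1).continuousOn
  refine ⟨max K 0, le_max_right _ _, fun x hx y hy => ?_⟩
  exact (convex_Icc (-N) N).norm_image_sub_le_of_norm_hasDerivWithin_le
    (fun z _ => (F.hasDerivAt_excess u lam z).hasDerivWithinAt)
    (fun z hz => (hK z hz).trans (le_max_left _ _)) hy hx

/-- A primitive of the excess. -/
theorem exists_primitive_excess (u lam : ℝ) :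
    ∃ G : ℝ → ℝ, (∀ x, HasDerivAt G (excess f u lam x) x) ∧
      ∀ v, v < u → lam = chordSpeed f u v → G u - G v = chordArea f u v := by
  refine ⟨fun x => lam * (x - u) ^ 2 / 2 + f u * x - ∫ t in (0 : ℝ)..x, f t, fun x => ?_, ?_⟩
  · have h := (((((hasDerivAt_id x).sub_const u).pow 2).const_mul lam).div_const 2).add
      ((hasDerivAt_id x).const_mul (f u)) |>.sub (F.hasDerivAt_primitive x)
    refine h.congr_deriv ?_
    simp [excess]
    ring
  · intro v hv hlam
    have h1 := chordSpeed_mul (f := f) hv.ne'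
    rw [← hlam] at h1
    rw [F.chordArea_eq]
    linear_combination (-(u - v) / 2) * h1

theorem strictMonoOn_chordSpeed_Ioi {u : ℝ} (hu : 0 ≤ u) :
    StrictMonoOn (chordSpeed f u) (Ioi u) := by
  refine strictMonoOn_of_hasDerivAt_pos (convex_Ioi _)
    (fun x hx => F.hasDerivAt_chordSpeed (ne_of_gt hx)) (fun x hx => ?_)
  rw [interior_Ioi] at hx
  have hx' : u < x := hx
  have h1 := F.tangentGap_neg (hu.trans hx'.le) hu hx'.ne'
  have h2 : 0 < (u - x) ^ 2 := by
    have : 0 < (x - u) ^ 2 := pow_pos (by linarith) 2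
    linarith
  exact div_pos (by linarith) h2

/-- Below the companion, down to the state itself, the chord is slower. -/
theorem chordSpeed_lt_of_mem_Ioo {u v c x : ℝ} (hu : 0 < u) (hv : v ≤ tangentState f f1 u)
    (hc : c ∈ Ico (tangentState f f1 u) u) (h : chordSpeed f u c = chordSpeed f u v)
    (hx : x ∈ Ioo v c) : chordSpeed f u x < chordSpeed f u v := by
  rcases le_total x (tangentState f f1 u) with h1 | h1
  · exact F.strictAntiOn_chordSpeed hu (mem_Iic.mpr hv) (mem_Iic.mpr h1) hx.1
  · rw [← h]
    exact F.strictMonoOn_chordSpeed hu ⟨h1, hx.2.trans hc.2⟩ hc hx.2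

variable {α p u up : ℝ} {w w1 : ℝ → ℝ}

/-- The potential is strictly larger at `up` than at `u`, and the total energy cannot increase. -/
theorem not_wave_up (hα : 0 ≤ α) (hu : 0 ≤ u) (hup : u < up)
    (h : IsMotionOn α p (excess f u (chordSpeed f u up)) w w1 univ)
    (hbot : Tendsto w atBot (𝓝 u)) (htop : Tendsto w atTop (𝓝 up)) : False := by
  obtain ⟨G, hG, -⟩ := F.exists_primitive_excess u (chordSpeed f u up)
  have h1 := And.intro (h.le_energy hα hG htop 0) (h.energy_le hα hG hbot 0)
  have h2 := strictMonoOn_of_hasDerivAt_pos (convex_Icc u up) (fun x _ => hG x) (fun x hx => by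
    rw [interior_Icc] at hx
    have h3 := F.strictMonoOn_chordSpeed_Ioi hu (mem_Ioi.mpr hx.1) (mem_Ioi.mpr hup) hx.2
    rw [excess_eq_mul hx.1.ne]
    exact mul_pos_of_neg_of_neg (by linarith [hx.1]) (by linarith)) ⟨le_rfl, hup.le⟩
    ⟨hup.le, le_rfl⟩ hup
  linarith [h1.1, h1.2]

/-- Right states of travelling waves are either the kinetic state or above its companion. -/
theorem eq_or_lt_of_wave (hα : 0 < α) (hp : 0 ≤ p) (hu : 0 < u) (hup : up < u) {c : ℝ}
    (hc : c ∈ Ico (tangentState f f1 u) u)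
    (hcv : chordSpeed f u c = chordSpeed f u (kineticState α ((p + 1) / 2) f f1 u))
    (h : IsMotionOn α p (excess f u (chordSpeed f u up)) w w1 univ)
    (hbot : Tendsto w atBot (𝓝 u)) (htop : Tendsto w atTop (𝓝 up)) :
    up = kineticState α ((p + 1) / 2) f f1 u ∨ c < up := by
  have hq : 0 < (p + 1) / 2 := by positivity
  obtain ⟨hv1, hv2, hv3⟩ := F.kineticState_spec hα hq hu
  have hFneg := fun x => F.arrivalEnergy_neg_of_lt_kineticState (v := x) hα hq hu
  have hFpos := fun x => F.arrivalEnergy_pos_of_gt_kineticState (v := x) hα hq hu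
  set v := kineticState α ((p + 1) / 2) f f1 u
  obtain ⟨G, hG, hGA⟩ := F.exists_primitive_excess u (chordSpeed f u up)
  have hE := fun t => And.intro (h.le_energy hα.le hG htop t) (h.energy_le hα.le hG hbot t)
  -- The potential drop along the wave is the chord area, which must be nonnegative.
  have hzero : zeroState f f1 u ≤ up := by
    by_contra! hlt
    have h1 := F.chordArea_neg_of_lt hu hlt
    have h2 := hGA up hup rfl
    linarith [(hE 0).1, (hE 0).2]
  have hlt1 := F.chordSpeed_lt_of_zeroState_le hu hzero hup
  obtain ⟨c', hc', hcc'⟩ := F.exists_companion hu (F.chordSpeed_tangentState_le hu hup) hlt1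
  have hYdef : ∀ x, arrivalEnergy α ((p + 1) / 2) f u x =
    profile α ((p + 1) / 2) f u (chordSpeed f u x) (u - x) := fun _ => rfl
  have hpos : ∀ x ∈ Ioo c' u, chordSpeed f u up < chordSpeed f u x := fun x hx => by
    rw [← hcc']
    exact F.strictMonoOn_chordSpeed hu hc' ⟨hc'.1.trans hx.1.le, hx.2⟩ hx.1
  have halt := h.profile_alternative hα.le hp hbot htop hup
    (fun x hx => by
      have := F.lt_chordSpeed_of_gt hu.le hx
      rw [excess_eq_mul hx.ne]
      exact mul_neg_of_neg_of_pos (by linarith) (by linarith))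
    hc'.2 (fun x hx => excess_pos hx.2 (hpos x hx))
    (F.isEnergyProfile hα.le hq u (chordSpeed f u up))
    (fun x hx => F.profile_pos hα.le hq hpos hx)
  have hYup := hYdef up
  have hev : ∀ T, excess f u (chordSpeed f u up) (w T) ≤ 0 → w T < u →
      chordSpeed f u (w T) ≤ chordSpeed f u up := fun T hT hT' => by
    by_contra! hlt
    exact absurd hT (not_le.mpr (excess_pos hT' hlt))
  rcases lt_trichotomy up v with hv | hv | hv
  -- The profile is negative at `up`, so the motion stops above it, at a point of lower potential
  -- than `up`; it can never climb there.
  · exfalso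
    have hF := hFneg up hv
    rcases halt with h0 | ⟨T, hT1, hT2, hT3, -, hT5⟩
    · linarith
    have h1 : up < w T := by
      by_contra! hle
      linarith [hT5 up ⟨hle, hup⟩]
    have h2 : w T ≤ c' := by
      by_contra! hlt
      exact absurd (hpos (w T) ⟨hlt, hT3⟩) (not_lt.mpr (hev T hT2 hT3))
    have h3 := strictAntiOn_of_hasDerivAt_neg (convex_Icc up c') (fun x _ => hG x)
      (fun x hx => by
        rw [interior_Icc] at hx
        exact excess_neg (hx.2.trans hc'.2)
          (F.chordSpeed_lt_of_mem_Ioo hu (hv.le.trans hv2) hc' hcc' hx)) ⟨le_rfl, h1.le.trans h2⟩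
      ⟨h1.le, h2⟩ h1
    have h4 := (hE T).1
    rw [hT1] at h4
    norm_num at h4
    linarith
  · exact Or.inl hv
  · rcases le_or_gt up (tangentState f f1 u) with ht | ht
    -- The profile is positive at `up`, so the motion would have to stop. It cannot stop left of
    -- `up`, where the force still pushes down, nor to its right, since a vanishing energy there
    -- would be negative on arrival at `up`.
    · exfalso
      have hF := hFpos up hv ht
      rcases halt with h0 | ⟨T, hT1, hT2, hT3, hT4, -⟩
      · linarith
      rcases lt_trichotomy (w T) up with h1 | h1 | h1
      · exact absurd (F.strictAntiOn_chordSpeed hu (mem_Iic.mpr (h1.le.trans ht))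
          (mem_Iic.mpr ht) h1) (not_lt.mpr (hev T hT2 hT3))
      · rw [h1] at hT4
        linarith
      · have h2 : w T ≤ c' := by
          by_contra! hlt
          exact absurd (hpos (w T) ⟨hlt, hT3⟩) (not_lt.mpr (hev T hT2 hT3))
        have := F.profile_neg_of_nonpos hα.le hq h1 hT3.le (fun x hx =>
          F.chordSpeed_lt_of_mem_Ioo hu ht hc' hcc' ⟨hx.1, hx.2.trans_le h2⟩) hT4.le
        linarith
    · right
      by_contra! hle
      have hupI : up ∈ Ico (tangentState f f1 u) u := ⟨ht.le, hup⟩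
      have hlam := (F.strictMonoOn_chordSpeed hu).monotoneOn hupI hc hle
      have hlamt := F.strictMonoOn_chordSpeed hu ⟨le_rfl, F.tangentState_lt hu⟩ hupI ht
      have hcont : ContinuousOn (chordSpeed f u) (Icc v (tangentState f f1 u)) := fun x hx =>
        (F.hasDerivAt_chordSpeed (hx.2.trans_lt (F.tangentState_lt hu)).ne).continuousAt.continuousWithinAt
      -- The other state on the same chord, to the left of the tangent state. The profile stays
      -- positive above it, so the motion passes `up` and could only stop at `v'`, where it would
      -- remain.
      obtain ⟨v', hv', hvv'⟩ := intermediate_value_Icc' hv2 hcont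
        (show chordSpeed f u up ∈ Icc _ _ from ⟨hlamt.le, by rw [← hcv]; exact hlam⟩)
      have hF : 0 ≤ arrivalEnergy α ((p + 1) / 2) f u v' := by
        rcases eq_or_lt_of_le hv'.1 with h1 | h1
        · rw [← h1, hv3]
        · exact (hFpos v' h1 hv'.2).le
      rw [hYdef, hvv'] at hF
      have hvup : v' < up := hv'.2.trans_lt ht
      have hYpos : ∀ x ∈ Ioc v' up,
          0 < profile α ((p + 1) / 2) f u (chordSpeed f u up) (u - x) := by
        intro x hx
        by_contra! hle
        have := F.profile_neg_of_nonpos hα.le hq hx.1 (hx.2.trans hup.le) (fun y hy => by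
          rw [← hvv']
          exact F.chordSpeed_lt_of_mem_Ioo hu hv'.2 hupI hvv'.symm
            ⟨hy.1, hy.2.trans_le hx.2⟩) hle
        linarith
      rcases halt with h0 | ⟨T, hT1, hT2, hT3, hT4, -⟩
      · linarith [hYpos up ⟨hvup, le_rfl⟩]
      have hTup : w T ≤ up := by
        by_contra! hlt
        exact absurd (F.strictMonoOn_chordSpeed hu hupI ⟨ht.le.trans hlt.le, hT3⟩ hlt)
          (not_lt.mpr (hev T hT2 hT3))
      rcases lt_trichotomy (w T) v' with h1 | h1 | h1
      · have := F.strictAntiOn_chordSpeed hu (mem_Iic.mpr (h1.le.trans hv'.2))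
          (mem_Iic.mpr hv'.2) h1
        rw [hvv'] at this
        exact absurd this (not_lt.mpr (hev T hT2 hT3))
      · have hrest : ∀ t, T ≤ t → w t = v' := by
          intro t htT
          have hwc : ContinuousOn w (Icc T t) := fun s _ =>
            (h.pos s (mem_univ s)).continuousAt.continuousWithinAt
          obtain ⟨N, hN⟩ := isCompact_Icc.exists_bound_of_continuousOn hwc
          obtain ⟨K, hK, hKe⟩ := F.exists_abs_excess_sub_le u (chordSpeed f u up) N
          have hmem : ∀ s ∈ Icc T t, w s ∈ Icc (-N) N := fun s hs => abs_le.mp (hN s hs)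
          refine (h.mono (subset_univ (Icc T t))).eq_of_rest hα.le hK (fun s hs => ?_) h1 hT1 t
            ⟨htT, le_rfl⟩
          have h2 := hKe (w s) (hmem s hs) v' (h1 ▸ hmem T ⟨le_rfl, htT⟩)
          rwa [← hvv', excess_chordSpeed (by linarith), sub_zero, hvv'] at h2
        have := tendsto_nhds_unique htop ((tendsto_const_nhds (x := v')).congr'
          ((eventually_ge_atTop T).mono fun t ht => (hrest t ht).symm))
        linarith
      · linarith [hYpos (w T) ⟨h1, hTup⟩]

end Flux

end KineticRelation

/-! ### Departure from the unstable rest point. -/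

namespace KineticRelation

/-- The square root of an energy profile that leaves `0` transversally is Lipschitz. -/
theorem IsEnergyProfile.exists_sqrt_bounds {α p d S : ℝ} {H Y : ℝ → ℝ} (hα : 0 ≤ α) (hp : 0 ≤ p)
    (hd : 0 < d) (hS : 0 < S) (hS1 : S ≤ 1) (hY : IsEnergyProfile α ((p + 1) / 2) H Y)
    (h1 : ∀ s ∈ Icc 0 S, d / 2 * s ≤ H s) (h2 : ∀ s ∈ Icc 0 S, H s ≤ 2 * d * s) :
    ∃ κ K, 0 < κ ∧ 0 < K ∧ (∀ s ∈ Icc 0 S, κ * s ≤ √(2 * Y s)) ∧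
      (∀ s ∈ Icc 0 S, 0 ≤ Y s) ∧
      ∀ x ∈ Icc 0 S, ∀ y ∈ Icc 0 S, |√(2 * Y x) - √(2 * Y y)| ≤ K * |x - y| := by
  -- Chosen so that `(κ * s) ^ 2 / 2` is a subsolution near zero: as `κ * s ≤ 1`, its damping is at
  -- most `κ * s`, and `κ * (1 + α) ≤ d / 2`.
  set κ := min 1 (d / (2 * (1 + α)))
  have hκ0 : 0 < κ := lt_min one_pos (by positivity)
  have hκ1 : κ ≤ 1 := min_le_left _ _
  have hκ2 : κ * (1 + α) ≤ d / 2 := by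
    have : κ ≤ d / (2 * (1 + α)) := min_le_right _ _
    rw [le_div_iff₀ (by positivity)] at this
    linarith
  have hlow : ∀ s ∈ Icc 0 S, (κ * s) ^ 2 / 2 ≤ Y s := by
    refine le_of_deriv_le_of_lt (f' := fun s => κ ^ 2 * s) (fun s _ => ?_)
      (fun s hs => hY.2 s hs.1) (by simp [hY.1]) (fun s hs hlt => ?_)
    · refine ((((hasDerivAt_id s).const_mul κ).pow 2).div_const 2).congr_deriv ?_
      simp; ring
    · have h3 := damp_mono (by positivity : 0 ≤ (p + 1) / 2) hlt.le
      have h0 : 0 ≤ κ * s := mul_nonneg hκ0.le hs.1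
      rw [damp_sq_half hp, abs_of_nonneg h0] at h3
      have h4 : (κ * s) ^ p ≤ 1 := Real.rpow_le_one h0 (by nlinarith [hs.1, hs.2]) hp
      have h5 : (κ * s) ^ p * (κ * s) ≤ κ * s := by nlinarith
      have h6 := mul_le_mul_of_nonneg_left (h3.trans h5) hα
      have h7 := h1 s hs
      have h8 := mul_le_mul_of_nonneg_right hκ2 hs.1
      have h9 : κ ^ 2 * s ≤ κ * s := by nlinarith
      linarith
  have hup := hY.le_quadratic hα h2
  have hnn : ∀ s ∈ Icc 0 S, 0 ≤ Y s := fun s hs => le_trans (by positivity) (hlow s hs)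
  have hφlow : ∀ s ∈ Icc 0 S, κ * s ≤ √(2 * Y s) := fun s hs =>
    Real.le_sqrt_of_sq_le (by linarith [hlow s hs])
  have hφup : ∀ s ∈ Icc 0 S, √(2 * Y s) ≤ √(2 * d) * s := fun s hs => by
    rw [Real.sqrt_le_left (by have := hs.1; positivity), mul_pow, Real.sq_sqrt (by positivity)]
    linarith [hup s hs]
  set M := √(2 * d) * S
  set K₀ := 2 * d / κ + α * M ^ p
  have hM : 0 ≤ M := by positivity
  have hK₀ : 0 ≤ K₀ := by positivity
  have hd1 : ∀ s ∈ Ioc 0 S, HasDerivAt (fun s => √(2 * Y s))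
      ((2 * (H s - α * damp ((p + 1) / 2) (Y s))) / (2 * √(2 * Y s))) s := fun s hs => by
    have h3 := hlow s ⟨hs.1.le, hs.2⟩
    have h4 : 0 < (κ * s) ^ 2 := by have := hs.1; positivity
    exact ((hY.2 s hs.1.le).const_mul 2).sqrt (by linarith)
  have hd2 : ∀ s ∈ Ioc 0 S,
      ‖(2 * (H s - α * damp ((p + 1) / 2) (Y s))) / (2 * √(2 * Y s))‖ ≤ K₀ := fun s hs => by
    have hs' : s ∈ Icc 0 S := ⟨hs.1.le, hs.2⟩
    have h3 := hφlow s hs'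
    have h4 : 0 < κ * s := mul_pos hκ0 hs.1
    set x := √(2 * Y s) with hx
    have hx0 : 0 < x := h4.trans_le h3
    have hYx : Y s = x ^ 2 / 2 := by
      rw [hx, Real.sq_sqrt (by linarith [hnn s hs'])]
      ring
    have hxM : x ≤ M := (hφup s hs').trans (mul_le_mul_of_nonneg_left hs.2 (by positivity))
    rw [hYx, damp_sq_half hp, abs_of_pos hx0, mul_div_mul_left _ _ two_ne_zero, Real.norm_eq_abs,
      abs_div, abs_of_pos hx0, div_le_iff₀ hx0]
    have h5 : x ^ p ≤ M ^ p := Real.rpow_le_rpow hx0.le hxM hp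
    have h6 : 0 ≤ α * (x ^ p * x) := by positivity
    have h7 : α * (x ^ p * x) ≤ α * M ^ p * x := by
      rw [mul_assoc]
      gcongr
    have h8 : 2 * d * s ≤ 2 * d / κ * x := by
      rw [div_mul_eq_mul_div, le_div_iff₀ hκ0]
      nlinarith
    have h9 := h1 s hs'
    have h10 := h2 s hs'
    have h11 : 0 ≤ d / 2 * s := by have := hs.1; positivity
    have : K₀ * x = 2 * d / κ * x + α * M ^ p * x := by ring
    rw [abs_le]
    constructor <;> linarith
  refine ⟨κ, K₀ + √(2 * d), hκ0, by positivity, hφlow, hnn, ?_⟩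
  have h0 : √(2 * Y 0) = 0 := by simp [hY.1]
  have hz : ∀ y ∈ Icc 0 S, √(2 * Y y) ≤ (K₀ + √(2 * d)) * y := fun y hy =>
    (hφup y hy).trans (mul_le_mul_of_nonneg_right (by linarith) hy.1)
  intro x hx y hy
  rcases eq_or_lt_of_le hx.1 with hx0 | hx0
  · rw [← hx0, h0, zero_sub, zero_sub, abs_neg, abs_neg, abs_of_nonneg (Real.sqrt_nonneg _),
      abs_of_nonneg hy.1]
    exact hz y hy
  rcases eq_or_lt_of_le hy.1 with hy0 | hy0
  · rw [← hy0, h0, sub_zero, sub_zero, abs_of_nonneg (Real.sqrt_nonneg _), abs_of_nonneg hx.1]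
    exact hz x hx
  refine ((convex_Ioc 0 S).norm_image_sub_le_of_norm_hasDerivWithin_le
    (fun s hs => (hd1 s hs).hasDerivWithinAt) hd2 ⟨hy0, hy.2⟩ ⟨hx0, hx.2⟩).trans ?_
  exact mul_le_mul_of_nonneg_right (by linarith [Real.sqrt_nonneg (2 * d)]) (abs_nonneg _)

/-- The backward orbit of a scalar equation into its rest point `0`. -/
theorem exists_backward_orbit {φ : ℝ → ℝ} {S κ K : ℝ} (hS : 0 < S) (hκ : 0 < κ) (hK : 0 ≤ K)
    (h0 : φ 0 = 0) (hlow : ∀ s ∈ Icc 0 S, κ * s ≤ φ s)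
    (hlip : ∀ x ∈ Icc 0 S, ∀ y ∈ Icc 0 S, |φ x - φ y| ≤ K * |x - y|) :
    ∃ s : ℝ → ℝ, s 0 = S ∧ (∀ t ≤ 0, s t ∈ Ioc 0 S ∧ HasDerivAt s (φ (s t)) t) ∧
      Tendsto s atBot (𝓝 0) := by
  set cl : ℝ → ℝ := fun x => max 0 (min x S)
  have hcl : ∀ x, cl x ∈ Icc 0 S := fun x =>
    ⟨le_max_left _ _, max_le hS.le (min_le_right _ _)⟩
  have hcleq : ∀ x ∈ Icc 0 S, cl x = x := fun x hx => by
    simp [cl, min_eq_left hx.2, max_eq_right hx.1]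
  have hcl1 : LipschitzWith 1 cl := (LipschitzWith.id.min_const S).const_max 0
  have hgl : ∀ x y, |φ (cl x) - φ (cl y)| ≤ K * |x - y| := fun x y =>
    (hlip _ (hcl x) _ (hcl y)).trans (mul_le_mul_of_nonneg_left
      (by simpa [Real.dist_eq] using hcl1.dist_le_mul x y) hK)
  have hg0 : φ (cl 0) = 0 := by rw [hcleq 0 ⟨le_rfl, hS.le⟩, h0]
  have hgnn : ∀ x, 0 ≤ φ (cl x) := fun x =>
    (mul_nonneg hκ.le (hcl x).1).trans (hlow _ (hcl x))
  obtain ⟨s, hs0, hsd⟩ := exists_global_integralCurve (fun _ x => φ (cl x))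
    (fun _ => continuous_const) (fun N => ⟨⟨K, hK⟩, ⟨K * S, by positivity⟩, fun t _ =>
      ⟨LipschitzWith.of_dist_le_mul fun x y => by
        rw [Real.dist_eq, Real.dist_eq]
        exact hgl x y, fun x => by
        have h1 := hlip _ (hcl x) 0 ⟨le_rfl, hS.le⟩
        rw [h0, sub_zero, sub_zero, abs_of_nonneg (hcl x).1] at h1
        exact h1.trans (mul_le_mul_of_nonneg_left (hcl x).2 hK)⟩⟩) S
  have hmono : MonotoneOn s univ :=
    monotoneOn_of_hasDerivAt_nonneg convex_univ (fun t _ => hsd t) (fun t _ => hgnn _)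
  have hle : ∀ t ≤ 0, s t ≤ S := fun t ht => hs0 ▸ hmono (mem_univ t) (mem_univ 0) ht
  have hexp : ∀ c t, HasDerivAt (fun t => Real.exp (-(c * t))) (Real.exp (-(c * t)) * -c) t :=
    fun c t => by simpa using ((hasDerivAt_id t).const_mul c).neg.exp
  -- Growth is at most exponential, so `s ^ 2 * exp (-2 K t)` is nonincreasing; a zero in the past
  -- would force `s 0 = 0`.
  have hne : ∀ t ≤ 0, s t ≠ 0 := fun t ht hst => by
    have h1 := antitoneOn_of_hasDerivAt_nonpos convex_univ
      (fun t _ => ((hsd t).pow 2).mul (hexp (2 * K) t)) (fun t _ => by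
        have h2 := hgl (s t) 0
        rw [hg0, sub_zero, sub_zero, abs_of_nonneg (hgnn _)] at h2
        have h3 : s t * φ (cl (s t)) ≤ K * s t ^ 2 := by
          rw [← sq_abs]
          nlinarith [le_abs_self (s t), abs_nonneg (s t), hgnn (s t)]
        have h4 := mul_nonneg (sub_nonneg.mpr h3) (Real.exp_pos (-(2 * K * t))).le
        norm_num
        linarith) (mem_univ t) (mem_univ 0) ht
    simp only [Pi.mul_apply, Pi.pow_apply, hst, hs0] at h1
    norm_num at h1
    linarith [pow_pos hS 2]
  have hc : Continuous s := continuous_iff_continuousAt.mpr fun t => (hsd t).continuousAt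
  have hpos : ∀ t ≤ 0, 0 < s t := fun t ht => by
    by_contra! hle0
    obtain ⟨x, hx, hx0⟩ := intermediate_value_Icc ht hc.continuousOn
      (show (0 : ℝ) ∈ Icc (s t) (s 0) from ⟨hle0, hs0 ▸ hS.le⟩)
    exact hne x hx.2 hx0
  refine ⟨s, hs0, fun t ht => ⟨⟨hpos t ht, hle t ht⟩, ?_⟩, ?_⟩
  · have := hsd t
    rwa [hcleq _ ⟨(hpos t ht).le, hle t ht⟩] at this
  -- Growth is at least exponential with rate `κ`, hence decay to zero backwards in time.
  · have h1 := monotoneOn_of_hasDerivAt_nonneg (convex_Iic 0)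
      (fun t _ => (hsd t).mul (hexp κ t)) (fun t ht => by
        have h2 := hlow _ ⟨(hpos t ht).le, hle t ht⟩
        rw [hcleq _ ⟨(hpos t ht).le, hle t ht⟩]
        have := mul_nonneg (sub_nonneg.mpr h2) (Real.exp_pos (-(κ * t))).le
        linarith)
    have h2 : ∀ t ≤ 0, s t ≤ S * Real.exp (κ * t) := fun t ht => by
      have h3 := h1 (mem_Iic.mpr ht) (mem_Iic.mpr le_rfl) ht
      simp only [Pi.mul_apply, hs0, mul_zero, neg_zero, Real.exp_zero, mul_one] at h3
      rwa [Real.exp_neg, ← div_eq_mul_inv, div_le_iff₀ (Real.exp_pos _)] at h3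
    refine tendsto_of_tendsto_of_tendsto_of_le_of_le' tendsto_const_nhds
      (h := fun t => S * Real.exp (κ * t)) ?_
      ((eventually_le_atBot 0).mono fun t ht => (hpos t ht).le)
      ((eventually_le_atBot 0).mono h2)
    have := (Real.tendsto_exp_atBot.comp (tendsto_id.const_mul_atBot hκ)).const_mul S
    simpa using this

/-- A motion along the energy profile that departs from an unstable rest point. -/
theorem exists_departure {α p u d m₀ : ℝ} {e Y : ℝ → ℝ} (hα : 0 ≤ α) (hp : 0 ≤ p) (hd : 0 < d)
    (hm₀ : m₀ < u) (he : HasDerivAt e (-d) u) (he0 : e u = 0)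
    (hY : IsEnergyProfile α ((p + 1) / 2) (fun s => e (u - s)) Y) :
    ∃ m ∈ Ioo m₀ u, ∃ w w1 : ℝ → ℝ, IsMotionOn α p e w w1 (Iic 0) ∧ w 0 = m ∧ w1 0 < 0 ∧
      w1 0 ^ 2 / 2 = Y (u - m) ∧ Tendsto w atBot (𝓝 u) ∧ ∀ t ≤ 0, w t ∈ Icc m u := by
  have hH : HasDerivAt (fun s => e (u - s)) d 0 := by
    have h1 : HasDerivAt e (-d) (u - 0) := by rwa [sub_zero]
    exact (h1.comp 0 ((hasDerivAt_id (0 : ℝ)).const_sub u)).congr_deriv (by ring)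
  have hev : ∀ᶠ s in 𝓝[>] (0 : ℝ), d / 2 < (e (u - s)) / s ∧ (e (u - s)) / s < 2 * d := by
    have h1 := hH.tendsto_slope.mono_left (nhdsWithin_mono 0
      (fun x hx => (ne_of_gt hx : x ≠ 0)) : 𝓝[>] (0 : ℝ) ≤ 𝓝[≠] 0)
    filter_upwards [h1.eventually (Ioo_mem_nhds (by linarith : d / 2 < d) (by linarith : d < 2 * d)),
      self_mem_nhdsWithin] with s hs hs0
    simpa [slope_def_field, he0] using hs
  obtain ⟨b, hb, h2⟩ := mem_nhdsGT_iff_exists_Ioo_subset.mp hev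
  have hb : (0 : ℝ) < b := hb
  set S := min (b / 2) (min 1 ((u - m₀) / 2))
  have hS : 0 < S := lt_min (by linarith) (lt_min one_pos (by linarith))
  have hS1 : S ≤ b / 2 := min_le_left _ _
  have hS2 : S ≤ 1 := (min_le_right _ _).trans (min_le_left _ _)
  have hS3 : S ≤ (u - m₀) / 2 := (min_le_right _ _).trans (min_le_right _ _)
  have hbd : ∀ s ∈ Icc 0 S, d / 2 * s ≤ e (u - s) ∧ e (u - s) ≤ 2 * d * s := fun s hs => by
    rcases eq_or_lt_of_le hs.1 with h3 | h3
    · simp [← h3, he0]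
    · have h4 := h2 (show s ∈ Ioo 0 b from ⟨h3, by linarith [hs.2]⟩)
      have h5 := h4.1
      have h6 := h4.2
      rw [lt_div_iff₀ h3] at h5
      rw [div_lt_iff₀ h3] at h6
      exact ⟨h5.le, h6.le⟩
  obtain ⟨κ, K, hκ, hK, hlow, hnn, hlip⟩ := hY.exists_sqrt_bounds hα hp hd hS hS2
    (fun s hs => (hbd s hs).1) (fun s hs => (hbd s hs).2)
  obtain ⟨s, hs0, hs1, hs2⟩ := exists_backward_orbit (φ := fun s => √(2 * Y s)) hS hκ hK.le
    (by simp [hY.1]) hlow hlip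
  have hφpos : ∀ t ≤ 0, 0 < √(2 * Y (s t)) := fun t ht =>
    (mul_pos hκ (hs1 t ht).1.1).trans_le (hlow _ (Ioc_subset_Icc_self (hs1 t ht).1))
  refine ⟨u - S, ⟨by linarith, by linarith⟩, fun t => u - s t, fun t => -√(2 * Y (s t)),
    ⟨fun t ht => (hs1 t ht).2.const_sub u, fun t ht => ?_⟩, by simp [hs0], ?_, ?_, ?_, ?_⟩
  · have hx := hφpos t ht
    have h3 : 0 < 2 * Y (s t) := Real.sqrt_pos.mp hx
    refine ((((hY.2 (s t) (hs1 t ht).1.1.le).comp t (hs1 t ht).2).const_mul 2).sqrt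
      h3.ne').neg.congr_deriv ?_
    have hYx : damp ((p + 1) / 2) (Y (s t)) = √(2 * Y (s t)) ^ p * √(2 * Y (s t)) := by
      have := damp_sq_half hp (√(2 * Y (s t)))
      rw [Real.sq_sqrt h3.le, mul_div_cancel_left₀ _ two_ne_zero, abs_of_pos hx] at this
      exact this
    rw [hYx, abs_neg, abs_of_pos hx]
    simp only [Function.comp]
    field_simp
    ring
  · exact neg_neg_of_pos (hφpos 0 le_rfl)
  · have h3 : 0 < 2 * Y (s 0) := Real.sqrt_pos.mp (hφpos 0 le_rfl)
    rw [neg_sq, Real.sq_sqrt h3.le, hs0, sub_sub_cancel]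
    ring
  · simpa using hs2.const_sub u
  · intro t ht
    have := (hs1 t ht).1
    exact ⟨by linarith [this.2], by linarith [this.1]⟩

end KineticRelation

/-! ### Global motions and convergence to rest points. -/

namespace KineticRelation

theorem exists_rpow_sub_le {p Z : ℝ} (hp : 0 ≤ p) :
    ∃ L, 0 ≤ L ∧ ∀ x ∈ Icc 0 Z, ∀ y ∈ Icc 0 Z, |x ^ (p + 1) - y ^ (p + 1)| ≤ L * |x - y| := by
  refine ⟨(p + 1) * |Z| ^ p, by positivity, fun x hx y hy => ?_⟩
  refine (convex_Icc 0 Z).norm_image_sub_le_of_norm_hasDerivWithin_le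
    (fun z _ => (Real.hasDerivAt_rpow_const (p := p + 1)
      (Or.inr (by linarith))).hasDerivWithinAt) (fun z hz => ?_) hy hx
  have h1 : z ^ p ≤ |Z| ^ p := Real.rpow_le_rpow hz.1 (hz.2.trans (le_abs_self Z)) hp
  have h2 : 0 ≤ z ^ p := Real.rpow_nonneg hz.1 p
  rw [add_sub_cancel_right, Real.norm_eq_abs, abs_of_nonneg (by positivity)]
  gcongr

/-- Motions under a bounded Lipschitz force with a potential that is bounded below exist for all
times. -/
theorem exists_motion {α p Gmin C : ℝ} {e G : ℝ → ℝ} {Ke : NNReal} (hα : 0 ≤ α) (hp : 0 ≤ p)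
    (he : LipschitzWith Ke e) (heC : ∀ x, |e x| ≤ C) (hG : ∀ x, HasDerivAt G (e x) x)
    (hGmin : ∀ x, Gmin ≤ G x) (m z₀ : ℝ) :
    ∃ w w1 : ℝ → ℝ, w 0 = m ∧ w1 0 = z₀ ∧ IsMotionOn α p e w w1 (Ici 0) := by
  set D := z₀ ^ 2 / 2 + G m - Gmin
  have hD : z₀ ^ 2 / 2 ≤ D := by have := hGmin m; simp only [D]; linarith
  have hD0 : 0 ≤ D := le_trans (by positivity) hD
  -- Larger than any speed that the initial energy allows, so truncating the velocity at `Z` does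
  -- not affect the motion.
  set Z := √(2 * D) + 1
  have hZ1 : 1 ≤ Z := by have := Real.sqrt_nonneg (2 * D); simp only [Z]; linarith
  have hZ : 2 * D < Z ^ 2 := by
    have h1 := Real.sq_sqrt (by linarith : 0 ≤ 2 * D)
    have := Real.sqrt_nonneg (2 * D)
    simp only [Z]
    nlinarith
  have hz₀ : |z₀| < Z := abs_lt_of_sq_lt_sq (by linarith) (by linarith)
  set cl : ℝ → ℝ := fun x => max 0 (min x Z)
  have hclmem : ∀ x, cl x ∈ Icc 0 Z := fun x =>
    ⟨le_max_left _ _, max_le (by linarith) (min_le_right _ _)⟩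
  have hcl1 : LipschitzWith 1 cl := (LipschitzWith.id.min_const Z).const_max 0
  have hcl : ∀ x y, |cl x - cl y| ≤ |x - y| := fun x y => by
    simpa [Real.dist_eq] using hcl1.dist_le_mul x y
  obtain ⟨L, hL, hLip⟩ := exists_rpow_sub_le (Z := Z) hp
  -- The velocity is split into truncated positive and negative parts so that `|z| ^ p * z` becomes
  -- a difference of powers of nonnegative numbers, Lipschitz as `p + 1 ≥ 1`.
  set V : ℝ → ℝ := fun z => cl z - cl (-z)
  set P : ℝ → ℝ := fun z => cl z ^ (p + 1) - cl (-z) ^ (p + 1)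
  have hV : ∀ x y, |V x - V y| ≤ 2 * |x - y| := fun x y => by
    have h1 := hcl x y
    have h2 := hcl (-x) (-y)
    rw [show -x - -y = -(x - y) by ring, abs_neg] at h2
    have h3 := abs_sub (cl x - cl y) (cl (-x) - cl (-y))
    rw [show V x - V y = cl x - cl y - (cl (-x) - cl (-y)) by simp only [V]; ring]
    linarith
  have hP : ∀ x y, |P x - P y| ≤ 2 * L * |x - y| := fun x y => by
    have h1 := (hLip _ (hclmem x) _ (hclmem y)).trans (mul_le_mul_of_nonneg_left (hcl x y) hL)
    have h2 := (hLip _ (hclmem (-x)) _ (hclmem (-y))).trans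
      (mul_le_mul_of_nonneg_left (hcl (-x) (-y)) hL)
    rw [show -x - -y = -(x - y) by ring, abs_neg] at h2
    have h3 := abs_sub (cl x ^ (p + 1) - cl y ^ (p + 1)) (cl (-x) ^ (p + 1) - cl (-y) ^ (p + 1))
    rw [show P x - P y = cl x ^ (p + 1) - cl y ^ (p + 1) -
      (cl (-x) ^ (p + 1) - cl (-y) ^ (p + 1)) by simp only [P]; ring]
    linarith
  have hp1 : p + 1 ≠ 0 := by linarith
  have hVeq : ∀ z, |z| ≤ Z → V z = z ∧ P z = |z| ^ p * z := fun z hz => by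
    obtain ⟨h1, h2⟩ := abs_le.mp hz
    rcases le_total 0 z with h0 | h0
    · have h3 : cl z = z := by simp [cl, min_eq_left h2, h0]
      have h4 : cl (-z) = 0 := by simp [cl, h0]
      simp only [V, P, h3, h4, sub_zero, Real.zero_rpow hp1, abs_of_nonneg h0,
        Real.rpow_add_one' h0 hp1, and_self]
    · have h3 : cl z = 0 := by simp [cl, h0]
      have h4 : cl (-z) = -z := by simp [cl, min_eq_left (by linarith : -z ≤ Z), h0]
      simp only [V, P, h3, h4, Real.zero_rpow hp1, abs_of_nonpos h0,
        Real.rpow_add_one' (neg_nonneg.mpr h0) hp1]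
      constructor <;> ring
  have hVb : ∀ z, |V z| ≤ Z := fun z => by
    have h1 := hclmem z
    have h2 := hclmem (-z)
    rw [abs_le]
    constructor <;> simp only [V] <;> linarith [h1.1, h1.2, h2.1, h2.2]
  have hPb : ∀ z, |P z| ≤ Z ^ (p + 1) := fun z => by
    have h1 := hclmem z
    have h2 := hclmem (-z)
    have h3 := Real.rpow_le_rpow h1.1 h1.2 (by linarith : 0 ≤ p + 1)
    have h4 := Real.rpow_le_rpow h2.1 h2.2 (by linarith : 0 ≤ p + 1)
    have h5 := Real.rpow_nonneg h1.1 (p + 1)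
    have h6 := Real.rpow_nonneg h2.1 (p + 1)
    rw [abs_le]
    constructor <;> simp only [P] <;> linarith
  have hC : 0 ≤ C := (abs_nonneg _).trans (heC 0)
  have hZp : 0 ≤ Z ^ (p + 1) := Real.rpow_nonneg (by linarith) _
  set F : ℝ × ℝ → ℝ × ℝ := fun x => (V x.2, -e x.1 - α * P x.2)
  have hFlip : ∀ x y, dist (F x) (F y) ≤ (2 + Ke + α * (2 * L)) * dist x y := fun x y => by
    have h1 : |x.1 - y.1| ≤ dist x y := by rw [← Real.dist_eq]; exact le_max_left _ _
    have h2 : |x.2 - y.2| ≤ dist x y := by rw [← Real.dist_eq]; exact le_max_right _ _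
    have h3 : |e x.1 - e y.1| ≤ Ke * |x.1 - y.1| := by
      simpa [Real.dist_eq] using he.dist_le_mul x.1 y.1
    have h0 : 0 ≤ dist x y := dist_nonneg
    have hK : (0 : ℝ) ≤ Ke := Ke.coe_nonneg
    have h4 : |V x.2 - V y.2| ≤ 2 * dist x y := (hV _ _).trans (by linarith)
    have h5 : |e x.1 - e y.1| ≤ Ke * dist x y := h3.trans (mul_le_mul_of_nonneg_left h1 hK)
    have h6 : α * |P x.2 - P y.2| ≤ α * (2 * L) * dist x y := by
      rw [mul_assoc]
      exact mul_le_mul_of_nonneg_left ((hP _ _).trans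
        (mul_le_mul_of_nonneg_left h2 (by positivity))) hα
    have h7 : |(-e x.1 - α * P x.2) - (-e y.1 - α * P y.2)| ≤
        |e x.1 - e y.1| + α * |P x.2 - P y.2| := by
      rw [show (-e x.1 - α * P x.2) - (-e y.1 - α * P y.2) =
        -(e x.1 - e y.1) - α * (P x.2 - P y.2) by ring]
      refine (abs_sub _ _).trans ?_
      rw [abs_neg, abs_mul, abs_of_nonneg hα]
    have h8 : 0 ≤ α * (2 * L) * dist x y := by positivity
    have h9 : 0 ≤ Ke * dist x y := by positivity
    change max (dist (V x.2) (V y.2)) (dist (-e x.1 - α * P x.2) (-e y.1 - α * P y.2)) ≤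
      (2 + Ke + α * (2 * L)) * dist x y
    rw [Real.dist_eq, Real.dist_eq]
    exact max_le (by linarith) (by linarith)
  have hFb : ∀ x, ‖F x‖ ≤ Z + C + α * Z ^ (p + 1) := fun x => by
    have h1 := hVb x.2
    have h2 := heC x.1
    have h3 := mul_le_mul_of_nonneg_left (hPb x.2) hα
    have h4 : |-e x.1 - α * P x.2| ≤ |e x.1| + α * |P x.2| := by
      refine (abs_sub _ _).trans ?_
      rw [abs_neg, abs_mul, abs_of_nonneg hα]
    have h5 : 0 ≤ α * Z ^ (p + 1) := by positivity
    change max |V x.2| |-e x.1 - α * P x.2| ≤ Z + C + α * Z ^ (p + 1)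
    exact max_le (by linarith) (by linarith)
  obtain ⟨γ, hγ0, hγ⟩ := exists_global_integralCurve (fun _ => F) (fun _ => continuous_const)
    (fun N => ⟨⟨2 + Ke + α * (2 * L), by positivity⟩, ⟨Z + C + α * Z ^ (p + 1), by positivity⟩,
      fun t _ => ⟨LipschitzWith.of_dist_le_mul hFlip, hFb⟩⟩) (m, z₀)
  set w : ℝ → ℝ := fun t => (γ t).1
  set w1 : ℝ → ℝ := fun t => (γ t).2
  have hw : ∀ t, HasDerivAt w (V (w1 t)) t := fun t => 
    (ContinuousLinearMap.fst ℝ ℝ ℝ).hasFDerivAt.comp_hasDerivAt t (hγ t)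
  have hw1 : ∀ t, HasDerivAt w1 (-e (w t) - α * P (w1 t)) t := fun t =>
    (ContinuousLinearMap.snd ℝ ℝ ℝ).hasFDerivAt.comp_hasDerivAt t (hγ t)
  have hw0 : w 0 = m := by simp [w, hγ0]
  have hw10 : w1 0 = z₀ := by simp [w1, hγ0]
  have hmot : ∀ I : Set ℝ, (∀ t ∈ I, |w1 t| ≤ Z) → IsMotionOn α p e w w1 I := fun I hI =>
    ⟨fun t ht => (hw t).congr_deriv (hVeq _ (hI t ht)).1,
      fun t ht => (hw1 t).congr_deriv (by rw [(hVeq _ (hI t ht)).2])⟩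
  refine ⟨w, w1, hw0, hw10, hmot _ fun t ht => ?_⟩
  have hcont : Continuous fun t => |w1 t| :=
    (continuous_iff_continuousAt.mpr fun t => (hw1 t).continuousAt).abs
  by_contra! hlt
  set S := {t | 0 ≤ t ∧ |w1 t| = Z} with hS
  have hivt : ∀ t, 0 ≤ t → Z ≤ |w1 t| → ∃ x ∈ Icc 0 t, |w1 x| = Z := fun t ht hle =>
    intermediate_value_Icc ht hcont.continuousOn ⟨by simp only [hw10]; exact hz₀.le, hle⟩
  have hSne : S.Nonempty := by
    obtain ⟨x, hx, hx1⟩ := hivt t ht hlt.le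
    exact ⟨x, hx.1, hx1⟩
  have hScl : IsClosed S := (isClosed_le continuous_const continuous_id).inter
    (isClosed_eq hcont continuous_const)
  have hSb : BddBelow S := ⟨0, fun t ht => ht.1⟩
  have hT := hScl.csInf_mem hSne hSb
  set T := sInf S
  have hle : ∀ t ∈ Icc 0 T, |w1 t| ≤ Z := fun t ht => by
    by_contra! hlt'
    obtain ⟨x, hx, hx1⟩ := hivt t ht.1 hlt'.le
    have h1 := csInf_le hSb (show x ∈ S from ⟨hx.1, hx1⟩)
    have h2 : x = t := le_antisymm hx.2 (ht.2.trans h1)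
    rw [h2] at hx1
    linarith
  have hE := (hmot _ hle).antitoneOn_energy hα (convex_Icc 0 T) (fun t _ => hG (w t))
    ⟨le_rfl, hT.1⟩ ⟨hT.1, le_rfl⟩ hT.1
  simp only [hw0, hw10] at hE
  rw [← sq_abs (w1 T), hT.2] at hE
  have := hGmin (w T)
  simp only [D] at hZ
  linarith

theorem abs_sub_le_of_hasDerivAt {g g' : ℝ → ℝ} {T K : ℝ} (hg : ∀ t, T ≤ t → HasDerivAt g (g' t) t)
    (hK : ∀ t, T ≤ t → |g' t| ≤ K) (s t : ℝ) (hs : T ≤ s) (hst : s ≤ t) :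
    |g s - g t| ≤ K * (t - s) := by
  have h1 := (convex_Ici T).norm_image_sub_le_of_norm_hasDerivWithin_le
    (fun x hx => (hg x hx).hasDerivWithinAt) (fun x hx => hK x hx) (mem_Ici.mpr hs)
    (mem_Ici.mpr (hs.trans hst))
  rw [Real.norm_eq_abs, Real.norm_eq_abs, abs_of_nonneg (sub_nonneg.mpr hst)] at h1
  rwa [abs_sub_comm]

/-- A motion trapped in a compact set with a single rest point converges to it. -/
theorem IsMotionOn.tendsto_of_mem_isCompact {α p T l : ℝ} {e w w1 G : ℝ → ℝ} {Ke : NNReal}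
    {s : Set ℝ} (h : IsMotionOn α p e w w1 (Ici T)) (hα : 0 < α) (hp : 0 ≤ p)
    (he : LipschitzWith Ke e) (hG : ∀ x, HasDerivAt G (e x) x) (hs : IsCompact s)
    (hw : ∀ t, T ≤ t → w t ∈ s) (hl : ∀ x ∈ s, e x = 0 → x = l) : Tendsto w atTop (𝓝 l) := by
  have hGc : Continuous G := continuous_iff_continuousAt.mpr fun x => (hG x).continuousAt
  obtain ⟨B, hB⟩ := hs.exists_bound_of_continuousOn hGc.continuousOn
  obtain ⟨C, hC⟩ := hs.exists_bound_of_continuousOn he.continuous.continuousOn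
  have hE := h.antitoneOn_energy hα.le (convex_Ici T) (fun t _ => hG (w t))
  have hlow : ∀ t, T ≤ t → -B ≤ G (w t) := fun t ht => (abs_le.mp (hB _ (hw t ht))).1
  set Z := √(2 * (w1 T ^ 2 / 2 + G (w T) + B))
  have hZ : ∀ t, T ≤ t → |w1 t| ≤ Z := fun t ht => by
    have h1 := hE (mem_Ici.mpr le_rfl) (mem_Ici.mpr ht) ht
    have h2 := hlow t ht
    exact Real.abs_le_sqrt (by simp only at h1; linarith)
  have hψ : ∀ t, T ≤ t → |(|w1 t| ^ p * w1 t)| ≤ Z ^ p * Z := fun t ht => by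
    have h1 := hZ t ht
    have h2 := Real.rpow_le_rpow (abs_nonneg _) h1 hp
    rw [abs_mul, abs_of_nonneg (Real.rpow_nonneg (abs_nonneg _) p)]
    gcongr
  have hK1 : ∀ t, T ≤ t → |-e (w t) - α * (|w1 t| ^ p * w1 t)| ≤ |C| + α * (Z ^ p * Z) :=
    fun t ht => by
      refine (abs_sub _ _).trans ?_
      rw [abs_neg, abs_mul, abs_of_pos hα]
      have h1 := (hC _ (hw t ht)).trans (le_abs_self C)
      have h2 := mul_le_mul_of_nonneg_left (hψ t ht) hα.le
      rw [Real.norm_eq_abs] at h1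
      linarith
  have hZ0 : 0 ≤ Z := Real.sqrt_nonneg _
  have hw1L := abs_sub_le_of_hasDerivAt h.vel hK1
  have hwL := abs_sub_le_of_hasDerivAt h.pos hZ
  obtain ⟨E, hEl⟩ : ∃ E, Tendsto (fun t => w1 t ^ 2 / 2 + G (w t)) atTop (𝓝 E) := by
    have hanti : Antitone fun t => w1 (max T t) ^ 2 / 2 + G (w (max T t)) := fun a b hab =>
      hE (mem_Ici.mpr (le_max_left _ _)) (mem_Ici.mpr (le_max_left _ _)) (max_le_max_left T hab)
    have := tendsto_atTop_ciInf hanti ⟨-B, by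
      rintro _ ⟨t, rfl⟩
      have := hlow (max T t) (le_max_left _ _)
      have := sq_nonneg (w1 (max T t))
      simp only
      linarith⟩
    refine ⟨_, this.congr' ?_⟩
    filter_upwards [eventually_ge_atTop T] with t ht
    rw [max_eq_right ht]
  -- The energy converges, and it would keep falling at a definite rate if the speed did not tend to
  -- zero.
  have hw1z : Tendsto w1 atTop (𝓝 0) := by
    refine squeeze_zero_norm' (a := fun t => |w1 t|) (Eventually.of_forall fun t => le_rfl) ?_
    refine (tendsto_order.mpr ⟨fun a ha => Eventually.of_forall fun t => ha.trans_le (abs_nonneg _),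
      fun a ha => ?_⟩)
    have h1 := eventually_le_of_deriv_le (g := fun t => w1 t ^ 2 / 2 + G (w t)) (ε := a / 2)
      (η := α * ((a / 4) ^ p * (a / 4) ^ 2))
      (fun t ht => (((h.vel t ht).pow 2).div_const 2).add ((hG (w t)).comp t (h.pos t ht))) hEl
      (K := |C| + α * (Z ^ p * Z)) (by positivity) (x := fun t => |w1 t|)
      (fun s t hs hst => (abs_abs_sub_abs_le _ _).trans (hw1L s t hs hst)) (by positivity)
      (by positivity) (Eventually.of_forall fun t ht => by
        have ht' : a / 4 ≤ |w1 t| := by linarith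
        have h2 := Real.rpow_le_rpow (by positivity) ht' hp
        have h3 := pow_le_pow_left₀ (by positivity) ht' 2
        have h4 := mul_le_mul_of_nonneg_left (mul_le_mul h2 h3 (by positivity) (by positivity)) hα.le
        rw [sq_abs] at h4
        norm_num
        linarith)
    filter_upwards [h1] with t ht
    linarith
  have hψz : Tendsto (fun t => α * (|w1 t| ^ p * w1 t)) atTop (𝓝 0) := by
    have h1 : Continuous fun x : ℝ => α * (|x| ^ p * x) :=
      continuous_const.mul ((continuous_abs.rpow_const fun _ => Or.inr hp).mul continuous_id)
    have h2 := (h1.tendsto 0).comp hw1z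
    rw [mul_zero, mul_zero] at h2
    exact h2
  have heL : ∀ s t, T ≤ s → s ≤ t → |e (w s) - e (w t)| ≤ Ke * Z * (t - s) := fun s t hs hst => by
    have h1 : |e (w s) - e (w t)| ≤ Ke * |w s - w t| := by
      simpa [Real.dist_eq] using he.dist_le_mul (w s) (w t)
    rw [mul_assoc]
    exact h1.trans (mul_le_mul_of_nonneg_left (hwL s t hs hst) Ke.coe_nonneg)
  -- The same argument with the velocity in place of the energy: friction is already negligible, so
  -- a persistent force of either sign would keep changing the velocity.
  have hez : Tendsto (fun t => e (w t)) atTop (𝓝 0) := by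
    refine squeeze_zero_norm' (a := fun t => |e (w t)|) (Eventually.of_forall fun t => le_rfl) ?_
    refine (tendsto_order.mpr ⟨fun a ha => Eventually.of_forall fun t => ha.trans_le (abs_nonneg _),
      fun a ha => ?_⟩)
    have hsmall := hψz.eventually
      (Ioo_mem_nhds (by linarith : -(a / 8) < 0) (by linarith : 0 < a / 8))
    have h1 := eventually_le_of_deriv_le (g := w1) (ε := a / 2) (η := a / 8) h.vel hw1z
      (K := Ke * Z) (by positivity) (x := fun t => e (w t)) heL (by positivity) (by positivity)
      (hsmall.mono fun t ht h2 => by linarith [ht.1])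
    have h2 := eventually_le_of_deriv_le (g := fun t => -w1 t) (ε := a / 2) (η := a / 8)
      (fun t ht => (h.vel t ht).neg) (by simpa using hw1z.neg)
      (K := Ke * Z) (by positivity) (x := fun t => -e (w t))
      (fun s t hs hst => by
        rw [show -e (w s) - -e (w t) = -(e (w s) - e (w t)) by ring, abs_neg]
        exact heL s t hs hst) (by positivity) (by positivity)
      (hsmall.mono fun t ht h2 => by linarith [ht.2])
    filter_upwards [h1, h2] with t ht1 ht2
    rw [abs_lt]
    constructor <;> linarith
  refine hs.tendsto_nhds_of_unique_mapClusterPt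
    ((eventually_ge_atTop T).mono fun t ht => hw t ht) (fun y hy hc => hl y hy ?_)
  have h1 : MapClusterPt (e y) atTop (e ∘ w) := hc.continuousAt_comp he.continuous.continuousAt
  by_contra hne
  have h2 := h1.frequently (Metric.ball_mem_nhds (e y) (half_pos (abs_pos.mpr hne)))
  have h3 := hez.eventually (Metric.ball_mem_nhds 0 (half_pos (abs_pos.mpr hne)))
  obtain ⟨t, ht1, ht2⟩ := (h2.and_eventually h3).exists
  simp only [Real.dist_eq, sub_zero] at ht1 ht2
  have h4 := abs_sub_abs_le_abs_sub (e y) (e (w t))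
  rw [abs_sub_comm] at ht1
  simp only [Function.comp] at ht1
  linarith

end KineticRelation

/-! ### The orbit that leaves the left state along the profile. -/

namespace KineticRelation

theorem IsMotionOn.congr {α p : ℝ} {e e' w w1 : ℝ → ℝ} {I : Set ℝ} (h : IsMotionOn α p e w w1 I)
    (he : ∀ t ∈ I, e' (w t) = e (w t)) : IsMotionOn α p e' w w1 I :=
  ⟨h.pos, fun t ht => by rw [he t ht]; exact h.vel t ht⟩

theorem IsMotionOn.glue {α p t₀ : ℝ} {e w w1 z z1 : ℝ → ℝ} (h : IsMotionOn α p e w w1 (Iic t₀))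
    (h' : IsMotionOn α p e z z1 (Ici t₀)) (hw : w t₀ = z t₀) (hw1 : w1 t₀ = z1 t₀) :
    IsMotionOn α p e (fun t => if t ≤ t₀ then w t else z t)
      (fun t => if t ≤ t₀ then w1 t else z1 t) univ := by
  constructor
  all_goals
    intro t _
    rcases lt_trichotomy t t₀ with ht | rfl | ht
  · simp only [if_pos ht.le]
    exact (h.pos t ht.le).congr_of_eventuallyEq
      ((eventually_lt_nhds ht).mono fun s hs => if_pos hs.le)
  · simp only [le_refl, if_true]
    have h1 := h'.pos t (mem_Ici.mpr le_rfl)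
    rw [← hw1] at h1
    exact hasDerivAt_ite_le (h.pos t (mem_Iic.mpr le_rfl)) h1 hw
  · simp only [if_neg (not_le.mpr ht)]
    exact (h'.pos t ht.le).congr_of_eventuallyEq
      ((eventually_gt_nhds ht).mono fun s hs => if_neg (not_le.mpr hs))
  · simp only [if_pos ht.le]
    exact (h.vel t ht.le).congr_of_eventuallyEq
      ((eventually_lt_nhds ht).mono fun s hs => if_pos hs.le)
  · simp only [le_refl, if_true]
    have h1 := h'.vel t (mem_Ici.mpr le_rfl)
    rw [← hw1, ← hw] at h1
    exact hasDerivAt_ite_le (h.vel t (mem_Iic.mpr le_rfl)) h1 hw1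
  · simp only [if_neg (not_le.mpr ht)]
    exact (h'.vel t ht.le).congr_of_eventuallyEq
      ((eventually_gt_nhds ht).mono fun s hs => if_neg (not_le.mpr hs))

namespace Flux

variable {f f1 f2 : ℝ → ℝ} (F : Flux f f1 f2) {α p u lam a : ℝ}
include F

/-- The excess, frozen outside an interval, and a primitive of it. -/
theorem exists_clamped_excess (hau : a < u) (ha : excess f u lam a ≤ 0) :
    ∃ (e G : ℝ → ℝ) (Ke : NNReal) (C Gmin : ℝ), LipschitzWith Ke e ∧ (∀ x, |e x| ≤ C) ∧
      (∀ x, HasDerivAt G (e x) x) ∧ (∀ x, Gmin ≤ G x) ∧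
      (∀ x ∈ Icc a u, e x = excess f u lam x) := by
  set cl : ℝ → ℝ := fun x => max a (min x u)
  have hcl : ∀ x, cl x ∈ Icc a u := fun x =>
    ⟨le_max_left _ _, max_le hau.le (min_le_right _ _)⟩
  have hcl1 : LipschitzWith 1 cl := (LipschitzWith.id.min_const u).const_max a
  obtain ⟨K, hK, hKe⟩ := F.exists_abs_excess_sub_le u lam (max |a| |u|)
  have hmem : ∀ x, cl x ∈ Icc (-max |a| |u|) (max |a| |u|) := fun x => by
    have h1 := neg_abs_le a
    have h2 := le_max_left |a| |u|
    have h3 := le_abs_self u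
    have h4 := le_max_right |a| |u|
    exact ⟨by linarith [(hcl x).1], by linarith [(hcl x).2]⟩
  set e : ℝ → ℝ := fun x => excess f u lam (cl x)
  have hlip : LipschitzWith ⟨K, hK⟩ e := LipschitzWith.of_dist_le_mul fun x y => by
    rw [Real.dist_eq, Real.dist_eq]
    exact (hKe _ (hmem x) _ (hmem y)).trans (mul_le_mul_of_nonneg_left
      (by simpa [Real.dist_eq] using hcl1.dist_le_mul x y) hK)
  obtain ⟨C, hC⟩ := isCompact_Icc.exists_bound_of_continuousOn (s := Icc a u)
    (F.continuous_excess u lam).continuousOn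
  have hG : ∀ x, HasDerivAt (fun x => ∫ t in (0 : ℝ)..x, e t) (e x) x := fun x =>
    intervalIntegral.integral_hasDerivAt_right (hlip.continuous.intervalIntegrable _ _)
      (hlip.continuous.stronglyMeasurableAtFilter _ _) hlip.continuous.continuousAt
  set G : ℝ → ℝ := fun x => ∫ t in (0 : ℝ)..x, e t
  have hGc : Continuous G := continuous_iff_continuousAt.mpr fun x => (hG x).continuousAt
  obtain ⟨B, hB⟩ := isCompact_Icc.exists_bound_of_continuousOn (s := Icc a u) hGc.continuousOn
  have hBlow : ∀ x ∈ Icc a u, -B ≤ G x := fun x hx => (abs_le.mp (hB x hx)).1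
  -- Left of `a` the frozen force is `excess f u lam a ≤ 0`, so the potential falls towards `a`;
  -- right of `u` it is zero. Hence the minimum over `[a, u]` bounds the potential everywhere.
  refine ⟨e, G, ⟨K, hK⟩, C, -B, hlip, fun x => hC _ (hcl x), hG, fun x => ?_, fun x hx => ?_⟩
  · rcases le_total x a with h1 | h1
    · refine (hBlow a ⟨le_rfl, hau.le⟩).trans (antitoneOn_of_hasDerivAt_nonpos (convex_Iic a)
        (fun x _ => hG x) (fun x hx => ?_) (mem_Iic.mpr h1) (mem_Iic.mpr le_rfl) h1)
      have : cl x = a := by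
        simp [cl, min_le_iff.mpr (Or.inl hx : x ≤ a ∨ u ≤ a)]
      simp only [e, this, ha]
    rcases le_total x u with h2 | h2
    · exact hBlow x ⟨h1, h2⟩
    · refine (hBlow u ⟨hau.le, le_rfl⟩).trans (monotoneOn_of_hasDerivAt_nonneg (convex_Ici u)
        (fun x _ => hG x) (fun x hx => ?_) (mem_Ici.mpr le_rfl) (mem_Ici.mpr h2) h2)
      have : cl x = u := by simp [cl, min_eq_right (mem_Ici.mp hx), hau.le]
      simp only [e, this, excess_self, le_refl]
  · have : cl x = x := by simp [cl, min_eq_left hx.2, max_eq_right hx.1]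
    simp only [e, this]

/-- The motion that departs from the left state along the energy profile either descends for ever
or comes to a stop on the profile. -/
theorem exists_clamped_motion (hα : 0 ≤ α) (hp : 0 ≤ p) (hlam : lam < f1 u) (hau : a < u)
    (ha : excess f u lam a ≤ 0) (hYa : profile α ((p + 1) / 2) f u lam (u - a) ≤ 0) :
    ∃ (e G w w1 : ℝ → ℝ) (Ke : NNReal) (m : ℝ), m < u ∧ LipschitzWith Ke e ∧
      (∀ x, HasDerivAt G (e x) x) ∧ (∀ x ∈ Icc a u, e x = excess f u lam x) ∧
      IsMotionOn α p e w w1 univ ∧ Tendsto w atBot (𝓝 u) ∧ (∀ t ≤ 0, w t ∈ Icc a u) ∧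
      ((AntitoneOn w (Ici 0) ∧ ∀ t, 0 ≤ t → w1 t < 0 ∧ w t ∈ Icc a m ∧
          w1 t ^ 2 / 2 = profile α ((p + 1) / 2) f u lam (u - w t)) ∨
        ∃ T, 0 < T ∧ w1 T = 0 ∧ profile α ((p + 1) / 2) f u lam (u - w T) = 0 ∧ e (w T) ≤ 0 ∧
          (∀ t ∈ Ico 0 T, w1 t < 0) ∧ ∀ t ∈ Icc 0 T, w t ∈ Icc a m) := by
  have hq : 0 < (p + 1) / 2 := by positivity
  have hY := F.isEnergyProfile hα hq u lam
  obtain ⟨m, hm, w, w1, hw, hw0, hw1, hwY, hbot, hwm⟩ := exists_departure (d := f1 u - lam) hα hp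
    (sub_pos.mpr hlam) hau ((F.hasDerivAt_excess u lam u).congr_deriv (by ring)) (excess_self f u lam)
    hY
  obtain ⟨e, G, Ke, C, Gmin, hlip, hC, hG, hGmin, he⟩ := F.exists_clamped_excess hau ha
  obtain ⟨z, z1, hz0, hz1, hz⟩ := exists_motion hα hp hlip hC hG hGmin m (w1 0)
  -- The profile of the frozen force coincides with the original one on `[0, u - a]`, by comparison
  -- in both directions.
  obtain ⟨Y', hY'⟩ := exists_isEnergyProfile hα hq
    (hlip.continuous.comp (continuous_const.sub continuous_id : Continuous fun s => u - s))
  have hYY : ∀ s ∈ Icc 0 (u - a), Y' s = profile α ((p + 1) / 2) f u lam s := by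
    have h1 : ∀ s ∈ Icc 0 (u - a), e (u - s) = excess f u lam (u - s) := fun s hs =>
      he _ ⟨by linarith [hs.2], by linarith [hs.1]⟩
    exact fun s hs => le_antisymm
      (hY'.mono hα le_rfl hq.le hY (fun s hs => (h1 s hs).le) s hs)
      (hY.mono hα le_rfl hq.le hY' (fun s hs => (h1 s hs).ge) s hs)
  have hYw : ∀ x ∈ Icc a u, Y' (u - x) = profile α ((p + 1) / 2) f u lam (u - x) := fun x hx =>
    hYY _ ⟨by linarith [hx.2], by linarith [hx.1]⟩
  have hzc : ContinuousOn z (Ici 0) := fun t ht => (hz.pos t ht).continuousAt.continuousWithinAt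
  have hivt : ∀ t, 0 ≤ t → z t ≤ a → ∃ x ∈ Icc 0 t, z x = a := fun t ht hle =>
    intermediate_value_Icc' ht (hzc.mono Icc_subset_Ici_self) ⟨hle, by rw [hz0]; exact hm.1.le⟩
  -- No energy is left at `a`, so the descending motion cannot pass it with nonzero velocity.
  have hvanish : ∀ x, z1 x ^ 2 / 2 = Y' (u - z x) → z x = a → z1 x = 0 := fun x h1 h2 => by
    rw [h2, hYw a ⟨le_rfl, hau.le⟩] at h1
    exact pow_eq_zero_iff two_ne_zero |>.mp
      (le_antisymm (by linarith) (sq_nonneg (z1 x)))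
  have hglue := (hw.congr (e' := e) fun t ht =>
    he _ ⟨hm.1.le.trans (hwm t ht).1, (hwm t ht).2⟩).glue hz (hw0.trans hz0.symm) hz1.symm
  have hwz : ∀ t, 0 ≤ t → (if t ≤ 0 then w t else z t) = z t := fun t ht => by
    rcases eq_or_lt_of_le ht with rfl | h
    · simp [hw0, hz0]
    · exact if_neg (not_le.mpr h)
  have hwz1 : ∀ t, 0 ≤ t → (if t ≤ 0 then w1 t else z1 t) = z1 t := fun t ht => by
    rcases eq_or_lt_of_le ht with rfl | h
    · simp [hz1]
    · exact if_neg (not_le.mpr h)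
  refine ⟨e, G, _, _, Ke, m, hm.2, hlip, hG, he, hglue, ?_, fun t ht => ?_, ?_⟩
  · exact hbot.congr' ((eventually_le_atBot 0).mono fun t ht => (if_pos ht).symm)
  · rw [if_pos ht]
    exact ⟨hm.1.le.trans (hwm t ht).1, (hwm t ht).2⟩
  rcases hz.follow_profile hα hp hY' (hz0 ▸ hm.2.le) (hz1 ▸ hw1)
    (by rw [hz0, hz1, hwY, hYw m ⟨hm.1.le, hm.2.le⟩]) with h | ⟨T, hT, h1, h2, h3, h4, h5⟩
  · left
    have hanti := antitoneOn_of_hasDerivAt_nonpos (convex_Ici 0) hz.pos fun t ht => (h t ht).1.le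
    refine ⟨fun x hx y hy hxy => ?_, fun t ht => ?_⟩
    · simp only [hwz x hx, hwz y hy]
      exact hanti hx hy hxy
    · simp only [hwz t ht, hwz1 t ht]
      have hza : a ≤ z t := by
        by_contra! hlt
        obtain ⟨x, hx, hxa⟩ := hivt t ht hlt.le
        have h1 := h x hx.1
        linarith [hvanish x h1.2.2 hxa]
      obtain ⟨h1, h2, h3⟩ := h t ht
      exact ⟨h1, ⟨hza, hz0 ▸ hanti (mem_Ici.mpr le_rfl) ht ht⟩, h3.trans (hYw _ ⟨hza, h2⟩)⟩
  · right
    have hza : a ≤ z T := by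
      by_contra! hlt
      obtain ⟨x, hx, hxa⟩ := hivt T hT.le hlt.le
      have hxT : x < T := lt_of_le_of_ne hx.2 (by rintro rfl; linarith)
      linarith [hvanish x (h5 x hx).2.2 hxa, h4 x ⟨hx.1, hxT⟩]
    have hTT : T ∈ Icc 0 T := ⟨hT.le, le_rfl⟩
    refine ⟨T, hT, ?_, ?_, ?_, fun t ht => ?_, fun t ht => ?_⟩
    · rw [hwz1 T hT.le, h1]
    · rw [hwz T hT.le, ← hYw _ ⟨hza, (h5 T hTT).2.1⟩, ← (h5 T hTT).2.2, h1]
      norm_num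
    · rw [hwz T hT.le]
      exact h2
    · rw [hwz1 t ht.1]
      exact h4 t ht
    · rw [hwz t ht.1]
      exact ⟨hza.trans (h3 ht hTT ht.2), hz0 ▸ h3 ⟨le_rfl, hT.le⟩ ht ht.1⟩

/-- The limit of a motion that descends for ever along the profile. -/
theorem exists_limit_of_descent {w w1 : ℝ → ℝ} {m : ℝ} (hα : 0 ≤ α) (hp : 0 ≤ p) (hm : m < u)
    (hd : ∀ t, 0 ≤ t → HasDerivAt w (w1 t) t) (hanti : AntitoneOn w (Ici 0))
    (h : ∀ t, 0 ≤ t → w1 t < 0 ∧ w t ∈ Icc a m ∧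
      w1 t ^ 2 / 2 = profile α ((p + 1) / 2) f u lam (u - w t)) :
    ∃ l ∈ Icc a m, Tendsto w atTop (𝓝 l) ∧ Tendsto w1 atTop (𝓝 0) ∧
      profile α ((p + 1) / 2) f u lam (u - l) = 0 := by
  have hY := F.isEnergyProfile hα (by positivity : 0 < (p + 1) / 2) u lam
  obtain ⟨l, hl⟩ : ∃ l, Tendsto w atTop (𝓝 l) := by
    have hanti' : Antitone fun t => w (max 0 t) := fun x y hxy =>
      hanti (mem_Ici.mpr (le_max_left _ _)) (mem_Ici.mpr (le_max_left _ _)) (max_le_max_left 0 hxy)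
    refine ⟨_, (tendsto_atTop_ciInf hanti' ⟨a, ?_⟩).congr' ?_⟩
    · rintro _ ⟨t, rfl⟩
      exact (h _ (le_max_left _ _)).2.1.1
    · filter_upwards [eventually_ge_atTop 0] with t ht
      rw [max_eq_right ht]
  have hlm : l ∈ Icc a m := isClosed_Icc.mem_of_tendsto hl
    ((eventually_ge_atTop 0).mono fun t ht => (h t ht).2.1)
  have hYl : Tendsto (fun t => profile α ((p + 1) / 2) f u lam (u - w t)) atTop
      (𝓝 (profile α ((p + 1) / 2) f u lam (u - l))) :=
    (hY.2 (u - l) (by linarith [hlm.2])).continuousAt.tendsto.comp (hl.const_sub u)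
  have hw1 : Tendsto w1 atTop (𝓝 (-√(2 * profile α ((p + 1) / 2) f u lam (u - l)))) := by
    refine ((hYl.const_mul 2).sqrt.neg).congr' ?_
    filter_upwards [eventually_ge_atTop 0] with t ht
    obtain ⟨h1, -, h2⟩ := h t ht
    rw [← h2, mul_div_cancel₀ _ two_ne_zero, Real.sqrt_sq_eq_abs, abs_of_neg h1, neg_neg]
  have h0 := eq_zero_of_tendsto_deriv hd hl hw1
  refine ⟨l, hlm, hl, h0 ▸ hw1, le_antisymm (Real.sqrt_eq_zero'.mp (neg_eq_zero.mp h0) |>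
    fun h => by linarith) (ge_of_tendsto hYl ?_)⟩
  filter_upwards [eventually_ge_atTop 0] with t ht
  rw [← (h t ht).2.2]
  positivity

end Flux

end KineticRelation

/-! ### Existence of the waves. -/

namespace KineticRelation

namespace Flux

variable {f f1 f2 : ℝ → ℝ} (F : Flux f f1 f2) {α p u : ℝ}
include F

theorem exists_companion_kineticState (hα : 0 < α) {q : ℝ} (hq : 0 < q) (hu : 0 < u) :
    ∃ c ∈ Ico (tangentState f f1 u) u,
      chordSpeed f u c = chordSpeed f u (kineticState α q f f1 u) := by
  have hvu := F.kineticState_lt hα hq hu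
  exact F.exists_companion hu (F.chordSpeed_tangentState_le hu hvu)
    (F.chordSpeed_lt_of_zeroState_le hu (F.kineticState_spec hα hq hu).1.le hvu)

/-- Above the companion the force is positive. Between the two, a vanishing energy would become
negative at the kinetic state, where it is zero. -/
theorem profile_kineticState_pos (hα : 0 < α) {q : ℝ} (hq : 0 < q) (hu : 0 < u) {x : ℝ}
    (hx : x ∈ Ioo (kineticState α q f f1 u) u) :
    0 < profile α q f u (chordSpeed f u (kineticState α q f f1 u)) (u - x) := by
  obtain ⟨c, hc, hcv⟩ := F.exists_companion_kineticState hα hq hu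
  obtain ⟨-, hv2, hv3⟩ := F.kineticState_spec hα hq hu
  set v := kineticState α q f f1 u
  rcases lt_or_ge c x with h | h
  · refine F.profile_pos hα.le hq (w₁ := c) (fun y hy => ?_) ⟨h, hx.2⟩
    rw [← hcv]
    exact F.strictMonoOn_chordSpeed hu hc ⟨hc.1.trans hy.1.le, hy.2⟩ hy.1
  · by_contra! hle
    have h1 := F.profile_neg_of_nonpos hα.le hq hx.1 hx.2.le (fun y hy =>
      F.chordSpeed_lt_of_mem_Ioo hu hv2 hc hcv ⟨hy.1, hy.2.trans_le h⟩) hle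
    have h2 : profile α q f u (chordSpeed f u v) (u - v) = 0 := hv3
    linarith

/-- There is a wave to the kinetic state. -/
theorem exists_wave_kineticState (hα : 0 < α) (hp : 0 ≤ p) (hu : 0 < u) :
    ∃ w w1 : ℝ → ℝ,
      IsMotionOn α p (excess f u (chordSpeed f u (kineticState α ((p + 1) / 2) f f1 u))) w w1 univ ∧
      Tendsto w atBot (𝓝 u) ∧ Tendsto w atTop (𝓝 (kineticState α ((p + 1) / 2) f f1 u)) := by
  have hq : 0 < (p + 1) / 2 := by positivity
  have hpos := fun x hx => F.profile_kineticState_pos hα hq hu (x := x) hx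
  obtain ⟨hv1, hv2, hv3⟩ := F.kineticState_spec hα hq hu
  have hvu := F.kineticState_lt hα hq hu
  set v := kineticState α ((p + 1) / 2) f f1 u
  obtain ⟨e, G, w, w1, Ke, m, hmu, hlip, -, he, hw, hbot, hw0, halt⟩ := F.exists_clamped_motion
    hα.le hp (F.chordSpeed_lt_of_zeroState_le hu hv1.le hvu) hvu (excess_chordSpeed hvu.ne').le
    (le_of_eq hv3)
  have hzero : ∀ x ∈ Icc v m, profile α ((p + 1) / 2) f u (chordSpeed f u v) (u - x) = 0 → x = v :=
    fun x hx h0 => by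
      by_contra hne
      have := hpos x ⟨lt_of_le_of_ne hx.1 (Ne.symm hne), hx.2.trans_lt hmu⟩
      linarith
  suffices hs : (∀ t, 0 ≤ t → w t ∈ Icc v u) ∧ Tendsto w atTop (𝓝 v) from
    ⟨w, w1, hw.congr fun t _ => (he _ ((le_total t 0).elim (hw0 t) (hs.1 t))).symm, hbot, hs.2⟩
  have hIcc : Icc v m ⊆ Icc v u := Icc_subset_Icc_right hmu.le
  rcases halt with ⟨hanti, h⟩ | ⟨T, hT, h1, h2, -, -, h3⟩
  · obtain ⟨l, hl, hwl, -, hYl⟩ := F.exists_limit_of_descent hα.le hp hmu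
      (fun t _ => hw.pos t (mem_univ t)) hanti h
    rw [hzero l hl hYl] at hwl
    exact ⟨fun t ht => hIcc (h t ht).2.1, hwl⟩
  · have hTv := hzero _ (h3 T ⟨hT.le, le_rfl⟩) h2
    have hev : e v = 0 := by rw [he v ⟨le_rfl, hvu.le⟩, excess_chordSpeed hvu.ne']
    have hrest : ∀ t, T ≤ t → w t = v := fun t ht =>
      (hw.mono (subset_univ (Icc T t))).eq_of_rest hα.le Ke.coe_nonneg (fun s _ => by
        have := hlip.dist_le_mul (w s) v
        rwa [Real.dist_eq, Real.dist_eq, hev, sub_zero] at this) hTv h1 t ⟨ht, le_rfl⟩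
    refine ⟨fun t ht => ?_, (tendsto_const_nhds (x := v)).congr'
      ((eventually_ge_atTop T).mono fun t ht => (hrest t ht).symm)⟩
    rcases le_total t T with h4 | h4
    · exact hIcc (h3 t ⟨ht, h4⟩)
    · rw [hrest t h4]
      exact ⟨le_rfl, hvu.le⟩

/-- There are waves to the states above the companion of the kinetic state. -/
theorem exists_wave_of_companion_lt (hα : 0 < α) (hp : 0 ≤ p) (hu : 0 < u) {c up : ℝ}
    (hc : c ∈ Ico (tangentState f f1 u) u)
    (hcv : chordSpeed f u c = chordSpeed f u (kineticState α ((p + 1) / 2) f f1 u))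
    (hup : up ∈ Ioo c u) :
    ∃ w w1 : ℝ → ℝ, IsMotionOn α p (excess f u (chordSpeed f u up)) w w1 univ ∧
      Tendsto w atBot (𝓝 u) ∧ Tendsto w atTop (𝓝 up) := by
  have hq : 0 < (p + 1) / 2 := by positivity
  obtain ⟨hv1, hv2, hv3⟩ := F.kineticState_spec hα hq hu
  have hvu := F.kineticState_lt hα hq hu
  set v := kineticState α ((p + 1) / 2) f f1 u
  have hupI : up ∈ Ico (tangentState f f1 u) u := ⟨hc.1.trans hup.1.le, hup.2⟩
  have htup : tangentState f f1 u < up := hc.1.trans_lt hup.1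
  set lam := chordSpeed f u up
  have hlamv : chordSpeed f u v < lam := by
    rw [← hcv]
    exact F.strictMonoOn_chordSpeed hu hc hupI hup.1
  -- Slightly left of the kinetic state the chord is still slower than `lam`. Then the force is
  -- negative from `a` up to `up`, and the profile is negative at `a`, so the motion cannot reach
  -- `a`.
  obtain ⟨a, hav, halam⟩ : ∃ a < v, chordSpeed f u a < lam := by
    have h1 : ∀ᶠ x in 𝓝[<] v, chordSpeed f u x < lam :=
      ((F.hasDerivAt_chordSpeed hvu.ne).continuousAt.eventually_lt_const hlamv).filter_mono
        nhdsWithin_le_nhds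
    obtain ⟨a, ha1, ha2⟩ := (h1.and self_mem_nhdsWithin).exists
    exact ⟨a, ha2, ha1⟩
  have hau : a < u := hav.trans hvu
  have hneg : ∀ x, a ≤ x → x < up → excess f u lam x < 0 := fun x hax hx => by
    refine excess_neg (hx.trans hup.2) ?_
    rcases le_total x (tangentState f f1 u) with h | h
    · exact ((F.strictAntiOn_chordSpeed hu).antitoneOn (mem_Iic.mpr (hax.trans h))
        (mem_Iic.mpr h) hax).trans_lt halam
    · exact F.strictMonoOn_chordSpeed hu ⟨h, hx.trans hup.2⟩ hupI hx
  have hpos : ∀ x, up < x → x < u → 0 < excess f u lam x := fun x h1 h2 =>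
    excess_pos h2 (F.strictMonoOn_chordSpeed hu hupI ⟨htup.le.trans h1.le, h2⟩ h1)
  have hYv : profile α ((p + 1) / 2) f u lam (u - v) ≤ 0 :=
    (F.profile_le_of_le hα.le hq hlamv.le (by linarith)).trans (le_of_eq hv3)
  have hYa : profile α ((p + 1) / 2) f u lam (u - a) < 0 :=
    F.profile_neg_of_nonpos hα.le hq hav hvu.le (fun x hx =>
      (F.strictAntiOn_chordSpeed hu (mem_Iic.mpr (hav.le.trans hv2)) (mem_Iic.mpr (hx.2.le.trans hv2))
        hx.1).trans halam) hYv
  obtain ⟨e, G, w, w1, Ke, m, hmu, hlip, hG, he, hw, hbot, hw0, halt⟩ := F.exists_clamped_motion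
    hα.le hp (F.chordSpeed_lt hu hupI.1 hup.2) hau (hneg a le_rfl (hav.trans_le
      (hv2.trans htup.le))).le hYa.le
  have hup0 : ∀ x ∈ Icc a m, e x = 0 → x = up := fun x hx h0 => by
    have hxu : x < u := hx.2.trans_lt hmu
    rw [he x ⟨hx.1, hxu.le⟩] at h0
    rcases lt_trichotomy x up with h | h | h
    · linarith [hneg x hx.1 h]
    · exact h
    · linarith [hpos x h hxu]
  suffices hs : (∀ t, 0 ≤ t → w t ∈ Icc a u) ∧ Tendsto w atTop (𝓝 up) from
    ⟨w, w1, hw.congr fun t _ => (he _ ((le_total t 0).elim (hw0 t) (hs.1 t))).symm, hbot, hs.2⟩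
  have hIcc : Icc a m ⊆ Icc a u := Icc_subset_Icc_right hmu.le
  rcases halt with ⟨hanti, h⟩ | ⟨T, hT, h1, h2, h3, h4, h5⟩
  · obtain ⟨l, hl, hwl, hw1l, hYl⟩ := F.exists_limit_of_descent hα.le hp hmu
      (fun t _ => hw.pos t (mem_univ t)) hanti h
    have hcont : Continuous fun x : ℝ => α * (|x| ^ p * x) :=
      continuous_const.mul ((continuous_abs.rpow_const fun _ => Or.inr hp).mul continuous_id)
    -- The acceleration converges along with position and velocity, so its limit is zero and the
    -- limit state is a rest point.
    have h6 : Tendsto (fun t => -e (w t) - α * (|w1 t| ^ p * w1 t)) atTop (𝓝 (-e l)) := by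
      have h7 := ((hlip.continuous.tendsto l).comp hwl).neg.sub ((hcont.tendsto 0).comp hw1l)
      rw [mul_zero, mul_zero, sub_zero] at h7
      exact h7
    have h0 := eq_zero_of_tendsto_deriv (T := 0) (fun t _ => hw.vel t (mem_univ t)) hw1l h6
    rw [hup0 l hl (neg_eq_zero.mp h0)] at hwl
    exact ⟨fun t ht => hIcc (h t ht).2.1, hwl⟩
  · have hTm : w T ∈ Icc a m := h5 T ⟨hT.le, le_rfl⟩
    have hTu : w T < u := hTm.2.trans_lt hmu
    have hTa : a < w T := lt_of_le_of_ne hTm.1 (fun h => by rw [← h] at h2; linarith)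
    have hTup : w T ≤ up := by
      by_contra! hlt
      rw [he _ (hIcc hTm)] at h3
      linarith [hpos _ hlt hTu]
    have hanti := hw.antitoneOn_energy hα.le convex_univ (fun t _ => hG (w t))
    -- Friction has dissipated energy strictly before the stop, so the potential at `w T` is
    -- strictly below that of `u`.
    have hET : G (w T) < G u := by
      have h6 := strictAntiOn_of_hasDerivAt_neg (convex_Icc 0 T)
        (fun t _ => (((hw.vel t (mem_univ t)).pow 2).div_const 2).add
          ((hG (w t)).comp t (hw.pos t (mem_univ t)))) (fun t ht => by
            rw [interior_Icc] at ht
            have h7 := h4 t ⟨ht.1.le, ht.2⟩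
            have h8 : 0 < |w1 t| := abs_pos.mpr h7.ne
            have h9 : 0 < α * (|w1 t| ^ p * |w1 t| ^ 2) := by positivity
            rw [sq_abs] at h9
            norm_num
            linarith) ⟨le_rfl, hT.le⟩ ⟨hT.le, le_rfl⟩ hT
      have h7 := hw.energy_le hα.le hG hbot 0
      simp only [Pi.add_apply, Pi.pow_apply, Function.comp, h1] at h6
      norm_num at h6
      linarith
    have hE : ∀ t, T ≤ t → G (w t) ≤ G (w T) := fun t ht => by
      have := hanti (mem_univ T) (mem_univ t) ht
      simp only [h1] at this
      norm_num at this
      linarith [sq_nonneg (w1 t)]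
    have hwc : Continuous w :=
      continuous_iff_continuousAt.mpr fun t => (hw.pos t (mem_univ t)).continuousAt
    have hGanti := strictAntiOn_of_hasDerivAt_neg (convex_Icc a up) (fun x _ => hG x)
      (fun x hx => by
        rw [interior_Icc] at hx
        rw [he x ⟨hx.1.le, hx.2.le.trans hup.2.le⟩]
        exact hneg x hx.1.le hx.2)
    -- Neither end of the well can be crossed: the potential is higher just below `w T` and at `u`.
    have htrap : ∀ t, T ≤ t → w t ∈ Icc (w T) u ∩ {x | G x ≤ G (w T)} := fun t ht => by
      refine ⟨⟨?_, ?_⟩, hE t ht⟩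
      · by_contra! hlt
        have h6 : max (w t) a < w T := max_lt hlt hTa
        obtain ⟨s, hs, hsx⟩ := intermediate_value_Icc' ht hwc.continuousOn
          (show max (w t) a ∈ Icc (w t) (w T) from ⟨le_max_left _ _, h6.le⟩)
        have h7 := hGanti ⟨le_max_right _ _, h6.le.trans hTup⟩ ⟨hTa.le, hTup⟩ h6
        have h8 := hE s hs.1
        rw [hsx] at h8
        linarith
      · by_contra! hlt
        obtain ⟨s, hs, hsx⟩ := intermediate_value_Icc ht hwc.continuousOn
          (show u ∈ Icc (w T) (w t) from ⟨hTu.le, hlt.le⟩)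
        have h8 := hE s hs.1
        rw [hsx] at h8
        linarith
    have hGc : Continuous G := continuous_iff_continuousAt.mpr fun x => (hG x).continuousAt
    refine ⟨fun t ht => ?_, (hw.mono (subset_univ (Ici T))).tendsto_of_mem_isCompact hα hp hlip hG
      (isCompact_Icc.inter_right (isClosed_le hGc continuous_const)) htrap (fun x hx h0 => ?_)⟩
    · rcases le_total t T with h6 | h6
      · exact hIcc (h5 t ⟨ht, h6⟩)
      · exact ⟨hTa.le.trans (htrap t h6).1.1, (htrap t h6).1.2⟩
    · have hxu : x < u := lt_of_le_of_ne hx.1.2 (by rintro rfl; exact absurd hx.2 (not_le.mpr hET))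
      rw [he x ⟨hTa.le.trans hx.1.1, hxu.le⟩] at h0
      rcases lt_trichotomy x up with h | h | h
      · linarith [hneg x (hTa.le.trans hx.1.1) h]
      · exact h
      · linarith [hpos x h hxu]

end Flux

end KineticRelation

/-! ### From motions to travelling waves, and the admissible states. -/

namespace KineticRelation

section waves

variable {f w w1 : ℝ → ℝ} {α p um up lam : ℝ}

theorem rankineHugoniot_iff (h : up ≠ um) :
    RankineHugoniot f um up lam ↔ lam = chordSpeed f um up := by
  have h1 : um - up ≠ 0 := sub_ne_zero.mpr h.symm
  unfold RankineHugoniot chordSpeed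
  rw [eq_div_iff h1]
  constructor <;> intro h2 <;> linarith

theorem IsTravelingWave.isMotionOn (h : IsTravelingWave f α p um up lam w) :
    IsMotionOn α p (excess f um lam) w (deriv w) univ := by
  have h1 : ContDiff ℝ 1 (deriv w) := by
    have := h.contDiff
    rw [show (2 : WithTop ℕ∞) = 1 + 1 from one_add_one_eq_two.symm, contDiff_succ_iff_deriv] at this
    exact this.2.2
  refine ⟨fun t _ => (h.contDiff.differentiable (by norm_num) t).hasDerivAt, fun t _ =>
    (h1.differentiable (by norm_num) t).hasDerivAt.congr_deriv ?_⟩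
  have h2 := h.ode t
  rw [iteratedDeriv_succ, iteratedDeriv_one] at h2
  unfold excess
  linarith

theorem IsMotionOn.isTravelingWave (h : IsMotionOn α p (excess f um lam) w w1 univ)
    (hf : Continuous f) (hp : 0 ≤ p) (hbot : Tendsto w atBot (𝓝 um))
    (htop : Tendsto w atTop (𝓝 up)) : IsTravelingWave f α p um up lam w := by
  have hw : deriv w = w1 := funext fun t => (h.pos t (mem_univ t)).deriv
  have hw1 : deriv w1 = fun t => -excess f um lam (w t) - α * (|w1 t| ^ p * w1 t) :=
    funext fun t => (h.vel t (mem_univ t)).deriv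
  have hwc : Continuous w :=
    continuous_iff_continuousAt.mpr fun t => (h.pos t (mem_univ t)).continuousAt
  have hw1c : Continuous w1 :=
    continuous_iff_continuousAt.mpr fun t => (h.vel t (mem_univ t)).continuousAt
  refine ⟨?_, fun y => ?_, hbot, htop⟩
  · rw [show (2 : WithTop ℕ∞) = 1 + 1 from one_add_one_eq_two.symm, contDiff_succ_iff_deriv, hw,
      contDiff_one_iff_deriv, hw1]
    refine ⟨fun t => (h.pos t (mem_univ t)).differentiableAt, by simp,
      fun t => (h.vel t (mem_univ t)).differentiableAt, ?_⟩
    have h1 : Continuous fun t => |w1 t| ^ p := hw1c.abs.rpow_const fun _ => Or.inr hp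
    have h2 : Continuous fun t => excess f um lam (w t) := by
      unfold excess
      fun_prop
    exact h2.neg.sub (continuous_const.mul (h1.mul hw1c))
  · rw [iteratedDeriv_succ, iteratedDeriv_one, hw, hw1]
    unfold excess
    ring

theorem mem_admissibleStates_iff (hf : Continuous f) (hp : 0 ≤ p) (h : up ≠ um) :
    up ∈ admissibleStates f α p um ↔ ∃ w w1 : ℝ → ℝ,
      IsMotionOn α p (excess f um (chordSpeed f um up)) w w1 univ ∧
      Tendsto w atBot (𝓝 um) ∧ Tendsto w atTop (𝓝 up) := by
  constructor
  · rintro ⟨lam, hlam, w, hw⟩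
    rw [rankineHugoniot_iff h] at hlam
    exact ⟨w, _, hlam ▸ hw.isMotionOn, hw.tendsto_atBot, hw.tendsto_atTop⟩
  · rintro ⟨w, w1, hw, hbot, htop⟩
    exact ⟨_, (rankineHugoniot_iff h).mpr rfl, w, hw.isTravelingWave hf hp hbot htop⟩

theorem self_mem_admissibleStates (f : ℝ → ℝ) (α p u : ℝ) : u ∈ admissibleStates f α p u := by
  refine ⟨0, by simp [RankineHugoniot], fun _ => u, contDiff_const, fun y => ?_, tendsto_const_nhds,
    tendsto_const_nhds⟩
  rw [iteratedDeriv_succ, iteratedDeriv_one]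
  simp

theorem neg_mem_admissibleStates_reflect (h : up ∈ admissibleStates f α p um) :
    -up ∈ admissibleStates (fun x => -f (-x)) α p (-um) := by
  obtain ⟨lam, hlam, w, hw⟩ := h
  refine ⟨lam, ?_, fun t => -w t, hw.contDiff.neg, fun y => ?_, hw.tendsto_atBot.neg,
    hw.tendsto_atTop.neg⟩
  · simp only [RankineHugoniot, neg_neg] at hlam ⊢
    linarith
  · have h1 := hw.ode y
    have hd : deriv (fun t => -w t) = fun t => -deriv w t := funext fun t => deriv.fun_neg
    rw [iteratedDeriv_succ, iteratedDeriv_one] at h1 ⊢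
    rw [hd, deriv.fun_neg, abs_neg, neg_neg, neg_neg]
    linarith

theorem neg_mem_admissibleStates_reflect_iff :
    -up ∈ admissibleStates (fun x => -f (-x)) α p (-um) ↔ up ∈ admissibleStates f α p um := by
  refine ⟨fun h => ?_, neg_mem_admissibleStates_reflect⟩
  have := neg_mem_admissibleStates_reflect h
  simpa only [neg_neg] using this

end waves

open scoped Classical in
/-- The companion of the kinetic state. -/
noncomputable def companionState (α q : ℝ) (f f1 : ℝ → ℝ) (u : ℝ) : ℝ :=
  if h : ∃ c ∈ Ico (tangentState f f1 u) u,
    chordSpeed f u c = chordSpeed f u (kineticState α q f f1 u) then h.choose else 0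

namespace Flux

variable {f f1 f2 : ℝ → ℝ} (F : Flux f f1 f2) {α p q u up : ℝ}
include F

theorem companionState_spec (hα : 0 < α) (hq : 0 < q) (hu : 0 < u) :
    companionState α q f f1 u ∈ Ico (tangentState f f1 u) u ∧
      chordSpeed f u (companionState α q f f1 u) = chordSpeed f u (kineticState α q f f1 u) := by
  have h := F.exists_companion_kineticState hα hq hu
  rw [companionState, dif_pos h]
  exact h.choose_spec

/-- The chord speed is injective on either side of the tangent state. Beyond `u` it exceeds `f1 u`,
while the kinetic chord is slower than `f1 u`. -/
theorem chordSpeed_eq_kineticState_iff (hα : 0 < α) (hq : 0 < q) (hu : 0 < u) {v : ℝ}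
    (hvu : v ≠ u) : chordSpeed f u v = chordSpeed f u (kineticState α q f f1 u) ↔
      v = kineticState α q f f1 u ∨ v = companionState α q f f1 u := by
  obtain ⟨hc, hcv⟩ := F.companionState_spec hα hq hu
  obtain ⟨hk1, hk2, -⟩ := F.kineticState_spec hα hq hu
  refine ⟨fun h => ?_, ?_⟩
  · rcases lt_or_gt_of_ne hvu with h1 | h1
    · rcases le_total v (tangentState f f1 u) with h2 | h2
      · exact Or.inl ((F.strictAntiOn_chordSpeed hu).injOn (mem_Iic.mpr h2) (mem_Iic.mpr hk2) h)
      · exact Or.inr ((F.strictMonoOn_chordSpeed hu).injOn ⟨h2, h1⟩ hc (h.trans hcv.symm))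
    · have h2 := F.lt_chordSpeed_of_gt hu.le h1
      have h3 := F.chordSpeed_lt_of_zeroState_le hu hk1.le (F.kineticState_lt hα hq hu)
      linarith
  · rintro (rfl | rfl)
    · rfl
    · exact hcv

theorem admissibleStates_eq (hα : 0 < α) (hp : 0 ≤ p) (hu : 0 < u) :
    admissibleStates f α p u = {kineticState α ((p + 1) / 2) f f1 u} ∪
      Ioc (companionState α ((p + 1) / 2) f f1 u) u := by
  have hq : 0 < (p + 1) / 2 := by positivity
  obtain ⟨hc, hcv⟩ := F.companionState_spec hα hq hu
  have hku := F.kineticState_lt hα hq hu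
  ext up
  rcases lt_trichotomy up u with h | rfl | h
  · rw [mem_admissibleStates_iff F.continuous hp h.ne]
    constructor
    · rintro ⟨w, w1, hw, hbot, htop⟩
      rcases F.eq_or_lt_of_wave hα hp hu h hc hcv hw hbot htop with h1 | h1
      · exact Or.inl h1
      · exact Or.inr ⟨h1, h.le⟩
    · rintro (h1 | h1)
      · rw [mem_singleton_iff.mp h1]
        exact F.exists_wave_kineticState hα hp hu
      · exact F.exists_wave_of_companion_lt hα hp hu hc hcv ⟨h1.1, h⟩
  · exact ⟨fun _ => Or.inr ⟨hc.2, le_rfl⟩, fun _ => self_mem_admissibleStates f α p up⟩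
  · constructor
    · intro h1
      obtain ⟨w, w1, hw, hbot, htop⟩ := (mem_admissibleStates_iff F.continuous hp h.ne').mp h1
      exact (F.not_wave_up hα.le hu.le h hw hbot htop).elim
    · rintro (h1 | h1)
      · rw [mem_singleton_iff] at h1
        linarith
      · linarith [h1.2]

theorem le_of_mem_admissibleStates (hα : 0 ≤ α) (hp : 0 ≤ p) (hu : 0 ≤ u)
    (h : up ∈ admissibleStates f α p u) : up ≤ u := by
  by_contra! hlt
  obtain ⟨w, w1, hw, hbot, htop⟩ := (mem_admissibleStates_iff F.continuous hp hlt.ne').mp h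
  exact F.not_wave_up hα hu hlt hw hbot htop

/-- The upper bound for waves from `0`, applied to the flux and to its reflection. -/
theorem admissibleStates_zero (hα : 0 ≤ α) (hp : 0 ≤ p) (h : up ∈ admissibleStates f α p 0) :
    up = 0 := by
  refine le_antisymm (F.le_of_mem_admissibleStates hα hp le_rfl h) ?_
  have h1 := neg_mem_admissibleStates_reflect h
  rw [neg_zero] at h1
  have := F.reflect.le_of_mem_admissibleStates hα hp le_rfl h1
  linarith

end Flux

theorem chordArea_reflect (f : ℝ → ℝ) (u v : ℝ) :
    chordArea (fun x => -f (-x)) (-u) (-v) = chordArea f u v := by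
  simp only [chordArea, neg_neg, intervalIntegral.integral_neg]
  rw [intervalIntegral.integral_comp_neg (fun x => f x), neg_neg, neg_neg,
    intervalIntegral.integral_symm]
  ring

theorem chordSpeed_reflect (f : ℝ → ℝ) (u v : ℝ) :
    chordSpeed (fun x => -f (-x)) (-u) (-v) = chordSpeed f u v := by
  simp only [chordSpeed, neg_neg]
  rw [← neg_div_neg_eq]
  congr 1 <;> ring

end KineticRelation

/-! ### Gluing functions on the two half lines. -/

namespace KineticRelation

/-- The function that is `g` on the positive half line, and `x ↦ h (-x)` on the negative one. -/
noncomputable def halves (g h : ℝ → ℝ) (u : ℝ) : ℝ :=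
  if 0 < u then g u else if u < 0 then h (-u) else 0

section halves

variable {g h : ℝ → ℝ} {u R K : ℝ}

theorem halves_of_pos (hu : 0 < u) : halves g h u = g u := if_pos hu

theorem halves_of_neg (hu : u < 0) : halves g h u = h (-u) := by
  rw [halves, if_neg hu.not_gt, if_pos hu]

@[simp] theorem halves_zero : halves g h 0 = 0 := by simp [halves]

theorem halves_nonneg (hg : ∀ u, 0 < u → 0 ≤ g u) (hh : ∀ u, 0 < u → 0 ≤ h u) (u : ℝ) :
    0 ≤ halves g h u := by
  rcases lt_trichotomy u 0 with hu | rfl | hu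
  · rw [halves_of_neg hu]
    exact hh _ (by linarith)
  · simp
  · rw [halves_of_pos hu]
    exact hg _ hu

theorem strictAnti_halves (hg : ∀ u u', 0 < u → u < u' → g u' < g u) (hg0 : ∀ u, 0 < u → g u < 0)
    (hh : ∀ u u', 0 < u → u < u' → h u < h u') (hh0 : ∀ u, 0 < u → 0 < h u) :
    StrictAnti (halves g h) := by
  intro x y hxy
  have hpos : ∀ x, 0 < x → halves g h x < 0 := fun x hx => by rw [halves_of_pos hx]; exact hg0 x hx
  have hneg : ∀ x, x < 0 → 0 < halves g h x := fun x hx => by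
    rw [halves_of_neg hx]; exact hh0 _ (by linarith)
  rcases lt_trichotomy x 0 with hx | rfl | hx
  · rcases lt_trichotomy y 0 with hy | rfl | hy
    · rw [halves_of_neg hx, halves_of_neg hy]
      exact hh _ _ (by linarith) (by linarith)
    · rw [halves_zero]
      exact hneg x hx
    · exact (hpos y hy).trans (hneg x hx)
  · rw [halves_zero]
    exact hpos y hxy
  · rw [halves_of_pos hx, halves_of_pos (hx.trans hxy)]
    exact hg x y hx hxy

theorem abs_halves_sub_le (hg : ∀ u u', 0 < u → u ≤ u' → u' ≤ R → |g u' - g u| ≤ K * (u' - u))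
    (hg0 : ∀ u, 0 < u → u ≤ R → |g u| ≤ K * u)
    (hh : ∀ u u', 0 < u → u ≤ u' → u' ≤ R → |h u' - h u| ≤ K * (u' - u))
    (hh0 : ∀ u, 0 < u → u ≤ R → |h u| ≤ K * u) {x y : ℝ} (hx : -R ≤ x) (hxy : x ≤ y) (hy : y ≤ R) :
    |halves g h y - halves g h x| ≤ K * (y - x) := by
  rcases lt_trichotomy x 0 with h1 | rfl | h1
  · have h3 := hh0 (-x) (by linarith) (by linarith)
    rcases lt_trichotomy y 0 with h2 | rfl | h2
    · rw [halves_of_neg h1, halves_of_neg h2, abs_sub_comm]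
      have := hh (-y) (-x) (by linarith) (by linarith) (by linarith)
      linarith
    · rw [halves_of_neg h1, halves_zero, zero_sub, abs_neg]
      linarith
    · rw [halves_of_neg h1, halves_of_pos h2]
      have := hg0 y h2 hy
      have := abs_sub (g y) (h (-x))
      linarith
  · rcases eq_or_lt_of_le hxy with h2 | h2
    · simp [← h2]
    · rw [halves_of_pos h2, halves_zero, sub_zero, sub_zero]
      exact hg0 y h2 hy
  · rw [halves_of_pos h1, halves_of_pos (h1.trans_le hxy)]
    exact hg x y h1 hxy hy

theorem lipschitzOnWith_of_le {φ : ℝ → ℝ} {s : Set ℝ} (hK : 0 ≤ K)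
    (hφ : ∀ x ∈ s, ∀ y ∈ s, x ≤ y → |φ y - φ x| ≤ K * (y - x)) : LipschitzOnWith ⟨K, hK⟩ φ s := by
  refine LipschitzOnWith.of_dist_le_mul fun x hx y hy => ?_
  rw [Real.dist_eq, Real.dist_eq]
  change |φ x - φ y| ≤ K * |x - y|
  rcases le_total x y with h1 | h1
  · rw [abs_sub_comm, abs_sub_comm x, abs_of_nonneg (sub_nonneg.mpr h1)]
    exact hφ x hx y hy h1
  · rw [abs_of_nonneg (sub_nonneg.mpr h1)]
    exact hφ y hy x hx h1

theorem locallyLipschitz_halves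
    (hg : ∀ R, 0 < R → ∃ K, 0 ≤ K ∧ (∀ u u', 0 < u → u ≤ u' → u' ≤ R → |g u' - g u| ≤ K * (u' - u)) ∧
      ∀ u, 0 < u → u ≤ R → |g u| ≤ K * u)
    (hh : ∀ R, 0 < R → ∃ K, 0 ≤ K ∧ (∀ u u', 0 < u → u ≤ u' → u' ≤ R → |h u' - h u| ≤ K * (u' - u)) ∧
      ∀ u, 0 < u → u ≤ R → |h u| ≤ K * u) : LocallyLipschitz (halves g h) := by
  intro x
  have hR : 0 < |x| + 1 := by positivity
  obtain ⟨K, hK, h1, h2⟩ := hg _ hR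
  obtain ⟨L, hL, h3, h4⟩ := hh _ hR
  refine ⟨⟨max K L, le_max_of_le_left hK⟩, Icc (-(|x| + 1)) (|x| + 1),
    Icc_mem_nhds (by linarith [neg_abs_le x]) (by linarith [le_abs_self x]),
    lipschitzOnWith_of_le _ fun x hx y hy hxy => abs_halves_sub_le (R := |_| + 1)
      (fun u u' a b c => (h1 u u' a b c).trans ?_) (fun u a b => (h2 u a b).trans ?_)
      (fun u u' a b c => (h3 u u' a b c).trans ?_) (fun u a b => (h4 u a b).trans ?_) hx.1 hxy hy.2⟩
  all_goals
    refine mul_le_mul_of_nonneg_right ?_ (by linarith)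
    simp

theorem locallyLipschitzOn_halves
    (hg : ∀ ε R, 0 < ε → ε < R → ∃ K, 0 ≤ K ∧
      ∀ u u', ε ≤ u → u ≤ u' → u' ≤ R → |g u' - g u| ≤ K * (u' - u))
    (hh : ∀ ε R, 0 < ε → ε < R → ∃ K, 0 ≤ K ∧
      ∀ u u', ε ≤ u → u ≤ u' → u' ≤ R → |h u' - h u| ≤ K * (u' - u)) :
    LocallyLipschitzOn {0}ᶜ (halves g h) := by
  intro x hx
  rcases lt_or_gt_of_ne hx with h1 | h1
  · obtain ⟨K, hK, hK'⟩ := hh (-x / 2) (-2 * x) (by linarith) (by linarith)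
    refine ⟨_, Icc (2 * x) (x / 2), mem_nhdsWithin_of_mem_nhds
      (Icc_mem_nhds (by linarith) (by linarith)), lipschitzOnWith_of_le hK fun y hy z hz hyz => ?_⟩
    rw [halves_of_neg (by linarith [hz.2]), halves_of_neg (by linarith [hy.2]), abs_sub_comm]
    have := hK' (-z) (-y) (by linarith [hz.2]) (by linarith) (by linarith [hy.1])
    linarith
  · obtain ⟨K, hK, hK'⟩ := hg (x / 2) (2 * x) (by linarith) (by linarith)
    refine ⟨_, Icc (x / 2) (2 * x), mem_nhdsWithin_of_mem_nhds
      (Icc_mem_nhds (by linarith) (by linarith)), lipschitzOnWith_of_le hK fun y hy z hz hyz => ?_⟩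
    rw [halves_of_pos (by linarith [hz.1]), halves_of_pos (by linarith [hy.1])]
    exact hK' y z hy.1 hyz hz.2

theorem continuousAt_halves_zero {r C : ℝ} (hr : 0 < r) (hR : 0 < R)
    (hg : ∀ u, 0 < u → u ≤ R → |g u| ≤ C * u ^ r)
    (hh : ∀ u, 0 < u → u ≤ R → |h u| ≤ C * u ^ r) : ContinuousAt (halves g h) 0 := by
  have h1 : Tendsto (fun u : ℝ => C * |u| ^ r) (𝓝 0) (𝓝 0) := by
    have h2 : Continuous fun u : ℝ => C * |u| ^ r :=
      continuous_const.mul (continuous_abs.rpow_const fun _ => Or.inr hr.le)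
    simpa [Real.zero_rpow hr.ne'] using h2.tendsto 0
  rw [ContinuousAt, halves_zero]
  refine squeeze_zero_norm' ?_ h1
  filter_upwards [Icc_mem_nhds (by linarith : -R < 0) hR] with u hu
  rw [Real.norm_eq_abs]
  rcases lt_trichotomy u 0 with h2 | rfl | h2
  · rw [halves_of_neg h2, abs_of_neg h2]
    exact hh _ (by linarith) (by linarith [hu.1])
  · simp [Real.zero_rpow hr.ne']
  · rw [halves_of_pos h2, abs_of_pos h2]
    exact hg _ h2 hu.2

end halves

/-! ### Concave-convex fluxes satisfy the bounds of `Flux`. -/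

theorem IsConcaveConvexFlux.flux {f : ℝ → ℝ} (hf : IsConcaveConvexFlux f) :
    Flux f (deriv f) (deriv (deriv f)) := by
  have h1 : ContDiff ℝ 2 (deriv f) := by
    have := hf.contDiff
    rw [show (3 : WithTop ℕ∞) = 2 + 1 from two_add_one_eq_three.symm, contDiff_succ_iff_deriv] at this
    exact this.2.2
  have h2 : ContDiff ℝ 1 (deriv (deriv f)) := by
    rw [show (2 : WithTop ℕ∞) = 1 + 1 from one_add_one_eq_two.symm, contDiff_succ_iff_deriv] at h1
    exact h1.2.2
  have hd2 : Differentiable ℝ (deriv (deriv f)) := h2.differentiable (by norm_num)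
  have hcc : ∀ u, u ≠ 0 → 0 < u * deriv (deriv f) u := fun u hu => by
    have := hf.concave_convex u hu
    rwa [iteratedDeriv_succ, iteratedDeriv_one] at this
  have h3 : deriv (deriv (deriv f)) 0 ≠ 0 := by
    have := hf.third_ne_zero
    rwa [iteratedDeriv_succ, iteratedDeriv_succ, iteratedDeriv_one] at this
  have hzero : deriv (deriv f) 0 = 0 := by
    have hc := h2.continuous
    apply le_antisymm
    · refine le_of_tendsto (hc.continuousAt.tendsto.mono_left nhdsWithin_le_nhds :
        Tendsto (deriv (deriv f)) (𝓝[<] (0 : ℝ)) (𝓝 _)) ?_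
      filter_upwards [self_mem_nhdsWithin] with x hx
      exact (neg_of_mul_pos_right (hcc x (ne_of_lt hx)) (le_of_lt hx)).le
    · refine ge_of_tendsto (hc.continuousAt.tendsto.mono_left nhdsWithin_le_nhds :
        Tendsto (deriv (deriv f)) (𝓝[>] (0 : ℝ)) (𝓝 _)) ?_
      filter_upwards [self_mem_nhdsWithin] with x hx
      exact (pos_of_mul_pos_right (hcc x (ne_of_gt hx)) (le_of_lt hx)).le
  -- The quotient `f''(x) / x`, extended by `f'''(0)` at zero. It is continuous and positive
  -- everywhere, the latter at zero by `f'''(0) ≠ 0`, so its extrema on a compact interval are the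
  -- required constants.
  set k := dslope (deriv (deriv f)) 0
  have hkeq : ∀ x, x * deriv (deriv f) x = k x * x ^ 2 := fun x => by
    have := sub_smul_dslope (deriv (deriv f)) 0 x
    rw [hzero, sub_zero, sub_zero, smul_eq_mul] at this
    rw [← this]
    ring
  have hkc : Continuous k := by
    rw [continuous_iff_continuousAt]
    intro x
    by_cases hx : x = 0
    · rw [hx, continuousAt_dslope_same]
      exact hd2 0
    · rw [continuousAt_dslope_of_ne hx]
      exact h2.continuous.continuousAt
  have hkpos' : ∀ x, x ≠ 0 → 0 < k x := fun x hx => by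
    have h4 := hcc x hx
    rw [hkeq] at h4
    exact pos_of_mul_pos_left h4 (sq_nonneg x)
  have hkpos : ∀ x, 0 < k x := fun x => by
    by_cases hx : x = 0
    · refine lt_of_le_of_ne ?_ (Ne.symm ?_)
      · rw [hx]
        refine ge_of_tendsto (hkc.continuousAt.tendsto.mono_left nhdsWithin_le_nhds :
          Tendsto k (𝓝[≠] 0) (𝓝 (k 0))) ?_
        filter_upwards [self_mem_nhdsWithin] with y hy
        exact (hkpos' y hy).le
      · rw [hx]
        simpa [k, dslope_same] using h3
    · exact hkpos' x hx
  refine ⟨fun x => (hf.contDiff.differentiable (by norm_num) x).hasDerivAt,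
    fun x => (h1.differentiable (by norm_num) x).hasDerivAt, fun R => ?_, fun R => ?_,
    hf.tendsto_atTop, hf.tendsto_atBot⟩
  · have hc3 : Continuous (deriv (deriv (deriv f))) := h2.continuous_deriv (by norm_num)
    obtain ⟨K, hK⟩ := isCompact_Icc.exists_bound_of_continuousOn (s := Icc (-R) R) hc3.continuousOn
    refine ⟨max K 0, le_max_right _ _, fun x hx y hy => ?_⟩
    exact (convex_Icc (-R) R).norm_image_sub_le_of_norm_hasDerivWithin_le
      (fun z _ => (hd2 z).hasDerivAt.hasDerivWithinAt)
      (fun z hz => (hK z hz).trans (le_max_left _ _)) hy hx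
  · rcases lt_or_ge R 0 with hR | hR
    · exact ⟨1, 1, one_pos, le_rfl, fun x hx => by linarith [hx.1, hx.2]⟩
    · have hne : (Icc (-R) R).Nonempty := ⟨0, by linarith, hR⟩
      obtain ⟨a, ha, hmin⟩ := isCompact_Icc.exists_isMinOn hne hkc.continuousOn
      obtain ⟨b, hb, hmax⟩ := isCompact_Icc.exists_isMaxOn hne hkc.continuousOn
      refine ⟨k a, k b, hkpos a, hmin hb, fun x hx => ?_⟩
      rw [hkeq]
      exact ⟨mul_le_mul_of_nonneg_right (hmin hx) (sq_nonneg x),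
        mul_le_mul_of_nonneg_right (hmax hx) (sq_nonneg x)⟩

end KineticRelation

/-! ### Assembly of the functions on the whole line. -/

namespace KineticRelation

namespace Flux

variable {f f1 f2 : ℝ → ℝ} (F : Flux f f1 f2) {α p q : ℝ}
include F

theorem exists_kineticState_bounds (hα : 0 < α) (hq : 1 / 2 ≤ q) {R : ℝ} (hR : 0 < R) :
    ∃ K, 0 ≤ K ∧
      (∀ u u', 0 < u → u ≤ u' → u' ≤ R →
        |kineticState α q f f1 u' - kineticState α q f f1 u| ≤ K * (u' - u)) ∧
      ∀ u, 0 < u → u ≤ R → |kineticState α q f f1 u| ≤ K * u := by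
  obtain ⟨K, hK, h1⟩ := F.exists_kineticState_lipschitz hα hq hR
  obtain ⟨L, hL, h2⟩ := F.exists_neg_kineticState_le hα hq hR
  refine ⟨max K L, le_max_of_le_left hK, fun u u' a b c => (h1 u u' a b c).trans
    (mul_le_mul_of_nonneg_right (le_max_left _ _) (by linarith)), fun u a b => ?_⟩
  rw [abs_of_neg (F.kineticState_neg hα (by linarith) a)]
  exact (h2 u a b).trans (mul_le_mul_of_nonneg_right (le_max_right _ _) a.le)

/-- The linear bound needed is `u ^ (3 - 4 q) ≤ ε ^ (2 - 4 q) * u` for `u ≥ ε`; its constant may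
blow up as `ε` tends to zero. -/
theorem exists_threshold_lipschitz_of_pos (hq : 1 / 2 ≤ q) (hq2 : q ≤ 2 / 3) {ε R : ℝ}
    (hε : 0 < ε) (hεR : ε < R) :
    ∃ K, 0 ≤ K ∧ ∀ u u', ε ≤ u → u ≤ u' → u' ≤ R →
      |threshold q f f1 u' - threshold q f f1 u| ≤ K * (u' - u) := by
  obtain ⟨C, hC, h1⟩ := F.exists_threshold_le_rpow hq hq2 (hε.trans hεR)
  obtain ⟨L, hL, h2⟩ := F.exists_threshold_lipschitz hq hq2 (hε.trans hεR)
  refine ⟨L * (C * ε ^ (2 - 4 * q)), by positivity, fun u u' hu huu' hu' =>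
    h2 u _ (hε.trans_le hu) (fun w hw => ?_) u' huu' hu'⟩
  have hεw : ε ≤ w := hu.trans hw.1
  have hw0 : 0 < w := hε.trans_le hεw
  refine (h1 w hw0 hw.2).trans ?_
  rw [show 3 - 4 * q = (2 - 4 * q) + 1 by ring, Real.rpow_add_one hw0.ne', mul_assoc]
  have h3 : w ^ (2 - 4 * q) ≤ ε ^ (2 - 4 * q) :=
    Real.rpow_le_rpow_of_nonpos hε hεw (by linarith)
  gcongr

/-- At `q = 1/2` the exponent `3 - 4 q` equals one, so the linear bound holds down to zero with a
uniform constant. -/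
theorem exists_threshold_lipschitz_linear {R : ℝ} (hR : 0 < R) :
    ∃ K, 0 ≤ K ∧
      (∀ u u', 0 < u → u ≤ u' → u' ≤ R →
        |threshold (1 / 2) f f1 u' - threshold (1 / 2) f f1 u| ≤ K * (u' - u)) ∧
      ∀ u, 0 < u → u ≤ R → |threshold (1 / 2) f f1 u| ≤ K * u := by
  obtain ⟨C, hC, h1⟩ := F.exists_threshold_le_rpow le_rfl (by norm_num : (1 / 2 : ℝ) ≤ 2 / 3) hR
  obtain ⟨L, hL, h2⟩ := F.exists_threshold_lipschitz le_rfl (by norm_num : (1 / 2 : ℝ) ≤ 2 / 3) hR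
  norm_num at h1
  refine ⟨max (L * C) C, le_max_of_le_right hC.le, fun u u' hu huu' hu' => ?_, fun u hu huR => ?_⟩
  · refine (h2 u C hu (fun w hw => by norm_num; exact h1 w (hu.trans_le hw.1) hw.2) u' huu' hu').trans ?_
    exact mul_le_mul_of_nonneg_right (le_max_left _ _) (by linarith)
  · rw [abs_of_nonneg (threshold_nonneg _ _ _ _)]
    norm_num
    exact (h1 u hu huR).trans (mul_le_mul_of_nonneg_right (le_max_right _ _) hu.le)

theorem kineticState_eq_tangentState_iff_threshold_le (hq : 1 / 2 ≤ q) (hq2 : q ≤ 2 / 3)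
    (hα : 0 < α) {u : ℝ} (hu : 0 < u) :
    kineticState α q f f1 u = tangentState f f1 u ↔ threshold q f f1 u ≤ α := by
  rw [F.kineticState_eq_tangentState_iff hα (by linarith) hu, F.arrivalEnergy_nonpos_iff hq hq2 hα hu]

/-- A shock of small strength is classical if the kinetic state of weak left states is the tangent
state. -/
theorem classical_of_small_strength (hα : 0 < α) (hp : 0 ≤ p) {u up δ : ℝ} (hu : 0 < u)
    (h : up ∈ admissibleStates f α p u) (hne : up ≠ u)
    (hδ : u < δ → kineticState α ((p + 1) / 2) f f1 u = tangentState f f1 u)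
    (hs : |up - u| < δ) : tangentState f f1 u ≤ up ∧ up < u := by
  have hq : 0 < (p + 1) / 2 := by positivity
  have hlt := lt_of_le_of_ne (F.le_of_mem_admissibleStates hα.le hp hu.le h) hne
  refine ⟨?_, hlt⟩
  rw [F.admissibleStates_eq hα hp hu] at h
  rcases h with h | h
  · rw [mem_singleton_iff] at h
    rw [h] at hs ⊢
    -- The kinetic state is negative, so the strength of the shock exceeds `u`.
    refine (hδ ?_).ge
    have := F.kineticState_neg hα hq hu
    linarith [(abs_lt.mp hs).1]
  · exact (F.companionState_spec hα hq hu).1.1.trans h.1.le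

end Flux

section functions

variable (f f1 : ℝ → ℝ)

/-- The tangent function. -/
noncomputable def tangentFunction : ℝ → ℝ :=
  halves (tangentState f f1) fun x => -tangentState (fun x => -f (-x)) (fun x => f1 (-x)) x

/-- The zero entropy dissipation function. -/
noncomputable def zeroFunction : ℝ → ℝ :=
  halves (zeroState f f1) fun x => -zeroState (fun x => -f (-x)) (fun x => f1 (-x)) x

/-- The kinetic function. -/
noncomputable def kineticFunction (α q : ℝ) : ℝ → ℝ :=
  halves (kineticState α q f f1) fun x =>
    -kineticState α q (fun x => -f (-x)) (fun x => f1 (-x)) x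

/-- The companion of the kinetic function. -/
noncomputable def companionFunction (α q : ℝ) : ℝ → ℝ :=
  halves (companionState α q f f1) fun x =>
    -companionState α q (fun x => -f (-x)) (fun x => f1 (-x)) x

/-- The threshold function. -/
noncomputable def thresholdFunction (q : ℝ) : ℝ → ℝ :=
  halves (threshold q f f1) (threshold q (fun x => -f (-x)) (fun x => f1 (-x)))

end functions

namespace Flux

variable {f f1 f2 : ℝ → ℝ} (F : Flux f f1 f2) {α p q : ℝ}
include F

theorem isTangentFunction : IsTangentFunction f (tangentFunction f f1) := by
  refine ⟨halves_zero, fun u hu => ?_⟩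
  rw [show deriv f = f1 from funext fun x => (F.hasDerivAt x).deriv]
  rcases lt_or_gt_of_ne hu with h | h
  · have hx : 0 < -u := by linarith
    rw [tangentFunction, halves_of_neg h]
    refine ⟨fun h1 => (F.reflect.tangentState_lt hx).ne (by linarith), ?_⟩
    rw [← chordSpeed_reflect, neg_neg]
    exact F.reflect.deriv_tangentState_eq hx
  · rw [tangentFunction, halves_of_pos h]
    exact ⟨(F.tangentState_lt h).ne, F.deriv_tangentState_eq h⟩

theorem isZeroDissipationFunction : IsZeroDissipationFunction f (zeroFunction f f1) := by
  refine ⟨halves_zero, fun u hu => ?_⟩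
  rcases lt_or_gt_of_ne hu with h | h
  · have hx : 0 < -u := by linarith
    have hlt := (F.reflect.zeroState_lt hx).trans (F.reflect.tangentState_lt hx)
    rw [zeroFunction, halves_of_neg h]
    have hne : -zeroState (fun x => -f (-x)) (fun x => f1 (-x)) (-u) ≠ u := fun h1 =>
      hlt.ne (by linarith)
    refine ⟨hne, ?_⟩
    rw [F.entropyDissipation_eq hne.symm, ← chordArea_reflect, neg_neg,
      F.reflect.chordArea_zeroState hx, neg_zero]
  · have hlt := (F.zeroState_lt h).trans (F.tangentState_lt h)
    rw [zeroFunction, halves_of_pos h, F.entropyDissipation_eq hlt.ne', F.chordArea_zeroState h,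
      neg_zero]
    exact ⟨hlt.ne, rfl⟩

theorem locallyLipschitz_kineticFunction (hα : 0 < α) (hq : 1 / 2 ≤ q) :
    LocallyLipschitz (kineticFunction f f1 α q) := by
  refine locallyLipschitz_halves (fun R hR => F.exists_kineticState_bounds hα hq hR) fun R hR => ?_
  obtain ⟨K, hK, h1, h2⟩ := F.reflect.exists_kineticState_bounds hα hq hR
  refine ⟨K, hK, fun u u' a b c => ?_, fun u a b => ?_⟩
  · rw [← neg_sub_neg, neg_neg, neg_neg, abs_sub_comm]
    exact h1 u u' a b c
  · rw [abs_neg]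
    exact h2 u a b

theorem strictAnti_kineticFunction (hα : 0 < α) (hq : 1 / 2 ≤ q) :
    StrictAnti (kineticFunction f f1 α q) :=
  strictAnti_halves (fun _ _ => F.kineticState_strictAnti hα hq)
    (fun _ => F.kineticState_neg hα (by linarith))
    (fun _ _ hu h => neg_lt_neg (F.reflect.kineticState_strictAnti hα hq hu h))
    (fun _ hu => neg_pos.mpr (F.reflect.kineticState_neg hα (by linarith) hu))

theorem isBetween (hα : 0 < α) (hq : 0 < q) :
    IsBetween (zeroFunction f f1) (tangentFunction f f1) (kineticFunction f f1 α q) := by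
  refine ⟨fun u hu => ?_, fun u hu => ?_⟩
  · rw [zeroFunction, tangentFunction, kineticFunction, halves_of_pos hu, halves_of_pos hu,
      halves_of_pos hu]
    have := F.kineticState_spec hα hq hu
    exact ⟨this.1, this.2.1⟩
  · rw [zeroFunction, tangentFunction, kineticFunction, halves_of_neg hu, halves_of_neg hu,
      halves_of_neg hu]
    have := F.reflect.kineticState_spec hα hq (neg_pos.mpr hu)
    exact ⟨neg_le_neg this.2.1, neg_lt_neg this.1⟩

theorem isCompanionFunction (hα : 0 < α) (hq : 0 < q) :
    IsCompanionFunction f (kineticFunction f f1 α q) (companionFunction f f1 α q) := by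
  refine ⟨halves_zero, fun u hu => ?_⟩
  rcases lt_or_gt_of_ne hu with h | h
  · have hx : 0 < -u := by linarith
    rw [kineticFunction, companionFunction, halves_of_neg h, halves_of_neg h]
    refine ⟨fun h1 => (F.reflect.companionState_spec hα hq hx).1.2.ne (by linarith), fun v hv => ?_⟩
    have := F.reflect.chordSpeed_eq_kineticState_iff hα hq hx (v := -v) (by simpa using hv)
    rw [chordSpeed_reflect, ← neg_eq_iff_eq_neg, ← neg_eq_iff_eq_neg] at *
    rw [← chordSpeed_reflect f u (-_), neg_neg, this]
  · rw [kineticFunction, companionFunction, halves_of_pos h, halves_of_pos h]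
    exact ⟨(F.companionState_spec hα hq h).1.2.ne, fun v hv =>
      F.chordSpeed_eq_kineticState_iff hα hq h hv⟩

theorem admissibleStates_eq_of_pos (hα : 0 < α) (hp : 0 ≤ p) {u : ℝ} (hu : 0 < u) :
    admissibleStates f α p u = {kineticFunction f f1 α ((p + 1) / 2) u} ∪
      Ioc (companionFunction f f1 α ((p + 1) / 2) u) u := by
  rw [kineticFunction, companionFunction, halves_of_pos hu, halves_of_pos hu]
  exact F.admissibleStates_eq hα hp hu

theorem admissibleStates_eq_of_neg (hα : 0 < α) (hp : 0 ≤ p) {u : ℝ} (hu : u < 0) :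
    admissibleStates f α p u = {kineticFunction f f1 α ((p + 1) / 2) u} ∪
      Ico u (companionFunction f f1 α ((p + 1) / 2) u) := by
  rw [kineticFunction, companionFunction, halves_of_neg hu, halves_of_neg hu]
  ext up
  rw [← neg_mem_admissibleStates_reflect_iff, F.reflect.admissibleStates_eq hα hp (neg_pos.mpr hu)]
  simp only [mem_union, mem_singleton_iff, mem_Ioc, mem_Ico, neg_eq_iff_eq_neg, lt_neg,
    neg_le_neg_iff, and_comm]

theorem kineticFunction_eq_tangentFunction_iff (hq : 1 / 2 ≤ q) (hq2 : q ≤ 2 / 3) (hα : 0 < α)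
    (u : ℝ) : kineticFunction f f1 α q u = tangentFunction f f1 u ↔
      thresholdFunction f f1 q u ≤ α := by
  rw [kineticFunction, tangentFunction, thresholdFunction]
  rcases lt_trichotomy u 0 with h | rfl | h
  · rw [halves_of_neg h, halves_of_neg h, halves_of_neg h, neg_inj]
    exact F.reflect.kineticState_eq_tangentState_iff_threshold_le hq hq2 hα (neg_pos.mpr h)
  · simp [hα.le]
  · rw [halves_of_pos h, halves_of_pos h, halves_of_pos h]
    exact F.kineticState_eq_tangentState_iff_threshold_le hq hq2 hα h

theorem locallyLipschitzOn_thresholdFunction (hq : 1 / 2 ≤ q) (hq2 : q ≤ 2 / 3) :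
    LocallyLipschitzOn {0}ᶜ (thresholdFunction f f1 q) :=
  locallyLipschitzOn_halves (fun _ _ => F.exists_threshold_lipschitz_of_pos hq hq2)
    (fun _ _ => F.reflect.exists_threshold_lipschitz_of_pos hq hq2)

theorem locallyLipschitz_thresholdFunction :
    LocallyLipschitz (thresholdFunction f f1 (1 / 2)) :=
  locallyLipschitz_halves (fun _ => F.exists_threshold_lipschitz_linear)
    (fun _ => F.reflect.exists_threshold_lipschitz_linear)

theorem continuous_thresholdFunction (hq : 1 / 2 ≤ q) (hq2 : q ≤ 2 / 3) :
    Continuous (thresholdFunction f f1 q) := by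
  rw [continuous_iff_continuousAt]
  intro x
  by_cases hx : x = 0
  · obtain ⟨C, hC, h1⟩ := F.exists_threshold_le_rpow hq hq2 one_pos
    obtain ⟨D, hD, h2⟩ := F.reflect.exists_threshold_le_rpow hq hq2 one_pos
    rw [hx]
    refine continuousAt_halves_zero (r := 3 - 4 * q) (C := max C D) (by linarith) one_pos
      (fun u a b => ?_) (fun u a b => ?_)
    · rw [abs_of_nonneg (threshold_nonneg _ _ _ _)]
      exact (h1 u a b).trans (mul_le_mul_of_nonneg_right (le_max_left _ _) (by positivity))
    · rw [abs_of_nonneg (threshold_nonneg _ _ _ _)]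
      exact (h2 u a b).trans (mul_le_mul_of_nonneg_right (le_max_right _ _) (by positivity))
  · exact (F.locallyLipschitzOn_thresholdFunction hq hq2).continuousOn.continuousAt
      (isOpen_compl_singleton.mem_nhds hx)

/-- The threshold is continuous and vanishes at zero, so for weak left states any given `α` exceeds
it and the kinetic state is the tangent state. -/
theorem exists_classical_of_small_strength (hα : 0 < α) (hp : 0 ≤ p) (hp3 : p ≤ 1 / 3) :
    ∃ δ, 0 < δ ∧ ∀ um up, up ∈ admissibleStates f α p um → up ≠ um → |up - um| < δ →
      IsClassicalShock (tangentFunction f f1) um up := by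
  have hq : 1 / 2 ≤ (p + 1) / 2 := by linarith
  have hq2 : (p + 1) / 2 ≤ 2 / 3 := by linarith
  have h0 : ∀ᶠ u in 𝓝 0, thresholdFunction f f1 ((p + 1) / 2) u < α :=
    (F.continuous_thresholdFunction hq hq2).continuousAt.eventually_lt_const
      (by simpa [thresholdFunction] using hα)
  obtain ⟨δ, hδ, hball⟩ := Metric.eventually_nhds_iff.mp h0
  have heq : ∀ u, |u| < δ →
      kineticFunction f f1 α ((p + 1) / 2) u = tangentFunction f f1 u := fun u hu =>
    (F.kineticFunction_eq_tangentFunction_iff hq hq2 hα u).mpr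
      (hball (by rwa [Real.dist_eq, sub_zero])).le
  refine ⟨δ, hδ, fun um up h hne hs => ?_⟩
  rcases lt_trichotomy um 0 with hu | rfl | hu
  · right
    have hx : 0 < -um := neg_pos.mpr hu
    have h1 := F.reflect.classical_of_small_strength hα hp hx (up := -up) (δ := δ)
      (neg_mem_admissibleStates_reflect h) (by simpa using hne) (fun hlt => by
        have h2 := heq um (by rwa [abs_of_neg hu])
        rwa [kineticFunction, tangentFunction, halves_of_neg hu, halves_of_neg hu, neg_inj] at h2)
      (by rwa [neg_sub_neg, abs_sub_comm])
    rw [tangentFunction, halves_of_neg hu]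
    exact ⟨hu, by linarith [h1.2], by linarith [h1.1]⟩
  · exact absurd (F.admissibleStates_zero hα.le hp h) hne
  · left
    have h1 := F.classical_of_small_strength hα hp hu (up := up) (δ := δ) h hne (fun hlt => by
        have h2 := heq um (by rwa [abs_of_pos hu])
        rwa [kineticFunction, tangentFunction, halves_of_pos hu, halves_of_pos hu] at h2) hs
    rw [tangentFunction, halves_of_pos hu]
    exact ⟨hu, h1⟩

theorem kineticState_ne_tangentState (hα : 0 < α) (hq : 2 / 3 < q) {u : ℝ} (hu : 0 < u) :
    kineticState α q f f1 u ≠ tangentState f f1 u := fun h =>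
  absurd ((F.kineticState_eq_tangentState_iff hα (by linarith) hu).mp h)
    (not_le.mpr (F.arrivalEnergy_tangentState_pos hα hq hu))

theorem kineticFunction_ne_tangentFunction (hα : 0 < α) (hq : 2 / 3 < q) {u : ℝ} (hu : u ≠ 0) :
    kineticFunction f f1 α q u ≠ tangentFunction f f1 u := by
  rw [kineticFunction, tangentFunction]
  rcases lt_or_gt_of_ne hu with h | h
  · rw [halves_of_neg h, halves_of_neg h, Ne, neg_inj]
    exact F.reflect.kineticState_ne_tangentState hα hq (neg_pos.mpr h)
  · rw [halves_of_pos h, halves_of_pos h]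
    exact F.kineticState_ne_tangentState hα hq h

theorem exists_small_nonclassical (hα : 0 < α) (hp : 1 / 3 < p) {δ : ℝ} (hδ : 0 < δ) :
    ∃ um up, up ∈ admissibleStates f α p um ∧
      IsNonclassicalShock (zeroFunction f f1) (tangentFunction f f1) um up ∧ |up - um| < δ := by
  have hq : 2 / 3 < (p + 1) / 2 := by linarith
  obtain ⟨K, hK, h1⟩ := F.exists_neg_kineticState_le hα (by linarith : 1 / 2 ≤ (p + 1) / 2) one_pos
  -- The kinetic state is at most of size `K * u`, so the strength is at most `(1 + K) * u ≤ δ / 2`.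
  set u := min 1 (δ / (2 * (1 + K)))
  have hu : 0 < u := lt_min one_pos (by positivity)
  have hu1 : u ≤ 1 := min_le_left _ _
  have hu2 : u * (2 * (1 + K)) ≤ δ := (le_div_iff₀ (by positivity)).mp (min_le_right _ _)
  have h2 := h1 u hu hu1
  have h3 := F.kineticState_neg hα (by linarith : 0 < (p + 1) / 2) hu
  obtain ⟨h4, h5, -⟩ := F.kineticState_spec hα (by linarith : 0 < (p + 1) / 2) hu
  refine ⟨u, kineticState α ((p + 1) / 2) f f1 u, ?_, Or.inl ⟨hu, ?_, ?_⟩, ?_⟩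
  · rw [F.admissibleStates_eq hα (by linarith) hu]
    exact Or.inl rfl
  · rw [zeroFunction, halves_of_pos hu]
    exact h4.le
  · rw [tangentFunction, halves_of_pos hu]
    exact lt_of_le_of_ne h5 (F.kineticState_ne_tangentState hα hq hu)
  · rw [abs_of_neg (by linarith)]
    linarith

end Flux

end KineticRelation


theorem mainTheorem1 (f : ℝ → ℝ) (hf : KineticRelation.IsConcaveConvexFlux f) :
    ∃ phiNat phiZero : ℝ → ℝ,
      KineticRelation.IsTangentFunction f phiNat ∧
      KineticRelation.IsZeroDissipationFunction f phiZero ∧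
      ∀ p : ℝ, 0 ≤ p →
        ∃ phiFlat phiSharp : ℝ → ℝ → ℝ,
          (∀ α : ℝ, 0 < α →
            LocallyLipschitz (phiFlat α) ∧
            StrictAnti (phiFlat α) ∧
            KineticRelation.IsBetween phiZero phiNat (phiFlat α) ∧
            KineticRelation.IsCompanionFunction f (phiFlat α) (phiSharp α) ∧
            (∀ u : ℝ, 0 < u →
              KineticRelation.admissibleStates f α p u
                = {phiFlat α u} ∪ Set.Ioc (phiSharp α u) u) ∧
            (∀ u : ℝ, u < 0 →
              KineticRelation.admissibleStates f α p u
                = {phiFlat α u} ∪ Set.Ico u (phiSharp α u))) ∧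
          (p ≤ 1 / 3 →
            (∃ A : ℝ → ℝ,
              (∀ u : ℝ, 0 ≤ A u) ∧
              A 0 = 0 ∧
              Continuous A ∧
              LocallyLipschitzOn {0}ᶜ A ∧
              (p = 0 → LocallyLipschitz A) ∧
              ∀ α : ℝ, 0 < α → ∀ u : ℝ, phiFlat α u = phiNat u ↔ A u ≤ α) ∧
            ∀ α : ℝ, 0 < α → ∃ δ : ℝ, 0 < δ ∧
              ∀ um up : ℝ, up ∈ KineticRelation.admissibleStates f α p um → up ≠ um →
                |up - um| < δ → KineticRelation.IsClassicalShock phiNat um up) ∧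
          (1 / 3 < p →
            ∀ α : ℝ, 0 < α →
              (∀ u : ℝ, u ≠ 0 → phiFlat α u ≠ phiNat u) ∧
              ∀ δ : ℝ, 0 < δ →
                ∃ um up : ℝ, up ∈ KineticRelation.admissibleStates f α p um ∧
                  KineticRelation.IsNonclassicalShock phiZero phiNat um up ∧
                  |up - um| < δ) := by
  have F := hf.flux
  refine ⟨KineticRelation.tangentFunction f (deriv f), KineticRelation.zeroFunction f (deriv f),
    F.isTangentFunction, F.isZeroDissipationFunction, fun p hp =>
      ⟨fun α => KineticRelation.kineticFunction f (deriv f) α ((p + 1) / 2),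
        fun α => KineticRelation.companionFunction f (deriv f) α ((p + 1) / 2),
        fun α hα => ?_, fun hp3 => ⟨?_, fun α hα => ?_⟩, fun hp3 α hα => ⟨fun u hu => ?_, fun δ hδ => ?_⟩⟩⟩
  · have hq : 1 / 2 ≤ (p + 1) / 2 := by linarith
    have hq0 : 0 < (p + 1) / 2 := by linarith
    exact ⟨F.locallyLipschitz_kineticFunction hα hq, F.strictAnti_kineticFunction hα hq,
      F.isBetween hα hq0, F.isCompanionFunction hα hq0,
      fun u hu => F.admissibleStates_eq_of_pos hα hp hu,
      fun u hu => F.admissibleStates_eq_of_neg hα hp hu⟩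
  · have hq : 1 / 2 ≤ (p + 1) / 2 := by linarith
    have hq2 : (p + 1) / 2 ≤ 2 / 3 := by linarith
    refine ⟨KineticRelation.thresholdFunction f (deriv f) ((p + 1) / 2),
      KineticRelation.halves_nonneg (fun u _ => KineticRelation.threshold_nonneg _ _ _ _)
        (fun u _ => KineticRelation.threshold_nonneg _ _ _ _),
      KineticRelation.halves_zero, F.continuous_thresholdFunction hq hq2,
      F.locallyLipschitzOn_thresholdFunction hq hq2, fun h0 => ?_,
      fun α hα => F.kineticFunction_eq_tangentFunction_iff hq hq2 hα⟩
    rw [h0, zero_add]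
    exact F.locallyLipschitz_thresholdFunction
  · exact F.exists_classical_of_small_strength hα hp hp3
  · exact F.kineticFunction_ne_tangentFunction hα (by linarith) hu
  · exact F.exists_small_nonclassical hα hp3 hδ
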